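/- **Setting.** Let $0<\mu<1$ and consider Euler's problem of two fixed centers $$H(q,p)=\tfrac12|p|^2-\frac{1-\mu}{|q-E|}-\frac{\mu}{|q-M|},\qquad E=(-\tfrac12,0),\quad M=(\tfrac12,0).$$ In elliptic coordinates $q=\tfrac12(\cosh\lambda\cos\nu,\ \sinh\lambda\sin\nu)$, with conjugate momenta $p_\lambda,p_\nu$, the motion of energy $c<0$ is regularized by $K=(H-c)(\cosh^2\lambda-\cos^2\nu)=K_\lambda+K_\nu$ on the level $K=0$, where $$K_\lambda=2p_\lambda^2-2\cosh\lambda-c\cosh^2\lambda,\qquad K_\nu=2p_\nu^2+2(1-2\mu)\cos\nu+c\cos^2\nu .$$ The second integral $G=g$ is given by $K_\lambda=g$, $K_\nu=-g$. The region $S$ (motion near either center) consists of the $(g,c)$ with $c<0$, $-2<g+c<-2|1-2\mu|$, $c<-|1-2\mu|$ and $gc<(1-2\mu)^2$; the last two conditions are automatic for $c<-1-2\sqrt{\mu(1-\mu)}$. The region $S'$ (motion near the heavier center only) consists of the $(g,c)$ with $c<0$ and $-2|1-2\mu|<g+c<2|1-2\mu|$. For $(g,c)$ in $S$ or $S'$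 and a center $b\in\{E,M\}$ around which motion is possible, the level set contains one Liouville torus around $b$, on which $\lambda$ oscillates about $0$ and $\nu$ about $\pi$ (if $b=E$) or $0$ (if $b=M$). Let $T_\lambda,T_\nu$ be the minimal periods of $(\lambda,p_\lambda)$ and $(\nu,p_\nu)$ for the flow of $K$. The torus is a $T_{k,l}$-torus if $T_\nu/T_\lambda=k/l$; here $k,l\ge1$ are coprime. The $T_{k,l}$-torus family (with $\mu$, $b$ fixed) consists of all orbits on all $T_{k,l}$-tori with $(g,c)\in S\cup S'$. **Invariants.** For a generic immersion $\gamma:S^1\to\mathbb C$ (only transverse double points), $J^+(\gamma)$ is Arnold's invariant: along regular homotopies it is unchanged by triple points and inverse self-tangencies, it increases by $2$ at each crossing through a direct self-tangency that creates two double points and decreases by $2$ at each one that destroys two, and it equals $0$ on the figure eight $K_0$ and $2-2j$ on $K_j$, $j\ge1$, the circle with $j-1$ small disjoint interior loops; it does not depend on the orientation. If $\gamma$ avoids $0$ and has winding number $w$ around $0$, put $\mathcal J_1(\gamma)=J^+(\gamma)+w^2/2$, and let $\mathcal J_2(\gamma)$ be $J^+$ of one of the two components of the preimage of $\gamma$ under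 $z\mapsto z^2$ if $w$ is even, and $J^+$ of the whole preimage if $w$ is odd. For an orbit of the family, these are evaluated on its simply covered trajectory in the $q$-plane $\cong\mathbb C$, with the origin placed at $b$, whenever this is a generic immersion that avoids $b$. A brake-brake orbit (it touches the boundary of the Hill's region at two distinct points), a collision-collision orbit (it collides with $b$ twice, with momenta distinct up to the common sign in $(p_\lambda,p_\nu)$) or a brake-collision orbit (it touches the boundary of the Hill's region and also collides with $b$) is assigned the common value of the invariant on all sufficiently close orbits of the family whose trajectories are generic immersions avoiding $b$. **Theorem.** Every orbit of the $T_{k,l}$-torus family either has a trajectory that is a generic immersion avoiding $b$ or is a brake-brake, collision-collision or brake-collision orbit; in the latter case it is a limit of orbits of the former kind in the family. On every orbit of the family both invariants are defined, and $$\mathcal J_1(T_{k,l})=\begin{cases}2kl-k-l+1 & \text{if } k+l \text{ is odd},\\[2pt] \dfrac{kl-k-l+2}{2} & \text{if } k+l \text{ is even},\end{cases}\qquad \mathcal J_2(T_{k,l})=kl-k-l+1 .$$ -/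

import Mathlib

open Set Filter Topology
open scoped ContDiff

noncomputable section

/-! ### Closed plane curves and Arnold's invariant -/

/-- A smooth immersed loop `ℝ / ℤ → ℂ`, written as a `1`-periodic function. -/
def IsImmersedLoop (γ : ℝ → ℂ) : Prop :=
  ContDiff ℝ ∞ γ ∧ Function.Periodic γ 1 ∧ ∀ t, deriv γ t ≠ 0

/-- A generic immersion: an immersed loop whose only multiple points are transverse double
points. -/
def IsGenericImmersion (γ : ℝ → ℂ) : Prop :=
  IsImmersedLoop γ ∧
  (∀ t₀ ∈ Ico (0 : ℝ) 1, ∀ t₁ ∈ Ico (0 : ℝ) 1, t₀ ≠ t₁ → γ t₀ = γ t₁ →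
    LinearIndependent ℝ ![deriv γ t₀, deriv γ t₁]) ∧
  (∀ t₀ ∈ Ico (0 : ℝ) 1, ∀ t₁ ∈ Ico (0 : ℝ) 1, ∀ t₂ ∈ Ico (0 : ℝ) 1,
    t₀ ≠ t₁ → t₁ ≠ t₂ → t₀ ≠ t₂ → ¬ (γ t₀ = γ t₁ ∧ γ t₁ = γ t₂))

/-- A regular homotopy `Γ s`, `s ∈ [0, 1]`: a path of immersed loops, continuous together with
the velocity. -/
def IsRegularHomotopy (Γ : ℝ → ℝ → ℂ) : Prop :=
  ContinuousOn (fun p : ℝ × ℝ => Γ p.1 p.2) (Icc (0 : ℝ) 1 ×ˢ univ) ∧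
  ContinuousOn (fun p : ℝ × ℝ => deriv (Γ p.1) p.2) (Icc (0 : ℝ) 1 ×ˢ univ) ∧
  ∀ s ∈ Icc (0 : ℝ) 1, IsImmersedLoop (Γ s)

/-- The curve `Γ s` has a direct self-tangency at the parameters `t₀`, `t₁`: the two velocities
point in the same direction. -/
def IsDirectTangency (Γ : ℝ → ℝ → ℂ) (s t₀ t₁ : ℝ) : Prop :=
  Γ s t₀ = Γ s t₁ ∧ ∃ r : ℝ, 0 < r ∧ deriv (Γ s) t₁ = r • deriv (Γ s) t₀

/-- The intersections of the two strands of `Γ s` near the parameters `t₀` and `t₁`. -/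
def localIntersections (Γ : ℝ → ℝ → ℂ) (s t₀ t₁ δ : ℝ) : Set (ℝ × ℝ) :=
  {p | |p.1 - t₀| < δ ∧ |p.2 - t₁| < δ ∧ Γ s p.1 = Γ s p.2}

/-- At time `s` the homotopy crosses positively through a direct self-tangency of the strands at
`t₀`, `t₁`: two double points of these strands are born. -/
def IsPositiveCrossing (Γ : ℝ → ℝ → ℂ) (s t₀ t₁ : ℝ) : Prop :=
  IsDirectTangency Γ s t₀ t₁ ∧ ∃ δ₀ > 0, ∀ δ, 0 < δ → δ < δ₀ →
    (∀ᶠ s' in 𝓝[<] s, (localIntersections Γ s' t₀ t₁ δ).encard = 0) ∧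
    (∀ᶠ s' in 𝓝[>] s, (localIntersections Γ s' t₀ t₁ δ).encard = 2)

/-- The same with two double points dying. -/
def IsNegativeCrossing (Γ : ℝ → ℝ → ℂ) (s t₀ t₁ : ℝ) : Prop :=
  IsDirectTangency Γ s t₀ t₁ ∧ ∃ δ₀ > 0, ∀ δ, 0 < δ → δ < δ₀ →
    (∀ᶠ s' in 𝓝[<] s, (localIntersections Γ s' t₀ t₁ δ).encard = 2) ∧
    (∀ᶠ s' in 𝓝[>] s, (localIntersections Γ s' t₀ t₁ δ).encard = 0)

/-- The finite sets `P`, `N` of triples `(s, t₀, t₁)` list the positive and the negative crossings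
of the regular homotopy `Γ` through direct self-tangencies, and `Γ` has no other direct
self-tangency. Triple points and inverse self-tangencies, through which Arnold's invariant does
not change, are not restricted. -/
def IsCrossingList (Γ : ℝ → ℝ → ℂ) (P N : Finset (ℝ × ℝ × ℝ)) : Prop :=
  (∀ e ∈ P ∪ N, e.1 ∈ Ioo (0 : ℝ) 1 ∧ 0 ≤ e.2.1 ∧ e.2.1 < e.2.2 ∧ e.2.2 < 1) ∧
  (∀ e ∈ P, IsPositiveCrossing Γ e.1 e.2.1 e.2.2) ∧
  (∀ e ∈ N, IsNegativeCrossing Γ e.1 e.2.1 e.2.2) ∧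
  (∀ s ∈ Icc (0 : ℝ) 1, ∀ t₀ t₁ : ℝ, 0 ≤ t₀ → t₀ < t₁ → t₁ < 1 →
    IsDirectTangency Γ s t₀ t₁ → (s, t₀, t₁) ∈ P ∪ N)

/-- The standard curves: `K₀` is a figure eight, `K₁` a circle, and `K_j`, `j ≥ 2`, is a circle
with `j - 1` small disjoint interior loops (an epitrochoid), of rotation number `j`. -/
def standardCurve : ℕ → ℝ → ℂ
  | 0 => fun t => (Real.sin (2 * Real.pi * t) : ℂ) + Real.sin (4 * Real.pi * t) * Complex.I
  | j + 1 => fun t => Complex.exp (2 * Real.pi * t * Complex.I) +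
      3 / (2 * ((j : ℂ) + 1)) * Complex.exp (2 * Real.pi * ((j : ℂ) + 1) * t * Complex.I)

/-- The normalization of `J⁺` on the standard curves: `0` on `K₀` and `2 - 2 j` on `K_j`. -/
def standardJPlus : ℕ → ℤ
  | 0 => 0
  | j + 1 => 2 - 2 * ((j : ℤ) + 1)

/-- `v` is the value `J⁺(γ)` of Arnold's invariant on the generic immersion `γ`: if `γ` is
homotoped to a standard curve, in either orientation, with `N₁` positive and `N₂` negative
crossings through direct self-tangencies, then `J⁺(γ) = J⁺(K_j) - 2 N₁ + 2 N₂`. -/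
def IsArnoldJPlus (γ : ℝ → ℂ) (v : ℤ) : Prop :=
  IsGenericImmersion γ ∧
  ∃ (Γ : ℝ → ℝ → ℂ) (j : ℕ) (P N : Finset (ℝ × ℝ × ℝ)),
    IsRegularHomotopy Γ ∧ IsCrossingList Γ P N ∧
    Γ 0 = γ ∧ (Γ 1 = standardCurve j ∨ Γ 1 = fun t => standardCurve j (-t)) ∧
    v = standardJPlus j - 2 * (P.card : ℤ) + 2 * (N.card : ℤ)

/-- `w` is the winding number around the origin of the loop `γ` in `ℂ ∖ {0}`. -/
def IsWindingNumber (γ : ℝ → ℂ) (w : ℤ) : Prop :=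
  (∀ t, γ t ≠ 0) ∧ ∃ θ : ℝ → ℝ, Continuous θ ∧
    (∀ t, γ t = (‖γ t‖ : ℂ) * Complex.exp (θ t * Complex.I)) ∧
    θ 1 - θ 0 = 2 * Real.pi * w

/-- `𝒥₁(γ) = J⁺(γ) + w₀(γ)² / 2`. -/
def IsJOne (γ : ℝ → ℂ) (a : ℚ) : Prop :=
  ∃ v w : ℤ, IsArnoldJPlus γ v ∧ IsWindingNumber γ w ∧ a = v + (w : ℚ) ^ 2 / 2

/-- `𝒥₂(γ)`: the value of `J⁺` on a component of the preimage of `γ` under `z ↦ z²` if the winding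
number is even, and on the whole preimage, which double covers `γ`, if it is odd. -/
def IsJTwo (γ : ℝ → ℂ) (a : ℚ) : Prop :=
  ∃ (v w : ℤ) (σ : ℝ → ℂ), IsWindingNumber γ w ∧
    ((Even w ∧ ∀ t, σ t ^ 2 = γ t) ∨ (Odd w ∧ ∀ t, σ t ^ 2 = γ (2 * t))) ∧
    IsArnoldJPlus σ v ∧ a = v

/-! ### Euler's problem of two fixed centers -/

/-- The two fixed centers, of mass `1 - μ` and `μ`. -/
inductive Primary
  | earth
  | moon

/-- The centers lie at `-1/2` and `1/2`. -/
def Primary.position : Primary → ℂ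
  | .earth => -1 / 2
  | .moon => 1 / 2

/-- The angular elliptic coordinate `ν` of the centers, which both have `λ = 0`. -/
def Primary.angle : Primary → ℝ
  | .earth => Real.pi
  | .moon => 0

/-- The Hamiltonian of the Euler problem. -/
def eulerHamiltonian (μ : ℝ) (q p : ℂ) : ℝ :=
  ‖p‖ ^ 2 / 2 - (1 - μ) / ‖q - Primary.earth.position‖ - μ / ‖q - Primary.moon.position‖

/-- The position with elliptic coordinates `(λ, ν)`, that is
`(cosh λ cos ν / 2, sinh λ sin ν / 2)`. -/
def ellipticPosition (lam nu : ℝ) : ℂ :=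
  ⟨Real.cosh lam * Real.cos nu / 2, Real.sinh lam * Real.sin nu / 2⟩

/-- `K_λ = 2 p_λ² - 2 cosh λ - c cosh² λ`. -/
def kLam (c lam pLam : ℝ) : ℝ :=
  2 * pLam ^ 2 - 2 * Real.cosh lam - c * Real.cosh lam ^ 2

/-- `K_ν = 2 p_ν² + 2 (1 - 2 μ) cos ν + c cos² ν`. -/
def kNu (μ c nu pNu : ℝ) : ℝ :=
  2 * pNu ^ 2 + 2 * (1 - 2 * μ) * Real.cos nu + c * Real.cos nu ^ 2

/-- The regularized Hamiltonian `K = (H - c) (cosh² λ - cos² ν) = K_λ + K_ν` on energy `c`. -/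
def regularizedHamiltonian (μ c lam nu pLam pNu : ℝ) : ℝ :=
  kLam c lam pLam + kNu μ c nu pNu

/-- Away from the centers `K` is the Euler Hamiltonian minus `c`, times `cosh² λ - cos² ν`, where
the momenta are related by `p₁ dq₁ + p₂ dq₂ = p_λ dλ + p_ν dν`. -/
theorem regularizedHamiltonian_eq (μ c lam nu p₁ p₂ : ℝ)
    (h : Real.cosh lam ^ 2 - Real.cos nu ^ 2 ≠ 0) :
    regularizedHamiltonian μ c lam nu
      (p₁ * (Real.sinh lam * Real.cos nu / 2) + p₂ * (Real.cosh lam * Real.sin nu / 2))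
      (p₁ * (-(Real.cosh lam * Real.sin nu) / 2) + p₂ * (Real.sinh lam * Real.cos nu / 2)) =
    (eulerHamiltonian μ (ellipticPosition lam nu) ⟨p₁, p₂⟩ - c) *
      (Real.cosh lam ^ 2 - Real.cos nu ^ 2) := by
  have hs := Real.cosh_sq lam
  have ht := Real.sin_sq_add_cos_sq nu
  have h1 := Real.one_le_cosh lam
  have h2 := Real.cos_le_one nu
  have h3 := Real.neg_one_le_cos nu
  have hE : ‖ellipticPosition lam nu - Primary.earth.position‖ =
      (Real.cosh lam + Real.cos nu) / 2 := by
    rw [Complex.norm_eq_sqrt_sq_add_sq, Real.sqrt_eq_iff_mul_self_eq (by positivity) (by linarith)]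
    simp [ellipticPosition, Primary.position]
    have e : Real.sin nu ^ 2 = 1 - Real.cos nu ^ 2 := by linarith
    have e' : Real.sinh lam ^ 2 = Real.cosh lam ^ 2 - 1 := by linarith
    ring_nf
    rw [e, e']
    ring
  have hM : ‖ellipticPosition lam nu - Primary.moon.position‖ =
      (Real.cosh lam - Real.cos nu) / 2 := by
    rw [Complex.norm_eq_sqrt_sq_add_sq, Real.sqrt_eq_iff_mul_self_eq (by positivity) (by linarith)]
    simp [ellipticPosition, Primary.position]
    have e : Real.sin nu ^ 2 = 1 - Real.cos nu ^ 2 := by linarith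
    have e' : Real.sinh lam ^ 2 = Real.cosh lam ^ 2 - 1 := by linarith
    ring_nf
    rw [e, e']
    ring
  have hp : ‖(⟨p₁, p₂⟩ : ℂ)‖ ^ 2 = p₁ ^ 2 + p₂ ^ 2 := by
    rw [← Complex.normSq_eq_norm_sq, Complex.normSq_mk]
    ring
  have hab : (Real.cosh lam + Real.cos nu) * (Real.cosh lam - Real.cos nu) ≠ 0 := by
    intro h0
    exact h (by linarith [h0, mul_comm (Real.cosh lam) (Real.cos nu), sq_sub_sq (Real.cosh lam) (Real.cos nu)])
  have ha := left_ne_zero_of_mul hab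
  have hb := right_ne_zero_of_mul hab
  unfold regularizedHamiltonian eulerHamiltonian kLam kNu
  rw [hE, hM, hp]
  have e : Real.sin nu ^ 2 = 1 - Real.cos nu ^ 2 := by linarith
  have e' : Real.sinh lam ^ 2 = Real.cosh lam ^ 2 - 1 := by linarith
  field_simp
  ring_nf
  simp only [e, e']
  ring

/-- A (complete) solution of the Hamiltonian equations of `K`, in the regularized time. -/
structure EulerOrbit (μ c : ℝ) where
  lam : ℝ → ℝ
  nu : ℝ → ℝ
  pLam : ℝ → ℝ
  pNu : ℝ → ℝ
  hasDerivAt_lam : ∀ t, HasDerivAt lam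
    (deriv (fun p => regularizedHamiltonian μ c (lam t) (nu t) p (pNu t)) (pLam t)) t
  hasDerivAt_nu : ∀ t, HasDerivAt nu
    (deriv (fun p => regularizedHamiltonian μ c (lam t) (nu t) (pLam t) p) (pNu t)) t
  hasDerivAt_pLam : ∀ t, HasDerivAt pLam
    (-deriv (fun x => regularizedHamiltonian μ c x (nu t) (pLam t) (pNu t)) (lam t)) t
  hasDerivAt_pNu : ∀ t, HasDerivAt pNu
    (-deriv (fun x => regularizedHamiltonian μ c (lam t) x (pLam t) (pNu t)) (nu t)) t

/-- The phase space point at time `t`. -/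
def EulerOrbit.state {μ c : ℝ} (x : EulerOrbit μ c) (t : ℝ) : ℝ × ℝ × ℝ × ℝ :=
  (x.lam t, x.nu t, x.pLam t, x.pNu t)

/-- The position at time `t` relative to the center `b`. -/
def EulerOrbit.relPosition {μ c : ℝ} (x : EulerOrbit μ c) (b : Primary) (t : ℝ) : ℂ :=
  ellipticPosition (x.lam t) (x.nu t) - b.position

/-- `T` is the minimal period of `f`. -/
def IsMinimalPeriod {α : Type*} (f : ℝ → α) (T : ℝ) : Prop :=
  IsLeast {T : ℝ | 0 < T ∧ Function.Periodic f T} T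

/-- The region `S` of regular values `(G, H) = (g, c)`, `c < 0`: motions close to either center.
Below the critical energy `c₁ = -1 - 2 √(μ (1 - μ))` the last two conditions follow from the
others. -/
def InRegionS (μ g c : ℝ) : Prop :=
  c < 0 ∧ -2 < g + c ∧ g + c < -2 * |1 - 2 * μ| ∧ c < -|1 - 2 * μ| ∧ g * c < (1 - 2 * μ) ^ 2

/-- The region `S'`: motions close to the heavier center only. -/
def InRegionS' (μ g c : ℝ) : Prop :=
  c < 0 ∧ -2 * |1 - 2 * μ| < g + c ∧ g + c < 2 * |1 - 2 * μ|

/-- The orbit lies on the Liouville torus around the center `b` with `(G, H) = (g, c)`, that is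
`K_λ = g`, `K_ν = -g`, where `ν` stays in the interval around `b.angle` of angles that are allowed
at this level; and the torus is a `T_{k,l}`-torus: the rotation number `T_ν / T_λ` is `k / l`. -/
def IsTorusOrbit {μ c : ℝ} (x : EulerOrbit μ c) (g : ℝ) (b : Primary) (k l : ℕ) : Prop :=
  (∀ t, kLam c (x.lam t) (x.pLam t) = g) ∧
  (∀ t, kNu μ c (x.nu t) (x.pNu t) = -g) ∧
  (∀ t, ∀ y ∈ uIcc b.angle (x.nu t), kNu μ c y 0 ≤ -g) ∧
  ∃ Tlam Tnu : ℝ, IsMinimalPeriod (fun t => (x.lam t, x.pLam t)) Tlam ∧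
    IsMinimalPeriod (fun t => (x.nu t, x.pNu t)) Tnu ∧ Tnu / Tlam = k / l

/-- `γ` is the simply covered closed curve of the orbit `x`, relative to the center `b` and
parametrized over `ℝ / ℤ`, and it is a generic immersion in the complement of `b`. -/
def IsGenericCurveOf {μ c : ℝ} (x : EulerOrbit μ c) (b : Primary) (γ : ℝ → ℂ) : Prop :=
  (∃ T, IsMinimalPeriod (x.relPosition b) T ∧ γ = fun t => x.relPosition b (T * t)) ∧
  IsGenericImmersion γ ∧ ∀ t, γ t ≠ 0

/-- The orbit touches the boundary of the Hill's region at time `t`. -/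
def EulerOrbit.IsBrake {μ c : ℝ} (x : EulerOrbit μ c) (t : ℝ) : Prop :=
  x.pLam t = 0 ∧ x.pNu t = 0

/-- The orbit collides with the center `b` at time `t`. -/
def EulerOrbit.IsCollision {μ c : ℝ} (x : EulerOrbit μ c) (b : Primary) (t : ℝ) : Prop :=
  x.lam t = 0 ∧ x.nu t = b.angle

/-- Brake-brake, collision-collision and brake-collision orbits. At a collision the momenta are
only defined up to the common sign, since the elliptic coordinates are a branched double cover. -/
def IsDistinguished {μ c : ℝ} (x : EulerOrbit μ c) (b : Primary) : Prop :=
  (∃ t t', x.IsBrake t ∧ x.IsBrake t' ∧ x.relPosition b t ≠ x.relPosition b t') ∨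
  (∃ t t', x.IsCollision b t ∧ x.IsCollision b t' ∧
    (x.pLam t, x.pNu t) ≠ (x.pLam t', x.pNu t') ∧
    (x.pLam t, x.pNu t) ≠ (-x.pLam t', -x.pNu t')) ∨
  (∃ t t', x.IsBrake t ∧ x.IsCollision b t')

/-- `γ` is a generic curve of the member with initial state `z` of the `T_{k,l}`-torus family
around `b`, in the region `S` or `S'`. -/
def IsGenericMember (μ : ℝ) (b : Primary) (k l : ℕ) (z : ℝ × ℝ × ℝ × ℝ) (γ : ℝ → ℂ) : Prop :=
  ∃ (g c : ℝ) (y : EulerOrbit μ c), (InRegionS μ g c ∨ InRegionS' μ g c) ∧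
    IsTorusOrbit y g b k l ∧ y.state 0 = z ∧ IsGenericCurveOf y b γ

/-- The invariant `J` (one of `𝒥₁`, `𝒥₂`) of the member `x` of the `T_{k,l}`-torus family around
`b` has the value `a`. If the curve of `x` is a generic immersion in the complement of `b`, this
is the value of `J` on that curve; if `x` is one of the three distinguished orbits, it is the
common value of `J` on all small perturbations of `x` to generic members of the family. -/
def HasInvariant (J : (ℝ → ℂ) → ℚ → Prop) {μ c : ℝ} (x : EulerOrbit μ c) (b : Primary)
    (k l : ℕ) (a : ℚ) : Prop :=
  (∃ γ, IsGenericCurveOf x b γ ∧ J γ a) ∨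
  (IsDistinguished x b ∧
    (∃ᶠ z in 𝓝 (x.state 0), ∃ γ, IsGenericMember μ b k l z γ) ∧
    (∀ᶠ z in 𝓝 (x.state 0), ∀ γ, IsGenericMember μ b k l z γ → J γ a))

end

noncomputable section

/-! ### Regular homotopies along which double points only die -/

/-! Why the theorem holds. In elliptic coordinates `q = cosh(λ + iν)/2`, so with `z = λ + i(ν -
ν_b)` the half-angle formula gives `q - b = ± sinh²(z/2)`. The regularized flow is a product of two
oscillators in symmetric potential wells. On a `T_{k,l}`-torus, `λ` and `ν - ν_b` are therefore
functions `f₁(kt + φ₁)` and `f₂(lt + φ₂)` that behave like cosines (`CosLike`), and the trajectory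
is the square of `σ = c sinh((f₁ + i f₂)/2)` with `c² = ±1`. If `k + l` is odd, `σ²` is simply
covered over the period of `σ`; if `k` and `l` are odd, `σ` changes sign after half a period and
`σ²` closes up at that time. In both cases `σ` is the lift that enters `𝒥₂`.

Genericity. On the strip `|Im z| < π` the odd map `sinh(z/2)` has a derivative of positive real
part, hence is injective. So if two points of `σ` agree up to sign and their velocities are
parallel, this can be read off from the two phases. A positive ratio makes the times differ by a
translation of the torus, that is, they are the same point of the loop. A negative ratio gives a
reflection of the torus, whose fixed time is a brake or a collision. Hence an orbit without brake
and collision is a generic immersion, and it has no direct self-tangency whatever `f₁`, `f₂` and the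
phases are (`TorusData.IsLoop`). Brakes and collisions sit at discrete values of `4(lφ₁ - kφ₂)`. So
`f₁`, `f₂` can be deformed to cosines, `sinh(z/2)` to `z/2`, and the phase to one close to a brake,
without changing `J⁺` (`TorusData.exists_deform`). The result is a thin curve that runs back and
forth along the Lissajous arc `(cos kθ, cos lθ)`, or along its square.

`J⁺` of thin curves. Such a curve is retracted by shortening the arc from one end (`Retraction`).
When the moving turn passes a double point of the arc, it leaves the two strands of the other
branch; they run in opposite directions, so one tangency is direct and one inverse. Each double
point costs one negative crossing (`Retraction.eventually_jPlusPath`). What remains is a thin curve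
along a segment, a circle or a figure eight with `J⁺ = 0`. Thus `J⁺` is twice the number of double
points of the arc (`IsArc.eventually_reduces`).

Counting. The Lissajous arc has `(k-1)(l-1)/2` double points, its square has `((k-1)(l-1) + kl)/2`
for `k + l` odd, and the square, run once, has `(k-1)(l-1)/4` for `k`, `l` odd. The winding number
of the trajectory is `0` for `k + l` odd, by a conjugation symmetry, and `±1` for `k`, `l` odd.
These numbers give the formulas.

An orbit with a brake or a collision is one of the three distinguished kinds, by a shift of half a
period. Shifting the phase of `λ` slightly makes it regular, and all regular members of the family
have the same values. -/

/-- There is a regular homotopy from `γ₀` to `γ₁` whose direct self-tangencies are `n` negative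
crossings. -/
def JPlusPath (γ₀ γ₁ : ℝ → ℂ) (n : ℕ) : Prop :=
  ∃ (Γ : ℝ → ℝ → ℂ) (N : Finset (ℝ × ℝ × ℝ)), IsRegularHomotopy Γ ∧ IsCrossingList Γ ∅ N ∧
    Γ 0 = γ₀ ∧ Γ 1 = γ₁ ∧ N.card = n

/-- Concatenation runs each homotopy at double speed. An increasing affine change of time respects
the left and right neighbourhoods of `s`, so crossings keep their sign. -/
theorem IsNegativeCrossing.comp_affine {Γ Γ' : ℝ → ℝ → ℂ} {a b s t₀ t₁ : ℝ} (ha : 0 < a)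
    (h : IsNegativeCrossing Γ' (a * s + b) t₀ t₁)
    (hΓ : ∀ᶠ s' in 𝓝 s, Γ s' = Γ' (a * s' + b)) : IsNegativeCrossing Γ s t₀ t₁ := by
  obtain ⟨h1, δ₀, hδ₀, h2⟩ := h
  have hc : Tendsto (fun s' => a * s' + b) (𝓝 s) (𝓝 (a * s + b)) := by
    have : Continuous fun s' : ℝ => a * s' + b := by fun_prop
    exact this.tendsto s
  have hlt : Tendsto (fun s' => a * s' + b) (𝓝[<] s) (𝓝[<] (a * s + b)) := by
    refine tendsto_nhdsWithin_iff.2 ⟨hc.mono_left nhdsWithin_le_nhds, ?_⟩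
    filter_upwards [self_mem_nhdsWithin] with x hx
    have := mul_lt_mul_of_pos_left (mem_Iio.1 hx) ha
    simpa using this
  have hgt : Tendsto (fun s' => a * s' + b) (𝓝[>] s) (𝓝[>] (a * s + b)) := by
    refine tendsto_nhdsWithin_iff.2 ⟨hc.mono_left nhdsWithin_le_nhds, ?_⟩
    filter_upwards [self_mem_nhdsWithin] with x hx
    have := mul_lt_mul_of_pos_left (mem_Ioi.1 hx) ha
    simpa using this
  refine ⟨?_, δ₀, hδ₀, fun δ hδ hδ' => ⟨?_, ?_⟩⟩
  · unfold IsDirectTangency at *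
    rwa [hΓ.self_of_nhds]
  · filter_upwards [hlt.eventually (h2 δ hδ hδ').1, hΓ.filter_mono nhdsWithin_le_nhds] with x hx hx'
    unfold localIntersections at *
    rwa [hx']
  · filter_upwards [hgt.eventually (h2 δ hδ hδ').2, hΓ.filter_mono nhdsWithin_le_nhds] with x hx hx'
    unfold localIntersections at *
    rwa [hx']

theorem continuousOn_homotopy_concat {E : Type*} [TopologicalSpace E] {F G H : ℝ → ℝ → E}
    (hF : ContinuousOn (fun p : ℝ × ℝ => F p.1 p.2) (Icc (0 : ℝ) 1 ×ˢ univ))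
    (hG : ContinuousOn (fun p : ℝ × ℝ => G p.1 p.2) (Icc (0 : ℝ) 1 ×ˢ univ))
    (hl : ∀ s ≤ 1 / 2, H s = F (2 * s + 0)) (hr : ∀ s ≥ 1 / 2, H s = G (2 * s + -1)) :
    ContinuousOn (fun p : ℝ × ℝ => H p.1 p.2) (Icc (0 : ℝ) 1 ×ˢ univ) := by
  have h1 : ContinuousOn (fun p : ℝ × ℝ => H p.1 p.2) (Icc (0 : ℝ) (1 / 2) ×ˢ univ) := by
    have : ContinuousOn (fun p : ℝ × ℝ => F (2 * p.1 + 0) p.2) (Icc (0 : ℝ) (1 / 2) ×ˢ univ) := by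
      refine hF.comp (f := fun p : ℝ × ℝ => (2 * p.1 + 0, p.2)) (by fun_prop) ?_
      rintro ⟨s, t⟩ ⟨⟨hs, hs'⟩, -⟩
      refine ⟨⟨?_, ?_⟩, trivial⟩ <;> simp at * <;> linarith
    refine this.congr ?_
    rintro ⟨s, t⟩ ⟨⟨hs, hs'⟩, -⟩
    simp only
    rw [hl s hs']
  have h2 : ContinuousOn (fun p : ℝ × ℝ => H p.1 p.2) (Icc (1 / 2 : ℝ) 1 ×ˢ univ) := by
    have : ContinuousOn (fun p : ℝ × ℝ => G (2 * p.1 + -1) p.2) (Icc (1 / 2 : ℝ) 1 ×ˢ univ) := by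
      refine hG.comp (f := fun p : ℝ × ℝ => (2 * p.1 + -1, p.2)) (by fun_prop) ?_
      rintro ⟨s, t⟩ ⟨⟨hs, hs'⟩, -⟩
      refine ⟨⟨?_, ?_⟩, trivial⟩ <;> simp at * <;> linarith
    refine this.congr ?_
    rintro ⟨s, t⟩ ⟨⟨hs, hs'⟩, -⟩
    simp only
    rw [hr s hs]
  have := h1.union_of_isClosed h2 (isClosed_Icc.prod isClosed_univ) (isClosed_Icc.prod isClosed_univ)
  rwa [← union_prod, Icc_union_Icc_eq_Icc (by norm_num) (by norm_num)] at this

/-- Crossing times lie in the open unit interval, so after compression those of the two halves stay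
away from the junction and from each other, and the counts add. -/
theorem JPlusPath.trans {γ₀ γ₁ γ₂ : ℝ → ℂ} {m n : ℕ} (h₁ : JPlusPath γ₀ γ₁ m)
    (h₂ : JPlusPath γ₁ γ₂ n) : JPlusPath γ₀ γ₂ (m + n) := by
  classical
  obtain ⟨Γ₁, N₁, ⟨hc1, hd1, hi1⟩, ⟨ha1, -, hb1, hl1⟩, h10, h11, hm⟩ := h₁
  obtain ⟨Γ₂, N₂, ⟨hc2, hd2, hi2⟩, ⟨ha2, -, hb2, hl2⟩, h20, h21, hn⟩ := h₂
  simp only [Finset.empty_union] at ha1 ha2 hl1 hl2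
  set Γ : ℝ → ℝ → ℂ := fun s => if s ≤ 1 / 2 then Γ₁ (2 * s + 0) else Γ₂ (2 * s + -1) with hΓ
  have hl : ∀ s ≤ 1 / 2, Γ s = Γ₁ (2 * s + 0) := fun s hs => if_pos hs
  have hr : ∀ s ≥ 1 / 2, Γ s = Γ₂ (2 * s + -1) := by
    intro s hs
    rcases hs.lt_or_eq with h | h
    · exact if_neg (not_le.2 h)
    · rw [hl s h.symm.le, ← h]
      norm_num [h11, h20]
  let f₁ : ℝ × ℝ × ℝ → ℝ × ℝ × ℝ := fun e => (e.1 / 2, e.2)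
  let f₂ : ℝ × ℝ × ℝ → ℝ × ℝ × ℝ := fun e => ((e.1 + 1) / 2, e.2)
  have hf₁ : Function.Injective f₁ := by
    rintro ⟨a, b⟩ ⟨c, d⟩ h
    simp only [f₁, Prod.mk.injEq] at h ⊢
    exact ⟨by linarith [h.1], h.2⟩
  have hf₂ : Function.Injective f₂ := by
    rintro ⟨a, b⟩ ⟨c, d⟩ h
    simp only [f₂, Prod.mk.injEq] at h ⊢
    exact ⟨by linarith [h.1], h.2⟩
  refine ⟨Γ, N₁.image f₁ ∪ N₂.image f₂, ⟨continuousOn_homotopy_concat hc1 hc2 hl hr, ?_, ?_⟩,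
    ⟨?_, by simp, ?_, ?_⟩, ?_, ?_, ?_⟩
  · exact continuousOn_homotopy_concat (F := fun s => deriv (Γ₁ s)) (G := fun s => deriv (Γ₂ s))
      (H := fun s => deriv (Γ s)) hd1 hd2 (fun s hs => by rw [hl s hs]) (fun s hs => by rw [hr s hs])
  · rintro s ⟨hs, hs'⟩
    rcases le_total s (1 / 2) with h | h
    · rw [hl s h]; exact hi1 _ ⟨by linarith, by linarith⟩
    · rw [hr s h]; exact hi2 _ ⟨by linarith, by linarith⟩
  · intro e he
    simp only [Finset.empty_union, Finset.mem_union, Finset.mem_image] at he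
    rcases he with ⟨e, he, rfl⟩ | ⟨e, he, rfl⟩
    · obtain ⟨⟨h1, h2⟩, h3⟩ := ha1 e he
      exact ⟨⟨by simp only [f₁]; linarith, by simp only [f₁]; linarith⟩, h3⟩
    · obtain ⟨⟨h1, h2⟩, h3⟩ := ha2 e he
      exact ⟨⟨by simp only [f₂]; linarith, by simp only [f₂]; linarith⟩, h3⟩
  · intro e he
    simp only [Finset.mem_union, Finset.mem_image] at he
    rcases he with ⟨e, he, rfl⟩ | ⟨e, he, rfl⟩
    · refine IsNegativeCrossing.comp_affine (Γ' := Γ₁) (a := 2) (b := 0) two_pos ?_ ?_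
      · have := hb1 e he
        simp only [f₁]; convert this using 1; ring
      · have : e.1 / 2 < 1 / 2 := by linarith [(ha1 e he).1.2]
        filter_upwards [Iio_mem_nhds this] with s hs using hl s (le_of_lt hs)
    · refine IsNegativeCrossing.comp_affine (Γ' := Γ₂) (a := 2) (b := -1) two_pos ?_ ?_
      · have := hb2 e he
        simp only [f₂]; convert this using 1; ring
      · have : 1 / 2 < (e.1 + 1) / 2 := by linarith [(ha2 e he).1.1]
        filter_upwards [Ioi_mem_nhds this] with s hs using hr s (le_of_lt hs)
  · rintro s ⟨hs, hs'⟩ t₀ t₁ h0 h01 h1 ht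
    simp only [Finset.empty_union, Finset.mem_union, Finset.mem_image]
    rcases le_total s (1 / 2) with h | h
    · left
      unfold IsDirectTangency at ht
      rw [hl s h] at ht
      exact ⟨_, hl1 (2 * s + 0) ⟨by linarith, by linarith⟩ t₀ t₁ h0 h01 h1 ht, by simp [f₁]⟩
    · right
      unfold IsDirectTangency at ht
      rw [hr s h] at ht
      refine ⟨_, hl2 (2 * s + -1) ⟨by linarith, by linarith⟩ t₀ t₁ h0 h01 h1 ht, ?_⟩
      simp only [f₂, Prod.mk.injEq, and_true]
      ring
  · rw [hl 0 (by norm_num)]; simpa using h10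
  · rw [hr 1 (by norm_num)]; norm_num; exact h21
  · rw [Finset.card_union_of_disjoint, Finset.card_image_of_injective _ hf₁,
      Finset.card_image_of_injective _ hf₂, hm, hn]
    rw [Finset.disjoint_left]
    intro e he he'
    simp only [Finset.mem_image] at he he'
    obtain ⟨e₁, h1, rfl⟩ := he
    obtain ⟨e₂, h2, h3⟩ := he'
    have h4 : (e₂.1 + 1) / 2 = e₁.1 / 2 := congrArg Prod.fst h3
    linarith [(ha1 e₁ h1).1.2, (ha2 e₂ h2).1.1]

/-- A regular homotopy without direct self-tangencies. -/
theorem JPlusPath.of_forall {Γ Γ' : ℝ → ℝ → ℂ}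
    (hc : Continuous fun p : ℝ × ℝ => Γ p.1 p.2) (hc' : Continuous fun p : ℝ × ℝ => Γ' p.1 p.2)
    (hd : ∀ s t, HasDerivAt (Γ s) (Γ' s t) t) (hsm : ∀ s, ContDiff ℝ ∞ (Γ s))
    (hper : ∀ s, Function.Periodic (Γ s) 1)
    (himm : ∀ s ∈ Icc (0 : ℝ) 1, ∀ t, Γ' s t ≠ 0)
    (hno : ∀ s ∈ Icc (0 : ℝ) 1, ∀ t₀ t₁ r : ℝ, 0 < r → Γ s t₀ = Γ s t₁ →
      Γ' s t₁ = r • Γ' s t₀ → ∃ n : ℤ, t₁ - t₀ = n) : JPlusPath (Γ 0) (Γ 1) 0 := by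
  have hder : ∀ s, deriv (Γ s) = Γ' s := fun s => funext fun t => (hd s t).deriv
  refine ⟨Γ, ∅, ⟨hc.continuousOn, ?_, fun s hs => ⟨hsm s, hper s, ?_⟩⟩,
    ⟨by simp, by simp, by simp, ?_⟩, rfl, rfl, rfl⟩
  · simp only [hder]; exact hc'.continuousOn
  · rw [hder]; exact himm s hs
  · rintro s hs t₀ t₁ h0 h01 h1 ⟨he, r, hr, hr'⟩
    rw [hder] at hr'
    obtain ⟨n, hn⟩ := hno s hs t₀ t₁ r hr he hr'
    have h2 : (0 : ℝ) < n := by linarith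
    have h3 : (n : ℝ) < 1 := by linarith
    have h4 : 0 < n := by exact_mod_cast h2
    have h5 : n < 1 := by exact_mod_cast h3
    omega

/-- Both `K₀` and `K₁` are normalized to `0`, so the value comes from the negative crossings alone.
-/
theorem JPlusPath.isArnoldJPlus {γ : ℝ → ℂ} {n j : ℕ} (hγ : IsGenericImmersion γ) (hj : j ≤ 1)
    (h : JPlusPath γ (standardCurve j) n ∨ JPlusPath γ (fun t => standardCurve j (-t)) n) :
    IsArnoldJPlus γ (2 * n) := by
  have hs : standardJPlus j = 0 := by
    interval_cases j <;> simp [standardJPlus]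
  rcases h with ⟨Γ, N, h1, h2, h3, h4, h5⟩ | ⟨Γ, N, h1, h2, h3, h4, h5⟩
  · exact ⟨hγ, Γ, j, ∅, N, h1, h2, h3, Or.inl h4, by simp [hs, h5]⟩
  · exact ⟨hγ, Γ, j, ∅, N, h1, h2, h3, Or.inr h4, by simp [hs, h5]⟩

/-- `γ` can be joined to a standard curve with `J⁺ = 0` by a homotopy with `n` negative crossings
as its only direct self-tangencies. -/
def ReducesToStandard (γ : ℝ → ℂ) (n : ℕ) : Prop :=
  ∃ j ≤ 1, JPlusPath γ (standardCurve j) n ∨ JPlusPath γ (fun t => standardCurve j (-t)) n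

theorem JPlusPath.reducesToStandard {γ₀ γ₁ : ℝ → ℂ} {m n : ℕ} (h : JPlusPath γ₀ γ₁ m)
    (h' : ReducesToStandard γ₁ n) : ReducesToStandard γ₀ (m + n) := by
  obtain ⟨j, hj, h' | h'⟩ := h'
  · exact ⟨j, hj, Or.inl (h.trans h')⟩
  · exact ⟨j, hj, Or.inr (h.trans h')⟩

theorem ReducesToStandard.isArnoldJPlus {γ : ℝ → ℂ} {n : ℕ} (h : ReducesToStandard γ n)
    (hγ : IsGenericImmersion γ) : IsArnoldJPlus γ (2 * n) := by
  obtain ⟨j, hj, h⟩ := h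
  exact JPlusPath.isArnoldJPlus hγ hj h

/-! ### Curves over a segment -/

theorem ContDiff.complex_ofReal {f : ℝ → ℝ} (hf : ContDiff ℝ ∞ f) :
    ContDiff ℝ ∞ fun t => (f t : ℂ) :=
  Complex.ofRealCLM.contDiff.comp hf

theorem cos_two_pi_eq_iff {t₀ t₁ : ℝ} :
    Real.cos (2 * Real.pi * t₀) = Real.cos (2 * Real.pi * t₁) ↔
      (∃ n : ℤ, t₁ - t₀ = n) ∨ ∃ n : ℤ, t₁ + t₀ = n := by
  have hpi := Real.pi_pos
  rw [Real.cos_eq_cos_iff]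
  constructor
  · rintro ⟨k, h | h⟩
    · left
      refine ⟨k, ?_⟩
      have : 2 * Real.pi * (t₁ - t₀ - k) = 0 := by linarith
      simpa [hpi.ne', sub_eq_zero] using this
    · right
      refine ⟨k, ?_⟩
      have : 2 * Real.pi * (t₁ + t₀ - k) = 0 := by linarith
      have h3 : t₁ + t₀ - k = 0 := by simpa [hpi.ne'] using this
      linarith
  · rintro (⟨n, h⟩ | ⟨n, h⟩)
    · exact ⟨n, Or.inl (by rw [← h]; ring)⟩
    · exact ⟨n, Or.inr (by rw [← h]; ring)⟩

theorem sin_two_pi_eq_zero_iff {t : ℝ} :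
    Real.sin (2 * Real.pi * t) = 0 ↔ ∃ n : ℤ, 2 * t = n := by
  have hpi := Real.pi_pos
  rw [Real.sin_eq_zero_iff]
  constructor
  · rintro ⟨n, h⟩
    refine ⟨n, ?_⟩
    have : Real.pi * (2 * t - n) = 0 := by linarith
    have h3 : 2 * t - n = 0 := by simpa [hpi.ne'] using this
    linarith
  · rintro ⟨n, h⟩
    exact ⟨n, by rw [← h]; ring⟩

theorem periodic_int {α : Type*} {f : ℝ → α} (hf : Function.Periodic f 1) (t : ℝ) (n : ℤ) :
    f (t + n) = f t := by
  have := hf.int_mul n t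
  simpa using this

theorem periodic_deriv {f f' : ℝ → ℂ} (hf : Function.Periodic f 1)
    (hd : ∀ t, HasDerivAt f (f' t) t) : Function.Periodic f' 1 := by
  intro t
  have h1 := (hd (t + 1)).comp_add_const t 1
  have h2 : (fun x => f (x + 1)) = f := funext hf
  rw [h2] at h1
  exact h1.unique (hd t)

theorem eq_int_or_half {t : ℝ} (h : ∃ n : ℤ, 2 * t = n) :
    (∃ m : ℤ, t = 0 + m) ∨ ∃ m : ℤ, t = 1 / 2 + m := by
  obtain ⟨n, hn⟩ := h
  rcases Int.even_or_odd' n with ⟨m, rfl | rfl⟩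
  · left; exact ⟨m, by push_cast at hn; linarith⟩
  · right; exact ⟨m, by push_cast at hn; linarith⟩

/-- Two parameters over the same point of the segment at which the curve has a direct
self-tangency are equal. -/
theorem int_sub_of_cos_eq {t₀ t₁ r : ℝ} (hr : 0 < r)
    (hc : Real.cos (2 * Real.pi * t₀) = Real.cos (2 * Real.pi * t₁))
    (hs : Real.sin (2 * Real.pi * t₁) = r * Real.sin (2 * Real.pi * t₀)) :
    ∃ n : ℤ, t₁ - t₀ = n := by
  rcases cos_two_pi_eq_iff.1 hc with h | ⟨n, hn⟩
  · exact h
  · have h1 : t₁ = n - t₀ := by linarith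
    have h2 : Real.sin (2 * Real.pi * t₁) = -Real.sin (2 * Real.pi * t₀) := by
      rw [h1, show 2 * Real.pi * (n - t₀) = n * (2 * Real.pi) - 2 * Real.pi * t₀ by ring,
        Real.sin_int_mul_two_pi_sub]
    have h3 : (1 + r) * Real.sin (2 * Real.pi * t₀) = 0 := by linarith
    have h4 : Real.sin (2 * Real.pi * t₀) = 0 := by
      rcases mul_eq_zero.1 h3 with h | h
      · linarith
      · exact h
    obtain ⟨m, hm⟩ := sin_two_pi_eq_zero_iff.1 h4
    exact ⟨n - m, by push_cast; linarith⟩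

/-- The curve `d + a (cos 2πt + i y(t))`. -/
def segmentCurve (a d : ℂ) (y : ℝ → ℝ) (t : ℝ) : ℂ :=
  d + a * ((Real.cos (2 * Real.pi * t) : ℂ) + (y t : ℂ) * Complex.I)

/-- Up to an affine map the real part is always `cos 2πt`, so points that coincide with velocities
in the same direction have the same parameter (`int_sub_of_cos_eq`), whatever `y` is. Being immersed
is only at stake at the two ends of the segment, where the equal signs of the two derivatives keep
their convex combination away from zero. -/
theorem segmentCurve_path {a₀ a₁ d₀ d₁ : ℂ} {y₀ y₁ : ℝ → ℝ} (ha₀ : a₀ ≠ 0) (ha₁ : a₁ ≠ 0)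
    (hy₀ : ContDiff ℝ ∞ y₀) (hy₁ : ContDiff ℝ ∞ y₁) (hp₀ : Function.Periodic y₀ 1)
    (hp₁ : Function.Periodic y₁ 1) (h0 : 0 < deriv y₀ 0 * deriv y₁ 0)
    (h1 : 0 < deriv y₀ (1 / 2) * deriv y₁ (1 / 2)) :
    JPlusPath (segmentCurve a₀ d₀ y₀) (segmentCurve a₁ d₁ y₁) 0 := by
  -- Interpolating logarithms keeps the factor nonzero.
  set a : ℝ → ℂ := fun s => Complex.exp ((1 - s) * Complex.log a₀ + s * Complex.log a₁)
  set d : ℝ → ℂ := fun s => (1 - s) * d₀ + s * d₁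
  set y : ℝ → ℝ → ℝ := fun s t => (1 - s) * y₀ t + s * y₁ t
  set y' : ℝ → ℝ → ℝ := fun s t => (1 - s) * deriv y₀ t + s * deriv y₁ t
  have e0 : segmentCurve a₀ d₀ y₀ = segmentCurve (a 0) (d 0) (y 0) := by
    funext t; simp [segmentCurve, a, d, y, Complex.exp_log ha₀]
  have e1 : segmentCurve a₁ d₁ y₁ = segmentCurve (a 1) (d 1) (y 1) := by
    funext t; simp [segmentCurve, a, d, y, Complex.exp_log ha₁]
  have hD₀ : Continuous (deriv y₀) := hy₀.continuous_deriv (by simp)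
  have hD₁ : Continuous (deriv y₁) := hy₁.continuous_deriv (by simp)
  have hC₀ := hy₀.continuous
  have hC₁ := hy₁.continuous
  have hane : ∀ s, a s ≠ 0 := fun s => Complex.exp_ne_zero _
  have hdy : ∀ s t, HasDerivAt (y s) (y' s t) t := fun s t =>
    (((hy₀.differentiable (by simp)) t).hasDerivAt.const_mul _).add
      (((hy₁.differentiable (by simp)) t).hasDerivAt.const_mul _)
  have hdper : ∀ {z : ℝ → ℝ}, ContDiff ℝ ∞ z → Function.Periodic z 1 →
      ∀ t (n : ℤ), deriv z (t + n) = deriv z t := by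
    intro z hz hp t n
    rw [← deriv_comp_add_const]
    congr 1
    funext x
    exact periodic_int hp x n
  rw [e0, e1]
  refine JPlusPath.of_forall (Γ := fun s => segmentCurve (a s) (d s) (y s))
    (Γ' := fun s t => a s * (((-Real.sin (2 * Real.pi * t) * (2 * Real.pi) : ℝ) : ℂ) +
      (y' s t : ℂ) * Complex.I)) ?_ ?_ ?_ ?_ ?_ ?_ ?_
  · simp only [segmentCurve, a, d, y]; fun_prop
  · simp only [a, y']; fun_prop
  · intro s t
    have hcos : HasDerivAt (fun t : ℝ => Real.cos (2 * Real.pi * t))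
        (-Real.sin (2 * Real.pi * t) * (2 * Real.pi)) t := by
      have := ((hasDerivAt_id t).const_mul (2 * Real.pi)).cos
      simpa using this
    exact ((hcos.ofReal_comp.add ((hdy s t).ofReal_comp.mul_const _)).const_mul (a s)).const_add _
  · intro s
    have h1 : ContDiff ℝ ∞ (y s) := by unfold y; fun_prop
    have h1 := h1.complex_ofReal
    have h2 : ContDiff ℝ ∞ fun t : ℝ => Real.cos (2 * Real.pi * t) := by fun_prop
    have h2 := h2.complex_ofReal
    unfold segmentCurve
    fun_prop
  · intro s t
    have : Real.cos (2 * Real.pi * (t + 1)) = Real.cos (2 * Real.pi * t) := by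
      rw [mul_add, mul_one, Real.cos_add_two_pi]
    simp only [segmentCurve, y, this, hp₀ t, hp₁ t]
  · rintro s ⟨hs, hs'⟩ t h
    rcases mul_eq_zero.1 h with h | h
    · exact hane s h
    have hre := congrArg Complex.re h
    have him := congrArg Complex.im h
    simp only [Complex.add_re, Complex.ofReal_re, Complex.re_ofReal_mul, Complex.I_re, mul_zero,
      add_zero, Complex.zero_re, Complex.add_im, Complex.ofReal_im, Complex.im_ofReal_mul,
      Complex.I_im, mul_one, zero_add, Complex.zero_im] at hre him
    have hs0 : Real.sin (2 * Real.pi * t) = 0 := by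
      have := Real.pi_pos
      rcases mul_eq_zero.1 hre with h | h
      · linarith
      · linarith
    have key : ∀ x z : ℝ, 0 < x * z → (1 - s) * x + s * z ≠ 0 := by
      intro x z hxz h
      have h1 : (1 - s) * x ^ 2 + s * (x * z) = 0 := by linear_combination x * h
      have h2 : (1 - s) * (x * z) + s * z ^ 2 = 0 := by linear_combination z * h
      have h3 : 0 ≤ (1 - s) * x ^ 2 := mul_nonneg (by linarith) (sq_nonneg _)
      have h4 : 0 ≤ s * z ^ 2 := mul_nonneg hs (sq_nonneg _)
      have h5 : x * z = 0 := by nlinarith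
      exact hxz.ne' h5
    rcases eq_int_or_half (sin_two_pi_eq_zero_iff.1 hs0) with ⟨m, rfl⟩ | ⟨m, rfl⟩
    · refine key _ _ h0 ?_
      simpa only [y', hdper hy₀ hp₀, hdper hy₁ hp₁] using him
    · refine key _ _ h1 ?_
      simpa only [y', hdper hy₀ hp₀, hdper hy₁ hp₁] using him
  · intro s hs t₀ t₁ r hr he hr'
    have h3 := mul_left_cancel₀ (hane s) (add_left_cancel he)
    have h4 := congrArg Complex.re h3
    simp only [Complex.real_smul] at hr'
    rw [mul_left_comm (r : ℂ)] at hr'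
    have h5 := congrArg Complex.re (mul_left_cancel₀ (hane s) hr')
    simp only [Complex.add_re, Complex.ofReal_re, Complex.re_ofReal_mul, Complex.I_re, mul_zero,
      add_zero] at h4 h5
    refine int_sub_of_cos_eq hr h4 ?_
    have := Real.pi_pos
    have h6 : (2 * Real.pi) * (Real.sin (2 * Real.pi * t₁) - r * Real.sin (2 * Real.pi * t₀)) = 0 := by
      linear_combination -h5
    rcases mul_eq_zero.1 h6 with h | h
    · linarith
    · linarith

/-- Shifting the parameter of a figure eight. -/
theorem figureEight_shift_path (e δ : ℝ) (he : e ≠ 0) :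
    JPlusPath (fun t => segmentCurve 1 0 (fun t => e * Real.sin (4 * Real.pi * t)) (t + 0 * δ))
      (fun t => segmentCurve 1 0 (fun t => e * Real.sin (4 * Real.pi * t)) (t + 1 * δ)) 0 := by
  have hpi := Real.pi_pos
  set G' : ℝ → ℂ := fun t => ((-Real.sin (2 * Real.pi * t) * (2 * Real.pi) : ℝ) : ℂ) +
      ((e * (Real.cos (4 * Real.pi * t) * (4 * Real.pi)) : ℝ) : ℂ) * Complex.I with hG'
  have hd : ∀ t, HasDerivAt (segmentCurve 1 0 (fun t => e * Real.sin (4 * Real.pi * t))) (G' t) t := by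
    intro t
    have hcos : HasDerivAt (fun t : ℝ => Real.cos (2 * Real.pi * t))
        (-Real.sin (2 * Real.pi * t) * (2 * Real.pi)) t := by
      have := ((hasDerivAt_id t).const_mul (2 * Real.pi)).cos
      simpa using this
    have hsin : HasDerivAt (fun t : ℝ => e * Real.sin (4 * Real.pi * t))
        (e * (Real.cos (4 * Real.pi * t) * (4 * Real.pi))) t := by
      have := (((hasDerivAt_id t).const_mul (4 * Real.pi)).sin).const_mul e
      simpa using this
    have := ((hcos.ofReal_comp.add (hsin.ofReal_comp.mul_const Complex.I)).const_mul 1).const_add 0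
    rw [one_mul] at this
    exact this
  refine JPlusPath.of_forall
    (Γ := fun s t => segmentCurve 1 0 (fun t => e * Real.sin (4 * Real.pi * t)) (t + s * δ))
    (Γ' := fun s t => G' (t + s * δ)) ?_ ?_ ?_ ?_ ?_ ?_ ?_
  · simp only [segmentCurve]; fun_prop
  · simp only [hG']; fun_prop
  · intro s t
    exact (hd (t + s * δ)).comp_add_const t (s * δ)
  · intro s
    have h1 : ContDiff ℝ ∞ fun t : ℝ => e * Real.sin (4 * Real.pi * (t + s * δ)) := by fun_prop
    have h1 := h1.complex_ofReal
    have h2 : ContDiff ℝ ∞ fun t : ℝ => Real.cos (2 * Real.pi * (t + s * δ)) := by fun_prop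
    have h2 := h2.complex_ofReal
    unfold segmentCurve
    fun_prop
  · intro s t
    have h1 : Real.cos (2 * Real.pi * (t + 1 + s * δ)) = Real.cos (2 * Real.pi * (t + s * δ)) := by
      rw [show 2 * Real.pi * (t + 1 + s * δ) = 2 * Real.pi * (t + s * δ) + 2 * Real.pi by ring,
        Real.cos_add_two_pi]
    have h2 : Real.sin (4 * Real.pi * (t + 1 + s * δ)) = Real.sin (4 * Real.pi * (t + s * δ)) := by
      rw [show 4 * Real.pi * (t + 1 + s * δ) = 4 * Real.pi * (t + s * δ) + 2 * Real.pi + 2 * Real.pi by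
        ring, Real.sin_add_two_pi, Real.sin_add_two_pi]
    simp only [segmentCurve, h1, h2]
  · intro s hs t h
    have hre := congrArg Complex.re h
    have him := congrArg Complex.im h
    simp only [hG', Complex.add_re, Complex.ofReal_re, Complex.re_ofReal_mul, Complex.I_re, mul_zero,
      add_zero, Complex.zero_re, Complex.add_im, Complex.ofReal_im, Complex.im_ofReal_mul,
      Complex.I_im, mul_one, zero_add, Complex.zero_im] at hre him
    have h1 : Real.sin (2 * Real.pi * (t + s * δ)) = 0 := by
      rcases mul_eq_zero.1 hre with h | h <;> linarith
    have h2 : Real.cos (4 * Real.pi * (t + s * δ)) = 0 := by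
      rcases mul_eq_zero.1 him with h | h
      · exact absurd h he
      · rcases mul_eq_zero.1 h with h | h <;> linarith
    have h3 := Real.cos_two_mul (2 * Real.pi * (t + s * δ))
    rw [show 2 * (2 * Real.pi * (t + s * δ)) = 4 * Real.pi * (t + s * δ) by ring, h2] at h3
    have h4 := Real.sin_sq_add_cos_sq (2 * Real.pi * (t + s * δ))
    rw [h1] at h4
    linarith
  · intro s hs t₀ t₁ r hr hq hr'
    have h4 := congrArg Complex.re hq
    have h5 := congrArg Complex.re hr'
    simp only [segmentCurve, hG', one_mul, zero_add, Complex.add_re, Complex.ofReal_re,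
      Complex.re_ofReal_mul, Complex.I_re, mul_zero, add_zero, Complex.real_smul] at h4 h5
    obtain ⟨n, hn⟩ := int_sub_of_cos_eq hr h4 (by
      have h6 : (2 * Real.pi) * (Real.sin (2 * Real.pi * (t₁ + s * δ)) -
          r * Real.sin (2 * Real.pi * (t₀ + s * δ))) = 0 := by linear_combination -h5
      rcases mul_eq_zero.1 h6 with h | h <;> linarith)
    exact ⟨n, by linarith⟩

/-- By `segmentCurve_path` only the signs of `y'` at the two turns matter. Opposite signs are those
of `sin 2πt`, which gives a circle; equal signs are those of `sin 4πt`, which gives a figure eight.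
-/
theorem segmentCurve_reduces {a d : ℂ} {y : ℝ → ℝ} (ha : a ≠ 0) (hy : ContDiff ℝ ∞ y)
    (hp : Function.Periodic y 1) (h0 : deriv y 0 ≠ 0) (h1 : deriv y (1 / 2) ≠ 0) :
    ReducesToStandard (segmentCurve a d y) 0 := by
  have hpi := Real.pi_pos
  have hdsin : ∀ e c t : ℝ, deriv (fun t => e * Real.sin (c * t)) t = e * (Real.cos (c * t) * c) := by
    intro e c t
    have := (((hasDerivAt_id t).const_mul c).sin).const_mul e
    simpa using this.deriv
  obtain ⟨e, he, he0⟩ : ∃ e : ℝ, (e = 1 ∨ e = -1) ∧ 0 < deriv y 0 * e := by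
    rcases lt_or_gt_of_ne h0 with h | h
    · exact ⟨-1, Or.inr rfl, by linarith⟩
    · exact ⟨1, Or.inl rfl, by linarith⟩
  have hcosπ : Real.cos (2 * Real.pi * (1 / 2)) = -1 := by
    rw [show 2 * Real.pi * (1 / 2) = Real.pi by ring, Real.cos_pi]
  have hcos2π : Real.cos (4 * Real.pi * (1 / 2)) = 1 := by
    rw [show 4 * Real.pi * (1 / 2) = 2 * Real.pi by ring, Real.cos_two_pi]
  rcases lt_or_gt_of_ne (mul_ne_zero h0 h1) with h | h
  · have e1 : 0 < deriv y (1 / 2) * -e := by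
      rcases he with rfl | rfl <;> nlinarith
    refine ⟨1, le_rfl, ?_⟩
    -- `K₁` is a circle of radius `1 + 3/2 = 5/2`; the sign `e` selects its orientation.
    have hpath := segmentCurve_path (a₀ := a) (a₁ := 5 / 2) (d₀ := d) (d₁ := 0) (y₀ := y)
      (y₁ := fun t => e * Real.sin (2 * Real.pi * t)) ha (by norm_num) hy (by fun_prop) hp
      (fun t => by
        show e * Real.sin (2 * Real.pi * (t + 1)) = e * Real.sin (2 * Real.pi * t)
        rw [mul_add, mul_one, Real.sin_add_two_pi])
      (by rw [hdsin]; simp only [mul_zero, Real.cos_zero]; nlinarith)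
      (by rw [hdsin, hcosπ]; nlinarith)
    have hexp : ∀ t : ℝ, standardCurve 1 t =
        5 / 2 * Complex.exp ((2 * Real.pi * t : ℝ) * Complex.I) := by
      intro t
      simp only [standardCurve]
      push_cast
      ring_nf
    rcases he with rfl | rfl
    · left
      convert hpath using 1
      funext t
      rw [hexp, Complex.exp_mul_I]
      simp [segmentCurve]
    · right
      convert hpath using 1
      funext t
      rw [hexp, Complex.exp_mul_I]
      simp [segmentCurve]
  · have e1 : 0 < deriv y (1 / 2) * e := by
      rcases he with rfl | rfl <;> nlinarith
    have hene : e ≠ 0 := by rintro rfl; simp at he0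
    refine ⟨0, zero_le_one, ?_⟩
    have hpath := segmentCurve_path (a₀ := a) (a₁ := 1) (d₀ := d) (d₁ := 0) (y₀ := y)
      (y₁ := fun t => e * Real.sin (4 * Real.pi * t)) ha (by norm_num) hy (by fun_prop) hp
      (fun t => by
        show e * Real.sin (4 * Real.pi * (t + 1)) = e * Real.sin (4 * Real.pi * t)
        rw [show 4 * Real.pi * (t + 1) = 4 * Real.pi * t + 2 * Real.pi + 2 * Real.pi by ring,
          Real.sin_add_two_pi, Real.sin_add_two_pi])
      (by rw [hdsin]; simp only [mul_zero, Real.cos_zero]; nlinarith)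
      (by rw [hdsin, hcos2π]; nlinarith)
    -- The standard figure eight has real part `sin 2πt` instead of `cos 2πt`, so the parameter
    -- moves by a quarter period, in the direction given by `e`.
    have hshift := figureEight_shift_path e (e / 4) hene
    simp only [zero_mul, add_zero, one_mul] at hshift
    have hpath2 := hpath.trans hshift
    rcases he with rfl | rfl
    · right
      convert hpath2 using 1
      funext t
      have e1 : Real.cos (2 * Real.pi * (t + 1 / 4)) = Real.sin (2 * Real.pi * -t) := by
        rw [show 2 * Real.pi * (t + 1 / 4) = 2 * Real.pi * t + Real.pi / 2 by ring,
          Real.cos_add_pi_div_two, mul_neg, Real.sin_neg]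
      have e2 : Real.sin (4 * Real.pi * (t + 1 / 4)) = Real.sin (4 * Real.pi * -t) := by
        rw [show 4 * Real.pi * (t + 1 / 4) = 4 * Real.pi * t + Real.pi by ring,
          Real.sin_add_pi, mul_neg, Real.sin_neg]
      simp only [segmentCurve, e1, one_mul, zero_add]
      rw [e2]
      rfl
    · left
      convert hpath2 using 1
      funext t
      have e1 : Real.cos (2 * Real.pi * (t + -1 / 4)) = Real.sin (2 * Real.pi * t) := by
        rw [show 2 * Real.pi * (t + -1 / 4) = 2 * Real.pi * t - Real.pi / 2 by ring,
          Real.cos_sub_pi_div_two]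
      have e2 : -1 * Real.sin (4 * Real.pi * (t + -1 / 4)) = Real.sin (4 * Real.pi * t) := by
        rw [show 4 * Real.pi * (t + -1 / 4) = 4 * Real.pi * t - Real.pi by ring,
          Real.sin_sub_pi]
        ring
      simp only [segmentCurve, e1, one_mul, zero_add]
      rw [e2]
      rfl

/-! ### Linear algebra in the plane -/

/-- The determinant of two plane vectors. -/
def cross (z w : ℂ) : ℝ := z.re * w.im - z.im * w.re

theorem continuous_cross : Continuous fun p : ℂ × ℂ => cross p.1 p.2 := by
  unfold cross
  fun_prop

theorem cross_smul_right (z w : ℂ) (r : ℝ) : cross z (r • w) = r * cross z w := by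
  simp only [cross, Complex.smul_re, Complex.smul_im, smul_eq_mul]; ring

theorem cross_smul_left (z w : ℂ) (r : ℝ) : cross (r • z) w = r * cross z w := by
  simp only [cross, Complex.smul_re, Complex.smul_im, smul_eq_mul]; ring

theorem cross_self_eq_zero (z : ℂ) : cross z z = 0 := by simp only [cross]; ring

theorem cross_comm (z w : ℂ) : cross z w = -cross w z := by simp only [cross]; ring

theorem cross_add_right (z w w' : ℂ) : cross z (w + w') = cross z w + cross z w' := by
  simp only [cross, Complex.add_re, Complex.add_im]; ring

theorem cross_add_left (z z' w : ℂ) : cross (z + z') w = cross z w + cross z' w := by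
  simp only [cross, Complex.add_re, Complex.add_im]; ring

theorem cross_mul_left (c z w : ℂ) : cross (c * z) (c * w) = Complex.normSq c * cross z w := by
  simp only [cross, Complex.mul_re, Complex.mul_im, Complex.normSq_apply]; ring

theorem abs_cross_le (z w : ℂ) : |cross z w| ≤ ‖z‖ * ‖w‖ := by
  have h : cross z w = ((starRingEnd ℂ) z * w).im := by
    simp [cross, Complex.mul_im]; ring
  rw [h]
  refine (Complex.abs_im_le_norm _).trans ?_
  simp

/-- The determinant with `w` isolates `a`, the determinant with `z` isolates `b`, and both are
bounded by the norm of the combination. -/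
theorem exists_le_norm_add_of_cross_ne_zero {z w : ℂ} (h : cross z w ≠ 0) :
    ∃ c > 0, ∀ a b : ℝ, c * (|a| + |b|) ≤ ‖a • z + b • w‖ := by
  have hz : z ≠ 0 := by rintro rfl; simp [cross] at h
  have hpos : 0 < ‖z‖ + ‖w‖ := by positivity
  refine ⟨|cross z w| / (‖z‖ + ‖w‖), by positivity, fun a b => ?_⟩
  have h1 := abs_cross_le (a • z + b • w) w
  have h2 := abs_cross_le z (a • z + b • w)
  rw [cross_add_left, cross_smul_left, cross_smul_left, cross_self_eq_zero, mul_zero, add_zero, abs_mul] at h1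
  rw [cross_add_right, cross_smul_right, cross_smul_right, cross_self_eq_zero, mul_zero, zero_add, abs_mul]
    at h2
  rw [div_mul_eq_mul_div, div_le_iff₀ hpos]
  nlinarith

/-! ### Uniform linear approximation -/

/-- The mean value inequality for `f x - x v`. -/
theorem norm_sub_sub_smul_le {f f' : ℝ → ℂ} {v : ℂ} {a b η : ℝ}
    (hf : ∀ x ∈ uIcc a b, HasDerivAt f (f' x) x) (hη : ∀ x ∈ uIcc a b, ‖f' x - v‖ ≤ η) :
    ‖f b - f a - (b - a) • v‖ ≤ η * |b - a| := by
  have hd : ∀ x ∈ uIcc a b, HasDerivWithinAt (fun x => f x - x • v) (f' x - v) (uIcc a b) x := by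
    intro x hx
    have h2 : HasDerivAt (fun x : ℝ => x • v) v x := by
      simpa using (hasDerivAt_id x).smul_const v
    exact ((hf x hx).sub h2).hasDerivWithinAt
  have := (convex_uIcc a b).norm_image_sub_le_of_norm_hasDerivWithin_le hd hη left_mem_uIcc
    right_mem_uIcc
  rw [Real.norm_eq_abs] at this
  rwa [show f b - f a - (b - a) • v = f b - b • v - (f a - a • v) by rw [sub_smul]; ring]

theorem eventually_norm_sub_sub_smul_le {P : Type*} [TopologicalSpace P] {f f' : P → ℝ → ℂ} {p₀ : P}
    {x₀ : ℝ} (hf : ∀ p x, HasDerivAt (f p) (f' p x) x)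
    (hc : Continuous fun q : P × ℝ => f' q.1 q.2) {η : ℝ} (hη : 0 < η) :
    ∀ᶠ q in 𝓝 (p₀, x₀, x₀),
      ‖f q.1 q.2.2 - f q.1 q.2.1 - (q.2.2 - q.2.1) • f' p₀ x₀‖ ≤ η * |q.2.2 - q.2.1| := by
  have h1 : ∀ᶠ q in 𝓝 (p₀, x₀), ‖f' q.1 q.2 - f' p₀ x₀‖ < η := by
    have : Continuous fun q : P × ℝ => ‖f' q.1 q.2 - f' p₀ x₀‖ := by fun_prop
    refine this.continuousAt.eventually_lt continuousAt_const ?_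
    simpa using hη
  obtain ⟨U, hU, V, hV, hUV⟩ := mem_nhds_prod_iff.1 h1
  obtain ⟨δ, hδ, hball⟩ := Metric.mem_nhds_iff.1 hV
  have h2 : U ×ˢ (Metric.ball x₀ δ ×ˢ Metric.ball x₀ δ) ∈ 𝓝 (p₀, x₀, x₀) :=
    prod_mem_nhds hU (prod_mem_nhds (Metric.ball_mem_nhds _ hδ) (Metric.ball_mem_nhds _ hδ))
  filter_upwards [h2] with q hq
  refine norm_sub_sub_smul_le (fun x _ => hf q.1 x) fun x hx => ?_
  have hx' : x ∈ Metric.ball x₀ δ := by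
    rw [Real.ball_eq_Ioo] at hq ⊢
    obtain ⟨-, ⟨h1, h2⟩, h3, h4⟩ := hq
    rcases mem_uIcc.1 hx with ⟨h5, h6⟩ | ⟨h5, h6⟩ <;> constructor <;> linarith
  exact (hUV (show (q.1, x) ∈ U ×ˢ V from ⟨hq.1, hball hx'⟩)).le

/-- Two transverse families of curves: local injectivity of their difference. -/
theorem eventually_eq_of_sub_eq {P : Type*} [TopologicalSpace P] {F F' G G' : P → ℝ → ℂ} {p₀ : P}
    {x₀ y₀ : ℝ} (hF : ∀ p x, HasDerivAt (F p) (F' p x) x) (hG : ∀ p x, HasDerivAt (G p) (G' p x) x)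
    (cF : Continuous fun q : P × ℝ => F' q.1 q.2) (cG : Continuous fun q : P × ℝ => G' q.1 q.2)
    (h : cross (F' p₀ x₀) (G' p₀ y₀) ≠ 0) :
    ∀ᶠ q : P × (ℝ × ℝ) × (ℝ × ℝ) in 𝓝 (p₀, (x₀, x₀), (y₀, y₀)), ∀ ε : ℝ, ε ≠ 0 →
      F q.1 q.2.1.2 - F q.1 q.2.1.1 = ε • (G q.1 q.2.2.2 - G q.1 q.2.2.1) →
      q.2.1.1 = q.2.1.2 ∧ q.2.2.1 = q.2.2.2 := by
  obtain ⟨c, hc, hcb⟩ := exists_le_norm_add_of_cross_ne_zero h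
  have h1 : ∀ᶠ q : P × (ℝ × ℝ) × (ℝ × ℝ) in 𝓝 (p₀, (x₀, x₀), (y₀, y₀)),
      ‖F q.1 q.2.1.2 - F q.1 q.2.1.1 - (q.2.1.2 - q.2.1.1) • F' p₀ x₀‖ ≤
        c / 2 * |q.2.1.2 - q.2.1.1| := by
    have ht : Tendsto (fun q : P × (ℝ × ℝ) × (ℝ × ℝ) => (q.1, q.2.1))
        (𝓝 (p₀, (x₀, x₀), (y₀, y₀))) (𝓝 (p₀, x₀, x₀)) := by
      have : Continuous fun q : P × (ℝ × ℝ) × (ℝ × ℝ) => (q.1, q.2.1) := by fun_prop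
      exact this.tendsto _
    exact ht.eventually (eventually_norm_sub_sub_smul_le hF cF (half_pos hc))
  have h2 : ∀ᶠ q : P × (ℝ × ℝ) × (ℝ × ℝ) in 𝓝 (p₀, (x₀, x₀), (y₀, y₀)),
      ‖G q.1 q.2.2.2 - G q.1 q.2.2.1 - (q.2.2.2 - q.2.2.1) • G' p₀ y₀‖ ≤
        c / 2 * |q.2.2.2 - q.2.2.1| := by
    have ht : Tendsto (fun q : P × (ℝ × ℝ) × (ℝ × ℝ) => (q.1, q.2.2))
        (𝓝 (p₀, (x₀, x₀), (y₀, y₀))) (𝓝 (p₀, y₀, y₀)) := by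
      have : Continuous fun q : P × (ℝ × ℝ) × (ℝ × ℝ) => (q.1, q.2.2) := by fun_prop
      exact this.tendsto _
    exact ht.eventually (eventually_norm_sub_sub_smul_le hG cG (half_pos hc))
  filter_upwards [h1, h2] with q hq1 hq2 ε hε he
  set a := q.2.1.2 - q.2.1.1
  set b := q.2.2.2 - q.2.2.1
  set X := F q.1 q.2.1.2 - F q.1 q.2.1.1
  set Y := G q.1 q.2.2.2 - G q.1 q.2.2.1
  -- The combination of the two tangents is at least `c (|a| + |εb|)`. As the increments agree, it
  -- consists of linearization errors only, which are at most half of that.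
  have h3 : c * (|a| + |-(ε * b)|) ≤ ‖a • F' p₀ x₀ + (-(ε * b)) • G' p₀ y₀‖ := hcb _ _
  have h4 : a • F' p₀ x₀ + (-(ε * b)) • G' p₀ y₀ =
      -(X - a • F' p₀ x₀) + ε • (Y - b • G' p₀ y₀) := by
    rw [smul_sub, ← he, neg_smul, mul_smul]; abel
  have h5 : ‖ε • (Y - b • G' p₀ y₀)‖ ≤ |ε| * (c / 2 * |b|) := by
    rw [norm_smul, Real.norm_eq_abs]
    exact mul_le_mul_of_nonneg_left hq2 (abs_nonneg _)
  have h6 : ‖a • F' p₀ x₀ + (-(ε * b)) • G' p₀ y₀‖ ≤ c / 2 * |a| + |ε| * (c / 2 * |b|) := by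
    rw [h4]
    refine (norm_add_le _ _).trans ?_
    rw [norm_neg]
    exact add_le_add hq1 h5
  rw [abs_neg, abs_mul] at h3
  have h7 : |a| + |ε| * |b| ≤ 0 := by nlinarith [abs_nonneg a, mul_nonneg (abs_nonneg ε) (abs_nonneg b)]
  have h8 : |a| ≤ 0 := by linarith [mul_nonneg (abs_nonneg ε) (abs_nonneg b)]
  have h9 : |ε| * |b| ≤ 0 := by linarith [abs_nonneg a]
  have h10 : b = 0 := by
    have : |b| ≤ 0 := by
      by_contra hb
      push Not at hb
      nlinarith [mul_pos (abs_pos.2 hε) hb]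
    exact abs_nonpos_iff.1 this
  exact ⟨(sub_eq_zero.1 (abs_nonpos_iff.1 h8)).symm, (sub_eq_zero.1 h10).symm⟩

/-! ### Thin curves around an arc -/

/-- A one-parameter family of arcs `A s`, `s ∈ [0, 1]`, together with a displacement `B` of the
doubled arc `t ↦ A s (cos 2πt)`, which is scaled by `ε`. -/
structure ThinFamily where
  A : ℝ → ℝ → ℂ
  A' : ℝ → ℝ → ℂ
  B : ℝ → ℝ → ℝ → ℂ
  B' : ℝ → ℝ → ℝ → ℂ
  hA : ∀ s u, HasDerivAt (A s) (A' s u) u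
  hB : ∀ ε s t, HasDerivAt (B ε s) (B' ε s t) t
  cA : Continuous fun p : ℝ × ℝ => A p.1 p.2
  cA' : Continuous fun p : ℝ × ℝ => A' p.1 p.2
  cB : Continuous fun p : ℝ × ℝ × ℝ => B p.1 p.2.1 p.2.2
  cB' : Continuous fun p : ℝ × ℝ × ℝ => B' p.1 p.2.1 p.2.2
  smA : ∀ s, ContDiff ℝ ∞ (A s)
  smB : ∀ ε s, ContDiff ℝ ∞ (B ε s)
  perB : ∀ ε s, Function.Periodic (B ε s) 1

namespace ThinFamily

variable (F : ThinFamily)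

/-- The thin curve. -/
def curve (ε s t : ℝ) : ℂ := F.A s (Real.cos (2 * Real.pi * t)) + ε • F.B ε s t

/-- The velocity of the thin curve. -/
def vel (ε s t : ℝ) : ℂ :=
  (-Real.sin (2 * Real.pi * t) * (2 * Real.pi)) • F.A' s (Real.cos (2 * Real.pi * t)) +
    ε • F.B' ε s t

theorem hasDerivAt_cos_two_pi (t : ℝ) : HasDerivAt (fun t : ℝ => Real.cos (2 * Real.pi * t))
    (-Real.sin (2 * Real.pi * t) * (2 * Real.pi)) t := by
  have := ((hasDerivAt_id t).const_mul (2 * Real.pi)).cos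
  simpa using this

theorem hasDerivAt_curve (ε s t : ℝ) : HasDerivAt (F.curve ε s) (F.vel ε s t) t := by
  have h1 := (F.hA s (Real.cos (2 * Real.pi * t))).scomp t (hasDerivAt_cos_two_pi t)
  exact h1.add ((F.hB ε s t).const_smul ε)

theorem continuous_curve : Continuous fun p : ℝ × ℝ × ℝ => F.curve p.1 p.2.1 p.2.2 := by
  have h1 : Continuous fun p : ℝ × ℝ × ℝ => F.A p.2.1 (Real.cos (2 * Real.pi * p.2.2)) :=
    F.cA.comp (g := fun p : ℝ × ℝ => F.A p.1 p.2)
      (f := fun p : ℝ × ℝ × ℝ => (p.2.1, Real.cos (2 * Real.pi * p.2.2))) (by fun_prop)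
  have h2 := F.cB
  unfold curve
  fun_prop

theorem continuous_vel : Continuous fun p : ℝ × ℝ × ℝ => F.vel p.1 p.2.1 p.2.2 := by
  have h1 : Continuous fun p : ℝ × ℝ × ℝ => F.A' p.2.1 (Real.cos (2 * Real.pi * p.2.2)) :=
    F.cA'.comp (g := fun p : ℝ × ℝ => F.A' p.1 p.2)
      (f := fun p : ℝ × ℝ × ℝ => (p.2.1, Real.cos (2 * Real.pi * p.2.2))) (by fun_prop)
  have h2 := F.cB'
  unfold vel
  fun_prop

theorem contDiff_curve (ε s : ℝ) : ContDiff ℝ ∞ (F.curve ε s) := by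
  have h1 : ContDiff ℝ ∞ fun t : ℝ => F.A s (Real.cos (2 * Real.pi * t)) :=
    (F.smA s).comp (by fun_prop)
  have h2 := F.smB ε s
  unfold curve
  fun_prop

theorem periodic_curve (ε s : ℝ) : Function.Periodic (F.curve ε s) 1 := by
  intro t
  simp only [curve, F.perB ε s t]
  rw [mul_add, mul_one, Real.cos_add_two_pi]

theorem periodic_vel (ε s : ℝ) : Function.Periodic (F.vel ε s) 1 :=
  periodic_deriv (F.periodic_curve ε s) (F.hasDerivAt_curve ε s)

/-- The arc is regular and the displacement is transverse to it at its ends. -/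
def RegularAt (s : ℝ) : Prop :=
  (∀ u ∈ Icc (-1 : ℝ) 1, F.A' s u ≠ 0) ∧
  ∀ t, Real.sin (2 * Real.pi * t) = 0 →
    cross (F.A' s (Real.cos (2 * Real.pi * t))) (F.B' 0 s t) ≠ 0

theorem eventually_cross_ne_zero {s t : ℝ} (h : cross (F.A' s (Real.cos (2 * Real.pi * t)))
    (F.B' 0 s t) ≠ 0) : ∀ᶠ q in 𝓝 ((0 : ℝ), s, t),
      cross (F.A' q.2.1 (Real.cos (2 * Real.pi * q.2.2))) (F.B' q.1 q.2.1 q.2.2) ≠ 0 := by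
  have h1 : Continuous fun p : ℝ × ℝ × ℝ => F.A' p.2.1 (Real.cos (2 * Real.pi * p.2.2)) :=
    F.cA'.comp (g := fun p : ℝ × ℝ => F.A' p.1 p.2)
      (f := fun p : ℝ × ℝ × ℝ => (p.2.1, Real.cos (2 * Real.pi * p.2.2))) (by fun_prop)
  have h2 := continuous_cross.comp (h1.prodMk F.cB')
  exact h2.continuousAt.eventually_ne h

/-- Away from the turns the velocity is close to that of the doubled arc. At a turn this limit
vanishes, but the determinant with the tangent of the arc removes the arc term and leaves `ε` times
a nonzero number. -/
theorem eventually_vel_ne_zero {s : ℝ} (h : F.RegularAt s) (t : ℝ) :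
    ∀ᶠ q in 𝓝 ((0 : ℝ), s, t), 0 < q.1 → F.vel q.1 q.2.1 q.2.2 ≠ 0 := by
  by_cases hs : Real.sin (2 * Real.pi * t) = 0
  · filter_upwards [F.eventually_cross_ne_zero (h.2 t hs)] with q hq hε h0
    unfold vel at h0
    have := congrArg (cross (F.A' q.2.1 (Real.cos (2 * Real.pi * q.2.2)))) h0
    rw [cross_add_right, cross_smul_right, cross_smul_right, cross_self_eq_zero] at this
    have h1 : q.1 * cross (F.A' q.2.1 (Real.cos (2 * Real.pi * q.2.2))) (F.B' q.1 q.2.1 q.2.2) = 0 := by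
      rw [← zero_add (q.1 * _), ← mul_zero (-Real.sin (2 * Real.pi * q.2.2) * (2 * Real.pi)), this]
      simp [cross]
    exact (mul_ne_zero hε.ne' hq) h1
  · have h0 : F.vel 0 s t ≠ 0 := by
      simp only [vel, zero_smul, add_zero]
      refine smul_ne_zero (mul_ne_zero (neg_ne_zero.2 hs) (by positivity)) (h.1 _ ?_)
      exact ⟨Real.neg_one_le_cos _, Real.cos_le_one _⟩
    filter_upwards [F.continuous_vel.continuousAt.eventually_ne h0] with q hq _ using hq

/-- The parameters `t₀`, `t₁` of the thin curve are not a direct self-tangency. -/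
def NoTangency (ε s t₀ t₁ : ℝ) : Prop :=
  ∀ r : ℝ, 0 < r → F.curve ε s t₀ = F.curve ε s t₁ → F.vel ε s t₁ = r • F.vel ε s t₀ →
    ∃ n : ℤ, t₁ - t₀ = n

theorem eventually_noTangency_of_ne {s t₀ t₁ : ℝ}
    (h : F.A s (Real.cos (2 * Real.pi * t₀)) ≠ F.A s (Real.cos (2 * Real.pi * t₁))) :
    ∀ᶠ q in 𝓝 ((0 : ℝ), s, t₀, t₁), 0 < q.1 → F.NoTangency q.1 q.2.1 q.2.2.1 q.2.2.2 := by
  have h0 : F.curve 0 s t₀ ≠ F.curve 0 s t₁ := by simpa [curve] using h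
  have c0 : Continuous fun q : ℝ × ℝ × ℝ × ℝ => F.curve q.1 q.2.1 q.2.2.1 :=
    F.continuous_curve.comp (f := fun q : ℝ × ℝ × ℝ × ℝ => (q.1, q.2.1, q.2.2.1)) (by fun_prop)
  have c1 : Continuous fun q : ℝ × ℝ × ℝ × ℝ => F.curve q.1 q.2.1 q.2.2.2 :=
    F.continuous_curve.comp (f := fun q : ℝ × ℝ × ℝ × ℝ => (q.1, q.2.1, q.2.2.2)) (by fun_prop)
  filter_upwards [c0.continuousAt.ne_iff_eventually_ne c1.continuousAt |>.1 h0] with q hq _ r _ he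
  exact absurd he hq

/-- Over a transverse double point of the arc the limit velocities are independent, so nearby
velocities are not parallel. -/
theorem eventually_noTangency_of_cross {s t₀ t₁ : ℝ} (h₀ : Real.sin (2 * Real.pi * t₀) ≠ 0)
    (h₁ : Real.sin (2 * Real.pi * t₁) ≠ 0)
    (h : cross (F.A' s (Real.cos (2 * Real.pi * t₀))) (F.A' s (Real.cos (2 * Real.pi * t₁))) ≠ 0) :
    ∀ᶠ q in 𝓝 ((0 : ℝ), s, t₀, t₁), 0 < q.1 → F.NoTangency q.1 q.2.1 q.2.2.1 q.2.2.2 := by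
  have hpi := Real.pi_pos
  have h0 : cross (F.vel 0 s t₀) (F.vel 0 s t₁) ≠ 0 := by
    simp only [vel, zero_smul, add_zero, cross_smul_left, cross_smul_right]
    simp only [ne_eq, mul_eq_zero, neg_eq_zero, h₀, h₁, h, hpi.ne', OfNat.ofNat_ne_zero, or_self,
      not_false_eq_true]
  have c0 : Continuous fun q : ℝ × ℝ × ℝ × ℝ => F.vel q.1 q.2.1 q.2.2.1 :=
    F.continuous_vel.comp (f := fun q : ℝ × ℝ × ℝ × ℝ => (q.1, q.2.1, q.2.2.1)) (by fun_prop)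
  have c1 : Continuous fun q : ℝ × ℝ × ℝ × ℝ => F.vel q.1 q.2.1 q.2.2.2 :=
    F.continuous_vel.comp (f := fun q : ℝ × ℝ × ℝ × ℝ => (q.1, q.2.1, q.2.2.2)) (by fun_prop)
  filter_upwards [(continuous_cross.comp (c0.prodMk c1)).continuousAt.eventually_ne h0]
    with q hq _ r _ _ hr
  simp only [Function.comp, hr, cross_smul_right, cross_self_eq_zero, mul_zero, ne_eq, not_true] at hq

/-- These are the two strands over one point of the arc. In the limit they run in opposite
directions, so the inner product of the velocities is negative and any tangency is inverse. -/
theorem eventually_noTangency_of_add {s t₀ t₁ : ℝ} (h : F.RegularAt s)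
    (h₀ : Real.sin (2 * Real.pi * t₀) ≠ 0) (h₁ : ∃ n : ℤ, t₁ + t₀ = n) :
    ∀ᶠ q in 𝓝 ((0 : ℝ), s, t₀, t₁), 0 < q.1 → F.NoTangency q.1 q.2.1 q.2.2.1 q.2.2.2 := by
  have hpi := Real.pi_pos
  obtain ⟨n, hn⟩ := h₁
  have h2 : F.vel 0 s t₁ = -F.vel 0 s t₀ := by
    have e1 : 2 * Real.pi * t₁ = n * (2 * Real.pi) - 2 * Real.pi * t₀ := by rw [← hn]; ring
    simp only [vel, zero_smul, add_zero, e1, Real.sin_int_mul_two_pi_sub,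
      Real.cos_int_mul_two_pi_sub, neg_neg, neg_mul, neg_smul]
  have hv : F.vel 0 s t₀ ≠ 0 := by
    simp only [vel, zero_smul, add_zero]
    exact smul_ne_zero (mul_ne_zero (neg_ne_zero.2 h₀) (by positivity)) (h.1 _
      ⟨Real.neg_one_le_cos _, Real.cos_le_one _⟩)
  let g : ℂ × ℂ → ℝ := fun p => p.1.re * p.2.re + p.1.im * p.2.im
  have cg : Continuous g := by simp only [g]; fun_prop
  have h0 : g (F.vel 0 s t₀, F.vel 0 s t₁) < 0 := by
    simp only [g, h2, Complex.neg_re, Complex.neg_im]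
    have := Complex.normSq_pos.2 hv
    rw [Complex.normSq_apply] at this
    linarith
  have c0 : Continuous fun q : ℝ × ℝ × ℝ × ℝ => F.vel q.1 q.2.1 q.2.2.1 :=
    F.continuous_vel.comp (f := fun q : ℝ × ℝ × ℝ × ℝ => (q.1, q.2.1, q.2.2.1)) (by fun_prop)
  have c1 : Continuous fun q : ℝ × ℝ × ℝ × ℝ => F.vel q.1 q.2.1 q.2.2.2 :=
    F.continuous_vel.comp (f := fun q : ℝ × ℝ × ℝ × ℝ => (q.1, q.2.1, q.2.2.2)) (by fun_prop)
  filter_upwards [(cg.comp (c0.prodMk c1)).continuousAt.eventually_lt continuousAt_const h0]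
    with q hq _ r hr0 _ hr
  simp only [Function.comp, hr, g, Complex.smul_re, Complex.smul_im, smul_eq_mul] at hq
  nlinarith [mul_nonneg hr0.le (sq_nonneg (F.vel q.1 q.2.1 q.2.2.1).re),
    mul_nonneg hr0.le (sq_nonneg (F.vel q.1 q.2.1 q.2.2.1).im)]

/-- The limit parameters agree modulo `1`, so this is local injectivity, uniform as `ε` tends to
`0`. At a turn it rests on the transversality of arc and displacement (`eventually_eq_of_sub_eq`),
elsewhere on the nonzero limit velocity. -/
theorem eventually_noTangency_of_sub {s t₀ t₁ : ℝ} (h : F.RegularAt s)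
    (h₁ : ∃ n : ℤ, t₁ - t₀ = n) :
    ∀ᶠ q in 𝓝 ((0 : ℝ), s, t₀, t₁), 0 < q.1 → F.NoTangency q.1 q.2.1 q.2.2.1 q.2.2.2 := by
  obtain ⟨n, hn⟩ := h₁
  by_cases hs : Real.sin (2 * Real.pi * t₀) = 0
  · have key := eventually_eq_of_sub_eq (P := ℝ × ℝ) (p₀ := ((0 : ℝ), s))
      (x₀ := Real.cos (2 * Real.pi * t₀)) (y₀ := t₀)
      (F := fun p => F.A p.2) (F' := fun p => F.A' p.2) (G := fun p => F.B p.1 p.2)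
      (G' := fun p => F.B' p.1 p.2) (fun p x => F.hA _ _) (fun p x => F.hB _ _ _)
      (F.cA'.comp (f := fun q : (ℝ × ℝ) × ℝ => (q.1.2, q.2)) (by fun_prop))
      (F.cB'.comp (f := fun q : (ℝ × ℝ) × ℝ => (q.1.1, q.1.2, q.2)) (by fun_prop))
      (h.2 t₀ hs)
    have ht : Tendsto (fun q : ℝ × ℝ × ℝ × ℝ => (((q.1, q.2.1), (Real.cos (2 * Real.pi * (q.2.2.2 - n)),
        Real.cos (2 * Real.pi * q.2.2.1)), (q.2.2.1, q.2.2.2 - n)) : (ℝ × ℝ) × (ℝ × ℝ) × (ℝ × ℝ)))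
        (𝓝 ((0 : ℝ), s, t₀, t₁)) (𝓝 (((0 : ℝ), s), (Real.cos (2 * Real.pi * t₀),
          Real.cos (2 * Real.pi * t₀)), (t₀, t₀))) := by
      refine Continuous.tendsto' (by fun_prop) _ _ ?_
      simp [show t₁ - n = t₀ by linarith]
    filter_upwards [ht.eventually key] with q hq hε r hr he _
    have he' : F.curve q.1 q.2.1 q.2.2.1 = F.curve q.1 q.2.1 (q.2.2.2 - n) := by
      rw [he]
      conv_lhs => rw [show q.2.2.2 = q.2.2.2 - n + n by ring]
      exact periodic_int (F.periodic_curve _ _) _ n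
    simp only [curve] at he'
    have := (hq q.1 hε.ne' (by rw [smul_sub]; linear_combination he')).2
    exact ⟨n, by linarith⟩
  · have hv : F.vel 0 s t₀ ≠ 0 := by
      simp only [vel, zero_smul, add_zero]
      exact smul_ne_zero (mul_ne_zero (neg_ne_zero.2 hs) (by positivity)) (h.1 _
        ⟨Real.neg_one_le_cos _, Real.cos_le_one _⟩)
    have key := eventually_norm_sub_sub_smul_le (P := ℝ × ℝ) (p₀ := ((0 : ℝ), s)) (x₀ := t₀)
      (f := fun p => F.curve p.1 p.2) (f' := fun p => F.vel p.1 p.2)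
      (fun p x => F.hasDerivAt_curve _ _ _)
      (F.continuous_vel.comp (f := fun q : (ℝ × ℝ) × ℝ => (q.1.1, q.1.2, q.2)) (by fun_prop))
      (η := ‖F.vel 0 s t₀‖ / 2) (by positivity)
    have ht : Tendsto (fun q : ℝ × ℝ × ℝ × ℝ => (((q.1, q.2.1), q.2.2.1, q.2.2.2 - n) :
        (ℝ × ℝ) × ℝ × ℝ)) (𝓝 ((0 : ℝ), s, t₀, t₁)) (𝓝 (((0 : ℝ), s), t₀, t₀)) := by
      refine Continuous.tendsto' (by fun_prop) _ _ ?_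
      simp [show t₁ - n = t₀ by linarith]
    filter_upwards [ht.eventually key] with q hq hε r hr he _
    have he' : F.curve q.1 q.2.1 q.2.2.1 = F.curve q.1 q.2.1 (q.2.2.2 - n) := by
      rw [he]
      conv_lhs => rw [show q.2.2.2 = q.2.2.2 - n + n by ring]
      exact periodic_int (F.periodic_curve _ _) _ n
    simp only [he', sub_self, zero_sub, norm_neg, norm_smul, Real.norm_eq_abs] at hq
    have h3 : 0 < ‖F.vel 0 s t₀‖ := norm_pos_iff.2 hv
    have h4 : |q.2.2.2 - n - q.2.2.1| ≤ 0 := by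
      by_contra hcon
      push Not at hcon
      nlinarith [mul_pos hcon h3]
    exact ⟨n, by linarith [abs_nonpos_iff.1 h4]⟩

theorem eventually_noTangency_of_cos_eq {s t₀ t₁ : ℝ} (h : F.RegularAt s)
    (hc : Real.cos (2 * Real.pi * t₀) = Real.cos (2 * Real.pi * t₁)) :
    ∀ᶠ q in 𝓝 ((0 : ℝ), s, t₀, t₁), 0 < q.1 → F.NoTangency q.1 q.2.1 q.2.2.1 q.2.2.2 := by
  rcases cos_two_pi_eq_iff.1 hc with h1 | ⟨n, hn⟩
  · exact F.eventually_noTangency_of_sub h h1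
  · by_cases hs : Real.sin (2 * Real.pi * t₀) = 0
    · obtain ⟨m, hm⟩ := sin_two_pi_eq_zero_iff.1 hs
      exact F.eventually_noTangency_of_sub h ⟨n - m, by push_cast; linarith⟩
    · exact F.eventually_noTangency_of_add h hs ⟨n, hn⟩

/-- The tube lemma over the compact cube of all `(s, t₀, t₁)`: local statements near `ε = 0` combine
to a single bound on `ε`. -/
theorem eventually_forall_of_forall {P : ℝ → ℝ → ℝ → ℝ → Prop}
    (h : ∀ s ∈ Icc (0 : ℝ) 1, ∀ t₀ ∈ Icc (0 : ℝ) 1, ∀ t₁ ∈ Icc (0 : ℝ) 1,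
      ∀ᶠ q in 𝓝 ((0 : ℝ), s, t₀, t₁), P q.1 q.2.1 q.2.2.1 q.2.2.2) :
    ∀ᶠ ε in 𝓝 (0 : ℝ), ∀ s ∈ Icc (0 : ℝ) 1, ∀ t₀ ∈ Icc (0 : ℝ) 1, ∀ t₁ ∈ Icc (0 : ℝ) 1,
      P ε s t₀ t₁ := by
  have hK : IsCompact (Icc (0 : ℝ) 1 ×ˢ (Icc (0 : ℝ) 1 ×ˢ Icc (0 : ℝ) 1)) :=
    isCompact_Icc.prod (isCompact_Icc.prod isCompact_Icc)
  have := hK.eventually_forall_of_forall_eventually (x₀ := (0 : ℝ))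
    (P := fun ε y => P ε y.1 y.2.1 y.2.2) (by
      rintro ⟨s, t₀, t₁⟩ ⟨hs, h0, h1⟩
      exact h s hs t₀ h0 t₁ h1)
  filter_upwards [this] with ε hε s hs t₀ h0 t₁ h1
  exact hε (s, t₀, t₁) ⟨hs, h0, h1⟩

theorem eventually_forall_vel_ne_zero (h : ∀ s ∈ Icc (0 : ℝ) 1, F.RegularAt s) :
    ∀ᶠ ε in 𝓝[>] (0 : ℝ), ∀ s ∈ Icc (0 : ℝ) 1, ∀ t, F.vel ε s t ≠ 0 := by
  have := eventually_forall_of_forall (P := fun ε s t _ => 0 < ε → F.vel ε s t ≠ 0) (by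
    intro s hs t₀ _ t₁ _
    have ht : Tendsto (fun q : ℝ × ℝ × ℝ × ℝ => (q.1, q.2.1, q.2.2.1))
        (𝓝 ((0 : ℝ), s, t₀, t₁)) (𝓝 ((0 : ℝ), s, t₀)) :=
      Continuous.tendsto' (by fun_prop) _ _ rfl
    exact ht.eventually (F.eventually_vel_ne_zero (h s hs) t₀))
  filter_upwards [this.filter_mono nhdsWithin_le_nhds, self_mem_nhdsWithin] with ε hε hpos s hs t
  have h1 := hε s hs (Int.fract t) ⟨Int.fract_nonneg t, (Int.fract_lt_one t).le⟩ 0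
    ⟨le_rfl, zero_le_one⟩ hpos
  rw [← periodic_int (F.periodic_vel ε s) (Int.fract t) ⌊t⌋, Int.fract_add_floor] at h1
  exact h1

theorem noTangency_of_forall_Icc {ε s : ℝ} (h : ∀ t₀ ∈ Icc (0 : ℝ) 1, ∀ t₁ ∈ Icc (0 : ℝ) 1,
    F.NoTangency ε s t₀ t₁) (t₀ t₁ : ℝ) : F.NoTangency ε s t₀ t₁ := by
  intro r hr he hv
  have e := fun t => periodic_int (F.periodic_curve ε s) (Int.fract t) ⌊t⌋
  have e' := fun t => periodic_int (F.periodic_vel ε s) (Int.fract t) ⌊t⌋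
  simp only [Int.fract_add_floor] at e e'
  obtain ⟨n, hn⟩ := h (Int.fract t₀) ⟨Int.fract_nonneg _, (Int.fract_lt_one _).le⟩ (Int.fract t₁)
    ⟨Int.fract_nonneg _, (Int.fract_lt_one _).le⟩ r hr (by rw [← e, ← e, he]) (by rw [← e', ← e', hv])
  refine ⟨n + ⌊t₁⌋ - ⌊t₀⌋, ?_⟩
  simp only [Int.fract] at hn
  push_cast
  linarith

/-- Thin curves along a family of arcs with transverse double points that avoid the ends have no
direct self-tangencies. -/
theorem eventually_path (h : ∀ s ∈ Icc (0 : ℝ) 1, F.RegularAt s)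
    (hd : ∀ s ∈ Icc (0 : ℝ) 1, ∀ u v, -1 ≤ u → u < v → v ≤ 1 → F.A s u = F.A s v →
      -1 < u ∧ v < 1 ∧ cross (F.A' s u) (F.A' s v) ≠ 0) :
    ∀ᶠ ε in 𝓝[>] (0 : ℝ), JPlusPath (F.curve ε 0) (F.curve ε 1) 0 := by
  have key := eventually_forall_of_forall (P := fun ε s t₀ t₁ => 0 < ε → F.NoTangency ε s t₀ t₁) (by
    intro s hs t₀ _ t₁ _
    by_cases hA : F.A s (Real.cos (2 * Real.pi * t₀)) = F.A s (Real.cos (2 * Real.pi * t₁))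
    swap
    · exact F.eventually_noTangency_of_ne hA
    have hsin : ∀ t, -1 < Real.cos (2 * Real.pi * t) → Real.cos (2 * Real.pi * t) < 1 →
        Real.sin (2 * Real.pi * t) ≠ 0 := by
      intro t h1 h2 h3
      have := Real.sin_sq_add_cos_sq (2 * Real.pi * t)
      rw [h3] at this
      nlinarith
    rcases lt_trichotomy (Real.cos (2 * Real.pi * t₀)) (Real.cos (2 * Real.pi * t₁)) with hc | hc | hc
    · obtain ⟨h1, h2, h3⟩ := hd s hs _ _ (Real.neg_one_le_cos _) hc (Real.cos_le_one _) hA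
      exact F.eventually_noTangency_of_cross (hsin _ h1 (hc.trans h2)) (hsin _ (h1.trans hc) h2) h3
    · exact F.eventually_noTangency_of_cos_eq (h s hs) hc
    · obtain ⟨h1, h2, h3⟩ := hd s hs _ _ (Real.neg_one_le_cos _) hc (Real.cos_le_one _) hA.symm
      refine F.eventually_noTangency_of_cross (hsin _ (h1.trans hc) h2) (hsin _ h1 (hc.trans h2)) ?_
      rw [cross_comm]
      exact neg_ne_zero.2 h3)
  filter_upwards [key.filter_mono nhdsWithin_le_nhds, F.eventually_forall_vel_ne_zero h,
    self_mem_nhdsWithin] with ε h1 h2 hε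
  refine JPlusPath.of_forall (Γ := F.curve ε) (Γ' := F.vel ε)
    (F.continuous_curve.comp (f := fun p : ℝ × ℝ => (ε, p)) (by fun_prop))
    (F.continuous_vel.comp (f := fun p : ℝ × ℝ => (ε, p)) (by fun_prop))
    (F.hasDerivAt_curve ε) (F.contDiff_curve ε) (F.periodic_curve ε) h2 ?_
  intro s hs t₀ t₁ r hr he hv
  exact F.noTangency_of_forall_Icc (fun a ha b hb => h1 s hs a ha b hb hε) t₀ t₁ r hr he hv

end ThinFamily

/-! ### Thin families given by jointly smooth functions -/

theorem contDiff_slice_deriv {E : Type*} [NormedAddCommGroup E] [NormedSpace ℝ E] {f : E × ℝ → ℂ}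
    (hf : ContDiff ℝ ∞ f) :
    (∀ x t, HasDerivAt (fun t => f (x, t)) (deriv (fun t => f (x, t)) t) t) ∧
      Continuous fun p : E × ℝ => deriv (fun t => f (p.1, t)) p.2 := by
  have h1 : ∀ x t, HasDerivAt (fun t => f (x, t)) (fderiv ℝ f (x, t) (0, 1)) t := by
    intro x t
    have h2 : HasFDerivAt f (fderiv ℝ f (x, t)) (x, t) :=
      (hf.differentiable (by simp) (x, t)).hasFDerivAt
    have h3 : HasDerivAt (fun t : ℝ => (x, t)) ((0 : E), (1 : ℝ)) t :=
      (hasDerivAt_const t x).prodMk (hasDerivAt_id t)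
    exact h2.comp_hasDerivAt t h3
  refine ⟨fun x t => (h1 x t).differentiableAt.hasDerivAt, ?_⟩
  have h2 : (fun p : E × ℝ => deriv (fun t => f (p.1, t)) p.2) = fun p => fderiv ℝ f p (0, 1) :=
    funext fun p => (h1 p.1 p.2).deriv
  rw [h2]
  exact (hf.continuous_fderiv (by simp)).clm_apply continuous_const

/-- The thin family of an arc `A` and a displacement `B` that are smooth in all variables. -/
def ThinFamily.ofContDiff (A : ℝ × ℝ → ℂ) (B : (ℝ × ℝ) × ℝ → ℂ) (hA : ContDiff ℝ ∞ A)
    (hB : ContDiff ℝ ∞ B) (hper : ∀ x t, B (x, t + 1) = B (x, t)) : ThinFamily where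
  A s u := A (s, u)
  A' s u := deriv (fun u => A (s, u)) u
  B ε s t := B ((ε, s), t)
  B' ε s t := deriv (fun t => B ((ε, s), t)) t
  hA s u := (contDiff_slice_deriv hA).1 s u
  hB ε s t := (contDiff_slice_deriv hB).1 (ε, s) t
  cA := hA.continuous
  cA' := (contDiff_slice_deriv hA).2
  cB := hB.continuous.comp (f := fun p : ℝ × ℝ × ℝ => ((p.1, p.2.1), p.2.2)) (by fun_prop)
  cB' := (contDiff_slice_deriv hB).2.comp (f := fun p : ℝ × ℝ × ℝ => ((p.1, p.2.1), p.2.2))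
    (by fun_prop)
  smA s := hA.comp (f := fun u : ℝ => (s, u)) (by fun_prop)
  smB ε s := hB.comp (f := fun t : ℝ => ((ε, s), t)) (by fun_prop)
  perB ε s t := hper (ε, s) t

/-! ### Polynomial arcs -/

open Polynomial in
/-- The secant slope `(α(p + v) - α(p)) / v` as a polynomial in `v`. -/
def secant (α : ℂ[X]) (p : ℂ) : ℂ[X] := (α.comp (X + C p)).divX

open Polynomial in
theorem secant_spec (α : ℂ[X]) (p v : ℂ) :
    v * (secant α p).eval v = α.eval (p + v) - α.eval p := by
  have h := congrArg (Polynomial.eval v) (divX_mul_X_add (α.comp (X + C p)))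
  simp only [eval_add, eval_mul, eval_X, eval_C, eval_comp, coeff_zero_eq_eval_zero, zero_add] at h
  rw [secant, mul_comm, add_comm p v, ← h]
  ring

open Polynomial in
theorem secant_deriv (α : ℂ[X]) (p v : ℂ) :
    (secant α p).eval v + v * (secant α p).derivative.eval v = α.derivative.eval (p + v) := by
  have h : X * secant α p = α.comp (X + C p) - C (α.eval p) :=
    Polynomial.funext fun x => by simp [secant_spec, add_comm]
  have h2 := congrArg (Polynomial.eval v) (congrArg Polynomial.derivative h)
  simp only [derivative_mul, derivative_X, one_mul, eval_add, eval_mul, eval_X, derivative_sub,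
    derivative_comp, derivative_C, sub_zero, add_zero, eval_comp,
    eval_C, derivative_add] at h2
  rw [h2, add_comm p v]

theorem secant_zero (α : Polynomial ℂ) (p : ℂ) :
    (secant α p).eval 0 = α.derivative.eval p := by
  simpa using secant_deriv α p 0

theorem Polynomial.contDiff_eval_real (α : Polynomial ℂ) : ContDiff ℝ ∞ fun z : ℂ => α.eval z :=
  (α.differentiable.contDiff (n := ∞)).restrict_scalars ℝ

theorem Polynomial.hasDerivAt_ofReal (α : Polynomial ℂ) (u : ℝ) :
    HasDerivAt (fun u : ℝ => α.eval (u : ℂ)) (α.derivative.eval (u : ℂ)) u :=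
  (α.hasDerivAt (u : ℂ)).comp_ofReal

/-- The arc `u ↦ α u`, `u ∈ [-1, 1]`, is regular; its multiple points are the transverse double
points listed in `E`, and they avoid the ends. -/
structure IsArc (α : Polynomial ℂ) (E : Finset (ℝ × ℝ)) : Prop where
  regular : ∀ u : ℝ, -1 ≤ u → u ≤ 1 → α.derivative.eval (u : ℂ) ≠ 0
  bounds : ∀ e ∈ E, -1 < e.1 ∧ e.1 < e.2 ∧ e.2 < 1
  eval_eq : ∀ e ∈ E, α.eval (e.1 : ℂ) = α.eval (e.2 : ℂ)
  transverse : ∀ e ∈ E, cross (α.derivative.eval (e.1 : ℂ)) (α.derivative.eval (e.2 : ℂ)) ≠ 0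
  mem : ∀ u v : ℝ, -1 ≤ u → u < v → v ≤ 1 → α.eval (u : ℂ) = α.eval (v : ℂ) → (u, v) ∈ E
  inj : ∀ e ∈ E, ∀ e' ∈ E, e.2 = e'.2 → e = e'

/-- A smooth bump that is `1` for `|x| ≤ ρ` and `0` for `|x| ≥ 2 ρ`. -/
def bump (ρ x : ℝ) : ℝ := Real.smoothTransition (2 - (x / ρ) ^ 2)

theorem bump_eq_one {ρ x : ℝ} (hρ : 0 < ρ) (h : |x| ≤ ρ) : bump ρ x = 1 := by
  refine Real.smoothTransition.one_of_one_le ?_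
  have : (x / ρ) ^ 2 ≤ 1 := by
    rw [div_pow, div_le_one (by positivity)]
    exact sq_le_sq' (by linarith [(abs_le.1 h).1]) (abs_le.1 h).2
  linarith

theorem bump_eq_zero {ρ x : ℝ} (hρ : 0 < ρ) (h : 2 * ρ ≤ |x|) : bump ρ x = 0 := by
  refine Real.smoothTransition.zero_of_nonpos ?_
  have : 2 ≤ (x / ρ) ^ 2 := by
    rw [div_pow, le_div_iff₀ (by positivity), ← sq_abs x]
    nlinarith
  linarith

theorem bump_nonneg (ρ x : ℝ) : 0 ≤ bump ρ x := Real.smoothTransition.nonneg _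

theorem bump_le_one (ρ x : ℝ) : bump ρ x ≤ 1 := Real.smoothTransition.le_one _

theorem contDiff_bump (ρ : ℝ) : ContDiff ℝ ∞ (bump ρ) :=
  Real.smoothTransition.contDiff.comp (by fun_prop)

/-- A smooth cutoff that is `0` for `u ≤ c` and `1` for `u ≥ (1 + c) / 2`. -/
def cutoff (c u : ℝ) : ℝ := Real.smoothTransition ((u - c) / ((1 - c) / 2))

theorem cutoff_eq_one {c u : ℝ} (hc : c < 1) (h : (1 + c) / 2 ≤ u) : cutoff c u = 1 := by
  refine Real.smoothTransition.one_of_one_le ?_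
  rw [le_div_iff₀ (by linarith)]
  linarith

theorem cutoff_eq_zero {c u : ℝ} (hc : c < 1) (h : u ≤ c) : cutoff c u = 0 :=
  Real.smoothTransition.zero_of_nonpos (div_nonpos_of_nonpos_of_nonneg (by linarith) (by linarith))

theorem contDiff_cutoff (c : ℝ) : ContDiff ℝ ∞ (cutoff c) :=
  Real.smoothTransition.contDiff.comp (by fun_prop)

/-! ### Shortening a thin curve along its arc -/

/-- Data for the retraction of a thin curve along an arc: the sides `σ`, `τ` of the two turns, the
size of the cutoffs, and the size `ρ` of the time intervals around the crossings. -/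
structure Retraction where
  α : Polynomial ℂ
  E : Finset (ℝ × ℝ)
  arc : IsArc α E
  σ : ℝ
  τ : ℝ
  hσ : σ = 1 ∨ σ = -1
  hτ : τ ≠ 0
  c : ℝ
  c_pos : 0 < c
  c_lt : c < 1
  -- The argument is the place, on the shortened arc rescaled to `[-1, 1]`, where the moving end
  -- meets the other branch at `e`. The displacement vanishes for `|cos 2πt| ≤ c`, so the crossed
  -- strands lie exactly on the arc there.
  abs_lt_c : ∀ e ∈ E, |2 * (1 + e.1) / (1 + e.2) - 1| < c
  ρ : ℝ
  ρ_pos : 0 < ρ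
  ρ_sep : ∀ e ∈ E, ∀ e' ∈ E, e ≠ e' → 4 * ρ < |(1 + e.2) / 2 - (1 + e'.2) / 2|
  ρ_lt : ∀ e ∈ E, 2 * ρ < (1 + e.2) / 2 ∧ 2 * ρ < 1 - (1 + e.2) / 2
  -- During the time window of `e` the direction of the crossed branch stays on one side of the
  -- tangent of the moving end.
  ρ_cross : ∀ e ∈ E, ∀ r : ℝ, |r - (1 + e.2) / 2| ≤ 2 * ρ →
    0 < (σ * cross (α.derivative.eval ((2 * r - 1 : ℝ) : ℂ)) (α.derivative.eval (e.1 : ℂ))) *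
      (σ * cross (α.derivative.eval (e.2 : ℂ)) (α.derivative.eval (e.1 : ℂ)))

namespace Retraction

variable (R : Retraction)

/-- The side of the turn at a crossing, `±1`. -/
def κ (e : ℝ × ℝ) : ℝ :=
  if 0 < R.σ * cross (R.α.derivative.eval (e.2 : ℂ)) (R.α.derivative.eval (e.1 : ℂ)) then 1 else -1

theorem κ_eq (e : ℝ × ℝ) : R.κ e = 1 ∨ R.κ e = -1 := by
  unfold κ; split_ifs <;> simp

theorem κ_sq (e : ℝ × ℝ) : R.κ e * R.κ e = 1 := by
  rcases R.κ_eq e with h | h <;> rw [h] <;> norm_num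

/-- The sign `κ` is chosen so that `κ α'(e.1)` points to the side `σ` of the moving end, and
`ρ_cross` keeps it there during the window. -/
theorem κ_cross {e : ℝ × ℝ} (he : e ∈ R.E) {r : ℝ} (hr : |r - (1 + e.2) / 2| ≤ 2 * R.ρ) :
    0 < R.σ * R.κ e *
      cross (R.α.derivative.eval ((2 * r - 1 : ℝ) : ℂ)) (R.α.derivative.eval (e.1 : ℂ)) := by
  have h := R.ρ_cross e he r hr
  unfold κ
  split_ifs with h1
  · have := (mul_pos_iff_of_pos_right h1).1 h
    linarith
  · have : R.σ * cross (R.α.derivative.eval (e.2 : ℂ)) (R.α.derivative.eval (e.1 : ℂ)) < 0 := by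
      rcases lt_or_eq_of_le (not_lt.1 h1) with h2 | h2
      · exact h2
      · rw [h2, mul_zero] at h; exact absurd h (lt_irrefl _)
    have := neg_of_mul_pos_left h this.le
    linarith

/-- The weight of the crossing `e` at the time `r`. -/
def θ (e : ℝ × ℝ) (r : ℝ) : ℝ := bump R.ρ (r - (1 + e.2) / 2)

theorem θ_eq_zero_of_ne {e e' : ℝ × ℝ} (he : e ∈ R.E) (he' : e' ∈ R.E) (hne : e ≠ e') {r : ℝ}
    (hr : |r - (1 + e.2) / 2| < 2 * R.ρ) : R.θ e' r = 0 := by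
  refine bump_eq_zero R.ρ_pos ?_
  have h1 := R.ρ_sep e he e' he' hne
  have h2 : (1 + e.2) / 2 - (1 + e'.2) / 2 = (r - (1 + e'.2) / 2) - (r - (1 + e.2) / 2) := by ring
  rw [h2] at h1
  have h3 := abs_sub (r - (1 + e'.2) / 2) (r - (1 + e.2) / 2)
  linarith

theorem θ_cases (r : ℝ) : (∀ e ∈ R.E, R.θ e r = 0) ∨
    ∃ e ∈ R.E, |r - (1 + e.2) / 2| < 2 * R.ρ ∧ ∀ e' ∈ R.E, e' ≠ e → R.θ e' r = 0 := by
  by_cases h : ∃ e ∈ R.E, |r - (1 + e.2) / 2| < 2 * R.ρ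
  · obtain ⟨e, he, hr⟩ := h
    exact Or.inr ⟨e, he, hr, fun e' he' hne => R.θ_eq_zero_of_ne he he' hne.symm hr⟩
  · push Not at h
    exact Or.inl fun e he => bump_eq_zero R.ρ_pos (h e he)

/-- The displacement of the moving turn at the time `r`, divided by the parameter `y`. -/
def w (r y : ℝ) : ℂ :=
  (1 - ∑ e ∈ R.E, R.θ e r) • (R.σ • (Complex.I * R.α.derivative.eval ((2 * r - 1 : ℝ) : ℂ))) +
    ∑ e ∈ R.E, R.θ e r • (R.κ e • (secant R.α e.1).eval ((R.κ e * (r * y) : ℝ) : ℂ))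

theorem w_of_forall_zero {r : ℝ} (h : ∀ e ∈ R.E, R.θ e r = 0) (y : ℝ) :
    R.w r y = R.σ • (Complex.I * R.α.derivative.eval ((2 * r - 1 : ℝ) : ℂ)) := by
  unfold w
  rw [Finset.sum_eq_zero h, Finset.sum_eq_zero fun e he => by rw [h e he, zero_smul]]
  simp

theorem w_of_forall_ne {r : ℝ} {e : ℝ × ℝ} (he : e ∈ R.E)
    (h : ∀ e' ∈ R.E, e' ≠ e → R.θ e' r = 0) (y : ℝ) :
    R.w r y = (1 - R.θ e r) • (R.σ • (Complex.I * R.α.derivative.eval ((2 * r - 1 : ℝ) : ℂ))) +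
      R.θ e r • (R.κ e • (secant R.α e.1).eval ((R.κ e * (r * y) : ℝ) : ℂ)) := by
  unfold w
  rw [Finset.sum_eq_single_of_mem e he h, Finset.sum_eq_single_of_mem e he
    fun e' he' hne => by rw [h e' he' hne, zero_smul]]

theorem cross_I_mul (z : ℂ) : cross z (Complex.I * z) = Complex.normSq z := by
  simp [cross, Complex.normSq_apply]

theorem σ_sq : R.σ * R.σ = 1 := by
  rcases R.hσ with h | h <;> rw [h] <;> norm_num

/-- Outside the windows the turn is displaced along the normal; well inside one it is displaced
along the branch to be crossed. Both directions point to the side `σ` of the tangent, so their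
convex combinations are transverse. -/
theorem cross_w {r : ℝ} (h0 : 0 ≤ r) (h1 : r ≤ 1) :
    cross (R.α.derivative.eval ((2 * r - 1 : ℝ) : ℂ)) (R.w r 0) ≠ 0 := by
  have hreg := Complex.normSq_pos.2 (R.arc.regular (2 * r - 1) (by linarith) (by linarith))
  suffices 0 < R.σ * cross (R.α.derivative.eval ((2 * r - 1 : ℝ) : ℂ)) (R.w r 0) by
    intro h; rw [h, mul_zero] at this; exact lt_irrefl _ this
  rcases R.θ_cases r with h | ⟨e, he, hr, h⟩
  · rw [R.w_of_forall_zero h, cross_smul_right, cross_I_mul, ← mul_assoc, R.σ_sq, one_mul]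
    exact hreg
  · rw [R.w_of_forall_ne he h, cross_add_right, cross_smul_right, cross_smul_right,
      cross_smul_right, cross_smul_right, cross_I_mul, mul_zero, mul_zero, Complex.ofReal_zero,
      secant_zero]
    have h2 := R.κ_cross he hr.le
    have h3 : 0 ≤ R.θ e r := bump_nonneg _ _
    have h4 : R.θ e r ≤ 1 := bump_le_one _ _
    set N := Complex.normSq (R.α.derivative.eval ((2 * r - 1 : ℝ) : ℂ))
    set Q := cross (R.α.derivative.eval ((2 * r - 1 : ℝ) : ℂ)) (R.α.derivative.eval (e.1 : ℂ))
    have h5 : R.σ * ((1 - R.θ e r) * (R.σ * N) + R.θ e r * (R.κ e * Q)) =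
        (1 - R.θ e r) * N + R.θ e r * (R.σ * R.κ e * Q) := by
      linear_combination ((1 - R.θ e r) * N) * R.σ_sq
    rw [h5]
    rcases h3.lt_or_eq with h6 | h6
    · have := mul_pos h6 h2
      have := mul_nonneg (sub_nonneg.2 h4) hreg.le
      linarith
    · rw [← h6]; simpa using hreg

/-- The displacement of the fixed turn. -/
def wEnd : ℂ := R.τ • (Complex.I * R.α.derivative.eval ((-1 : ℝ) : ℂ))

/-- The displacement of the thin curve. -/
def disp (p : (ℝ × ℝ) × ℝ) : ℂ :=
  Real.sin (2 * Real.pi * p.2) • (cutoff R.c (Real.cos (2 * Real.pi * p.2)) •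
    R.w (1 - p.1.2) (p.1.1 * (Real.sin (2 * Real.pi * p.2) *
      cutoff R.c (Real.cos (2 * Real.pi * p.2)))) +
    cutoff R.c (-Real.cos (2 * Real.pi * p.2)) • R.wEnd)

theorem contDiff_disp : ContDiff ℝ ∞ R.disp := by
  have hc := contDiff_cutoff R.c
  have hb := contDiff_bump R.ρ
  have hsec := fun e : ℝ × ℝ => (secant R.α e.1).contDiff_eval_real
  have hder := R.α.derivative.contDiff_eval_real
  have hof : ContDiff ℝ ∞ fun x : ℝ => (x : ℂ) := Complex.ofRealCLM.contDiff
  have h1 : ContDiff ℝ ∞ fun p : (ℝ × ℝ) × ℝ => cutoff R.c (Real.cos (2 * Real.pi * p.2)) :=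
    hc.comp (by fun_prop)
  have h2 : ContDiff ℝ ∞ fun p : (ℝ × ℝ) × ℝ => cutoff R.c (-Real.cos (2 * Real.pi * p.2)) :=
    hc.comp (by fun_prop)
  have h3 : ContDiff ℝ ∞ fun q : ℝ × ℝ => R.w q.1 q.2 := by
    have hθ : ∀ e, ContDiff ℝ ∞ fun q : ℝ × ℝ => R.θ e q.1 := fun e =>
      hb.comp (g := bump R.ρ) (f := fun q : ℝ × ℝ => q.1 - (1 + e.2) / 2) (by fun_prop)
    have hα : ContDiff ℝ ∞ fun q : ℝ × ℝ => R.α.derivative.eval ((2 * q.1 - 1 : ℝ) : ℂ) :=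
      (hder.comp hof).comp (f := fun q : ℝ × ℝ => 2 * q.1 - 1) (by fun_prop)
    have hs : ∀ e : ℝ × ℝ, ContDiff ℝ ∞ fun q : ℝ × ℝ =>
        (secant R.α e.1).eval ((R.κ e * (q.1 * q.2) : ℝ) : ℂ) := fun e =>
      ((hsec e).comp hof).comp (f := fun q : ℝ × ℝ => R.κ e * (q.1 * q.2)) (by fun_prop)
    unfold w
    refine ContDiff.add ?_ (ContDiff.sum fun e _ => ?_)
    · exact (contDiff_const.sub (ContDiff.sum fun e _ => hθ e)).smul
        ((contDiff_const.mul hα).const_smul R.σ)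
    · exact (hθ e).smul ((hs e).const_smul (R.κ e))
  have h4 : ContDiff ℝ ∞ fun p : (ℝ × ℝ) × ℝ => R.w (1 - p.1.2) (p.1.1 *
      (Real.sin (2 * Real.pi * p.2) * cutoff R.c (Real.cos (2 * Real.pi * p.2)))) :=
    h3.comp (f := fun p : (ℝ × ℝ) × ℝ => (1 - p.1.2, p.1.1 *
      (Real.sin (2 * Real.pi * p.2) * cutoff R.c (Real.cos (2 * Real.pi * p.2))))) (by fun_prop)
  have h5 : ContDiff ℝ ∞ fun p : (ℝ × ℝ) × ℝ => Real.sin (2 * Real.pi * p.2) := by fun_prop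
  exact h5.smul ((h1.smul h4).add (h2.smul contDiff_const))

theorem disp_periodic (x : ℝ × ℝ) (t : ℝ) : R.disp (x, t + 1) = R.disp (x, t) := by
  simp only [disp, mul_add, mul_one, Real.sin_add_two_pi, Real.cos_add_two_pi]

/-- The arc at time `s`, starting at `-1` and rescaled. -/
def arcAt (p : ℝ × ℝ) : ℂ :=
  (1 + p.2) • (secant R.α (-1)).eval (((1 - p.1) * (1 + p.2) : ℝ) : ℂ)

theorem contDiff_arcAt : ContDiff ℝ ∞ R.arcAt := by
  have hof : ContDiff ℝ ∞ fun x : ℝ => (x : ℂ) := Complex.ofRealCLM.contDiff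
  have h1 : ContDiff ℝ ∞ fun p : ℝ × ℝ =>
      (secant R.α (-1)).eval (((1 - p.1) * (1 + p.2) : ℝ) : ℂ) :=
    ((secant R.α (-1)).contDiff_eval_real.comp hof).comp
      (f := fun p : ℝ × ℝ => (1 - p.1) * (1 + p.2)) (by fun_prop)
  have h2 : ContDiff ℝ ∞ fun p : ℝ × ℝ => 1 + p.2 := by fun_prop
  exact h2.smul h1

/-- The secant polynomial carries out the division by `1 - s`. The shortened arc is blown up to
constant size, and the family stays smooth up to `s = 1`, where it is a segment along the tangent at
`-1`. -/
theorem arcAt_spec (s u : ℝ) : (1 - s) • R.arcAt (s, u) =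
    R.α.eval ((-1 + (1 - s) * (1 + u) : ℝ) : ℂ) - R.α.eval ((-1 : ℝ) : ℂ) := by
  have h := secant_spec R.α (-1) (((1 - s) * (1 + u) : ℝ) : ℂ)
  simp only [arcAt, Complex.real_smul]
  push_cast at h ⊢
  rw [← h]
  ring

/-- The rescaling cancels the factor `1 - s` of the chain rule, so the rescaled arc inherits its
velocity, and thereby its regularity, from `α` even at `s = 1`. -/
theorem hasDerivAt_arcAt (s u : ℝ) : HasDerivAt (fun u => R.arcAt (s, u))
    (R.α.derivative.eval ((-1 + (1 - s) * (1 + u) : ℝ) : ℂ)) u := by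
  have h1 : HasDerivAt (fun u : ℝ => (1 - s) * (1 + u)) (1 - s) u := by
    simpa using ((hasDerivAt_id u).const_add 1).const_mul (1 - s)
  have h2 := ((secant R.α (-1)).hasDerivAt_ofReal ((1 - s) * (1 + u))).scomp u h1
  have h3 := ((hasDerivAt_id u).const_add 1).smul h2
  have h4 := secant_deriv R.α (-1) (((1 - s) * (1 + u) : ℝ) : ℂ)
  refine h3.congr_deriv ?_
  simp only [id, Complex.real_smul, Function.comp]
  push_cast at h4 ⊢
  rw [← h4]
  ring

/-- The family of thin curves of the retraction. -/
def family : ThinFamily :=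
  ThinFamily.ofContDiff R.arcAt R.disp R.contDiff_arcAt R.contDiff_disp R.disp_periodic

theorem family_A (s u : ℝ) : R.family.A s u = R.arcAt (s, u) := rfl

theorem family_B (ε s t : ℝ) : R.family.B ε s t = R.disp ((ε, s), t) := rfl

theorem family_A' (s u : ℝ) : R.family.A' s u =
    R.α.derivative.eval ((-1 + (1 - s) * (1 + u) : ℝ) : ℂ) := (R.hasDerivAt_arcAt s u).deriv

end Retraction

namespace Retraction

variable (R : Retraction)

theorem hasDerivAt_sin_two_pi (t : ℝ) : HasDerivAt (fun t : ℝ => Real.sin (2 * Real.pi * t))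
    (Real.cos (2 * Real.pi * t) * (2 * Real.pi)) t := by
  have := ((hasDerivAt_id t).const_mul (2 * Real.pi)).sin
  simpa using this

/-- Where the sine vanishes only the derivative of this factor contributes, and at `ε = 0` the
second argument of `w` is zero. -/
theorem family_B'_of_sin_eq_zero {s t : ℝ} (h : Real.sin (2 * Real.pi * t) = 0) :
    R.family.B' 0 s t = (Real.cos (2 * Real.pi * t) * (2 * Real.pi)) •
      (cutoff R.c (Real.cos (2 * Real.pi * t)) • R.w (1 - s) 0 +
        cutoff R.c (-Real.cos (2 * Real.pi * t)) • R.wEnd) := by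
  have hg : Differentiable ℝ fun t : ℝ => cutoff R.c (Real.cos (2 * Real.pi * t)) • R.w (1 - s) 0 +
      cutoff R.c (-Real.cos (2 * Real.pi * t)) • R.wEnd := by
    have hc := (contDiff_cutoff R.c).differentiable (by simp)
    have h1 : Differentiable ℝ fun t : ℝ => cutoff R.c (Real.cos (2 * Real.pi * t)) :=
      hc.comp (by fun_prop)
    have h2 : Differentiable ℝ fun t : ℝ => cutoff R.c (-Real.cos (2 * Real.pi * t)) :=
      hc.comp (by fun_prop)
    fun_prop
  have h1 := ((hasDerivAt_sin_two_pi t).smul (hg t).hasDerivAt).deriv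
  rw [h, zero_smul, zero_add] at h1
  rw [← h1]
  simp only [family, ThinFamily.ofContDiff, disp, zero_mul]
  rfl

theorem family_regularAt {s : ℝ} (hs : s ∈ Icc (0 : ℝ) 1) : R.family.RegularAt s := by
  obtain ⟨h0, h1⟩ := hs
  have hpi := Real.pi_pos
  refine ⟨fun u hu => ?_, fun t ht => ?_⟩
  · rw [family_A']
    refine R.arc.regular _ ?_ ?_
    · nlinarith [mul_nonneg (sub_nonneg.2 h1) (show 0 ≤ 1 + u by linarith [hu.1])]
    · nlinarith [hu.1, hu.2, mul_nonneg h0 (show 0 ≤ 1 + u by linarith [hu.1])]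
  · rw [family_A', R.family_B'_of_sin_eq_zero ht]
    have hc : Real.cos (2 * Real.pi * t) = 1 ∨ Real.cos (2 * Real.pi * t) = -1 := by
      have := Real.sin_sq_add_cos_sq (2 * Real.pi * t)
      rw [ht] at this
      rcases mul_eq_zero.1 (show (Real.cos (2 * Real.pi * t) - 1) *
        (Real.cos (2 * Real.pi * t) + 1) = 0 by nlinarith) with h | h
      · exact Or.inl (by linarith)
      · exact Or.inr (by linarith)
    have := R.c_pos
    have := R.c_lt
    rcases hc with hc | hc <;> rw [hc]
    · rw [cutoff_eq_one R.c_lt (by linarith), cutoff_eq_zero R.c_lt (by linarith), one_smul,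
        zero_smul, add_zero, cross_smul_right,
        show -1 + (1 - s) * (1 + 1) = 2 * (1 - s) - 1 by ring]
      exact mul_ne_zero (by positivity) (R.cross_w (by linarith) (by linarith))
    · rw [neg_neg, cutoff_eq_one (u := 1) R.c_lt (by linarith),
        cutoff_eq_zero (u := -1) R.c_lt (by linarith), one_smul, zero_smul, zero_add, cross_smul_right, wEnd, cross_smul_right,
        show -1 + (1 - s) * (1 + -1) = -1 by ring, cross_I_mul]
      have := Complex.normSq_pos.2 (R.arc.regular (-1) le_rfl (by norm_num))
      exact mul_ne_zero (by nlinarith) (mul_ne_zero R.hτ this.ne')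

/-- The time of the crossing `e`. -/
def time (e : ℝ × ℝ) : ℝ := 1 - (1 + e.2) / 2

/-- The position on the retracting arc of the strand that is crossed. -/
def strandPos (e : ℝ × ℝ) : ℝ := 2 * (1 + e.1) / (1 + e.2) - 1

/-- The parameter on the arc `α` at time `s`. -/
def par (s t : ℝ) : ℝ := -1 + (1 - s) * (1 + Real.cos (2 * Real.pi * t))

theorem continuous_par : Continuous fun p : ℝ × ℝ => par p.1 p.2 := by
  unfold par; fun_prop

theorem hasDerivAt_par (s t : ℝ) : HasDerivAt (par s)
    ((1 - s) * (-Real.sin (2 * Real.pi * t) * (2 * Real.pi))) t :=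
  (((ThinFamily.hasDerivAt_cos_two_pi t).const_add 1).const_mul (1 - s)).const_add (-1)

/-- Both cutoffs vanish here: the two strands coincide on the arc. They run in opposite directions,
which is harmless because inverse self-tangencies are unrestricted. -/
theorem strand_curve {ε s t : ℝ} (h : |Real.cos (2 * Real.pi * t)| ≤ R.c) :
    (1 - s) • R.family.curve ε s t =
      R.α.eval ((par s t : ℝ) : ℂ) - R.α.eval ((-1 : ℝ) : ℂ) := by
  have h1 := abs_le.1 h
  rw [ThinFamily.curve, family_A, family_B, disp, cutoff_eq_zero R.c_lt h1.2,
    cutoff_eq_zero R.c_lt (by linarith), zero_smul, zero_smul, add_zero, smul_zero, smul_zero,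
    add_zero, arcAt_spec, par]

theorem strand_vel {ε s t : ℝ} (h : |Real.cos (2 * Real.pi * t)| < R.c) :
    R.family.vel ε s t = (-Real.sin (2 * Real.pi * t) * (2 * Real.pi)) •
      R.α.derivative.eval ((par s t : ℝ) : ℂ) := by
  have h2 : R.family.B ε s =ᶠ[𝓝 t] fun _ => 0 := by
    have hc : Continuous fun t : ℝ => |Real.cos (2 * Real.pi * t)| := by fun_prop
    filter_upwards [hc.continuousAt.eventually_lt continuousAt_const h] with x hx
    have h1 := abs_lt.1 hx
    rw [family_B, disp, cutoff_eq_zero R.c_lt h1.2.le, cutoff_eq_zero R.c_lt (by linarith),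
      zero_smul, zero_smul, add_zero, smul_zero]
  have h3 : R.family.B' ε s t = 0 := by
    rw [← (R.family.hB ε s t).deriv, h2.deriv_eq, deriv_const]
  rw [ThinFamily.vel, h3, smul_zero, add_zero, family_A', par]

/-- The parameter on the crossed strand that corresponds to a point of the moving turn. -/
def crossPar (e : ℝ × ℝ) (ε s t : ℝ) : ℝ :=
  e.1 + R.κ e * ((1 - s) * (ε * Real.sin (2 * Real.pi * t)))

theorem continuous_crossPar (e : ℝ × ℝ) :
    Continuous fun p : ℝ × ℝ × ℝ => R.crossPar e p.1 p.2.1 p.2.2 := by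
  unfold crossPar; fun_prop

theorem hasDerivAt_crossPar (e : ℝ × ℝ) (ε s t : ℝ) : HasDerivAt (R.crossPar e ε s)
    (R.κ e * ((1 - s) * (ε * (Real.cos (2 * Real.pi * t) * (2 * Real.pi))))) t :=
  ((((hasDerivAt_sin_two_pi t).const_mul ε).const_mul (1 - s)).const_mul (R.κ e)).const_add e.1

/-- Around the time of `e` the weight is `1`, and the secant at `e.1` turns the displacement into an
exact increment of `α` along the crossed branch. Up to translation and scaling, the turn is the sum
of a point of the retracting branch and a point of the crossed branch, which makes its intersections
with the latter explicit. -/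
theorem tip_curve {e : ℝ × ℝ} (he : e ∈ R.E) {ε s t : ℝ} (hs : |s - time e| ≤ R.ρ)
    (h : (1 + R.c) / 2 ≤ Real.cos (2 * Real.pi * t)) :
    (1 - s) • R.family.curve ε s t = R.α.eval ((par s t : ℝ) : ℂ) - R.α.eval ((-1 : ℝ) : ℂ) +
      (R.α.eval ((R.crossPar e ε s t : ℝ) : ℂ) - R.α.eval (e.1 : ℂ)) := by
  have hc := R.c_lt
  have hc' := R.c_pos
  have hr : |1 - s - (1 + e.2) / 2| ≤ R.ρ := by
    rw [abs_sub_comm] at hs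
    convert hs using 2
    unfold time; ring
  have hθ : R.θ e (1 - s) = 1 := bump_eq_one R.ρ_pos hr
  have h3 := fun e' he' hne => R.θ_eq_zero_of_ne (e' := e') he he' hne
    (r := 1 - s) (by linarith [R.ρ_pos])
  have hw := R.w_of_forall_ne he (fun e' he' hne => h3 e' he' hne.symm)
    (ε * (Real.sin (2 * Real.pi * t) * 1))
  rw [hθ, sub_self, zero_smul, zero_add, one_smul] at hw
  have h4 := secant_spec R.α e.1 ((R.κ e * ((1 - s) * (ε * (Real.sin (2 * Real.pi * t) * 1))) : ℝ) : ℂ)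
  rw [ThinFamily.curve, family_A, family_B, disp, cutoff_eq_one R.c_lt h,
    cutoff_eq_zero R.c_lt (by linarith), one_smul, zero_smul, add_zero]
  simp only
  rw [hw, smul_add, arcAt_spec, par]
  congr 1
  have h5 : ((R.crossPar e ε s t : ℝ) : ℂ) = e.1 +
      ((R.κ e * ((1 - s) * (ε * (Real.sin (2 * Real.pi * t) * 1))) : ℝ) : ℂ) := by
    rw [crossPar]; push_cast; ring
  rw [h5, ← h4]
  simp only [Complex.real_smul]
  push_cast
  ring

theorem tip_vel {e : ℝ × ℝ} (he : e ∈ R.E) {ε s t : ℝ} (hs : |s - time e| ≤ R.ρ)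
    (h : (1 + R.c) / 2 < Real.cos (2 * Real.pi * t)) :
    (1 - s) • R.family.vel ε s t =
      ((1 - s) * (-Real.sin (2 * Real.pi * t) * (2 * Real.pi))) •
        R.α.derivative.eval ((par s t : ℝ) : ℂ) +
      (R.κ e * ((1 - s) * (ε * (Real.cos (2 * Real.pi * t) * (2 * Real.pi))))) •
        R.α.derivative.eval ((R.crossPar e ε s t : ℝ) : ℂ) := by
  have h1 : HasDerivAt (fun t => (1 - s) • R.family.curve ε s t) ((1 - s) • R.family.vel ε s t) t :=
    (R.family.hasDerivAt_curve ε s t).const_smul (1 - s)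
  have h2 := (((R.α.hasDerivAt_ofReal (par s t)).scomp t (hasDerivAt_par s t)).sub_const
    (R.α.eval ((-1 : ℝ) : ℂ))).add (((R.α.hasDerivAt_ofReal (R.crossPar e ε s t)).scomp t
      (R.hasDerivAt_crossPar e ε s t)).sub_const (R.α.eval (e.1 : ℂ)))
  refine h1.unique (h2.congr_of_eventuallyEq ?_)
  have hc : Continuous fun t : ℝ => Real.cos (2 * Real.pi * t) := by fun_prop
  filter_upwards [continuousAt_const.eventually_lt hc.continuousAt h] with x hx
  exact R.tip_curve he hs hx.le

theorem par_tip (e : ℝ × ℝ) (n : ℤ) : par (time e) n = e.2 := by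
  have : Real.cos (2 * Real.pi * n) = 1 := by
    rw [mul_comm]; exact Real.cos_int_mul_two_pi n
  rw [par, time, this]; ring

theorem sin_two_pi_int (n : ℤ) : Real.sin (2 * Real.pi * n) = 0 :=
  sin_two_pi_eq_zero_iff.2 ⟨2 * n, by push_cast; ring⟩

theorem cos_two_pi_int (n : ℤ) : Real.cos (2 * Real.pi * n) = 1 := by
  rw [mul_comm]; exact Real.cos_int_mul_two_pi n

theorem par_strand {e : ℝ × ℝ} (he : e ∈ R.E) {t : ℝ}
    (ht : Real.cos (2 * Real.pi * t) = strandPos e) : par (time e) t = e.1 := by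
  have := R.arc.bounds e he
  have h2 : 1 + e.2 ≠ 0 := by linarith
  rw [par, time, ht, strandPos]
  field_simp
  ring

/-- Near a crossing, the moving turn meets the crossed strand exactly where the arc parameters
match. -/
theorem eventually_curve_eq_iff {e : ℝ × ℝ} (he : e ∈ R.E) {t : ℝ}
    (ht : Real.cos (2 * Real.pi * t) = strandPos e) (n : ℤ) (ε₀ : ℝ) :
    ∀ᶠ q in 𝓝 (ε₀, time e, (n : ℝ), t),
      (R.family.curve q.1 q.2.1 q.2.2.1 = R.family.curve q.1 q.2.1 q.2.2.2 ↔
        par q.2.1 q.2.2.1 = e.2 ∧ par q.2.1 q.2.2.2 = R.crossPar e q.1 q.2.1 q.2.2.1) := by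
  have hb := R.arc.bounds e he
  have hc0 := R.c_pos
  have hc1 := R.c_lt
  have key := eventually_eq_of_sub_eq (P := ℝ) (p₀ := 0) (x₀ := e.1) (y₀ := e.2)
    (F := fun _ u => R.α.eval (u : ℂ)) (F' := fun _ u => R.α.derivative.eval (u : ℂ))
    (G := fun _ u => R.α.eval (u : ℂ)) (G' := fun _ u => R.α.derivative.eval (u : ℂ))
    (fun _ x => R.α.hasDerivAt_ofReal x) (fun _ x => R.α.hasDerivAt_ofReal x)
    (by fun_prop) (by fun_prop) (R.arc.transverse e he)
  have hcr := R.continuous_crossPar e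
  have hpar := continuous_par
  have htend : Tendsto (fun q : ℝ × ℝ × ℝ × ℝ => ((0 : ℝ), (R.crossPar e q.1 q.2.1 q.2.2.1,
      par q.2.1 q.2.2.2), (e.2, par q.2.1 q.2.2.1))) (𝓝 (ε₀, time e, (n : ℝ), t))
      (𝓝 ((0 : ℝ), (e.1, e.1), (e.2, e.2))) := by
    have c1 : Continuous fun q : ℝ × ℝ × ℝ × ℝ => R.crossPar e q.1 q.2.1 q.2.2.1 :=
      hcr.comp (f := fun q : ℝ × ℝ × ℝ × ℝ => (q.1, q.2.1, q.2.2.1)) (by fun_prop)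
    have c2 : Continuous fun q : ℝ × ℝ × ℝ × ℝ => par q.2.1 q.2.2.2 :=
      hpar.comp (f := fun q : ℝ × ℝ × ℝ × ℝ => (q.2.1, q.2.2.2)) (by fun_prop)
    have c3 : Continuous fun q : ℝ × ℝ × ℝ × ℝ => par q.2.1 q.2.2.1 :=
      hpar.comp (f := fun q : ℝ × ℝ × ℝ × ℝ => (q.2.1, q.2.2.1)) (by fun_prop)
    refine Continuous.tendsto' (by fun_prop) _ _ ?_
    simp only [Prod.mk.injEq, true_and]
    refine ⟨⟨?_, R.par_strand he ht⟩, par_tip e n⟩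
    rw [crossPar, sin_two_pi_int]; ring
  have ev1 : ∀ᶠ q in 𝓝 (ε₀, time e, (n : ℝ), t), |q.2.1 - time e| < R.ρ := by
    have : Continuous fun q : ℝ × ℝ × ℝ × ℝ => |q.2.1 - time e| := by fun_prop
    refine this.continuousAt.eventually_lt continuousAt_const ?_
    simpa using R.ρ_pos
  have ev2 : ∀ᶠ q in 𝓝 (ε₀, time e, (n : ℝ), t), (1 + R.c) / 2 < Real.cos (2 * Real.pi * q.2.2.1) := by
    have : Continuous fun q : ℝ × ℝ × ℝ × ℝ => Real.cos (2 * Real.pi * q.2.2.1) := by fun_prop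
    refine continuousAt_const.eventually_lt this.continuousAt ?_
    simp only [cos_two_pi_int]; linarith
  have ev3 : ∀ᶠ q in 𝓝 (ε₀, time e, (n : ℝ), t), |Real.cos (2 * Real.pi * q.2.2.2)| < R.c := by
    have : Continuous fun q : ℝ × ℝ × ℝ × ℝ => |Real.cos (2 * Real.pi * q.2.2.2)| := by fun_prop
    refine this.continuousAt.eventually_lt continuousAt_const ?_
    simp only [ht]
    exact R.abs_lt_c e he
  have ev4 : ∀ᶠ q in 𝓝 (ε₀, time e, (n : ℝ), t), q.2.1 < 1 := by
    have : Continuous fun q : ℝ × ℝ × ℝ × ℝ => q.2.1 := by fun_prop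
    refine this.continuousAt.eventually_lt continuousAt_const ?_
    simp only [time]; linarith
  filter_upwards [htend.eventually key, ev1, ev2, ev3, ev4] with q h1 h2 h3 h4 h5
  have h6 : (1 - q.2.1) ≠ 0 := by linarith
  have htip := R.tip_curve he h2.le (ε := q.1) h3.le
  have hstr := R.strand_curve (ε := q.1) (s := q.2.1) h4.le
  have hE := R.arc.eval_eq e he
  constructor
  · intro h
    rw [h, hstr] at htip
    -- Since `α` agrees at `e.1` and `e.2`, the equation equates an increment of `α` near `e.1` with
    -- one near `e.2`. By transversality of the branches both increments are trivial.
    have := h1 1 one_ne_zero (by rw [one_smul]; linear_combination htip - hE)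
    exact ⟨this.2.symm, this.1.symm⟩
  · rintro ⟨h7, h8⟩
    refine smul_right_injective ℂ h6 ?_
    simp only
    rw [htip, hstr, h7, h8]
    linear_combination -hE

/-- The crossing event `e`: the tip of the moving turn lies on the crossed strand and moves in the
same direction. -/
def Event (s t₀ t₁ : ℝ) : Prop :=
  ∃ e ∈ R.E, s = time e ∧ (∃ n : ℤ, t₀ = n) ∧ Real.cos (2 * Real.pi * t₁) = strandPos e ∧
    R.κ e * Real.sin (2 * Real.pi * t₁) < 0

/-- At an intersection the arc parameters match (`eventually_curve_eq_iff`). The determinant with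
the tangent of the crossed strand then leaves only a multiple of `sin 2πt₀`, so a tangency happens
at the tip, hence at the time of `e`. There both velocities are multiples of `α'(e.1)`, and their
signs single out one of the two coinciding strands. -/
theorem eventually_event {e : ℝ × ℝ} (he : e ∈ R.E) {t : ℝ}
    (ht : Real.cos (2 * Real.pi * t) = strandPos e) (n : ℤ) :
    ∀ᶠ q in 𝓝 ((0 : ℝ), time e, (n : ℝ), t), 0 < q.1 → ∀ r : ℝ, 0 < r →
      R.family.curve q.1 q.2.1 q.2.2.1 = R.family.curve q.1 q.2.1 q.2.2.2 →
      R.family.vel q.1 q.2.1 q.2.2.2 = r • R.family.vel q.1 q.2.1 q.2.2.1 →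
      R.Event q.2.1 q.2.2.1 q.2.2.2 := by
  have hb := R.arc.bounds e he
  have hc0 := R.c_pos
  have hc1 := R.c_lt
  have hpi := Real.pi_pos
  have ev1 : ∀ᶠ q in 𝓝 ((0 : ℝ), time e, (n : ℝ), t), |q.2.1 - time e| < R.ρ := by
    have : Continuous fun q : ℝ × ℝ × ℝ × ℝ => |q.2.1 - time e| := by fun_prop
    refine this.continuousAt.eventually_lt continuousAt_const ?_
    simpa using R.ρ_pos
  have ev2 : ∀ᶠ q in 𝓝 ((0 : ℝ), time e, (n : ℝ), t),
      (1 + R.c) / 2 < Real.cos (2 * Real.pi * q.2.2.1) := by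
    have : Continuous fun q : ℝ × ℝ × ℝ × ℝ => Real.cos (2 * Real.pi * q.2.2.1) := by fun_prop
    refine continuousAt_const.eventually_lt this.continuousAt ?_
    simp only [cos_two_pi_int]; linarith
  have ev3 : ∀ᶠ q in 𝓝 ((0 : ℝ), time e, (n : ℝ), t), |Real.cos (2 * Real.pi * q.2.2.2)| < R.c := by
    have : Continuous fun q : ℝ × ℝ × ℝ × ℝ => |Real.cos (2 * Real.pi * q.2.2.2)| := by fun_prop
    refine this.continuousAt.eventually_lt continuousAt_const ?_
    simp only [ht]
    exact R.abs_lt_c e he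
  have ev4 : ∀ᶠ q in 𝓝 ((0 : ℝ), time e, (n : ℝ), t), q.2.1 < 1 := by
    have : Continuous fun q : ℝ × ℝ × ℝ × ℝ => q.2.1 := by fun_prop
    refine this.continuousAt.eventually_lt continuousAt_const ?_
    simp only [time]; linarith
  have ev5 : ∀ᶠ q in 𝓝 ((0 : ℝ), time e, (n : ℝ), t), |q.2.2.1 - (n : ℝ)| < 1 / 2 := by
    have : Continuous fun q : ℝ × ℝ × ℝ × ℝ => |q.2.2.1 - (n : ℝ)| := by fun_prop
    refine this.continuousAt.eventually_lt continuousAt_const ?_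
    simp
  have ev6 : ∀ᶠ q in 𝓝 ((0 : ℝ), time e, (n : ℝ), t),
      cross (R.α.derivative.eval ((par q.2.1 q.2.2.2 : ℝ) : ℂ))
        (R.α.derivative.eval (e.2 : ℂ)) ≠ 0 := by
    have c2 : Continuous fun q : ℝ × ℝ × ℝ × ℝ => par q.2.1 q.2.2.2 :=
      continuous_par.comp (f := fun q : ℝ × ℝ × ℝ × ℝ => (q.2.1, q.2.2.2)) (by fun_prop)
    have c3 : Continuous fun q : ℝ × ℝ × ℝ × ℝ =>
        cross (R.α.derivative.eval ((par q.2.1 q.2.2.2 : ℝ) : ℂ)) (R.α.derivative.eval (e.2 : ℂ)) :=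
      continuous_cross.comp (f := fun q : ℝ × ℝ × ℝ × ℝ =>
        (R.α.derivative.eval ((par q.2.1 q.2.2.2 : ℝ) : ℂ), R.α.derivative.eval (e.2 : ℂ)))
        (by fun_prop)
    refine c3.continuousAt.eventually_ne ?_
    simp only [R.par_strand he ht]
    exact R.arc.transverse e he
  filter_upwards [R.eventually_curve_eq_iff he ht n 0, ev1, ev2, ev3, ev4, ev5, ev6]
    with q h1 h2 h3 h4 h5 h6 h7 hε r hr hq hv
  obtain ⟨h8, h9⟩ := h1.1 hq
  have htip := R.tip_vel he h2.le (ε := q.1) h3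
  have hstr := R.strand_vel (ε := q.1) (s := q.2.1) h4
  rw [h8, ← h9] at htip
  set D := R.α.derivative.eval ((par q.2.1 q.2.2.2 : ℝ) : ℂ)
  have h10 : (1 - q.2.1) • R.family.vel q.1 q.2.1 q.2.2.2 =
      r • ((1 - q.2.1) • R.family.vel q.1 q.2.1 q.2.2.1) := by rw [hv, smul_comm]
  have h5' : 0 < 1 - q.2.1 := by linarith
  have hsin : Real.sin (2 * Real.pi * q.2.2.1) = 0 := by
    have h11 := congrArg (cross D) h10
    rw [htip, hstr, cross_smul_right, cross_smul_right, cross_smul_right, cross_add_right,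
      cross_smul_right, cross_smul_right, cross_self_eq_zero] at h11
    have h12 : r * ((1 - q.2.1) * (2 * Real.pi)) * cross D (R.α.derivative.eval (e.2 : ℂ)) *
        Real.sin (2 * Real.pi * q.2.2.1) = 0 := by linear_combination h11
    exact (mul_eq_zero.1 h12).resolve_left (mul_ne_zero (by positivity) h7)
  have hn : q.2.2.1 = n := by
    obtain ⟨m, hm⟩ := sin_two_pi_eq_zero_iff.1 hsin
    have h11 := abs_lt.1 h6
    have h12 : ((2 * n - 1 : ℤ) : ℝ) < m := by push_cast; linarith
    have h13 : (m : ℝ) < ((2 * n + 1 : ℤ) : ℝ) := by push_cast; linarith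
    have h14 : m = 2 * n := by
      have := Int.cast_lt.1 h12
      have := Int.cast_lt.1 h13
      omega
    rw [h14] at hm; push_cast at hm; linarith
  have hcos : Real.cos (2 * Real.pi * q.2.2.1) = 1 := by rw [hn]; exact cos_two_pi_int n
  have hs : q.2.1 = time e := by
    rw [par, hcos] at h8
    rw [time]; linarith
  have hpar : par q.2.1 q.2.2.2 = e.1 := by
    rw [h9, crossPar, hsin]; ring
  refine ⟨e, he, hs, ⟨n, hn⟩, ?_, ?_⟩
  · rw [← R.par_strand he ht, hs, par, par] at hpar
    have h15 : (1 - time e) ≠ 0 := by rw [← hs]; exact h5'.ne'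
    rw [← ht]
    exact add_left_cancel (mul_left_cancel₀ h15 (add_left_cancel hpar))
  · have hD : D ≠ 0 := R.arc.regular _ (by rw [hpar]; linarith) (by rw [hpar]; linarith)
    rw [htip, hstr, hsin, hcos, neg_zero, zero_mul, mul_zero, zero_smul, zero_add, smul_smul,
      smul_smul] at h10
    have h11 := smul_left_injective ℝ hD h10
    have h12 : (1 - q.2.1) * (2 * Real.pi) * (-Real.sin (2 * Real.pi * q.2.2.2) - r * R.κ e * q.1) = 0 := by
      linear_combination h11
    have h13 := (mul_eq_zero.1 h12).resolve_left (by positivity)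
    have h14 := R.κ_sq e
    have h15 : R.κ e * Real.sin (2 * Real.pi * q.2.2.2) = -(r * q.1) := by
      linear_combination (-R.κ e) * h13 - r * q.1 * h14
    rw [h15]
    have := mul_pos hr hε
    linarith

end Retraction

/-- The parameter in `(0, 1)` at which `cos 2πt = u` and `sin 2πt` has the sign of `-κ`. -/
def cosBranch (κ u : ℝ) : ℝ :=
  if κ = 1 then 1 - Real.arccos u / (2 * Real.pi) else Real.arccos u / (2 * Real.pi)

theorem continuous_cosBranch (κ : ℝ) : Continuous (cosBranch κ) := by
  unfold cosBranch
  split_ifs <;> fun_prop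

theorem cos_cosBranch (κ : ℝ) {u : ℝ} (h0 : -1 ≤ u) (h1 : u ≤ 1) :
    Real.cos (2 * Real.pi * cosBranch κ u) = u := by
  have hpi := Real.pi_pos
  unfold cosBranch
  split_ifs
  · rw [show 2 * Real.pi * (1 - Real.arccos u / (2 * Real.pi)) = 2 * Real.pi - Real.arccos u by
      field_simp, Real.cos_two_pi_sub, Real.cos_arccos h0 h1]
  · rw [mul_div_cancel₀ _ (by positivity), Real.cos_arccos h0 h1]

theorem cosBranch_mem {κ u : ℝ} (h1 : u < 1) : cosBranch κ u ∈ Ioo (0 : ℝ) 1 := by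
  have hpi := Real.pi_pos
  have h2 := Real.arccos_pos.2 h1
  have h3 : Real.arccos u ≤ Real.pi := Real.arccos_le_pi u
  have h4 : 0 < Real.arccos u / (2 * Real.pi) := by positivity
  have h5 : Real.arccos u / (2 * Real.pi) < 1 := by
    rw [div_lt_one (by positivity)]; linarith
  unfold cosBranch
  split_ifs
  · exact ⟨by linarith, by linarith⟩
  · exact ⟨h4, h5⟩

theorem sin_cosBranch {κ u : ℝ} (hκ : κ = 1 ∨ κ = -1) (h0 : -1 < u) (h1 : u < 1) :
    0 < -(κ * Real.sin (2 * Real.pi * cosBranch κ u)) ∧ κ = 1 ∨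
    0 < (Real.sin (2 * Real.pi * cosBranch κ u)) ∧ κ = -1 := by
  have hpi := Real.pi_pos
  have h2 : 0 < Real.sin (Real.arccos u) := by
    rw [Real.sin_arccos]
    exact Real.sqrt_pos.2 (by nlinarith)
  unfold cosBranch
  rcases hκ with h | h
  · left
    refine ⟨?_, h⟩
    rw [if_pos h, show 2 * Real.pi * (1 - Real.arccos u / (2 * Real.pi)) =
      2 * Real.pi - Real.arccos u by field_simp, Real.sin_two_pi_sub, h]
    linarith
  · right
    refine ⟨?_, h⟩
    rw [if_neg (by rw [h]; norm_num), mul_div_cancel₀ _ (by positivity)]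
    exact h2

theorem mul_sin_cosBranch {κ u : ℝ} (hκ : κ = 1 ∨ κ = -1) (h0 : -1 < u) (h1 : u < 1) :
    κ * Real.sin (2 * Real.pi * cosBranch κ u) < 0 := by
  rcases sin_cosBranch hκ h0 h1 with ⟨h, h'⟩ | ⟨h, h'⟩
  · linarith
  · rw [h'] at h ⊢; linarith

theorem eq_cosBranch {κ t : ℝ} (h0 : 0 < t) (h1 : t < 1) (hs : κ * Real.sin (2 * Real.pi * t) < 0)
    (hκ : κ = 1 ∨ κ = -1) : t = cosBranch κ (Real.cos (2 * Real.pi * t)) := by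
  have hpi := Real.pi_pos
  rcases hκ with h | h
  · have h2 : 1 / 2 < t := by
      by_contra hc
      have := Real.sin_nonneg_of_nonneg_of_le_pi (x := 2 * Real.pi * t) (by positivity)
        (by nlinarith [not_lt.1 hc])
      rw [h] at hs; linarith
    have h3 : Real.cos (2 * Real.pi * t) = Real.cos (2 * Real.pi - 2 * Real.pi * t) := by
      rw [Real.cos_two_pi_sub]
    rw [cosBranch, if_pos h, h3, Real.arccos_cos (by nlinarith) (by nlinarith)]
    field_simp
    ring
  · have h2 : t < 1 / 2 := by
      by_contra hc
      have := Real.sin_nonneg_of_nonneg_of_le_pi (x := 2 * Real.pi - 2 * Real.pi * t) (by nlinarith)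
        (by nlinarith [not_lt.1 hc])
      rw [Real.sin_two_pi_sub] at this
      rw [h] at hs; linarith
    rw [cosBranch, if_neg (by rw [h]; norm_num), Real.arccos_cos (by positivity) (by nlinarith)]
    field_simp

namespace Retraction

variable (R : Retraction)

theorem strandPos_mem {e : ℝ × ℝ} (he : e ∈ R.E) : -1 < strandPos e ∧ strandPos e < 1 := by
  have h := abs_lt.1 (R.abs_lt_c e he)
  have := R.c_lt
  exact ⟨by unfold strandPos; linarith, by unfold strandPos; linarith⟩

/-- The parameter of the crossed strand. -/
def strandTime (e : ℝ × ℝ) : ℝ := cosBranch (R.κ e) (strandPos e)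

/-- The turn meets the strand where `cos 2πt₀ = (1 + e.2)/(1 - s) - 1`. Before the time of `e` the
right-hand side is below `1` and there are two solutions near `0`; afterwards it exceeds `1` and
there is none. Of the two coinciding strands, `strandTime` picks the one that runs in the direction
of the tip. -/
theorem isNegativeCrossing {e : ℝ × ℝ} (he : e ∈ R.E) {ε : ℝ} (hε : 0 < ε) :
    IsNegativeCrossing (R.family.curve ε) (time e) 0 (R.strandTime e) := by
  have hpi := Real.pi_pos
  have hb := R.arc.bounds e he
  obtain ⟨hu0, hu1⟩ := R.strandPos_mem he
  have hκ := R.κ_eq e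
  have hcosT : Real.cos (2 * Real.pi * R.strandTime e) = strandPos e :=
    cos_cosBranch _ hu0.le hu1.le
  have hsinT := mul_sin_cosBranch hκ hu0 hu1
  have hT := cosBranch_mem (κ := R.κ e) hu1
  change R.κ e * Real.sin (2 * Real.pi * R.strandTime e) < 0 at hsinT
  change R.strandTime e ∈ _ at hT
  set T := R.strandTime e
  have hs1 : 0 < 1 - time e := by unfold time; linarith
  have ev := R.eventually_curve_eq_iff he hcosT 0 ε
  rw [Int.cast_zero] at ev
  refine ⟨⟨?_, ?_⟩, ?_⟩
  · refine (ev.self_of_nhds.2 ⟨?_, ?_⟩)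
    · simpa using par_tip e 0
    · simp only [R.par_strand he hcosT, crossPar]; simp
  · simp only [(R.family.hasDerivAt_curve ε (time e) _).deriv]
    have h1 := R.tip_vel he (ε := ε) (s := time e) (t := 0) (by simpa using R.ρ_pos.le)
      (by simp; linarith [R.c_lt])
    have h2 := R.strand_vel (ε := ε) (s := time e) (t := T) (by
      rw [hcosT]; exact R.abs_lt_c e he)
    have h3 : R.crossPar e ε (time e) 0 = e.1 := by simp [crossPar]
    rw [h3] at h1
    rw [R.par_strand he hcosT] at h2
    have h1' : R.family.vel ε (time e) 0 = (R.κ e * (ε * (2 * Real.pi))) •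
        R.α.derivative.eval (e.1 : ℂ) := by
      refine smul_right_injective ℂ hs1.ne' ?_
      simp only [h1, mul_zero, Real.sin_zero, Real.cos_zero, neg_zero, zero_mul, zero_smul, zero_add,
        one_mul, smul_smul]
      congr 1
      ring
    -- The velocities are `2πεκ α'(e.1)` at the tip and `-2π sin(2πT) α'(e.1)` on the strand; the
    -- ratio is positive by the choice of the branch `T`.
    refine ⟨-(R.κ e * Real.sin (2 * Real.pi * T)) / ε, div_pos (by linarith) hε, ?_⟩
    rw [h1', h2, smul_smul]
    congr 1
    have := R.κ_sq e
    field_simp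
    linear_combination (Real.sin (2 * Real.pi * T)) * this
  · have ev' : ∀ᶠ q in 𝓝 (ε, time e, (0 : ℝ), T), q.2.2.2 ∈ Ioo (0 : ℝ) 1 ∧
        R.κ e * Real.sin (2 * Real.pi * q.2.2.2) < 0 := by
      have c1 : Continuous fun q : ℝ × ℝ × ℝ × ℝ => q.2.2.2 := by fun_prop
      have c2 : Continuous fun q : ℝ × ℝ × ℝ × ℝ => R.κ e * Real.sin (2 * Real.pi * q.2.2.2) := by
        fun_prop
      exact (c1.continuousAt.eventually (isOpen_Ioo.mem_nhds hT)).and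
        (c2.continuousAt.eventually_lt continuousAt_const hsinT)
    obtain ⟨η, hη, hη'⟩ := Metric.eventually_nhds_iff.1 (ev.and ev')
    have hη2 : ∀ s p₀ p₁ : ℝ, |s - time e| < η → |p₀ - 0| < η → |p₁ - T| < η →
        (R.family.curve ε s p₀ = R.family.curve ε s p₁ ↔
          par s p₀ = e.2 ∧ par s p₁ = R.crossPar e ε s p₀) ∧
        p₁ ∈ Ioo (0 : ℝ) 1 ∧ R.κ e * Real.sin (2 * Real.pi * p₁) < 0 := by
      intro s p₀ p₁ h1 h2 h3
      refine hη' (y := (ε, s, p₀, p₁)) ?_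
      simp only [Prod.dist_eq, Real.dist_eq, sub_self, abs_zero]
      exact max_lt hη (max_lt h1 (max_lt h2 h3))
    have evs : ∀ᶠ s in 𝓝 (time e), |s - time e| < η ∧ s < 1 := by
      have c1 : Continuous fun s : ℝ => |s - time e| := by fun_prop
      exact (c1.continuousAt.eventually_lt continuousAt_const (by simpa using hη)).and
        (eventually_lt_nhds (by linarith))
    refine ⟨min η (1 / 2), lt_min hη (by norm_num), fun δ hδ hδ' => ⟨?_, ?_⟩⟩
    · -- two intersections before
      have hδη := hδ'.trans_le (min_le_left _ _)
      have hδh := hδ'.trans_le (min_le_right _ _)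
      -- `C s` is the value of `cos 2πt₀` at an intersection, `±τ s` are the two parameters of the
      -- turn with this value, and `V` is the resulting cosine on the crossed strand.
      let C : ℝ → ℝ := fun s => (1 + e.2) / (1 - s) - 1
      let τ : ℝ → ℝ := fun s => Real.arccos (C s) / (2 * Real.pi)
      let V : ℝ → ℝ → ℝ := fun s p => (1 + R.crossPar e ε s p) / (1 - s) - 1
      have hC : ContinuousAt C (time e) := by
        refine ContinuousAt.sub (ContinuousAt.div continuousAt_const ?_ hs1.ne') continuousAt_const
        fun_prop
      have hC1 : C (time e) = 1 := by
        simp only [C, time]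
        have : 1 + e.2 ≠ 0 := by linarith
        rw [show 1 - (1 - (1 + e.2) / 2) = (1 + e.2) / 2 by ring, div_div_cancel₀ this]
        norm_num
      have hτ : ContinuousAt τ (time e) :=
        (Real.continuous_arccos.continuousAt.comp hC).div_const _
      have hτ0 : τ (time e) = 0 := by simp [τ, hC1]
      have hV : ∀ f : ℝ → ℝ, ContinuousAt f (time e) → f (time e) = 0 →
          Tendsto (fun s => cosBranch (R.κ e) (V s (f s))) (𝓝 (time e)) (𝓝 T) ∧
          ∀ᶠ s in 𝓝 (time e), -1 ≤ V s (f s) ∧ V s (f s) ≤ 1 := by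
        intro f hf hf0
        have h1 : ContinuousAt (fun s => V s (f s)) (time e) := by
          refine ContinuousAt.sub (ContinuousAt.div (continuousAt_const.add ?_)
            (by fun_prop) hs1.ne') continuousAt_const
          exact (R.continuous_crossPar e).continuousAt.comp (f := fun s => (ε, s, f s))
            (continuousAt_const.prodMk (continuousAt_id.prodMk hf))
        have h2 : V (time e) (f (time e)) = strandPos e := by
          simp only [V, hf0, crossPar, mul_zero, Real.sin_zero, add_zero]
          simp only [time, strandPos]
          have : 1 + e.2 ≠ 0 := by linarith
          rw [show 1 - (1 - (1 + e.2) / 2) = (1 + e.2) / 2 by ring]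
          field_simp
        have h3 : Tendsto (fun s => V s (f s)) (𝓝 (time e)) (𝓝 (strandPos e)) := h2 ▸ h1
        refine ⟨((continuous_cosBranch (R.κ e)).tendsto _).comp h3, ?_⟩
        filter_upwards [h3.eventually (lt_mem_nhds hu0), h3.eventually (gt_mem_nhds hu1)] with s a b
        exact ⟨a.le, b.le⟩
      obtain ⟨hp1, hp2⟩ := hV τ hτ hτ0
      obtain ⟨hm1, hm2⟩ := hV (fun s => -τ s) hτ.neg (by simp [hτ0])
      have habs : Continuous fun x : ℝ => |x - T| := by fun_prop
      have hlim : ∀ {f : ℝ → ℝ}, Tendsto f (𝓝 (time e)) (𝓝 T) →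
          ∀ᶠ s in 𝓝 (time e), |f s - T| < δ := fun hf =>
        (habs.tendsto T).comp hf |>.eventually (gt_mem_nhds (by simpa using hδ))
      have evτ : ∀ᶠ s in 𝓝 (time e), τ s < δ := by
        have : Tendsto τ (𝓝 (time e)) (𝓝 0) := hτ0 ▸ hτ
        exact this.eventually (gt_mem_nhds hδ)
      have evC : ∀ᶠ s in 𝓝 (time e), -1 < C s := by
        have : Tendsto C (𝓝 (time e)) (𝓝 1) := hC1 ▸ hC
        exact this.eventually (lt_mem_nhds (by norm_num))
      filter_upwards [evs.filter_mono nhdsWithin_le_nhds, evτ.filter_mono nhdsWithin_le_nhds,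
        evC.filter_mono nhdsWithin_le_nhds, hp2.filter_mono nhdsWithin_le_nhds,
        hm2.filter_mono nhdsWithin_le_nhds, (hlim hp1).filter_mono nhdsWithin_le_nhds,
        (hlim hm1).filter_mono nhdsWithin_le_nhds, self_mem_nhdsWithin]
        with s ⟨hs2, hs3⟩ h4 h5 h6 h7 h8 h9 hlt
      have hlt : s < time e := hlt
      have h1s : 0 < 1 - s := by linarith
      have hC2 : C s < 1 := by
        simp only [C]
        rw [sub_lt_iff_lt_add, div_lt_iff₀ h1s]
        unfold time at hlt
        linarith
      have hτpos : 0 < τ s := div_pos (Real.arccos_pos.2 hC2) (by positivity)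
      have hcosτ : Real.cos (2 * Real.pi * τ s) = C s := by
        simp only [τ]
        rw [mul_div_cancel₀ _ (by positivity), Real.cos_arccos h5.le hC2.le]
      have hpar : ∀ p a, par s p = a ↔ Real.cos (2 * Real.pi * p) = (1 + a) / (1 - s) - 1 := by
        intro p a
        rw [par, eq_sub_iff_add_eq, eq_div_iff h1s.ne']
        constructor <;> intro h <;> linarith
      have hset : localIntersections (R.family.curve ε) s 0 T δ =
          {(τ s, cosBranch (R.κ e) (V s (τ s))), (-τ s, cosBranch (R.κ e) (V s (-τ s)))} := by
        ext ⟨p₀, p₁⟩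
        simp only [localIntersections, mem_ofPred_eq, mem_insert_iff, mem_singleton_iff, Prod.mk.injEq]
        constructor
        · rintro ⟨h10, h11, h12⟩
          obtain ⟨hiff, h13, h14⟩ := hη2 s p₀ p₁ hs2 (h10.trans hδη) (h11.trans hδη)
          obtain ⟨h15, h16⟩ := hiff.1 h12
          rw [hpar] at h15 h16
          have h17 : p₁ = cosBranch (R.κ e) (V s p₀) := by
            have h := eq_cosBranch h13.1 h13.2 h14 hκ
            rwa [h16] at h
          have h18 : p₀ = τ s ∨ p₀ = -τ s := by
            have h19 : Real.cos (2 * Real.pi * p₀) = Real.cos (2 * Real.pi * τ s) := by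
              rw [h15, hcosτ]
            rw [sub_zero, abs_lt] at h10
            rcases cos_two_pi_eq_iff.1 h19 with ⟨n, hn⟩ | ⟨n, hn⟩
            · have a1 : (n : ℝ) < 1 := by linarith
              have a2 : (-1 : ℝ) < n := by linarith
              have a3 : n = 0 := by
                have : n < 1 := by exact_mod_cast a1
                have : -1 < n := by exact_mod_cast a2
                omega
              rw [a3] at hn; left; push_cast at hn; linarith
            · have a1 : (n : ℝ) < 1 := by linarith
              have a2 : (-1 : ℝ) < n := by linarith
              have a3 : n = 0 := by
                have : n < 1 := by exact_mod_cast a1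
                have : -1 < n := by exact_mod_cast a2
                omega
              rw [a3] at hn; right; push_cast at hn; linarith
          rcases h18 with h | h
          · exact Or.inl ⟨h, by rw [h17, h]⟩
          · exact Or.inr ⟨h, by rw [h17, h]⟩
        · rintro (⟨rfl, rfl⟩ | ⟨rfl, rfl⟩)
          · refine ⟨by rw [sub_zero, abs_of_pos hτpos]; exact h4, h8, ?_⟩
            refine (hη2 s _ _ hs2 (by rw [sub_zero, abs_of_pos hτpos]; linarith)
              (h8.trans hδη)).1.2 ⟨(hpar _ _).2 hcosτ, (hpar _ _).2 ?_⟩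
            exact cos_cosBranch _ h6.1 h6.2
          · refine ⟨by rw [sub_zero, abs_neg, abs_of_pos hτpos]; exact h4, h9, ?_⟩
            refine (hη2 s _ _ hs2 (by rw [sub_zero, abs_neg, abs_of_pos hτpos]; linarith)
              (h9.trans hδη)).1.2 ⟨(hpar _ _).2 ?_, (hpar _ _).2 ?_⟩
            · rw [mul_neg, Real.cos_neg]; exact hcosτ
            · exact cos_cosBranch _ h7.1 h7.2
      rw [hset]
      refine encard_pair fun h => ?_
      have := congrArg Prod.fst h
      simp only at this
      linarith
    · have hδη := hδ'.trans_le (min_le_left _ _)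
      filter_upwards [evs.filter_mono nhdsWithin_le_nhds, self_mem_nhdsWithin] with s ⟨hs2, hs3⟩ hgt
      have hgt : time e < s := hgt
      rw [encard_eq_zero, eq_empty_iff_forall_notMem]
      rintro ⟨p₀, p₁⟩ ⟨h1, h2, h3⟩
      obtain ⟨h4, _⟩ := (hη2 s p₀ p₁ hs2 (h1.trans hδη) (h2.trans hδη)).1.1 h3
      rw [par] at h4
      have h5 := Real.cos_le_one (2 * Real.pi * p₀)
      unfold time at hgt
      nlinarith

end Retraction

namespace Retraction

variable (R : Retraction)

/-- Double points of the retracting arc. -/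
theorem arcAt_eq {s : ℝ} (hs : s ∈ Icc (0 : ℝ) 1) {u v : ℝ} (hu : -1 ≤ u) (huv : u < v) (hv : v ≤ 1)
    (h : R.arcAt (s, u) = R.arcAt (s, v)) :
    s < 1 ∧ (-1 + (1 - s) * (1 + u), -1 + (1 - s) * (1 + v)) ∈ R.E := by
  obtain ⟨h0, h1⟩ := hs
  have hs1 : s < 1 := by
    -- At `s = 1` the arc is a segment and has no double points.
    refine lt_of_le_of_ne h1 ?_
    rintro rfl
    simp only [arcAt, sub_self, zero_mul, Complex.ofReal_zero, secant_zero] at h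
    have := smul_left_injective ℝ (R.arc.regular (-1) le_rfl (by norm_num)) (by simpa using h)
    linarith
  refine ⟨hs1, R.arc.mem _ _ ?_ ?_ ?_ ?_⟩
  · nlinarith
  · nlinarith
  · nlinarith
  · have h2 := R.arcAt_spec s u
    have h3 := R.arcAt_spec s v
    rw [h, h3] at h2
    linear_combination -h2

/-- Two arc parameters with the same image form a double point of `α`. If the upper one is not the
moving end, the branches cross transversally and no tangency is near; if it is, `eventually_event`
applies. -/
theorem eventually_tangency_of_lt {s t₀ t₁ : ℝ} (hs : s ∈ Icc (0 : ℝ) 1)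
    (hlt : Real.cos (2 * Real.pi * t₁) < Real.cos (2 * Real.pi * t₀))
    (hA : R.arcAt (s, Real.cos (2 * Real.pi * t₁)) = R.arcAt (s, Real.cos (2 * Real.pi * t₀))) :
    ∀ᶠ q in 𝓝 ((0 : ℝ), s, t₀, t₁), 0 < q.1 → ∀ r : ℝ, 0 < r →
      R.family.curve q.1 q.2.1 q.2.2.1 = R.family.curve q.1 q.2.1 q.2.2.2 →
      R.family.vel q.1 q.2.1 q.2.2.2 = r • R.family.vel q.1 q.2.1 q.2.2.1 →
      (∃ n : ℤ, q.2.2.2 - q.2.2.1 = (n : ℝ)) ∨ R.Event q.2.1 q.2.2.1 q.2.2.2 := by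
  obtain ⟨hs1, hE⟩ := R.arcAt_eq hs (Real.neg_one_le_cos _) hlt (Real.cos_le_one _) hA
  have hb := R.arc.bounds _ hE
  have hc1 := Real.cos_le_one (2 * Real.pi * t₁)
  have hc0 := Real.cos_le_one (2 * Real.pi * t₀)
  have hs1' : 0 < 1 - s := by linarith
  simp only at hb
  have hm1 : -1 < Real.cos (2 * Real.pi * t₁) := by
    by_contra h
    have : 1 + Real.cos (2 * Real.pi * t₁) = 0 := by
      linarith [not_lt.1 h, Real.neg_one_le_cos (2 * Real.pi * t₁)]
    rw [this] at hb; linarith [hb.1]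
  have hsin : ∀ t, -1 < Real.cos (2 * Real.pi * t) → Real.cos (2 * Real.pi * t) < 1 →
      Real.sin (2 * Real.pi * t) ≠ 0 := by
    intro t h1 h2 h3
    have := Real.sin_sq_add_cos_sq (2 * Real.pi * t)
    rw [h3] at this
    nlinarith
  rcases hc0.lt_or_eq with h | h
  · have hcr := R.arc.transverse _ hE
    have := R.family.eventually_noTangency_of_cross (s := s) (hsin t₀ (hm1.trans hlt) h)
      (hsin t₁ hm1 (hlt.trans h)) (by
        rw [family_A', family_A', cross_comm]
        exact neg_ne_zero.2 hcr)
    filter_upwards [this] with q hq hε r hr he hv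
    exact Or.inl (hq hε r hr he hv)
  · obtain ⟨n, hn⟩ : ∃ n : ℤ, t₀ = n := by
      rcases cos_two_pi_eq_iff (t₀ := t₀) (t₁ := 0) |>.1 (by simpa using h) with ⟨n, hn⟩ | ⟨n, hn⟩
      · exact ⟨-n, by push_cast; linarith⟩
      · exact ⟨n, by linarith⟩
    set e : ℝ × ℝ := (-1 + (1 - s) * (1 + Real.cos (2 * Real.pi * t₁)),
      -1 + (1 - s) * (1 + Real.cos (2 * Real.pi * t₀))) with he
    have hst : s = time e := by simp only [time, he, h]; ring
    have ht : Real.cos (2 * Real.pi * t₁) = strandPos e := by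
      simp only [strandPos, he, h]
      field_simp
      ring
    have := R.eventually_event hE ht n
    rw [← hst, ← hn] at this
    filter_upwards [this] with q hq hε r hr he hv
    exact Or.inr (hq hε r hr he hv)

/-- The limit parameters lie over distinct points of the arc, over one parameter of the arc, or over
a double point. Only the last case allows direct tangencies, and compactness makes the bound on `ε`
uniform. -/
theorem eventually_tangency : ∀ᶠ ε in 𝓝[>] (0 : ℝ), ∀ s ∈ Icc (0 : ℝ) 1,
    ∀ t₀ ∈ Icc (0 : ℝ) 1, ∀ t₁ ∈ Icc (0 : ℝ) 1, ∀ r : ℝ, 0 < r →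
      R.family.curve ε s t₀ = R.family.curve ε s t₁ →
      R.family.vel ε s t₁ = r • R.family.vel ε s t₀ →
      (∃ n : ℤ, t₁ - t₀ = (n : ℝ)) ∨ R.Event s t₀ t₁ ∨ R.Event s t₁ t₀ := by
  have key := ThinFamily.eventually_forall_of_forall (P := fun ε s t₀ t₁ => 0 < ε →
    ∀ r : ℝ, 0 < r → R.family.curve ε s t₀ = R.family.curve ε s t₁ →
      R.family.vel ε s t₁ = r • R.family.vel ε s t₀ →
      (∃ n : ℤ, t₁ - t₀ = (n : ℝ)) ∨ R.Event s t₀ t₁ ∨ R.Event s t₁ t₀) (by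
    intro s hs t₀ _ t₁ _
    have hreg := R.family_regularAt hs
    by_cases hA : R.arcAt (s, Real.cos (2 * Real.pi * t₁)) = R.arcAt (s, Real.cos (2 * Real.pi * t₀))
    swap
    · filter_upwards [R.family.eventually_noTangency_of_ne (s := s) (t₀ := t₀) (t₁ := t₁)
        (fun h => hA h.symm)] with q hq hε r hr he hv
      exact Or.inl (hq hε r hr he hv)
    rcases lt_trichotomy (Real.cos (2 * Real.pi * t₁)) (Real.cos (2 * Real.pi * t₀)) with hc | hc | hc
    · filter_upwards [R.eventually_tangency_of_lt hs hc hA] with q hq hε r hr he hv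
      rcases hq hε r hr he hv with h | h
      · exact Or.inl h
      · exact Or.inr (Or.inl h)
    · filter_upwards [R.family.eventually_noTangency_of_cos_eq hreg hc.symm] with q hq hε r hr he hv
      exact Or.inl (hq hε r hr he hv)
    · have hsw : Tendsto (fun q : ℝ × ℝ × ℝ × ℝ => (q.1, q.2.1, q.2.2.2, q.2.2.1))
          (𝓝 ((0 : ℝ), s, t₀, t₁)) (𝓝 ((0 : ℝ), s, t₁, t₀)) :=
        Continuous.tendsto' (by fun_prop) _ _ rfl
      filter_upwards [hsw.eventually (R.eventually_tangency_of_lt hs hc hA.symm)]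
        with q hq hε r hr he hv
      rcases hq hε r⁻¹ (inv_pos.2 hr) he.symm
        (by simp only [hv, smul_smul, inv_mul_cancel₀ hr.ne', one_smul]) with ⟨n, h⟩ | h
      · exact Or.inl ⟨-n, by push_cast; linarith⟩
      · exact Or.inr (Or.inr h))
  filter_upwards [key.filter_mono nhdsWithin_le_nhds, self_mem_nhdsWithin] with ε h hε
    s hs t₀ h0 t₁ h1
  exact h s hs t₀ h0 t₁ h1 hε

theorem eventually_jPlusPath : ∀ᶠ ε in 𝓝[>] (0 : ℝ),
    JPlusPath (R.family.curve ε 0) (R.family.curve ε 1) R.E.card := by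
  filter_upwards [R.eventually_tangency,
    R.family.eventually_forall_vel_ne_zero fun s hs => R.family_regularAt hs,
    self_mem_nhdsWithin] with ε h1 h2 hε
  have hder : ∀ s, deriv (R.family.curve ε s) = R.family.vel ε s := fun s =>
    funext fun t => (R.family.hasDerivAt_curve ε s t).deriv
  have hT := fun e (he : e ∈ R.E) => cosBranch_mem (κ := R.κ e) (R.strandPos_mem he).2
  let f : ℝ × ℝ → ℝ × ℝ × ℝ := fun e => (time e, 0, R.strandTime e)
  refine ⟨R.family.curve ε, R.E.image f, ⟨?_, ?_, fun s hs => ⟨R.family.contDiff_curve ε s,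
    R.family.periodic_curve ε s, ?_⟩⟩, ⟨?_, by simp, ?_, ?_⟩, rfl, rfl, ?_⟩
  · exact (R.family.continuous_curve.comp (f := fun p : ℝ × ℝ => (ε, p)) (by fun_prop)).continuousOn
  · simp only [hder]
    exact (R.family.continuous_vel.comp (f := fun p : ℝ × ℝ => (ε, p)) (by fun_prop)).continuousOn
  · rw [hder]; exact h2 s hs
  · simp only [Finset.empty_union, Finset.mem_image, forall_exists_index, and_imp]
    rintro _ e he rfl
    have hb := R.arc.bounds e he
    refine ⟨⟨?_, ?_⟩, le_rfl, (hT e he).1, (hT e he).2⟩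
    · simp only [f, time]; linarith
    · simp only [f, time]; linarith
  · simp only [Finset.mem_image, forall_exists_index, and_imp]
    rintro _ e he rfl
    exact R.isNegativeCrossing he hε
  · rintro s hs t₀ t₁ h0 h01 h11 ⟨he, r, hr, hv⟩
    rw [hder] at hv
    simp only [Finset.empty_union, Finset.mem_image]
    rcases h1 s hs t₀ ⟨h0, by linarith⟩ t₁ ⟨by linarith, h11.le⟩ r hr he hv with
      ⟨n, hn⟩ | ⟨e, heE, hse, ⟨n, hn⟩, hcos, hsin⟩ | ⟨e, heE, hse, ⟨n, hn⟩, hcos, hsin⟩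
    · have h4 : 0 < n := by exact_mod_cast (show (0 : ℝ) < n by linarith)
      have h5 : n < 1 := by exact_mod_cast (show (n : ℝ) < 1 by linarith)
      omega
    · have h4 : -1 < n := by exact_mod_cast (show (-1 : ℝ) < n by linarith)
      have h5 : n < 1 := by exact_mod_cast (show (n : ℝ) < 1 by linarith)
      have h6 : n = 0 := by omega
      refine ⟨e, heE, ?_⟩
      simp only [f, Prod.mk.injEq]
      refine ⟨hse.symm, by rw [hn, h6, Int.cast_zero], ?_⟩
      rw [strandTime, ← hcos]
      exact (eq_cosBranch (by linarith) h11 hsin (R.κ_eq e)).symm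
    · have h4 : 0 < n := by exact_mod_cast (show (0 : ℝ) < n by linarith)
      have h5 : n < 1 := by exact_mod_cast (show (n : ℝ) < 1 by linarith)
      omega
  -- The crossing time determines `e.2`, and double points with the same upper parameter are equal.
  · refine Finset.card_image_of_injOn fun e he e' he' hee => R.arc.inj e he e' he' ?_
    have := congrArg Prod.fst hee
    simp only [f, time] at this
    linarith

theorem hτ_smul_cross : cross (R.α.derivative.eval ((-1 : ℝ) : ℂ)) R.wEnd =
    R.τ * Complex.normSq (R.α.derivative.eval ((-1 : ℝ) : ℂ)) := by
  rw [wEnd, cross_smul_right, cross_I_mul]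

/-- The end of the retraction is a thin curve along a segment. -/
theorem curve_one_reduces {ε : ℝ} (hε : 0 < ε) :
    ReducesToStandard (R.family.curve ε 1) 0 := by
  have hpi := Real.pi_pos
  set a := R.α.derivative.eval ((-1 : ℝ) : ℂ) with ha
  have ha0 : a ≠ 0 := R.arc.regular (-1) le_rfl (by norm_num)
  let y : ℝ → ℝ := fun t => ε * (Real.sin (2 * Real.pi * t) *
    (R.σ * cutoff R.c (Real.cos (2 * Real.pi * t)) + R.τ * cutoff R.c (-Real.cos (2 * Real.pi * t))))
  have hcurve : R.family.curve ε 1 = segmentCurve a a y := by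
    funext t
    have hw : R.w 0 (ε * (Real.sin (2 * Real.pi * t) * cutoff R.c (Real.cos (2 * Real.pi * t)))) =
        R.σ • (Complex.I * a) := by
      rw [R.w_of_forall_zero fun e he => bump_eq_zero R.ρ_pos ?_]
      · simp [ha]
      · have h := (R.ρ_lt e he).1
        rw [zero_sub, abs_neg]
        exact h.le.trans (le_abs_self _)
    rw [ThinFamily.curve, family_A, family_B, disp, arcAt, wEnd, ← ha]
    simp only [sub_self, hw, zero_mul, Complex.ofReal_zero, secant_zero, segmentCurve, y,
      Complex.real_smul]
    rw [show ((-1 : ℂ)) = ((-1 : ℝ) : ℂ) by push_cast; rfl, ← ha]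
    push_cast
    ring
  have hc1 : ContDiff ℝ ∞ fun t : ℝ => cutoff R.c (Real.cos (2 * Real.pi * t)) :=
    (contDiff_cutoff R.c).comp (by fun_prop)
  have hc2 : ContDiff ℝ ∞ fun t : ℝ => cutoff R.c (-Real.cos (2 * Real.pi * t)) :=
    (contDiff_cutoff R.c).comp (by fun_prop)
  have hy : ContDiff ℝ ∞ y := by
    have h3 : ContDiff ℝ ∞ fun t : ℝ => Real.sin (2 * Real.pi * t) := by fun_prop
    exact contDiff_const.mul (h3.mul ((contDiff_const.mul hc1).add (contDiff_const.mul hc2)))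
  have hder : ∀ t, Real.sin (2 * Real.pi * t) = 0 → deriv y t =
      ε * (Real.cos (2 * Real.pi * t) * (2 * Real.pi) *
      (R.σ * cutoff R.c (Real.cos (2 * Real.pi * t)) +
        R.τ * cutoff R.c (-Real.cos (2 * Real.pi * t)))) := by
    intro t ht
    have h3 := ((contDiff_const.mul hc1).add (contDiff_const.mul hc2) :
      ContDiff ℝ ∞ fun t : ℝ => R.σ * cutoff R.c (Real.cos (2 * Real.pi * t)) +
        R.τ * cutoff R.c (-Real.cos (2 * Real.pi * t))).differentiable (by simp) t
    have h4 := (((hasDerivAt_sin_two_pi t).mul h3.hasDerivAt).const_mul ε).deriv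
    rw [ht, zero_mul, add_zero] at h4
    exact h4
  have := R.c_pos
  have := R.c_lt
  have hσ : R.σ ≠ 0 := by rcases R.hσ with h | h <;> rw [h] <;> norm_num
  rw [hcurve]
  refine segmentCurve_reduces ha0 hy ?_ ?_ ?_
  · intro t
    simp only [y, mul_add, mul_one, Real.sin_add_two_pi, Real.cos_add_two_pi]
  · rw [hder 0 (by simp)]
    simp only [mul_zero, Real.cos_zero]
    rw [cutoff_eq_one (u := 1) R.c_lt (by linarith), cutoff_eq_zero (u := -1) R.c_lt (by linarith)]
    simp [hσ, hpi.ne', hε.ne']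
  · have h2 : 2 * Real.pi * (1 / 2) = Real.pi := by ring
    rw [hder (1 / 2) (by rw [h2, Real.sin_pi]), h2, Real.cos_pi, neg_neg,
      cutoff_eq_one (u := 1) R.c_lt (by linarith), cutoff_eq_zero (u := -1) R.c_lt (by linarith)]
    simp [R.hτ, hpi.ne', hε.ne']

theorem eventually_reduces : ∀ᶠ ε in 𝓝[>] (0 : ℝ),
    ReducesToStandard (R.family.curve ε 0) R.E.card := by
  filter_upwards [R.eventually_jPlusPath, self_mem_nhdsWithin] with ε h hε
  exact h.reducesToStandard (R.curve_one_reduces hε)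

end Retraction

theorem exists_sign_mul_pos {x : ℝ} (h : x ≠ 0) : ∃ σ : ℝ, (σ = 1 ∨ σ = -1) ∧ 0 < σ * x := by
  rcases h.lt_or_gt with h | h
  · exact ⟨-1, Or.inr rfl, by linarith⟩
  · exact ⟨1, Or.inl rfl, by linarith⟩

namespace IsArc

variable {α : Polynomial ℂ} {E : Finset (ℝ × ℝ)}

/-- There are finitely many double points, so the conditions on `c` hold close to `1` and those on
`ρ` close to `0`. -/
theorem exists_retraction (h : IsArc α E) {σ τ : ℝ} (hσ : σ = 1 ∨ σ = -1) (hτ : τ ≠ 0) :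
    ∃ R : Retraction, R.α = α ∧ R.E = E ∧ R.σ = σ ∧ R.τ = τ := by
  have hpos : ∀ e ∈ E, |2 * (1 + e.1) / (1 + e.2) - 1| < 1 := by
    intro e he
    have hb := h.bounds e he
    have h1 : 0 < 1 + e.2 := by linarith
    rw [abs_lt]
    constructor
    · have : 0 < 2 * (1 + e.1) / (1 + e.2) := div_pos (by linarith) h1
      linarith
    · rw [sub_lt_iff_lt_add, div_lt_iff₀ h1]; linarith
  obtain ⟨c, hc, hc0, hc1⟩ : ∃ c : ℝ, (∀ e ∈ E, |2 * (1 + e.1) / (1 + e.2) - 1| < c) ∧ 0 < c ∧ c < 1 := by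
    have h1 : ∀ᶠ c in 𝓝[<] (1 : ℝ), ∀ e ∈ E, |2 * (1 + e.1) / (1 + e.2) - 1| < c :=
      (Finset.eventually_all E).2 fun e he =>
        nhdsWithin_le_nhds (lt_mem_nhds (hpos e he))
    have h2 : ∀ᶠ c in 𝓝[<] (1 : ℝ), 0 < c := nhdsWithin_le_nhds (lt_mem_nhds one_pos)
    exact (h1.and (h2.and self_mem_nhdsWithin)).exists
  have hσ0 : 0 < σ * σ := by rcases hσ with h | h <;> rw [h] <;> norm_num
  have hcross : ∀ e ∈ E, ∃ δ > 0, ∀ r : ℝ, |r - (1 + e.2) / 2| < δ →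
      0 < (σ * cross (α.derivative.eval ((2 * r - 1 : ℝ) : ℂ)) (α.derivative.eval (e.1 : ℂ))) *
      (σ * cross (α.derivative.eval (e.2 : ℂ)) (α.derivative.eval (e.1 : ℂ))) := by
    intro e he
    have c1 : Continuous fun r : ℝ => (σ * cross (α.derivative.eval ((2 * r - 1 : ℝ) : ℂ))
        (α.derivative.eval (e.1 : ℂ))) *
        (σ * cross (α.derivative.eval (e.2 : ℂ)) (α.derivative.eval (e.1 : ℂ))) := by
      have : Continuous fun r : ℝ => cross (α.derivative.eval ((2 * r - 1 : ℝ) : ℂ))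
          (α.derivative.eval (e.1 : ℂ)) :=
        continuous_cross.comp (f := fun r : ℝ => (α.derivative.eval ((2 * r - 1 : ℝ) : ℂ),
          α.derivative.eval (e.1 : ℂ))) (by fun_prop)
      fun_prop
    have ht := h.transverse e he
    rw [cross_comm] at ht
    have ht2 : 0 < cross (α.derivative.eval (e.2 : ℂ)) (α.derivative.eval (e.1 : ℂ)) *
        cross (α.derivative.eval (e.2 : ℂ)) (α.derivative.eval (e.1 : ℂ)) :=
      mul_self_pos.2 (neg_ne_zero.1 ht)
    have h2 := continuousAt_const.eventually_lt (x₀ := (1 + e.2) / 2) (f := fun _ => (0 : ℝ))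
      c1.continuousAt (by
        rw [show 2 * ((1 + e.2) / 2) - 1 = e.2 by ring]
        have := mul_pos hσ0 ht2
        linarith)
    obtain ⟨δ, hδ, hδ'⟩ := Metric.eventually_nhds_iff.1 h2
    exact ⟨δ, hδ, fun r hr => hδ' (by rwa [Real.dist_eq])⟩
  have hlin : ∀ a b : ℝ, 0 < b → ∀ᶠ ρ in 𝓝[>] (0 : ℝ), a * ρ < b := by
    intro a b hb
    have : Continuous fun ρ : ℝ => a * ρ := by fun_prop
    exact nhdsWithin_le_nhds (this.continuousAt.eventually_lt continuousAt_const (by simpa using hb))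
  have h1 : ∀ᶠ ρ in 𝓝[>] (0 : ℝ), ∀ e ∈ E, ∀ e' ∈ E, e ≠ e' →
      4 * ρ < |(1 + e.2) / 2 - (1 + e'.2) / 2| := by
    refine (Finset.eventually_all E).2 fun e he => (Finset.eventually_all E).2 fun e' he' => ?_
    by_cases hne : e = e'
    · exact Eventually.of_forall fun ρ h => absurd hne h
    · refine (hlin 4 _ (abs_pos.2 fun h0 => hne (h.inj e he e' he' (by linarith)))).mono
        fun ρ hρ _ => hρ
  have h2 : ∀ᶠ ρ in 𝓝[>] (0 : ℝ), ∀ e ∈ E, 2 * ρ < (1 + e.2) / 2 ∧ 2 * ρ < 1 - (1 + e.2) / 2 := by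
    refine (Finset.eventually_all E).2 fun e he => ?_
    have hb := h.bounds e he
    exact (hlin 2 _ (by linarith)).and (hlin 2 _ (by linarith))
  have h3 : ∀ᶠ ρ in 𝓝[>] (0 : ℝ), ∀ e ∈ E, ∀ r : ℝ, |r - (1 + e.2) / 2| ≤ 2 * ρ →
      0 < (σ * cross (α.derivative.eval ((2 * r - 1 : ℝ) : ℂ)) (α.derivative.eval (e.1 : ℂ))) *
      (σ * cross (α.derivative.eval (e.2 : ℂ)) (α.derivative.eval (e.1 : ℂ))) := by
    refine (Finset.eventually_all E).2 fun e he => ?_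
    obtain ⟨δ, hδ, hδ'⟩ := hcross e he
    exact (hlin 2 δ hδ).mono fun ρ hρ r hr => hδ' r (hr.trans_lt hρ)
  obtain ⟨ρ, h1, h2, h3, hρ⟩ := (h1.and (h2.and (h3.and self_mem_nhdsWithin))).exists
  exact ⟨⟨α, E, h, σ, τ, hσ, hτ, c, hc0, hc1, hc, ρ, hρ, h1, h2, h3⟩, rfl, rfl, rfl, rfl⟩

/-- A thin curve that runs back and forth along an arc, and turns at the ends of the arc, can be
contracted, with one crossing for each double point of the arc. -/
theorem eventually_reduces (h : IsArc α E) {B : ℝ × ℝ → ℂ} (hB : ContDiff ℝ ∞ B)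
    (hper : ∀ ε t, B (ε, t + 1) = B (ε, t))
    (h1 : cross (α.derivative.eval 1) (deriv (fun t => B (0, t)) 0) ≠ 0)
    (h2 : cross (α.derivative.eval (-1)) (deriv (fun t => B (0, t)) (1 / 2)) ≠ 0) :
    ∀ᶠ ε in 𝓝[>] (0 : ℝ), ReducesToStandard
      (fun t => α.eval ((Real.cos (2 * Real.pi * t) : ℝ) : ℂ) + ε • B (ε, t)) E.card := by
  have hpi := Real.pi_pos
  obtain ⟨σ, hσ, hσ'⟩ := exists_sign_mul_pos h1
  obtain ⟨τ, hτ, hτ'⟩ := exists_sign_mul_pos h2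
  -- The turns of the retraction are put on the sides of the given displacement. At the second turn
  -- the sine decreases, which reverses its displacement; hence `-τ`.
  obtain ⟨R, rfl, rfl, rfl, hRτ⟩ := h.exists_retraction hσ (τ := -τ)
    (by rcases hτ with h | h <;> rw [h] <;> norm_num)
  have hof : ContDiff ℝ ∞ fun x : ℝ => (x : ℂ) := Complex.ofRealCLM.contDiff
  -- The retraction starts from the arc translated so that `α(-1)` becomes the origin. This
  -- translation is made while `B` is interpolated linearly to the displacement of the retraction.
  have hA : ContDiff ℝ ∞ fun p : ℝ × ℝ => R.α.eval (p.2 : ℂ) - p.1 • R.α.eval ((-1 : ℝ) : ℂ) := by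
    have h3 : ContDiff ℝ ∞ fun p : ℝ × ℝ => R.α.eval (p.2 : ℂ) :=
      (R.α.contDiff_eval_real.comp hof).comp (f := fun p : ℝ × ℝ => p.2) (by fun_prop)
    fun_prop
  have hBB : ContDiff ℝ ∞ fun p : (ℝ × ℝ) × ℝ =>
      (1 - p.1.2) • B (p.1.1, p.2) + p.1.2 • R.disp ((p.1.1, 0), p.2) := by
    have h3 : ContDiff ℝ ∞ fun p : (ℝ × ℝ) × ℝ => B (p.1.1, p.2) :=
      hB.comp (f := fun p : (ℝ × ℝ) × ℝ => (p.1.1, p.2)) (by fun_prop)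
    have h4 : ContDiff ℝ ∞ fun p : (ℝ × ℝ) × ℝ => R.disp ((p.1.1, 0), p.2) :=
      R.contDiff_disp.comp (f := fun p : (ℝ × ℝ) × ℝ => ((p.1.1, (0 : ℝ)), p.2)) (by fun_prop)
    have h5 : ContDiff ℝ ∞ fun p : (ℝ × ℝ) × ℝ => p.1.2 := by fun_prop
    exact ((contDiff_const.sub h5).smul h3).add (h5.smul h4)
  let F : ThinFamily := ThinFamily.ofContDiff _ _ hA hBB
    (fun x t => by simp only [hper, R.disp_periodic])
  have hA' : ∀ s u, F.A' s u = R.α.derivative.eval (u : ℂ) := fun s u =>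
    ((R.α.hasDerivAt_ofReal u).sub_const (s • R.α.eval ((-1 : ℝ) : ℂ))).deriv
  have hB' : ∀ s t, F.B' 0 s t = (1 - s) • deriv (fun t => B (0, t)) t + s • R.family.B' 0 0 t := by
    intro s t
    have h3 := (contDiff_slice_deriv hB).1 0 t
    have h4 := R.family.hB 0 0 t
    exact ((h3.const_smul (1 - s)).add (h4.const_smul s)).deriv
  have hdper : Function.Periodic (deriv fun t => B (0, t)) 1 := 
    periodic_deriv (f := fun t => B (0, t)) (fun t => hper 0 t) ((contDiff_slice_deriv hB).1 0)
  have hconv : ∀ {x y s : ℝ}, s ∈ Icc (0 : ℝ) 1 → 0 < x → 0 < y → 0 < (1 - s) * x + s * y := by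
    intro x y s hs hx hy
    rcases hs.1.eq_or_lt with h | h
    · rw [← h]; linarith
    · have := mul_pos h hy
      have := mul_nonneg (sub_nonneg.2 hs.2) hx.le
      linarith
  have hw : R.w 1 0 = R.σ • (Complex.I * R.α.derivative.eval 1) := by
    rw [R.w_of_forall_zero fun e he => bump_eq_zero R.ρ_pos ?_]
    · norm_num
    · exact (R.ρ_lt e he).2.le.trans (le_abs_self _)
  -- At each turn both displacements point to the same side of the arc, so the interpolation stays
  -- transverse.
  have hreg : ∀ s ∈ Icc (0 : ℝ) 1, F.RegularAt s := by
    intro s hs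
    refine ⟨fun u hu => by rw [hA']; exact R.arc.regular u hu.1 hu.2, fun t ht => ?_⟩
    rw [hA', hB', R.family_B'_of_sin_eq_zero ht, cross_add_right, cross_smul_right, cross_smul_right,
      sub_zero]
    have := R.c_pos
    have := R.c_lt
    obtain ⟨m, hm⟩ := sin_two_pi_eq_zero_iff.1 ht
    rcases Int.even_or_odd' m with ⟨n, rfl | rfl⟩
    · have h3 : t = 0 + n := by push_cast at hm; linarith
      have h4 : Real.cos (2 * Real.pi * t) = 1 := by rw [h3, zero_add]; exact Retraction.cos_two_pi_int n
      rw [h4, cutoff_eq_one (u := 1) R.c_lt (by linarith), cutoff_eq_zero (u := -1) R.c_lt (by linarith),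
        one_smul, zero_smul, add_zero, hw, cross_smul_right, Complex.ofReal_one, cross_smul_right,
        Retraction.cross_I_mul]
      have h5 : deriv (fun t => B (0, t)) t = deriv (fun t => B (0, t)) 0 := by
        rw [h3]; exact periodic_int hdper 0 n
      rw [h5]
      have h6 := Complex.normSq_pos.2 (R.arc.regular 1 (by norm_num) le_rfl)
      rw [Complex.ofReal_one] at h6
      have h7 := hconv hs hσ' (mul_pos (by positivity : 0 < 2 * Real.pi) (mul_pos (show 0 < R.σ * R.σ by
        rw [R.σ_sq]; norm_num) h6))
      intro h0
      rw [show (1 - s) * (R.σ * cross (R.α.derivative.eval 1) (deriv (fun t => B (0, t)) 0)) +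
        s * (2 * Real.pi * (R.σ * R.σ * Complex.normSq (R.α.derivative.eval 1))) =
        R.σ * ((1 - s) * cross (R.α.derivative.eval 1) (deriv (fun t => B (0, t)) 0) +
          s * (1 * (2 * Real.pi) * (R.σ * Complex.normSq (R.α.derivative.eval 1)))) by ring, h0,
        mul_zero] at h7
      exact lt_irrefl _ h7
    · have h3 : t = 1 / 2 + n := by push_cast at hm; linarith
      have h4 : Real.cos (2 * Real.pi * t) = -1 := by
        rw [h3, show 2 * Real.pi * (1 / 2 + n) = Real.pi + n * (2 * Real.pi) by ring,
          Real.cos_add_int_mul_two_pi, Real.cos_pi]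
      rw [h4, neg_neg, cutoff_eq_one (u := 1) R.c_lt (by linarith),
        cutoff_eq_zero (u := -1) R.c_lt (by linarith),
        one_smul, zero_smul, zero_add, cross_smul_right, R.hτ_smul_cross, hRτ]
      have h5 : deriv (fun t => B (0, t)) t = deriv (fun t => B (0, t)) (1 / 2) := by
        rw [h3]; exact periodic_int hdper (1 / 2) n
      rw [h5]
      have h6 := Complex.normSq_pos.2 (R.arc.regular (-1) le_rfl (by norm_num))
      have hτ2 : τ * τ = 1 := by rcases hτ with h | h <;> rw [h] <;> norm_num
      have e1 : ((-1 : ℝ) : ℂ) = -1 := by push_cast; rfl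
      rw [e1] at h6 ⊢
      have h7 := hconv hs hτ' (mul_pos (by positivity : 0 < 2 * Real.pi) (mul_pos (show 0 < τ * τ by
        rw [hτ2]; norm_num) h6))
      intro h0
      rw [show (1 - s) * (τ * cross (R.α.derivative.eval (-1)) (deriv (fun t => B (0, t)) (1 / 2))) +
        s * (2 * Real.pi * (τ * τ * Complex.normSq (R.α.derivative.eval (-1)))) =
        τ * ((1 - s) * cross (R.α.derivative.eval (-1)) (deriv (fun t => B (0, t)) (1 / 2)) +
          s * (-1 * (2 * Real.pi) * (-τ * Complex.normSq (R.α.derivative.eval (-1))))) by ring, h0,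
        mul_zero] at h7
      exact lt_irrefl _ h7
  have hd : ∀ s ∈ Icc (0 : ℝ) 1, ∀ u v, -1 ≤ u → u < v → v ≤ 1 → F.A s u = F.A s v →
      -1 < u ∧ v < 1 ∧ cross (F.A' s u) (F.A' s v) ≠ 0 := by
    intro s _ u v hu huv hv he
    have hE := R.arc.mem u v hu huv hv (sub_left_inj.1 he)
    have hb := R.arc.bounds _ hE
    rw [hA', hA']
    exact ⟨hb.1, hb.2.2, R.arc.transverse _ hE⟩
  filter_upwards [F.eventually_path hreg hd, R.eventually_reduces] with ε h3 h4
  have e0 : F.curve ε 0 = fun t => R.α.eval ((Real.cos (2 * Real.pi * t) : ℝ) : ℂ) + ε • B (ε, t) := by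
    funext t
    simp [ThinFamily.curve, F, ThinFamily.ofContDiff]
  have e1 : F.curve ε 1 = R.family.curve ε 0 := by
    funext t
    have := R.arcAt_spec 0 (Real.cos (2 * Real.pi * t))
    rw [sub_zero, one_smul] at this
    rw [ThinFamily.curve, ThinFamily.curve, R.family_A, this, R.family_B]
    simp [F, ThinFamily.ofContDiff]
  rw [e0, e1] at h3
  simpa using h3.reducesToStandard h4

end IsArc

/-! ### Double points of Lissajous arcs -/

/-- The indices `i`, `j` of a node of the Lissajous arc `(cos kτ, cos lτ)` or of its square: the
angles at the node have the sum `πi/k` and the difference `πj/l`, or conversely. -/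
structure IsNode (k l i j : ℕ) : Prop where
  left_pos : 0 < i
  right_pos : 0 < j
  parity : i % 2 = j % 2
  lt : i * l + j * k < 2 * (k * l)
  proper : (k + l) % 2 = 1 ∨ i % 2 = 0 ∨ i * l + j * k < k * l

/-- The larger angle at a node. -/
def nodeLarge (k l i j : ℕ) : ℝ := Real.pi / 2 * ((i : ℝ) / k + (j : ℝ) / l)

/-- The smaller angle at a node. -/
def nodeSmall (k l i j : ℕ) : ℝ := Real.pi / 2 * |(i : ℝ) / k - (j : ℝ) / l|

theorem nodeLarge_comm (k l i j : ℕ) : nodeLarge l k j i = nodeLarge k l i j := by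
  unfold nodeLarge; rw [add_comm]

theorem nodeSmall_comm (k l i j : ℕ) : nodeSmall l k j i = nodeSmall k l i j := by
  unfold nodeSmall; rw [abs_sub_comm]

namespace IsNode

variable {k l i j : ℕ}

theorem symm (h : IsNode k l i j) : IsNode l k j i :=
  ⟨h.right_pos, h.left_pos, h.parity.symm, by have := h.lt; rw [mul_comm l k]; omega, by
    have h1 := h.proper; have h2 := h.parity; rw [mul_comm l k]; omega⟩

/-- If the sine vanished, `l` would divide `jk`, so `j = l` by coprimality and size, and `i`, `j`,
`k`, `l` would all have the same parity. Each alternative of `proper` contradicts this: the first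
directly, the second by coprimality, the third by size. -/
theorem sin_ne_zero (hk : 0 < k) (hl : 0 < l) (hc : k.Coprime l) (h : IsNode k l i j) {s : ℤ}
    (hs : s = 1 ∨ s = -1) :
    Real.sin (k * (Real.pi / 2 * ((i : ℝ) / k + s * ((j : ℝ) / l)))) ≠ 0 := by
  intro h0
  obtain ⟨n, hn⟩ := Real.sin_eq_zero_iff.1 h0
  have hk' : (k : ℝ) ≠ 0 := by positivity
  have hl' : (l : ℝ) ≠ 0 := by positivity
  have hpi := Real.pi_ne_zero
  have h1 : 2 * (n : ℝ) * l = i * l + s * (j * k) := by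
    refine mul_left_cancel₀ hpi ?_
    have h2 : (n : ℝ) * Real.pi * (2 * l) = Real.pi * (i * l + s * (j * k)) := by
      rw [hn]; field_simp
    linarith
  have h2 : 2 * n * l = i * l + s * (j * k) := by exact_mod_cast h1
  have h3 : (l : ℤ) ∣ j * k := by
    rcases hs with rfl | rfl
    · exact ⟨2 * n - i, by linarith⟩
    · exact ⟨i - 2 * n, by linarith⟩
  have h4 : l ∣ j * k := by exact_mod_cast h3
  obtain ⟨m, rfl⟩ := hc.symm.dvd_of_dvd_mul_right h4
  have hm : m = 1 := by
    have h5 := h.right_pos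
    have h6 := h.lt
    have h7 : 0 < m := Nat.pos_of_mul_pos_left h5
    have h8 : l * k * m < l * k * 2 := by nlinarith
    have h9 := lt_of_mul_lt_mul_left h8 (Nat.zero_le _)
    omega
  subst hm
  have h5 : 2 * n = i + s * k := by
    have : (l : ℤ) ≠ 0 := by exact_mod_cast hl.ne'
    refine mul_right_cancel₀ this ?_
    push_cast at h2
    linear_combination h2
  have hp := h.parity
  rw [mul_one] at hp
  rcases h.proper with h6 | h6 | h6
  · rcases hs with rfl | rfl <;> omega
  · have hk2 : 2 ∣ k := by rcases hs with rfl | rfl <;> omega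
    have hl2 : 2 ∣ l := by omega
    have := Nat.dvd_gcd hk2 hl2
    rw [hc] at this
    omega
  · nlinarith

theorem sin_nodeLarge_ne_zero (hk : 0 < k) (hl : 0 < l) (hc : k.Coprime l) (h : IsNode k l i j) :
    Real.sin (k * nodeLarge k l i j) ≠ 0 := by
  have := h.sin_ne_zero hk hl hc (Or.inl rfl)
  simpa [nodeLarge] using this

theorem nodeSmall_eq (k l i j : ℕ) :
    (nodeSmall k l i j = Real.pi / 2 * ((i : ℝ) / k - (j : ℝ) / l) ∧ (j : ℝ) / l ≤ i / k) ∨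
    (nodeSmall k l i j = Real.pi / 2 * ((j : ℝ) / l - (i : ℝ) / k) ∧ (i : ℝ) / k ≤ j / l) := by
  unfold nodeSmall
  rcases le_total ((j : ℝ) / l) (i / k) with h1 | h1
  · exact Or.inl ⟨by rw [abs_of_nonneg (by linarith)], h1⟩
  · exact Or.inr ⟨by rw [abs_of_nonpos (by linarith)]; ring, h1⟩

theorem nodeSmall_pos (hk : 0 < k) (hl : 0 < l) (hc : k.Coprime l) (h : IsNode k l i j) :
    0 < nodeSmall k l i j := by
  have hpi := Real.pi_pos
  refine mul_pos (by positivity) (abs_pos.2 fun h0 => ?_)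
  have := h.sin_ne_zero hk hl hc (Or.inr rfl)
  push_cast at this
  rw [neg_one_mul, ← sub_eq_add_neg, h0] at this
  simp at this

theorem nodeSmall_lt_nodeLarge (hk : 0 < k) (hl : 0 < l) (h : IsNode k l i j) :
    nodeSmall k l i j < nodeLarge k l i j := by
  have hpi := Real.pi_pos
  have h1 : 0 < (i : ℝ) / k := div_pos (by exact_mod_cast h.left_pos) (by positivity)
  have h2 : 0 < (j : ℝ) / l := div_pos (by exact_mod_cast h.right_pos) (by positivity)
  unfold nodeSmall nodeLarge
  refine mul_lt_mul_of_pos_left ?_ (by positivity)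
  rw [abs_lt]
  constructor <;> linarith

theorem add_div_lt (hk : 0 < k) (hl : 0 < l) {c : ℕ} (h : i * l + j * k < c * (k * l)) :
    (i : ℝ) / k + (j : ℝ) / l < c := by
  have h1 : ((i * l + j * k : ℕ) : ℝ) < ((c * (k * l) : ℕ) : ℝ) := by exact_mod_cast h
  push_cast at h1
  have hk' : (0 : ℝ) < k := by positivity
  have hl' : (0 : ℝ) < l := by positivity
  rw [div_add_div _ _ hk'.ne' hl'.ne', div_lt_iff₀ (by positivity)]
  linarith

theorem nodeLarge_lt_pi (hk : 0 < k) (hl : 0 < l) (h : IsNode k l i j) :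
    nodeLarge k l i j < Real.pi := by
  have hpi := Real.pi_pos
  have := add_div_lt hk hl h.lt
  push_cast at this
  unfold nodeLarge
  nlinarith

/-- `k` times the small angle is `iπ` minus `k` times the large one, or the negative of this. -/
theorem cos_mul_nodeSmall (hk : 0 < k) (_h : IsNode k l i j) :
    Real.cos (k * nodeSmall k l i j) = (-1) ^ i * Real.cos (k * nodeLarge k l i j) := by
  have hk' : (k : ℝ) ≠ 0 := by positivity
  rcases nodeSmall_eq k l i j with ⟨h1, _⟩ | ⟨h1, _⟩
  · rw [show (k : ℝ) * nodeSmall k l i j = i * Real.pi - k * nodeLarge k l i j by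
      rw [h1, nodeLarge]; field_simp; ring, Real.cos_nat_mul_pi_sub]
  · rw [show (k : ℝ) * nodeSmall k l i j = k * nodeLarge k l i j - i * Real.pi by
      rw [h1, nodeLarge]; field_simp; ring, Real.cos_sub_nat_mul_pi]

theorem cos_mul_nodeSmall' (hl : 0 < l) (h : IsNode k l i j) :
    Real.cos (l * nodeSmall k l i j) = (-1) ^ i * Real.cos (l * nodeLarge k l i j) := by
  have h1 := h.symm.cos_mul_nodeSmall hl
  rw [nodeSmall_comm, nodeLarge_comm] at h1
  rw [h1, neg_one_pow_eq_pow_mod_two, ← h.parity, ← neg_one_pow_eq_pow_mod_two]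

/-- Between the two passages through a node one velocity component is reversed relative to the
other. This is the source of transversality. -/
theorem sin_nodeSmall (hk : 0 < k) (hl : 0 < l) (h : IsNode k l i j) :
    ∃ s : ℝ, s ≠ 0 ∧ Real.sin (k * nodeSmall k l i j) = s * Real.sin (k * nodeLarge k l i j) ∧
      Real.sin (l * nodeSmall k l i j) = -(s * Real.sin (l * nodeLarge k l i j)) := by
  have hk' : (k : ℝ) ≠ 0 := by positivity
  have hl' : (l : ℝ) ≠ 0 := by positivity
  have hij : ((-1) ^ j : ℝ) = (-1) ^ i := by
    rw [neg_one_pow_eq_pow_mod_two, ← h.parity, ← neg_one_pow_eq_pow_mod_two]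
  rcases nodeSmall_eq k l i j with ⟨h1, _⟩ | ⟨h1, _⟩
  · refine ⟨-(-1) ^ i, by simp, ?_, ?_⟩
    · rw [show (k : ℝ) * nodeSmall k l i j = i * Real.pi - k * nodeLarge k l i j by
        rw [h1, nodeLarge]; field_simp; ring, Real.sin_nat_mul_pi_sub]; ring
    · rw [show (l : ℝ) * nodeSmall k l i j = l * nodeLarge k l i j - j * Real.pi by
        rw [h1, nodeLarge]; field_simp; ring, Real.sin_sub_nat_mul_pi, hij]; ring
  · refine ⟨(-1) ^ i, by simp, ?_, ?_⟩
    · rw [show (k : ℝ) * nodeSmall k l i j = k * nodeLarge k l i j - i * Real.pi by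
        rw [h1, nodeLarge]; field_simp; ring, Real.sin_sub_nat_mul_pi]
    · rw [show (l : ℝ) * nodeSmall k l i j = j * Real.pi - l * nodeLarge k l i j by
        rw [h1, nodeLarge]; field_simp; ring, Real.sin_nat_mul_pi_sub, hij]

theorem cross_ne_zero (hk : 0 < k) (hl : 0 < l) (hc : k.Coprime l) (h : IsNode k l i j) :
    Real.sin (k * nodeLarge k l i j) * Real.sin (l * nodeSmall k l i j) -
      Real.sin (l * nodeLarge k l i j) * Real.sin (k * nodeSmall k l i j) ≠ 0 := by
  obtain ⟨s, hs, h1, h2⟩ := h.sin_nodeSmall hk hl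
  have h3 := h.sin_nodeLarge_ne_zero hk hl hc
  have h4 := h.symm.sin_nodeLarge_ne_zero hl hk hc.symm
  rw [nodeLarge_comm] at h4
  rw [h1, h2]
  have := mul_ne_zero (mul_ne_zero hs h3) h4
  intro h5
  exact this (by linarith)

/-- Equal small angles mean `il - jk = ±(i'l - j'k)`. By coprimality the difference, respectively
the sum, of the two pairs is a multiple `m (k, l)`. Size forces `m = 0` for the difference and `m =
1` for the sum, and `hp` excludes the latter. -/
theorem eq_of_nodeSmall_eq (hk : 0 < k) (hl : 0 < l) (hc : k.Coprime l) {i' j' : ℕ}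
    (h : IsNode k l i j) (h' : IsNode k l i' j')
    (hp : (k + l) % 2 = 1 ∨ (i % 2 = 0 ∧ i' % 2 = 0) ∨ i * l + j * k + (i' * l + j' * k) < 2 * (k * l))
    (he : nodeSmall k l i j = nodeSmall k l i' j') : i = i' ∧ j = j' := by
  have hpi := Real.pi_pos
  have hk' : (k : ℝ) ≠ 0 := by positivity
  have hl' : (l : ℝ) ≠ 0 := by positivity
  unfold nodeSmall at he
  have he := mul_left_cancel₀ (by positivity) he
  have hlt := h.lt
  have hlt' := h'.lt
  have h1 := h.parity
  have h2 := h'.parity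
  have h3 := h.left_pos
  have h4 := h.right_pos
  have h5 := h'.left_pos
  have h6 := h'.right_pos
  have hcZ : IsCoprime (k : ℤ) l := Nat.isCoprime_iff_coprime.2 hc
  have hkZ : (0 : ℤ) < k := by exact_mod_cast hk
  have hlZ : (0 : ℤ) < l := by exact_mod_cast hl
  rcases abs_eq_abs.1 he with he | he
  · field_simp at he
    have he' : (i : ℤ) * l - j * k = i' * l - j' * k := by
      have : ((i : ℝ) * l - k * j) = i' * l - k * j' := by linarith
      have : (i : ℤ) * l - k * j = i' * l - k * j' := by exact_mod_cast this
      linarith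
    obtain ⟨m, hm⟩ : (k : ℤ) ∣ (i - i') :=
      hcZ.dvd_of_dvd_mul_right (⟨(j : ℤ) - j', by linear_combination he'⟩)
    have hj : (j : ℤ) - j' = l * m := by
      refine mul_left_cancel₀ hkZ.ne' ?_
      linear_combination (-1 : ℤ) * he' + l * hm
    have h7 : ((i : ℤ) * l + j * k) - (i' * l + j' * k) = 2 * (k * l) * m := by
      linear_combination l * hm + k * hj
    have h8 : (0 : ℤ) < k * l := by positivity
    have hltZ : (i : ℤ) * l + j * k < 2 * (k * l) := by exact_mod_cast hlt
    have hltZ' : (i' : ℤ) * l + j' * k < 2 * (k * l) := by exact_mod_cast hlt'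
    have h9 : (0 : ℤ) ≤ i * l + j * k := by positivity
    have h10 : (0 : ℤ) ≤ i' * l + j' * k := by positivity
    have h11 : m < 1 := lt_of_mul_lt_mul_left (a := 2 * ((k : ℤ) * l)) (by linarith) (by positivity)
    have h12 : -1 < m := lt_of_mul_lt_mul_left (a := 2 * ((k : ℤ) * l)) (by linarith) (by positivity)
    have h13 : m = 0 := by omega
    rw [h13, mul_zero] at hm hj
    omega
  · exfalso
    field_simp at he
    have he' : (i : ℤ) * l - j * k = -(i' * l - j' * k) := by
      have : ((i : ℝ) * l - k * j) = -(i' * l - k * j') := by linarith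
      have : (i : ℤ) * l - k * j = -(i' * l - k * j') := by exact_mod_cast this
      linarith
    obtain ⟨m, hm⟩ : (k : ℤ) ∣ (i + i') :=
      hcZ.dvd_of_dvd_mul_right (⟨(j : ℤ) + j', by linear_combination he'⟩)
    have hj : (j : ℤ) + j' = l * m := by
      refine mul_left_cancel₀ hkZ.ne' ?_
      linear_combination (-1 : ℤ) * he' + l * hm
    have h7 : ((i : ℤ) * l + j * k) + (i' * l + j' * k) = 2 * (k * l) * m := by
      linear_combination l * hm + k * hj
    have h8 : (0 : ℤ) < k * l := by positivity
    have hltZ : (i : ℤ) * l + j * k < 2 * (k * l) := by exact_mod_cast hlt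
    have hltZ' : (i' : ℤ) * l + j' * k < 2 * (k * l) := by exact_mod_cast hlt'
    have h9 : (0 : ℤ) < i * l + j * k := by positivity
    have h10 : (0 : ℤ) < i' * l + j' * k := by positivity
    have h11 : m < 2 := lt_of_mul_lt_mul_left (a := 2 * ((k : ℤ) * l)) (by linarith) (by positivity)
    have h12 : 0 < m := lt_of_mul_lt_mul_left (a := 2 * ((k : ℤ) * l)) (by linarith) (by positivity)
    have h13 : m = 1 := by omega
    subst h13
    rcases hp with hp | hp | hp
    · omega
    · have hk2 : 2 ∣ k := by omega
      have hl2 : 2 ∣ l := by omega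
      have := Nat.dvd_gcd hk2 hl2
      rw [hc] at this
      omega
    · have hpZ : (i : ℤ) * l + j * k + (i' * l + j' * k) < 2 * (k * l) := by exact_mod_cast hp
      linarith

end IsNode

/-- Angles `τ < τ'` at which the Lissajous arc takes the same values up to a common sign. -/
theorem exists_node {k l : ℕ} (hk : 0 < k) (hl : 0 < l) (hc : k.Coprime l) {e : ℕ} {τ τ' : ℝ}
    (h0 : 0 ≤ τ) (h1 : τ < τ') (h2 : τ' ≤ Real.pi)
    (hck : Real.cos (k * τ) = (-1) ^ e * Real.cos (k * τ'))
    (hcl : Real.cos (l * τ) = (-1) ^ e * Real.cos (l * τ')) :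
    (∃ i j : ℕ, 0 < i ∧ 0 < j ∧ i % 2 = e % 2 ∧ j % 2 = e % 2 ∧ τ = nodeSmall k l i j ∧
      τ' = nodeLarge k l i j ∧ i * l + j * k ≤ 2 * (k * l)) ∨
    (τ + τ' = Real.pi ∧ k % 2 = e % 2 ∧ l % 2 = e % 2) := by
  have hpi := Real.pi_pos
  -- Each coordinate makes the difference or the sum of the angles, times its frequency, a multiple
  -- of `π` with the parity of `e`.
  have key : ∀ m : ℕ, 0 < m → Real.cos (m * τ) = (-1) ^ e * Real.cos (m * τ') →
      ∃ i : ℕ, 0 < i ∧ i % 2 = e % 2 ∧ (m * (τ' - τ) = Real.pi * i ∨ m * (τ' + τ) = Real.pi * i) := by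
    intro m hm h
    have hm' : (0 : ℝ) < m := by positivity
    rw [← Real.cos_add_nat_mul_pi, eq_comm, Real.cos_eq_cos_iff] at h
    obtain ⟨n, hn⟩ := h
    rcases hn with hn | hn
    · have h3 : m * (τ' - τ) = Real.pi * ((-(e : ℤ) - 2 * n : ℤ) : ℝ) := by
        push_cast; linarith
      have hpos : 0 < m * (τ' - τ) := mul_pos hm' (by linarith)
      have h4 : 0 < -(e : ℤ) - 2 * n := by
        rw [h3] at hpos
        exact_mod_cast pos_of_mul_pos_right hpos hpi.le
      obtain ⟨i, hi⟩ := Int.eq_ofNat_of_zero_le h4.le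
      exact ⟨i, by omega, by omega, Or.inl (by rw [h3, hi]; push_cast; rfl)⟩
    · have h3 : m * (τ' + τ) = Real.pi * ((2 * n - (e : ℤ) : ℤ) : ℝ) := by
        push_cast; linarith
      have hpos : 0 < m * (τ' + τ) := mul_pos hm' (by linarith)
      have h4 : 0 < 2 * n - (e : ℤ) := by
        rw [h3] at hpos
        exact_mod_cast pos_of_mul_pos_right hpos hpi.le
      obtain ⟨i, hi⟩ := Int.eq_ofNat_of_zero_le h4.le
      exact ⟨i, by omega, by omega, Or.inr (by rw [h3, hi]; push_cast; rfl)⟩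
  obtain ⟨i, hi0, hi, hi'⟩ := key k hk hck
  obtain ⟨j, hj0, hj, hj'⟩ := key l hl hcl
  have hk' : (0 : ℝ) < k := by positivity
  have hl' : (0 : ℝ) < l := by positivity
  -- If both coordinates restrict the same combination, coprimality makes it equal to `π`. For the
  -- difference this means `τ = 0`, `τ' = π`, so in either case the angles add up to `π`.
  have deg : ∀ x : ℝ, k * x = Real.pi * i → l * x = Real.pi * j → x < 2 * Real.pi →
      x = Real.pi ∧ k % 2 = e % 2 ∧ l % 2 = e % 2 := by
    intro x h3 h4 h5
    have h6 : (i : ℝ) * l = j * k := by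
      refine mul_left_cancel₀ hpi.ne' ?_
      linear_combination k * h4 - l * h3
    have h7 : i * l = j * k := by exact_mod_cast h6
    obtain ⟨m, rfl⟩ : k ∣ i := hc.dvd_of_dvd_mul_right ⟨j, by linarith⟩
    have h8 : j = l * m := by
      refine Nat.eq_of_mul_eq_mul_right hk ?_
      linarith
    have hx : x = Real.pi * m := by
      refine mul_left_cancel₀ hk'.ne' ?_
      push_cast at h3
      linarith
    have hm : m = 1 := by
      have a1 : 0 < m := Nat.pos_of_mul_pos_left hi0
      have a2 : (m : ℝ) < 2 := by
        rw [hx] at h5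
        nlinarith
      have a3 : m < 2 := by exact_mod_cast a2
      omega
    subst hm
    refine ⟨by rw [hx]; simp, by simpa using hi, ?_⟩
    rw [h8] at hj
    simpa using hj
  have fin : ∀ A D : ℝ, τ' = (A + D) / 2 → τ = |A - D| / 2 → k * A = Real.pi * i → l * D = Real.pi * j →
      (∃ i j : ℕ, 0 < i ∧ 0 < j ∧ i % 2 = e % 2 ∧ j % 2 = e % 2 ∧ τ = nodeSmall k l i j ∧
        τ' = nodeLarge k l i j ∧ i * l + j * k ≤ 2 * (k * l)) := by
    intro A D hA hD h3 h4
    have h5 : A = Real.pi * (i / k) := by field_simp; linarith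
    have h6 : D = Real.pi * (j / l) := by field_simp; linarith
    have h7 : τ' = nodeLarge k l i j := by rw [hA, h5, h6, nodeLarge]; ring
    refine ⟨i, j, hi0, hj0, hi, hj, ?_, h7, ?_⟩
    · rw [hD, h5, h6, nodeSmall, ← mul_sub, abs_mul, abs_of_pos hpi]; ring
    · rw [h7, nodeLarge] at h2
      have h8 : (i : ℝ) / k + j / l ≤ 2 := by nlinarith
      rw [div_add_div _ _ hk'.ne' hl'.ne', div_le_iff₀ (by positivity)] at h8
      have h9 : ((i * l + j * k : ℕ) : ℝ) ≤ ((2 * (k * l) : ℕ) : ℝ) := by push_cast; linarith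
      exact_mod_cast h9
  rcases hi' with hi' | hi' <;> rcases hj' with hj' | hj'
  · right
    obtain ⟨h3, h4⟩ := deg _ hi' hj' (by linarith)
    exact ⟨by linarith, h4⟩
  · left
    exact fin (τ' - τ) (τ' + τ) (by ring) (by
      rw [show τ' - τ - (τ' + τ) = -(2 * τ) by ring, abs_neg, abs_of_nonneg (by linarith)]; ring) hi' hj'
  · left
    exact fin (τ' + τ) (τ' - τ) (by ring) (by
      rw [show τ' + τ - (τ' - τ) = 2 * τ by ring, abs_of_nonneg (by linarith)]; ring) hi' hj'
  · right
    obtain ⟨h3, h4⟩ := deg _ hi' hj' (by linarith)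
    exact ⟨by linarith, h4⟩

/-! ### Counting nodes -/

/-- The involution exchanges the elements of weight below `M` with those of weight above `M`. -/
theorem Finset.two_mul_card_filter_lt {ι : Type*} [DecidableEq ι] (S : Finset ι) (f : ι → ι) (w : ι → ℕ) (M : ℕ)
    (hf : ∀ x ∈ S, f x ∈ S) (hff : ∀ x ∈ S, f (f x) = x) (hw : ∀ x ∈ S, w x + w (f x) = 2 * M)
    (hne : ∀ x ∈ S, w x ≠ M) : 2 * (S.filter fun x => w x < M).card = S.card := by
  have h1 : (S.filter fun x => w x < M).card = (S.filter fun x => ¬ w x < M).card := by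
    refine Finset.card_nbij' f f ?_ ?_ ?_ ?_
    · intro x hx
      simp only [Finset.coe_filter, mem_ofPred_eq] at hx ⊢
      have := hw x hx.1
      exact ⟨hf x hx.1, by omega⟩
    · intro x hx
      simp only [Finset.coe_filter, mem_ofPred_eq] at hx ⊢
      have := hw x hx.1
      have := hne x hx.1
      exact ⟨hf x hx.1, by omega⟩
    · intro x hx
      simp only [Finset.coe_filter, mem_ofPred_eq] at hx
      exact hff x hx.1
    · intro x hx
      simp only [Finset.coe_filter, mem_ofPred_eq] at hx
      exact hff x hx.1
  have h2 := Finset.card_filter_add_card_filter_not (s := S) (fun x => w x < M)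
  omega

theorem card_filter_mod_two_Ico (n : ℕ) :
    ((Finset.Ico 1 n).filter fun i => i % 2 = 0).card = (n - 1) / 2 ∧
    ((Finset.Ico 1 n).filter fun i => i % 2 = 1).card = n / 2 := by
  induction n with
  | zero => simp
  | succ n ih =>
    rcases Nat.eq_zero_or_pos n with rfl | hn
    · simp
    · have hnot : ∀ p : ℕ → Prop, [DecidablePred p] → n ∉ (Finset.Ico 1 n).filter p := by simp
      rw [← Finset.insert_Ico_right_eq_Ico_add_one hn, Finset.filter_insert, Finset.filter_insert]
      constructor
      · split_ifs
        · rw [Finset.card_insert_of_notMem (hnot _)]; omega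
        · omega
      · split_ifs
        · rw [Finset.card_insert_of_notMem (hnot _)]; omega
        · omega

theorem card_filter_parity (m n : ℕ) :
    ((Finset.Ico 1 m ×ˢ Finset.Ico 1 n).filter fun x => x.1 % 2 = 0 ∧ x.2 % 2 = 0).card =
      (m - 1) / 2 * ((n - 1) / 2) ∧
    ((Finset.Ico 1 m ×ˢ Finset.Ico 1 n).filter fun x => x.1 % 2 = x.2 % 2).card =
      (m - 1) / 2 * ((n - 1) / 2) + m / 2 * (n / 2) := by
  have h0 : ((Finset.Ico 1 m ×ˢ Finset.Ico 1 n).filter fun x => x.1 % 2 = 0 ∧ x.2 % 2 = 0).card =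
      (m - 1) / 2 * ((n - 1) / 2) := by
    rw [Finset.filter_product (fun i => i % 2 = 0) (fun i => i % 2 = 0), Finset.card_product,
      (card_filter_mod_two_Ico m).1,
      (card_filter_mod_two_Ico n).1]
  have h1 : ((Finset.Ico 1 m ×ˢ Finset.Ico 1 n).filter fun x => x.1 % 2 = 1 ∧ x.2 % 2 = 1).card =
      m / 2 * (n / 2) := by
    rw [Finset.filter_product (fun i => i % 2 = 1) (fun i => i % 2 = 1), Finset.card_product,
      (card_filter_mod_two_Ico m).2,
      (card_filter_mod_two_Ico n).2]
  refine ⟨h0, ?_⟩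
  rw [← h0, ← h1, ← Finset.card_union_of_disjoint, ← Finset.filter_or]
  · congr 1
    refine Finset.filter_congr fun x _ => ?_
    omega
  · rw [Finset.disjoint_filter]
    intro x _ h
    omega

/-- The nodes of the Lissajous arc. -/
def evenNodes (k l : ℕ) : Finset (ℕ × ℕ) :=
  ((Finset.Ico 1 (2 * k) ×ˢ Finset.Ico 1 (2 * l)).filter fun x => x.1 % 2 = 0 ∧ x.2 % 2 = 0).filter
    fun x => x.1 * l + x.2 * k < 2 * (k * l)

/-- The nodes of the square of the Lissajous arc for `k + l` odd. -/
def squareNodes (k l : ℕ) : Finset (ℕ × ℕ) :=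
  ((Finset.Ico 1 (2 * k) ×ˢ Finset.Ico 1 (2 * l)).filter fun x => x.1 % 2 = x.2 % 2).filter
    fun x => x.1 * l + x.2 * k < 2 * (k * l)

/-- The nodes of the square of the Lissajous arc for `k`, `l` odd. -/
def foldNodes (k l : ℕ) : Finset (ℕ × ℕ) :=
  ((Finset.Ico 1 k ×ˢ Finset.Ico 1 l).filter fun x => x.1 % 2 = x.2 % 2).filter
    fun x => x.1 * l + x.2 * k < k * l

section

variable {k l : ℕ} (hk : 0 < k) (hl : 0 < l) (hc : k.Coprime l)
include hk hl hc

theorem eq_of_mul_add_mul_eq {m i j : ℕ} (h : i * l + j * k = m * (k * l)) :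
    ∃ a b, i = k * a ∧ j = l * b ∧ a + b = m := by
  have h1 : (k : ℤ) ∣ i := (Nat.isCoprime_iff_coprime.2 hc).dvd_of_dvd_mul_right
    ⟨m * l - j, by have : (i : ℤ) * l + j * k = m * (k * l) := by exact_mod_cast h
                   linear_combination this⟩
  have h2 : (l : ℤ) ∣ j := (Nat.isCoprime_iff_coprime.2 hc.symm).dvd_of_dvd_mul_right
    ⟨m * k - i, by have : (i : ℤ) * l + j * k = m * (k * l) := by exact_mod_cast h
                   linear_combination this⟩
  obtain ⟨a, rfl⟩ : k ∣ i := by exact_mod_cast h1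
  obtain ⟨b, rfl⟩ : l ∣ j := by exact_mod_cast h2
  refine ⟨a, b, rfl, rfl, ?_⟩
  refine Nat.eq_of_mul_eq_mul_right (Nat.mul_pos hk hl) ?_
  rw [← h]; ring

/-- Equality would force `i = k` and `j = l`, with the large angle at the end `π` of the arc; the
parities exclude this. -/
theorem two_mul_ne_of_parity {i j : ℕ} (hi : 0 < i) (hj : 0 < j) (hij : i % 2 = j % 2)
    (hp : (k + l) % 2 = 1 ∨ i % 2 = 0) : i * l + j * k ≠ 2 * (k * l) := by
  intro h
  obtain ⟨a, b, rfl, rfl, hab⟩ := eq_of_mul_add_mul_eq hk hl hc h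
  have ha := Nat.pos_of_mul_pos_left hi
  have hb := Nat.pos_of_mul_pos_left hj
  have ha1 : a = 1 := by omega
  have hb1 : b = 1 := by omega
  subst ha1 hb1
  rw [mul_one] at hp hij
  rw [mul_one] at hij
  rcases hp with hp | hp
  · omega
  · have := Nat.dvd_gcd (show 2 ∣ k by omega) (show 2 ∣ l by omega)
    rw [hc] at this
    omega

/-- The reflection `(i, j) ↦ (2k - i, 2l - j)` keeps the parities and exchanges the two sides of `il
+ jk = 2kl`. The rectangle contains `(k-1)(l-1)` pairs of even numbers. -/
theorem two_mul_card_evenNodes : 2 * (evenNodes k l).card = (k - 1) * (l - 1) := by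
  have h := (card_filter_parity (2 * k) (2 * l)).1
  rw [show (2 * k - 1) / 2 = k - 1 by omega, show (2 * l - 1) / 2 = l - 1 by omega] at h
  rw [← h, evenNodes]
  refine Finset.two_mul_card_filter_lt _ (fun x => (2 * k - x.1, 2 * l - x.2))
    (fun x => x.1 * l + x.2 * k) _ ?_ ?_ ?_ ?_
  · simp only [Finset.mem_filter, Finset.mem_product, Finset.mem_Ico]; omega
  · simp only [Finset.mem_filter, Finset.mem_product, Finset.mem_Ico, Prod.ext_iff]; omega
  · simp only [Finset.mem_filter, Finset.mem_product, Finset.mem_Ico]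
    rintro x ⟨⟨h1, h2⟩, _⟩
    zify [h1.2.le, h2.2.le]
    ring
  · simp only [Finset.mem_filter, Finset.mem_product, Finset.mem_Ico]
    rintro x ⟨⟨h1, h2⟩, h3⟩
    exact two_mul_ne_of_parity hk hl hc h1.1 h2.1 (by omega) (Or.inr h3.1)

/-- The same reflection; the `kl` pairs of odd numbers now count as well. -/
theorem two_mul_card_squareNodes (hkl : (k + l) % 2 = 1) :
    2 * (squareNodes k l).card = (k - 1) * (l - 1) + k * l := by
  have h := (card_filter_parity (2 * k) (2 * l)).2
  rw [show (2 * k - 1) / 2 = k - 1 by omega, show (2 * l - 1) / 2 = l - 1 by omega,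
    show 2 * k / 2 = k by omega, show 2 * l / 2 = l by omega] at h
  rw [← h, squareNodes]
  refine Finset.two_mul_card_filter_lt _ (fun x => (2 * k - x.1, 2 * l - x.2))
    (fun x => x.1 * l + x.2 * k) _ ?_ ?_ ?_ ?_
  · simp only [Finset.mem_filter, Finset.mem_product, Finset.mem_Ico]; omega
  · simp only [Finset.mem_filter, Finset.mem_product, Finset.mem_Ico, Prod.ext_iff]; omega
  · simp only [Finset.mem_filter, Finset.mem_product, Finset.mem_Ico]
    rintro x ⟨⟨h1, h2⟩, _⟩
    zify [h1.2.le, h2.2.le]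
    ring
  · simp only [Finset.mem_filter, Finset.mem_product, Finset.mem_Ico]
    rintro x ⟨⟨h1, h2⟩, h3⟩
    exact two_mul_ne_of_parity hk hl hc h1.1 h2.1 h3 (Or.inl hkl)

/-- As `k` and `l` are odd, `(i, j) ↦ (k - i, l - j)` preserves `i ≡ j` modulo `2`, and it exchanges
the two sides of `il + jk = kl`. -/
theorem four_mul_card_foldNodes (hk2 : k % 2 = 1) (hl2 : l % 2 = 1) :
    4 * (foldNodes k l).card = (k - 1) * (l - 1) := by
  obtain ⟨a, rfl⟩ : ∃ a, k = 2 * a + 1 := ⟨k / 2, by omega⟩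
  obtain ⟨b, rfl⟩ : ∃ b, l = 2 * b + 1 := ⟨l / 2, by omega⟩
  have h := (card_filter_parity (2 * a + 1) (2 * b + 1)).2
  rw [show (2 * a + 1 - 1) / 2 = a by omega, show (2 * b + 1 - 1) / 2 = b by omega,
    show (2 * a + 1) / 2 = a by omega, show (2 * b + 1) / 2 = b by omega] at h
  have key : 2 * (foldNodes (2 * a + 1) (2 * b + 1)).card = a * b + a * b := by
    rw [← h, foldNodes]
    have hM : ∀ x : ℕ, x = 1 * x := fun x => (one_mul x).symm
    rw [hM ((2 * a + 1) * (2 * b + 1))]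
    refine Finset.two_mul_card_filter_lt _ (fun x => (2 * a + 1 - x.1, 2 * b + 1 - x.2))
      (fun x => x.1 * (2 * b + 1) + x.2 * (2 * a + 1)) _ ?_ ?_ ?_ ?_
    · simp only [Finset.mem_filter, Finset.mem_product, Finset.mem_Ico]; omega
    · simp only [Finset.mem_filter, Finset.mem_product, Finset.mem_Ico, Prod.ext_iff]; omega
    · simp only [Finset.mem_filter, Finset.mem_product, Finset.mem_Ico]
      rintro x ⟨⟨h1, h2⟩, _⟩
      zify [h1.2.le, h2.2.le]
      ring
    · simp only [Finset.mem_filter, Finset.mem_product, Finset.mem_Ico]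
      rintro x ⟨⟨h1, h2⟩, h3⟩ h4
      obtain ⟨p, q, h5, h6, h7⟩ := eq_of_mul_add_mul_eq hk hl hc h4
      have hp : 0 < p := by rcases Nat.eq_zero_or_pos p with rfl | hp <;> omega
      have hq : 0 < q := by rcases Nat.eq_zero_or_pos q with rfl | hq <;> omega
      omega
  have h1 : 2 * a + 1 - 1 = 2 * a := by omega
  have h2 : 2 * b + 1 - 1 = 2 * b := by omega
  rw [h1, h2]
  linarith

end

theorem isNode_of_mem_evenNodes {k l : ℕ} {x : ℕ × ℕ} (h : x ∈ evenNodes k l) : IsNode k l x.1 x.2 := by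
  simp only [evenNodes, Finset.mem_filter, Finset.mem_product, Finset.mem_Ico] at h
  exact ⟨by omega, by omega, by omega, h.2, by omega⟩

theorem isNode_of_mem_squareNodes {k l : ℕ} (hkl : (k + l) % 2 = 1) {x : ℕ × ℕ} (h : x ∈ squareNodes k l) :
    IsNode k l x.1 x.2 := by
  simp only [squareNodes, Finset.mem_filter, Finset.mem_product, Finset.mem_Ico] at h
  exact ⟨by omega, by omega, by omega, h.2, by omega⟩

theorem isNode_of_mem_foldNodes {k l : ℕ} (hk : 0 < k) (hl : 0 < l) {x : ℕ × ℕ} (h : x ∈ foldNodes k l) : IsNode k l x.1 x.2 := by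
  simp only [foldNodes, Finset.mem_filter, Finset.mem_product, Finset.mem_Ico] at h
  exact ⟨by omega, by omega, by omega, by have := Nat.mul_pos hk hl; omega, by omega⟩

theorem lt_of_mul_add_mul_lt {k l : ℕ} (hk : 0 < k) (hl : 0 < l) {c i j : ℕ} (hi : 0 < i) (hj : 0 < j)
    (h : i * l + j * k < c * (k * l)) : i < c * k ∧ j < c * l := by
  constructor
  · refine lt_of_mul_lt_mul_right (a := l) ?_ (Nat.zero_le _)
    have := Nat.mul_pos hj hk
    calc i * l < c * (k * l) := by omega
      _ = c * k * l := by ring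
  · refine lt_of_mul_lt_mul_right (a := k) ?_ (Nat.zero_le _)
    have := Nat.mul_pos hi hl
    calc j * k < c * (k * l) := by omega
      _ = c * l * k := by ring

/-! ### Arcs in terms of angles -/

/-- The substitution `u = cos θ` is decreasing, so the large angle gives the lower parameter of a
double point. Distinct upper parameters amount to distinct small angles. -/
theorem IsArc.of_angles {ι : Type*} [DecidableEq ι] {α : Polynomial ℂ} (I : Finset ι) (A B : ι → ℝ)
    (hB : ∀ x ∈ I, 0 < B x) (hBA : ∀ x ∈ I, B x < A x) (hA : ∀ x ∈ I, A x < Real.pi)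
    (hreg : ∀ θ, 0 ≤ θ → θ ≤ Real.pi → α.derivative.eval ((Real.cos θ : ℝ) : ℂ) ≠ 0)
    (heq : ∀ x ∈ I, α.eval ((Real.cos (A x) : ℝ) : ℂ) = α.eval ((Real.cos (B x) : ℝ) : ℂ))
    (htr : ∀ x ∈ I, cross (α.derivative.eval ((Real.cos (A x) : ℝ) : ℂ))
      (α.derivative.eval ((Real.cos (B x) : ℝ) : ℂ)) ≠ 0)
    (hmem : ∀ θ θ', 0 ≤ θ → θ < θ' → θ' ≤ Real.pi → α.eval ((Real.cos θ : ℝ) : ℂ) =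
      α.eval ((Real.cos θ' : ℝ) : ℂ) → ∃ x ∈ I, B x = θ ∧ A x = θ')
    (hinj : ∀ x ∈ I, ∀ y ∈ I, B x = B y → x = y) :
    ∃ E : Finset (ℝ × ℝ), IsArc α E ∧ E.card = I.card := by
  have hcos : ∀ x ∈ I, ∀ y ∈ I, Real.cos (B x) = Real.cos (B y) → x = y := by
    intro x hx y hy h
    refine hinj x hx y hy (Real.injOn_cos ⟨(hB x hx).le, ?_⟩ ⟨(hB y hy).le, ?_⟩ h)
    · linarith [hBA x hx, hA x hx]
    · linarith [hBA y hy, hA y hy]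
  refine ⟨I.image fun x => (Real.cos (A x), Real.cos (B x)), ⟨?_, ?_, ?_, ?_, ?_, ?_⟩, ?_⟩
  · intro u h0 h1
    rw [← Real.cos_arccos h0 h1]
    exact hreg _ (Real.arccos_nonneg u) (Real.arccos_le_pi u)
  · simp only [Finset.mem_image, forall_exists_index, and_imp]
    rintro _ x hx rfl
    have h1 := hB x hx
    have h2 := hBA x hx
    have h3 := hA x hx
    refine ⟨?_, Real.cos_lt_cos_of_nonneg_of_le_pi h1.le h3.le h2, ?_⟩
    · rw [← Real.cos_pi]; exact Real.cos_lt_cos_of_nonneg_of_le_pi (by linarith) le_rfl h3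
    · rw [← Real.cos_zero]; exact Real.cos_lt_cos_of_nonneg_of_le_pi le_rfl (by linarith) h1
  · simp only [Finset.mem_image, forall_exists_index, and_imp]
    rintro _ x hx rfl
    exact heq x hx
  · simp only [Finset.mem_image, forall_exists_index, and_imp]
    rintro _ x hx rfl
    exact htr x hx
  · intro u v hu huv hv h
    have hv' : -1 ≤ v := by linarith
    have hu' : u ≤ 1 := by linarith
    obtain ⟨x, hx, h1, h2⟩ := hmem (Real.arccos v) (Real.arccos u) (Real.arccos_nonneg v)
      (Real.strictAntiOn_arccos ⟨hu, hu'⟩ ⟨hv', hv⟩ huv) (Real.arccos_le_pi u)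
      (by rw [Real.cos_arccos hv' hv, Real.cos_arccos hu hu', h])
    refine Finset.mem_image.2 ⟨x, hx, ?_⟩
    rw [h1, h2, Real.cos_arccos hv' hv, Real.cos_arccos hu hu']
  · simp only [Finset.mem_image, forall_exists_index, and_imp]
    rintro _ x hx rfl _ y hy rfl h
    rw [hcos x hx y hy h]
  · exact Finset.card_image_of_injOn fun x hx y hy h => hcos x hx y hy (congrArg Prod.snd h)

/-! ### Lissajous arcs as polynomial arcs -/

open Polynomial Polynomial.Chebyshev in
/-- The polynomial arc with `cos θ ↦ c (a₁ cos kθ + i a₂ cos lθ)`. -/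
def lissajous (c : ℂ) (a₁ a₂ : ℝ) (k l : ℕ) : ℂ[X] :=
  Polynomial.C c * (Polynomial.C (a₁ : ℂ) * T ℂ k + Polynomial.C ((a₂ : ℂ) * Complex.I) * T ℂ l)

open Polynomial Polynomial.Chebyshev in
/-- The polynomial arc with `cos 2θ ↦ (c (a₁ cos kθ + i a₂ cos lθ))²` for odd `k`, `l` and
`a₁ = ±1`, `a₂ = ±1`. -/
def lissajousFold (c : ℂ) (a₁ a₂ : ℝ) (k l : ℕ) : ℂ[X] :=
  Polynomial.C (c ^ 2) * (Polynomial.C (1 / 2) * (T ℂ k - T ℂ l) +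
    Polynomial.C ((a₁ * a₂ : ℂ) * Complex.I) * (T ℂ (((k : ℤ) + l) / 2) + T ℂ (((k : ℤ) - l) / 2)))

theorem cross_ofReal (w : ℂ) (r : ℝ) : cross w (r : ℂ) = -(w.im * r) := by simp [cross]

theorem cross_mul_ofReal_ne_zero {c w : ℂ} (hc : c ≠ 0) (hw : w.im ≠ 0) {r : ℝ} (hr : r ≠ 0) :
    cross (c * w) (c * (r : ℂ)) ≠ 0 := by
  rw [cross_mul_left, cross_ofReal]
  exact mul_ne_zero (Complex.normSq_pos.2 hc).ne' (neg_ne_zero.2 (mul_ne_zero hw hr))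

section

variable {c : ℂ} {a₁ a₂ : ℝ} {k l : ℕ}

theorem lissajous_eval_cos (θ : ℝ) : (lissajous c a₁ a₂ k l).eval ((Real.cos θ : ℝ) : ℂ) =
    c * ((a₁ * Real.cos (k * θ) : ℝ) + (a₂ * Real.cos (l * θ) : ℝ) * Complex.I) := by
  simp only [lissajous, Polynomial.eval_mul, Polynomial.eval_add, Polynomial.eval_C,
    Complex.ofReal_cos, Polynomial.Chebyshev.T_complex_cos]
  push_cast
  ring

/-- From `T_n' = n U_{n-1}` and `U_{n-1}(cos θ) sin θ = sin nθ`; the factor `sin θ` is kept on the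
left because it vanishes at the ends. -/
theorem lissajous_derivative_eval_cos (θ : ℝ) :
    (lissajous c a₁ a₂ k l).derivative.eval ((Real.cos θ : ℝ) : ℂ) * (Real.sin θ : ℝ) =
    c * ((a₁ * k * Real.sin (k * θ) : ℝ) + (a₂ * l * Real.sin (l * θ) : ℝ) * Complex.I) := by
  have h : ∀ n : ℕ, (Polynomial.Chebyshev.T ℂ n).derivative.eval (Complex.cos θ) * Complex.sin θ =
      n * Complex.sin (n * θ) := by
    intro n
    rw [Polynomial.Chebyshev.T_derivative_eq_U, Polynomial.eval_mul, mul_assoc,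
      Polynomial.Chebyshev.U_complex_cos]
    simp
  simp only [lissajous, Polynomial.derivative_C_mul, Polynomial.derivative_add,
    Polynomial.eval_mul, Polynomial.eval_add, Polynomial.eval_C, Complex.ofReal_cos,
    Complex.ofReal_sin]
  have h1 := h k
  have h2 := h l
  push_cast
  linear_combination (c * a₁) * h1 + (c * a₂ * Complex.I) * h2

/-- At an end the sine gives no information and `U_{n-1}(1) = n` is used instead. The nonzero
imaginary part makes a displacement in the direction `c` transverse. -/
theorem lissajous_derivative_eval_one (ha₂ : a₂ ≠ 0) (hl : 0 < l) :
    ∃ w : ℂ, (lissajous c a₁ a₂ k l).derivative.eval 1 = c * w ∧ w.im ≠ 0 := by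
  refine ⟨(a₁ * k * k : ℝ) + (a₂ * l * l : ℝ) * Complex.I, ?_, ?_⟩
  · simp only [lissajous, Polynomial.derivative_C_mul, Polynomial.derivative_add,
      Polynomial.eval_mul, Polynomial.eval_add, Polynomial.eval_C,
      Polynomial.Chebyshev.T_derivative_eq_U, Polynomial.Chebyshev.U_eval_one, Int.cast_natCast, Polynomial.eval_natCast]
    push_cast
    ring
  · simp [ha₂, hl.ne']

theorem lissajous_derivative_eval_neg_one (ha₂ : a₂ ≠ 0) (hl : 0 < l) :
    ∃ w : ℂ, (lissajous c a₁ a₂ k l).derivative.eval (-1) = c * w ∧ w.im ≠ 0 := by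
  have hs : ∀ n : ℤ, ∃ s : ℝ, s ≠ 0 ∧ ((n.negOnePow : ℤ) : ℂ) = (s : ℂ) := by
    intro n
    rcases Int.even_or_odd n with h | h
    · exact ⟨1, one_ne_zero, by rw [Int.negOnePow_even n h]; simp⟩
    · exact ⟨-1, by norm_num, by rw [Int.negOnePow_odd n h]; simp⟩
  obtain ⟨s, hs0, hs1⟩ := hs ((k : ℤ) - 1)
  obtain ⟨s', hs0', hs1'⟩ := hs ((l : ℤ) - 1)
  refine ⟨(a₁ * k * (s * k) : ℝ) + (a₂ * l * (s' * l) : ℝ) * Complex.I, ?_, ?_⟩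
  · simp only [lissajous, Polynomial.derivative_C_mul, Polynomial.derivative_add,
      Polynomial.eval_mul, Polynomial.eval_add, Polynomial.eval_C,
      Polynomial.Chebyshev.T_derivative_eq_U, Polynomial.Chebyshev.U_eval_neg_one, hs1, hs1',
      Int.cast_natCast, Polynomial.eval_natCast]
    push_cast
    ring
  · simp [ha₂, hl.ne', hs0']

/-- Bézout: `θ` is an integer combination of `kθ` and `lθ`. -/
theorem eq_zero_of_sin_eq_zero (hc : k.Coprime l) {θ : ℝ}
    (h1 : Real.sin (k * θ) = 0) (h2 : Real.sin (l * θ) = 0) : Real.sin θ = 0 := by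
  obtain ⟨m, hm⟩ := Real.sin_eq_zero_iff.1 h1
  obtain ⟨n, hn⟩ := Real.sin_eq_zero_iff.1 h2
  have hb : (k : ℤ) * k.gcdA l + l * k.gcdB l = 1 := by
    have := Nat.gcd_eq_gcd_ab k l
    rw [hc] at this
    exact_mod_cast this.symm
  refine Real.sin_eq_zero_iff.2 ⟨m * k.gcdA l + n * k.gcdB l, ?_⟩
  have hb' : (k : ℝ) * k.gcdA l + l * k.gcdB l = 1 := by exact_mod_cast hb
  push_cast
  linear_combination (k.gcdA l : ℝ) * hm + (k.gcdB l : ℝ) * hn + θ * hb'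

theorem exists_of_cos_eq_zero (hc : k.Coprime l) {θ : ℝ}
    (h1 : Real.cos (k * θ) = 0) (h2 : Real.cos (l * θ) = 0) :
    ∃ m : ℤ, θ = Real.pi / 2 * m ∧ Odd (k * m) ∧ Odd (l * m) := by
  have hpi := Real.pi_ne_zero
  obtain ⟨p, hp⟩ := Real.cos_eq_zero_iff.1 h1
  obtain ⟨q, hq⟩ := Real.cos_eq_zero_iff.1 h2
  have hb : (k : ℤ) * k.gcdA l + l * k.gcdB l = 1 := by
    have := Nat.gcd_eq_gcd_ab k l
    rw [hc] at this
    exact_mod_cast this.symm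
  have hb' : (k : ℝ) * k.gcdA l + l * k.gcdB l = 1 := by exact_mod_cast hb
  have hθ : θ = Real.pi / 2 * (((2 * p + 1) * k.gcdA l + (2 * q + 1) * k.gcdB l : ℤ) : ℝ) := by
    push_cast
    linear_combination (k.gcdA l : ℝ) * hp + (k.gcdB l : ℝ) * hq - θ * hb'
  refine ⟨_, hθ, ⟨p, ?_⟩, ⟨q, ?_⟩⟩
  · rw [hθ] at hp
    have : (k : ℝ) * (((2 * p + 1) * k.gcdA l + (2 * q + 1) * k.gcdB l : ℤ) : ℝ) = 2 * p + 1 :=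
      mul_left_cancel₀ hpi (by linear_combination 2 * hp)
    exact_mod_cast this
  · rw [hθ] at hq
    have : (l : ℝ) * (((2 * p + 1) * k.gcdA l + (2 * q + 1) * k.gcdB l : ℤ) : ℝ) = 2 * q + 1 :=
      mul_left_cancel₀ hpi (by linear_combination 2 * hq)
    exact_mod_cast this

theorem ofReal_add_mul_I_ne_zero {x y : ℝ} (h : ¬ (x = 0 ∧ y = 0)) :
    (x : ℂ) + (y : ℂ) * Complex.I ≠ 0 := by
  intro h0
  exact h ⟨by simpa using congrArg Complex.re h0, by simpa using congrArg Complex.im h0⟩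

theorem lissajous_derivative_ne_zero (hc0 : c ≠ 0) (ha₁ : a₁ ≠ 0) (ha₂ : a₂ ≠ 0) (hk : 0 < k)
    (hl : 0 < l) (hc : k.Coprime l) {θ : ℝ} (h0 : 0 ≤ θ) (h1 : θ ≤ Real.pi) :
    (lissajous c a₁ a₂ k l).derivative.eval ((Real.cos θ : ℝ) : ℂ) ≠ 0 := by
  have hw : ∀ w : ℂ, w.im ≠ 0 → c * w ≠ 0 := fun w hw =>
    mul_ne_zero hc0 fun h => hw (by rw [h]; rfl)
  by_cases hs : Real.sin θ = 0
  · rcases h0.eq_or_lt with rfl | h0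
    · obtain ⟨w, h2, h3⟩ := lissajous_derivative_eval_one (c := c) (a₁ := a₁) (k := k) ha₂ hl
      simpa [h2] using hw w h3
    · rcases h1.eq_or_lt with rfl | h1
      · obtain ⟨w, h2, h3⟩ := lissajous_derivative_eval_neg_one (c := c) (a₁ := a₁) (k := k) ha₂ hl
        simpa [h2] using hw w h3
      · exact absurd hs (Real.sin_pos_of_pos_of_lt_pi h0 h1).ne'
  · intro h
    have h2 := lissajous_derivative_eval_cos (c := c) (a₁ := a₁) (a₂ := a₂) (k := k) (l := l) θ
    rw [h, zero_mul] at h2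
    refine mul_ne_zero hc0 (ofReal_add_mul_I_ne_zero ?_) h2.symm
    rintro ⟨h3, h4⟩
    have hk' : (k : ℝ) ≠ 0 := by positivity
    have hl' : (l : ℝ) ≠ 0 := by positivity
    simp only [mul_eq_zero, ha₁, ha₂, hk', hl', false_or] at h3 h4
    exact hs (eq_zero_of_sin_eq_zero hc h3 h4)

theorem lissajous_cross_ne_zero (hc0 : c ≠ 0) (ha₁ : a₁ ≠ 0) (ha₂ : a₂ ≠ 0) (hk : 0 < k)
    (hl : 0 < l) (hc : k.Coprime l) {i j : ℕ} (h : IsNode k l i j) :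
    cross ((lissajous c a₁ a₂ k l).derivative.eval ((Real.cos (nodeLarge k l i j) : ℝ) : ℂ))
      ((lissajous c a₁ a₂ k l).derivative.eval ((Real.cos (nodeSmall k l i j) : ℝ) : ℂ)) ≠ 0 := by
  intro h0
  have h1 := lissajous_derivative_eval_cos (c := c) (a₁ := a₁) (a₂ := a₂) (k := k) (l := l)
    (nodeLarge k l i j)
  have h2 := lissajous_derivative_eval_cos (c := c) (a₁ := a₁) (a₂ := a₂) (k := k) (l := l)
    (nodeSmall k l i j)
  have h3 := h.cross_ne_zero hk hl hc
  rw [mul_comm, ← Complex.real_smul] at h1 h2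
  have h4 : cross (Real.sin (nodeLarge k l i j) •
      (lissajous c a₁ a₂ k l).derivative.eval ((Real.cos (nodeLarge k l i j) : ℝ) : ℂ))
      (Real.sin (nodeSmall k l i j) •
      (lissajous c a₁ a₂ k l).derivative.eval ((Real.cos (nodeSmall k l i j) : ℝ) : ℂ)) = 0 := by
    rw [cross_smul_left, cross_smul_right, h0, mul_zero, mul_zero]
  rw [h1, h2, cross_mul_left] at h4
  have h5 := (mul_eq_zero.1 h4).resolve_left (Complex.normSq_pos.2 hc0).ne'
  simp only [cross, Complex.add_re, Complex.add_im, Complex.ofReal_re, Complex.ofReal_im,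
    Complex.re_ofReal_mul, Complex.im_ofReal_mul, Complex.I_re, Complex.I_im, mul_zero, mul_one,
    add_zero, zero_add] at h5
  have hk' : (k : ℝ) ≠ 0 := by positivity
  have hl' : (l : ℝ) ≠ 0 := by positivity
  refine mul_ne_zero (mul_ne_zero (mul_ne_zero ha₁ ha₂) (mul_ne_zero hk' hl')) h3 ?_
  linear_combination h5

theorem eq_of_lissajous_eq (hc0 : c ≠ 0) (ha₁ : a₁ ≠ 0) (ha₂ : a₂ ≠ 0) {e : ℕ} {θ θ' : ℝ}
    (h : (lissajous c a₁ a₂ k l).eval ((Real.cos θ : ℝ) : ℂ) =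
      (-1) ^ e * (lissajous c a₁ a₂ k l).eval ((Real.cos θ' : ℝ) : ℂ)) :
    Real.cos (k * θ) = (-1) ^ e * Real.cos (k * θ') ∧
      Real.cos (l * θ) = (-1) ^ e * Real.cos (l * θ') := by
  rw [lissajous_eval_cos, lissajous_eval_cos, mul_left_comm] at h
  have h := mul_left_cancel₀ hc0 h
  have hs : ((-1 : ℂ)) ^ e = (((-1 : ℝ) ^ e : ℝ) : ℂ) := by push_cast; rfl
  rw [hs] at h
  have h1 := congrArg Complex.re h
  have h2 := congrArg Complex.im h
  simp only [Complex.add_re, Complex.add_im, Complex.ofReal_re, Complex.ofReal_im,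
    Complex.re_ofReal_mul, Complex.im_ofReal_mul, Complex.I_re, Complex.I_im, mul_zero, mul_one,
    add_zero, zero_add] at h1 h2
  exact ⟨mul_left_cancel₀ ha₁ (by linarith), mul_left_cancel₀ ha₂ (by linarith)⟩

theorem lissajous_node (hk : 0 < k) (hl : 0 < l) {i j : ℕ} (h : IsNode k l i j) :
    (lissajous c a₁ a₂ k l).eval ((Real.cos (nodeSmall k l i j) : ℝ) : ℂ) =
      (-1) ^ i * (lissajous c a₁ a₂ k l).eval ((Real.cos (nodeLarge k l i j) : ℝ) : ℂ) := by
  rw [lissajous_eval_cos, lissajous_eval_cos, h.cos_mul_nodeSmall hk, h.cos_mul_nodeSmall' hl]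
  push_cast
  ring

/-- Both cosines vanish only at `θ = mπ/2` with `km` and `lm` odd. This requires `k` and `l` odd,
and then the first such angle is `π/2`. -/
theorem lissajous_eval_ne_zero (hc0 : c ≠ 0) (ha₁ : a₁ ≠ 0) (ha₂ : a₂ ≠ 0)
    (hc : k.Coprime l) {θ : ℝ} (h0 : 0 ≤ θ)
    (h1 : (k + l) % 2 = 1 ∨ θ < Real.pi / 2) :
    (lissajous c a₁ a₂ k l).eval ((Real.cos θ : ℝ) : ℂ) ≠ 0 := by
  rw [lissajous_eval_cos]
  refine mul_ne_zero hc0 (ofReal_add_mul_I_ne_zero ?_)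
  rintro ⟨h3, h4⟩
  simp only [mul_eq_zero, ha₁, ha₂, false_or] at h3 h4
  obtain ⟨m, hm, h5, h6⟩ := exists_of_cos_eq_zero hc h3 h4
  rw [Int.odd_mul] at h5 h6
  rcases h1 with h1 | h1
  · have h7 := h5.1
    have h8 := h6.1
    rw [Int.odd_iff] at h7 h8
    omega
  · have hpi := Real.pi_pos
    have h7 : (m : ℝ) < 1 := by nlinarith
    have h8 : (0 : ℝ) ≤ m := by
      by_contra h9
      nlinarith [not_le.1 h9]
    have h9 : m < 1 := by exact_mod_cast h7
    have h10 : 0 ≤ m := by exact_mod_cast h8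
    have h11 : m = 0 := by omega
    rw [h11] at h5
    exact absurd h5.2 (by decide)

/-- Equal values at two angles are classified by `exists_node` with `e = 0`. The degenerate
alternative would make `k` and `l` both even. -/
theorem isArc_lissajous (hc0 : c ≠ 0) (ha₁ : a₁ ≠ 0) (ha₂ : a₂ ≠ 0) (hk : 0 < k)
    (hl : 0 < l) (hc : k.Coprime l) :
    ∃ E, IsArc (lissajous c a₁ a₂ k l) E ∧ 2 * E.card = (k - 1) * (l - 1) := by
  have hn := fun x (hx : x ∈ evenNodes k l) => isNode_of_mem_evenNodes hx
  have hev : ∀ x ∈ evenNodes k l, x.1 % 2 = 0 := fun x hx => by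
    simp only [evenNodes, Finset.mem_filter] at hx
    exact hx.1.2.1
  obtain ⟨E, hE, hcard⟩ := IsArc.of_angles (α := lissajous c a₁ a₂ k l) (evenNodes k l)
    (fun x => nodeLarge k l x.1 x.2) (fun x => nodeSmall k l x.1 x.2)
    (fun x hx => (hn x hx).nodeSmall_pos hk hl hc)
    (fun x hx => (hn x hx).nodeSmall_lt_nodeLarge hk hl)
    (fun x hx => (hn x hx).nodeLarge_lt_pi hk hl)
    (fun θ h0 h1 => lissajous_derivative_ne_zero hc0 ha₁ ha₂ hk hl hc h0 h1)
    (fun x hx => by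
      rw [lissajous_node hk hl (hn x hx), neg_one_pow_eq_pow_mod_two, hev x hx, pow_zero, one_mul])
    (fun x hx => lissajous_cross_ne_zero hc0 ha₁ ha₂ hk hl hc (hn x hx))
    (by
      intro θ θ' h0 h1 h2 h
      have h3 := eq_of_lissajous_eq (e := 0) (θ := θ) (θ' := θ') hc0 ha₁ ha₂
        (by rw [pow_zero, one_mul]; exact h)
      rcases exists_node (e := 0) hk hl hc h0 h1 h2 h3.1 h3.2 with
        ⟨i, j, hi, hj, hi2, hj2, h4, h5, h6⟩ | ⟨_, h4, h5⟩
      · have h7 := two_mul_ne_of_parity hk hl hc hi hj (by omega) (Or.inr hi2)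
        have h8 := lt_of_le_of_ne h6 h7
        have h9 := lt_of_mul_add_mul_lt hk hl hi hj h8
        refine ⟨(i, j), ?_, h4.symm, h5.symm⟩
        simp only [evenNodes, Finset.mem_filter, Finset.mem_product, Finset.mem_Ico]
        exact ⟨⟨⟨⟨hi, h9.1⟩, hj, h9.2⟩, hi2, hj2⟩, h8⟩
      · have := Nat.dvd_gcd (Nat.dvd_of_mod_eq_zero h4) (Nat.dvd_of_mod_eq_zero h5)
        rw [hc] at this
        omega)
    (by
      intro x hx y hy h
      have := (hn x hx).eq_of_nodeSmall_eq hk hl hc (hn y hy) (Or.inr (Or.inl ⟨hev x hx, hev y hy⟩)) h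
      exact Prod.ext this.1 this.2)
  exact ⟨E, hE, by rw [hcard]; exact two_mul_card_evenNodes hk hl hc⟩

/-- Squaring multiplies the two tangents at a node by `2p` and `2q = ±2p`, that is, by the same
complex number up to sign. -/
theorem cross_sq_derivative_ne_zero {p q p' q' : ℂ} {e : ℕ} (hp : p ≠ 0) (hq : q = (-1) ^ e * p)
    (h : cross p' q' ≠ 0) : cross (2 * p * p') (2 * q * q') ≠ 0 := by
  rw [hq, show 2 * ((-1) ^ e * p) * q' = ((-1 : ℝ) ^ e) • (2 * p * q') by
    rw [Complex.real_smul]; push_cast; ring, cross_smul_right, cross_mul_left]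
  exact mul_ne_zero (by simp) (mul_ne_zero (Complex.normSq_pos.2 (by simpa using hp)).ne' h)

/-- Double points of the square are pairs of angles with equal or opposite values, so the odd nodes
enter too. For `k + l` odd the arc avoids the branch point `0`, and the degenerate alternative of
`exists_node` is ruled out by parity. -/
theorem isArc_lissajous_sq (hc0 : c ≠ 0) (ha₁ : a₁ ≠ 0) (ha₂ : a₂ ≠ 0) (hk : 0 < k)
    (hl : 0 < l) (hc : k.Coprime l) (hkl : (k + l) % 2 = 1) :
    ∃ E, IsArc (lissajous c a₁ a₂ k l ^ 2) E ∧ 2 * E.card = (k - 1) * (l - 1) + k * l := by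
  have hn := fun x (hx : x ∈ squareNodes k l) => isNode_of_mem_squareNodes hkl hx
  have hder : ∀ z : ℂ, (lissajous c a₁ a₂ k l ^ 2).derivative.eval z =
      2 * (lissajous c a₁ a₂ k l).eval z * (lissajous c a₁ a₂ k l).derivative.eval z := by
    intro z; simp [Polynomial.derivative_pow]
  have hne := fun θ (h0 : 0 ≤ θ) =>
    lissajous_eval_ne_zero (θ := θ) hc0 ha₁ ha₂ hc h0 (Or.inl hkl)
  have hsq : ∀ i : ℕ, (((-1 : ℂ)) ^ i) ^ 2 = 1 := fun i => by
    rw [← pow_mul, mul_comm, pow_mul]; simp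
  obtain ⟨E, hE, hcard⟩ := IsArc.of_angles (α := lissajous c a₁ a₂ k l ^ 2) (squareNodes k l)
    (fun x => nodeLarge k l x.1 x.2) (fun x => nodeSmall k l x.1 x.2)
    (fun x hx => (hn x hx).nodeSmall_pos hk hl hc)
    (fun x hx => (hn x hx).nodeSmall_lt_nodeLarge hk hl)
    (fun x hx => (hn x hx).nodeLarge_lt_pi hk hl)
    (fun θ h0 h1 => by
      rw [hder]
      exact mul_ne_zero (mul_ne_zero two_ne_zero (hne θ h0))
        (lissajous_derivative_ne_zero hc0 ha₁ ha₂ hk hl hc h0 h1))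
    (fun x hx => by
      rw [Polynomial.eval_pow, Polynomial.eval_pow, lissajous_node hk hl (hn x hx), mul_pow, hsq,
        one_mul])
    (fun x hx => by
      rw [hder, hder]
      have h0 := (hn x hx).nodeSmall_pos hk hl hc
      have h1 := (hn x hx).nodeSmall_lt_nodeLarge hk hl
      exact cross_sq_derivative_ne_zero (hne _ (by linarith)) (lissajous_node hk hl (hn x hx))
        (lissajous_cross_ne_zero hc0 ha₁ ha₂ hk hl hc (hn x hx)))
    (by
      intro θ θ' h0 h1 h2 h
      rw [Polynomial.eval_pow, Polynomial.eval_pow] at h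
      obtain ⟨e, he⟩ : ∃ e : ℕ, (lissajous c a₁ a₂ k l).eval ((Real.cos θ : ℝ) : ℂ) =
          (-1) ^ e * (lissajous c a₁ a₂ k l).eval ((Real.cos θ' : ℝ) : ℂ) := by
        rcases sq_eq_sq_iff_eq_or_eq_neg.1 h with h | h
        · exact ⟨0, by rw [h]; simp⟩
        · exact ⟨1, by rw [h]; simp⟩
      have h3 := eq_of_lissajous_eq hc0 ha₁ ha₂ he
      rcases exists_node hk hl hc h0 h1 h2 h3.1 h3.2 with
        ⟨i, j, hi, hj, hi2, hj2, h4, h5, h6⟩ | ⟨_, h4, h5⟩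
      · have h7 := two_mul_ne_of_parity hk hl hc hi hj (by omega) (Or.inl hkl)
        have h8 := lt_of_le_of_ne h6 h7
        have h9 := lt_of_mul_add_mul_lt hk hl hi hj h8
        refine ⟨(i, j), ?_, h4.symm, h5.symm⟩
        simp only [squareNodes, Finset.mem_filter, Finset.mem_product, Finset.mem_Ico]
        exact ⟨⟨⟨⟨hi, h9.1⟩, hj, h9.2⟩, by omega⟩, h8⟩
      · omega)
    (by
      intro x hx y hy h
      have := (hn x hx).eq_of_nodeSmall_eq hk hl hc (hn y hy) (Or.inl hkl) h
      exact Prod.ext this.1 this.2)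
  exact ⟨E, hE, by rw [hcard]; exact two_mul_card_squareNodes hk hl hc hkl⟩

/-- Use `2T_k² = T_{2k} + 1` and `2T_k T_l = T_{k+l} + T_{k-l}`. In the square the constants cancel
because `a₁² = a₂² = 1`, and the remaining indices are even, so it is a polynomial in `T₂`. -/
theorem lissajousFold_comp (ha₁ : a₁ ^ 2 = 1) (ha₂ : a₂ ^ 2 = 1) (hk2 : k % 2 = 1)
    (hl2 : l % 2 = 1) : (lissajousFold c a₁ a₂ k l).comp (Polynomial.Chebyshev.T ℂ 2) =
      lissajous c a₁ a₂ k l ^ 2 := by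
  have h1 : (k : ℤ) + l = ((k : ℤ) + l) / 2 * 2 := by omega
  have h2 : (k : ℤ) - l = ((k : ℤ) - l) / 2 * 2 := by omega
  have e1 := Polynomial.Chebyshev.T_mul_T ℂ (k : ℤ) k
  have e2 := Polynomial.Chebyshev.T_mul_T ℂ (l : ℤ) l
  have e3 := Polynomial.Chebyshev.T_mul_T ℂ (k : ℤ) l
  rw [h1, h2] at e3
  rw [sub_self, Polynomial.Chebyshev.T_zero, ← mul_two] at e1 e2
  have ha₁' : (Polynomial.C (a₁ : ℂ)) ^ 2 = 1 := by
    rw [← map_pow, ← Complex.ofReal_pow, ha₁]; simp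
  have ha₂' : (Polynomial.C (a₂ : ℂ)) ^ 2 = 1 := by
    rw [← map_pow, ← Complex.ofReal_pow, ha₂]; simp
  have hI : (Polynomial.C Complex.I) ^ 2 = -1 := by
    rw [← map_pow, Complex.I_sq]; simp
  have hh : Polynomial.C (1 / 2 : ℂ) * 2 = 1 := by
    rw [show (2 : Polynomial ℂ) = Polynomial.C 2 by rfl, ← map_mul]; norm_num
  simp only [lissajousFold, lissajous, Polynomial.mul_comp, Polynomial.add_comp,
    Polynomial.sub_comp, Polynomial.C_comp, ← Polynomial.Chebyshev.T_mul]
  simp only [map_mul, map_pow]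
  linear_combination (Polynomial.C c ^ 2) * (-(Polynomial.C (1 / 2 : ℂ)) * e1 +
    Polynomial.C (1 / 2 : ℂ) * e2 - Polynomial.C (a₁ : ℂ) * Polynomial.C (a₂ : ℂ) * Polynomial.C Complex.I * e3 +
    (Polynomial.Chebyshev.T ℂ k ^ 2 - Polynomial.Chebyshev.T ℂ l ^ 2) * hh
    - (Polynomial.Chebyshev.T ℂ k ^ 2) * ha₁' - (Polynomial.C (a₂ : ℂ)) ^ 2 * (Polynomial.Chebyshev.T ℂ l ^ 2) * hI
    + (Polynomial.Chebyshev.T ℂ l ^ 2) * ha₂')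

end

section

variable {c : ℂ} {a₁ a₂ : ℝ} {k l : ℕ}

theorem lissajousFold_eval (ha₁ : a₁ ^ 2 = 1) (ha₂ : a₂ ^ 2 = 1) (hk2 : k % 2 = 1)
    (hl2 : l % 2 = 1) (θ : ℝ) :
    (lissajousFold c a₁ a₂ k l).eval ((Real.cos (2 * θ) : ℝ) : ℂ) =
      (lissajous c a₁ a₂ k l).eval ((Real.cos θ : ℝ) : ℂ) ^ 2 := by
  have h := congrArg (Polynomial.eval ((Real.cos θ : ℝ) : ℂ))
    (lissajousFold_comp (c := c) ha₁ ha₂ hk2 hl2)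
  rw [Polynomial.eval_comp, Polynomial.eval_pow] at h
  rw [← h, Complex.ofReal_cos, Complex.ofReal_cos, Polynomial.Chebyshev.T_complex_cos]
  push_cast
  rfl

theorem lissajousFold_derivative_comp (ha₁ : a₁ ^ 2 = 1) (ha₂ : a₂ ^ 2 = 1) (hk2 : k % 2 = 1)
    (hl2 : l % 2 = 1) : 4 * Polynomial.X *
      (lissajousFold c a₁ a₂ k l).derivative.comp (Polynomial.Chebyshev.T ℂ 2) =
      2 * lissajous c a₁ a₂ k l * (lissajous c a₁ a₂ k l).derivative := by
  have h := congrArg Polynomial.derivative (lissajousFold_comp (c := c) ha₁ ha₂ hk2 hl2)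
  rw [Polynomial.derivative_comp, Polynomial.derivative_sq, Polynomial.Chebyshev.T_two] at h
  rw [Polynomial.Chebyshev.T_two]
  have h2 : Polynomial.derivative (2 * Polynomial.X ^ 2 - 1 : Polynomial ℂ) = 4 * Polynomial.X := by
    simp
    ring
  rw [h2] at h
  rw [h]
  rfl

theorem lissajousFold_derivative_eval (ha₁ : a₁ ^ 2 = 1) (ha₂ : a₂ ^ 2 = 1) (hk2 : k % 2 = 1)
    (hl2 : l % 2 = 1) (θ : ℝ) : (4 * Real.cos θ : ℝ) •
      (lissajousFold c a₁ a₂ k l).derivative.eval ((Real.cos (2 * θ) : ℝ) : ℂ) =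
      2 * (lissajous c a₁ a₂ k l).eval ((Real.cos θ : ℝ) : ℂ) *
        (lissajous c a₁ a₂ k l).derivative.eval ((Real.cos θ : ℝ) : ℂ) := by
  have h := congrArg (Polynomial.eval ((Real.cos θ : ℝ) : ℂ))
    (lissajousFold_derivative_comp (c := c) ha₁ ha₂ hk2 hl2)
  simp only [Polynomial.eval_mul, Polynomial.eval_comp, Polynomial.eval_X, Polynomial.eval_ofNat] at h
  rw [← h, Complex.real_smul, Complex.ofReal_cos, Complex.ofReal_cos,
    Polynomial.Chebyshev.T_complex_cos]
  push_cast
  rfl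

theorem lissajous_eval_zero (hk2 : k % 2 = 1) (hl2 : l % 2 = 1) :
    (lissajous c a₁ a₂ k l).eval 0 = 0 := by
  have h : ∀ n : ℕ, n % 2 = 1 → (Polynomial.Chebyshev.T ℂ n).eval 0 = 0 := fun n hn =>
    Polynomial.Chebyshev.T_eval_zero_of_odd ℂ (by rw [Int.odd_iff]; omega)
  simp [lissajous, h k hk2, h l hl2]

theorem lissajous_derivative_eval_zero (ha₂ : a₂ ≠ 0) (hl2 : l % 2 = 1) :
    ∃ w : ℂ, (lissajous c a₁ a₂ k l).derivative.eval 0 = c * w ∧ w.im ≠ 0 := by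
  have h := lissajous_derivative_eval_cos (c := c) (a₁ := a₁) (a₂ := a₂) (k := k) (l := l)
    (Real.pi / 2)
  rw [Real.cos_pi_div_two, Real.sin_pi_div_two, Complex.ofReal_one, mul_one, Complex.ofReal_zero] at h
  refine ⟨_, h, ?_⟩
  have hsin : Real.sin (l * (Real.pi / 2)) ≠ 0 := by
    intro h0
    obtain ⟨n, hn⟩ := Real.sin_eq_zero_iff.1 h0
    have h1 : (n : ℝ) * 2 = l := mul_left_cancel₀ Real.pi_ne_zero (by linear_combination 2 * hn)
    have h2 : n * 2 = (l : ℤ) := by exact_mod_cast h1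
    omega
  have hl' : (l : ℝ) ≠ 0 := by
    have : l ≠ 0 := by omega
    exact_mod_cast this
  simp only [Complex.add_im, Complex.ofReal_im, Complex.im_ofReal_mul, Complex.I_im, mul_one, zero_add]
  exact mul_ne_zero (mul_ne_zero ha₂ hl') hsin

/-- At `-1 = T₂(0)` the factor `4X` of the derivative identity vanishes. Differentiating that
identity once more at `0`, where the arc passes through the origin, gives the value. -/
theorem lissajousFold_derivative_eval_neg_one (ha₁ : a₁ ^ 2 = 1) (ha₂ : a₂ ^ 2 = 1)
    (hk2 : k % 2 = 1) (hl2 : l % 2 = 1) :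
    2 * (lissajousFold c a₁ a₂ k l).derivative.eval (-1) =
      (lissajous c a₁ a₂ k l).derivative.eval 0 ^ 2 := by
  have h := congrArg (Polynomial.eval 0) (congrArg Polynomial.derivative
    (lissajousFold_derivative_comp (c := c) ha₁ ha₂ hk2 hl2))
  simp only [Polynomial.derivative_mul, Polynomial.derivative_X, Polynomial.derivative_ofNat,
    Polynomial.eval_add, Polynomial.eval_mul, Polynomial.eval_comp, Polynomial.Chebyshev.T_two,
    Polynomial.eval_X, Polynomial.eval_ofNat, lissajous_eval_zero hk2 hl2] at h
  simp at h
  linear_combination (1 / 2 : ℂ) * h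

/-- For `k`, `l` odd the angles `θ` and `π - θ` have opposite values, so the square runs over its
image twice. The quotient is parametrized by `2θ` with `θ ≤ π/2`. It ends at the branch point `0`,
and its double points are the nodes with large angle below `π/2`. -/
theorem isArc_lissajousFold (hc0 : c ≠ 0) (ha₁ : a₁ ^ 2 = 1) (ha₂ : a₂ ^ 2 = 1) (hk2 : k % 2 = 1)
    (hl2 : l % 2 = 1) (hc : k.Coprime l) :
    ∃ E, IsArc (lissajousFold c a₁ a₂ k l) E ∧ 4 * E.card = (k - 1) * (l - 1) := by
  have hk : 0 < k := by omega
  have hl : 0 < l := by omega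
  have hpi := Real.pi_pos
  have ha₁' : a₁ ≠ 0 := by rintro rfl; norm_num at ha₁
  have ha₂' : a₂ ≠ 0 := by rintro rfl; norm_num at ha₂
  have hn := fun x (hx : x ∈ foldNodes k l) => isNode_of_mem_foldNodes hk hl hx
  have hlt : ∀ x ∈ foldNodes k l, x.1 * l + x.2 * k < k * l := fun x hx => by
    simp only [foldNodes, Finset.mem_filter] at hx
    exact hx.2
  have hlarge : ∀ x ∈ foldNodes k l, nodeLarge k l x.1 x.2 < Real.pi / 2 := fun x hx => by
    have h := IsNode.add_div_lt (i := x.1) (j := x.2) hk hl (c := 1) (by rw [one_mul]; exact hlt x hx)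
    rw [Nat.cast_one] at h
    unfold nodeLarge
    nlinarith
  have hpos : ∀ θ, 0 ≤ θ → θ < Real.pi / 2 → 0 < Real.cos θ := fun θ h0 h1 =>
    Real.cos_pos_of_mem_Ioo ⟨by linarith, h1⟩
  have hne := fun θ (h0 : 0 ≤ θ) (h1 : θ < Real.pi / 2) =>
    lissajous_eval_ne_zero (θ := θ) hc0 ha₁' ha₂' hc h0 (Or.inr h1)
  have hsq : ∀ i : ℕ, (((-1 : ℂ)) ^ i) ^ 2 = 1 := fun i => by
    rw [← pow_mul, mul_comm, pow_mul]; simp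
  obtain ⟨E, hE, hcard⟩ := IsArc.of_angles (α := lissajousFold c a₁ a₂ k l) (foldNodes k l)
    (fun x => 2 * nodeLarge k l x.1 x.2) (fun x => 2 * nodeSmall k l x.1 x.2)
    (fun x hx => by linarith [(hn x hx).nodeSmall_pos hk hl hc])
    (fun x hx => by linarith [(hn x hx).nodeSmall_lt_nodeLarge hk hl])
    (fun x hx => by linarith [hlarge x hx])
    (fun θ h0 h1 => by
      rcases h1.lt_or_eq with h1 | rfl
      · have h := lissajousFold_derivative_eval (c := c) ha₁ ha₂ hk2 hl2 (θ / 2)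
        rw [mul_div_cancel₀ _ two_ne_zero] at h
        intro h2
        rw [h2, smul_zero] at h
        exact mul_ne_zero (mul_ne_zero two_ne_zero (hne _ (by linarith) (by linarith)))
          (lissajous_derivative_ne_zero hc0 ha₁' ha₂' hk hl hc (by linarith) (by linarith)) h.symm
      · have h := lissajousFold_derivative_eval_neg_one (c := c) ha₁ ha₂ hk2 hl2
        obtain ⟨w, hw, hw'⟩ := lissajous_derivative_eval_zero (c := c) (a₁ := a₁) (k := k) ha₂' hl2
        intro h2
        rw [Real.cos_pi, Complex.ofReal_neg, Complex.ofReal_one] at h2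
        rw [h2, mul_zero, hw] at h
        exact pow_ne_zero 2 (mul_ne_zero hc0 fun h3 => hw' (by rw [h3]; rfl)) h.symm)
    (fun x hx => by
      rw [lissajousFold_eval ha₁ ha₂ hk2 hl2, lissajousFold_eval ha₁ ha₂ hk2 hl2,
        lissajous_node hk hl (hn x hx), mul_pow, hsq, one_mul])
    (fun x hx h => by
      have h0 := (hn x hx).nodeSmall_pos hk hl hc
      have h1 := (hn x hx).nodeSmall_lt_nodeLarge hk hl
      have h2 := cross_sq_derivative_ne_zero (hne _ (by linarith) (hlarge x hx))
        (lissajous_node hk hl (hn x hx)) (lissajous_cross_ne_zero hc0 ha₁' ha₂' hk hl hc (hn x hx))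
      rw [← lissajousFold_derivative_eval ha₁ ha₂ hk2 hl2,
        ← lissajousFold_derivative_eval ha₁ ha₂ hk2 hl2, cross_smul_left, cross_smul_right, h] at h2
      simp at h2)
    (by
      intro θ θ' h0 h1 h2 h
      have h' := lissajousFold_eval (c := c) ha₁ ha₂ hk2 hl2 (θ / 2)
      have h'' := lissajousFold_eval (c := c) ha₁ ha₂ hk2 hl2 (θ' / 2)
      rw [mul_div_cancel₀ _ two_ne_zero] at h' h''
      rw [h', h''] at h
      obtain ⟨e, he⟩ : ∃ e : ℕ, (lissajous c a₁ a₂ k l).eval ((Real.cos (θ / 2) : ℝ) : ℂ) =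
          (-1) ^ e * (lissajous c a₁ a₂ k l).eval ((Real.cos (θ' / 2) : ℝ) : ℂ) := by
        rcases sq_eq_sq_iff_eq_or_eq_neg.1 h with h | h
        · exact ⟨0, by rw [h]; simp⟩
        · exact ⟨1, by rw [h]; simp⟩
      have h3 := eq_of_lissajous_eq hc0 ha₁' ha₂' he
      rcases exists_node hk hl hc (by linarith) (by linarith) (by linarith) h3.1 h3.2 with
        ⟨i, j, hi, hj, hi2, hj2, h4, h5, h6⟩ | ⟨h6, h4, h5⟩
      · have h7 : i * l + j * k ≠ 1 * (k * l) := by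
          intro h7
          obtain ⟨a, b, rfl, rfl, hab⟩ := eq_of_mul_add_mul_eq hk hl hc h7
          have := Nat.pos_of_mul_pos_left hi
          have := Nat.pos_of_mul_pos_left hj
          omega
        have h8 : i * l + j * k ≤ k * l := by
          have h9 : nodeLarge k l i j ≤ Real.pi / 2 := by rw [← h5]; linarith
          unfold nodeLarge at h9
          have h10 : (i : ℝ) / k + j / l ≤ 1 := by nlinarith
          rw [div_add_div _ _ (by positivity) (by positivity), div_le_iff₀ (by positivity)] at h10
          have h11 : ((i * l + j * k : ℕ) : ℝ) ≤ ((k * l : ℕ) : ℝ) := by push_cast; linarith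
          exact_mod_cast h11
        have h8 : i * l + j * k < 1 * (k * l) := lt_of_le_of_ne (by rwa [one_mul]) h7
        have h9 := lt_of_mul_add_mul_lt hk hl hi hj h8
        rw [one_mul, one_mul] at h9
        rw [one_mul] at h8
        refine ⟨(i, j), ?_, by simp only [← h4]; ring, by simp only [← h5]; ring⟩
        simp only [foldNodes, Finset.mem_filter, Finset.mem_product, Finset.mem_Ico]
        exact ⟨⟨⟨⟨hi, h9.1⟩, hj, h9.2⟩, by omega⟩, h8⟩
      · linarith)
    (by
      intro x hx y hy h
      have := (hn x hx).eq_of_nodeSmall_eq hk hl hc (hn y hy)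
        (Or.inr (Or.inr (by linarith [hlt x hx, hlt y hy]))) (by linarith)
      exact Prod.ext this.1 this.2)
  exact ⟨E, hE, by rw [hcard]; exact four_mul_card_foldNodes hk hl hc hk2 hl2⟩

/-! ### Thin curves along Lissajous arcs -/

/-- The thin Lissajous curve. -/
def thinLissajous (c : ℂ) (a₁ a₂ b : ℝ) (k l : ℕ) (ε t : ℝ) : ℂ :=
  c * ((a₁ * Real.cos (k * t) + ε * (b * Real.sin (k * t)) : ℝ) +
    (a₂ * Real.cos (l * t) : ℝ) * Complex.I)

theorem thinLissajous_eq (b ε t : ℝ) : thinLissajous c a₁ a₂ b k l ε t =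
    (lissajous c a₁ a₂ k l).eval ((Real.cos t : ℝ) : ℂ) +
      ε • (c * ((b * Real.sin (k * t) : ℝ) : ℂ)) := by
  rw [lissajous_eval_cos, thinLissajous, Complex.real_smul]
  push_cast
  ring

theorem hasDerivAt_displacement (b v t : ℝ) :
    HasDerivAt (fun t : ℝ => c * ((b * Real.sin (v * t) : ℝ) : ℂ))
      (c * ((b * (Real.cos (v * t) * v) : ℝ) : ℂ)) t := by
  have h1 : HasDerivAt (fun t : ℝ => b * Real.sin (v * t)) (b * (Real.cos (v * t) * v)) t := by
    have := (((hasDerivAt_id t).const_mul v).sin).const_mul b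
    simpa using this
  exact h1.ofReal_comp.const_mul c

theorem contDiff_displacement (b v : ℝ) :
    ContDiff ℝ ∞ (fun p : ℝ × ℝ => c * ((b * Real.sin (v * p.2) : ℝ) : ℂ)) := by
  have h1 : ContDiff ℝ ∞ (fun p : ℝ × ℝ => b * Real.sin (v * p.2)) := by fun_prop
  exact contDiff_const.mul (Complex.ofRealCLM.contDiff.comp h1)

theorem thinLissajous_reduces (hc0 : c ≠ 0) (ha₁ : a₁ ≠ 0) (ha₂ : a₂ ≠ 0) {b : ℝ} (hb : b ≠ 0)
    (hk : 0 < k) (hl : 0 < l) (hc : k.Coprime l) :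
    ∃ n, 2 * n = (k - 1) * (l - 1) ∧ ∀ᶠ ε in 𝓝[>] (0 : ℝ),
      ReducesToStandard (fun t => thinLissajous c a₁ a₂ b k l ε (2 * Real.pi * t)) n := by
  obtain ⟨E, hE, hcard⟩ := isArc_lissajous (c := c) hc0 ha₁ ha₂ hk hl hc
  have hpi := Real.pi_pos
  have hk' : (k : ℝ) ≠ 0 := by positivity
  refine ⟨E.card, hcard, ?_⟩
  have hd := fun t : ℝ => (hasDerivAt_displacement (c := c) b (k * (2 * Real.pi)) t).deriv
  have h := hE.eventually_reduces
    (B := fun p : ℝ × ℝ => c * ((b * Real.sin (k * (2 * Real.pi) * p.2) : ℝ) : ℂ))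
    (contDiff_displacement b _) (fun ε t => by
      simp only
      rw [show (k : ℝ) * (2 * Real.pi) * (t + 1) = k * (2 * Real.pi) * t + k * (2 * Real.pi) by ring,
        Real.sin_add_nat_mul_two_pi]) (by
      obtain ⟨w, hw, hw'⟩ := lissajous_derivative_eval_one (c := c) (a₁ := a₁) (k := k) ha₂ hl
      rw [hd 0, hw]
      refine cross_mul_ofReal_ne_zero hc0 hw' ?_
      simp [hb, hk', hpi.ne']) (by
      obtain ⟨w, hw, hw'⟩ := lissajous_derivative_eval_neg_one (c := c) (a₁ := a₁) (k := k) ha₂ hl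
      rw [hd (1 / 2), hw]
      refine cross_mul_ofReal_ne_zero hc0 hw' ?_
      rw [show (k : ℝ) * (2 * Real.pi) * (1 / 2) = k * Real.pi by ring, Real.cos_nat_mul_pi]
      simp [hb, hk', hpi.ne'])
  refine h.mono fun ε hε => ?_
  convert hε using 2 with t
  rw [thinLissajous_eq]
  simp only [mul_assoc]

theorem cross_two_mul (p p' d : ℂ) : cross (2 * p * p') (2 * p * d) =
    Complex.normSq (2 * p) * cross p' d := cross_mul_left _ _ _

/-- Squaring `p + εd` gives the arc `p²` with displacement `2pd + εd²`. At both ends `d` vanishes,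
so the derivative of the displacement is `2pd'`, and transversality to `2pp'` is that of `d'` and
`p'`. -/
theorem thinLissajous_sq_reduces (hc0 : c ≠ 0) (ha₁ : a₁ ≠ 0) (ha₂ : a₂ ≠ 0) {b : ℝ} (hb : b ≠ 0)
    (hk : 0 < k) (hl : 0 < l) (hc : k.Coprime l) (hkl : (k + l) % 2 = 1) :
    ∃ n, 2 * n = (k - 1) * (l - 1) + k * l ∧ ∀ᶠ ε in 𝓝[>] (0 : ℝ),
      ReducesToStandard (fun t => thinLissajous c a₁ a₂ b k l ε (2 * Real.pi * t) ^ 2) n := by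
  obtain ⟨E, hE, hcard⟩ := isArc_lissajous_sq (c := c) hc0 ha₁ ha₂ hk hl hc hkl
  have hpi := Real.pi_pos
  have hk' : (k : ℝ) ≠ 0 := by positivity
  refine ⟨E.card, hcard, ?_⟩
  set p := lissajous c a₁ a₂ k l with hp
  let d : ℝ → ℂ := fun t => c * ((b * Real.sin (k * (2 * Real.pi) * t) : ℝ) : ℂ)
  have hder : ∀ z : ℂ, (p ^ 2).derivative.eval z = 2 * p.eval z * p.derivative.eval z := by
    intro z; simp [Polynomial.derivative_pow]
  have hper : ∀ t, d (t + 1) = d t := fun t => by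
    simp only [d]
    rw [show (k : ℝ) * (2 * Real.pi) * (t + 1) = k * (2 * Real.pi) * t + k * (2 * Real.pi) by ring,
      Real.sin_add_nat_mul_two_pi]
  have hdp : Differentiable ℝ fun t : ℝ => p.eval ((Real.cos (2 * Real.pi * t) : ℝ) : ℂ) := fun t =>
    ((p.hasDerivAt_ofReal _).scomp t (ThinFamily.hasDerivAt_cos_two_pi t)).differentiableAt
  have hd : ∀ t, d t = 0 → deriv (fun t => 2 * p.eval ((Real.cos (2 * Real.pi * t) : ℝ) : ℂ) * d t +
      (0 : ℝ) • d t ^ 2) t = 2 * p.eval ((Real.cos (2 * Real.pi * t) : ℝ) : ℂ) *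
      (c * ((b * (Real.cos (k * (2 * Real.pi) * t) * (k * (2 * Real.pi))) : ℝ) : ℂ)) := by
    intro t ht
    have h1 := ((hdp t).hasDerivAt.const_mul 2).mul (hasDerivAt_displacement (c := c) b
      (k * (2 * Real.pi)) t)
    simp only [zero_smul, add_zero]
    refine h1.deriv.trans ?_
    change _ * d t + _ = _
    rw [ht, mul_zero, zero_add]
  have h := hE.eventually_reduces
    (B := fun q : ℝ × ℝ => 2 * p.eval ((Real.cos (2 * Real.pi * q.2) : ℝ) : ℂ) * d q.2 +
      q.1 • d q.2 ^ 2) (by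
      have h1 : ContDiff ℝ ∞ fun q : ℝ × ℝ => d q.2 := contDiff_displacement b _
      have h2 : ContDiff ℝ ∞ fun q : ℝ × ℝ => ((Real.cos (2 * Real.pi * q.2) : ℝ) : ℂ) :=
        Complex.ofRealCLM.contDiff.comp (f := fun q : ℝ × ℝ => Real.cos (2 * Real.pi * q.2)) (by fun_prop)
      have h3 : ContDiff ℝ ∞ fun q : ℝ × ℝ => p.eval ((Real.cos (2 * Real.pi * q.2) : ℝ) : ℂ) :=
        p.contDiff_eval_real.comp h2
      exact ((contDiff_const.mul h3).mul h1).add (contDiff_fst.smul (h1.pow 2)))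
    (fun ε t => by
      simp only [hper]
      rw [show 2 * Real.pi * (t + 1) = 2 * Real.pi * t + 2 * Real.pi by ring, Real.cos_add_two_pi]) (by
      obtain ⟨w, hw, hw'⟩ := lissajous_derivative_eval_one (c := c) (a₁ := a₁) (k := k) ha₂ hl
      have h0 := lissajous_eval_ne_zero (θ := 0) hc0 ha₁ ha₂ hc le_rfl (Or.inl hkl)
      rw [Real.cos_zero, Complex.ofReal_one] at h0
      rw [hd 0 (by simp [d]), hder, mul_zero, Real.cos_zero, Complex.ofReal_one, cross_two_mul, hw]
      refine mul_ne_zero (Complex.normSq_pos.2 (mul_ne_zero two_ne_zero h0)).ne'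
        (cross_mul_ofReal_ne_zero hc0 hw' ?_)
      simp [hb, hk', hpi.ne']) (by
      obtain ⟨w, hw, hw'⟩ := lissajous_derivative_eval_neg_one (c := c) (a₁ := a₁) (k := k) ha₂ hl
      have h0 := lissajous_eval_ne_zero (θ := Real.pi) hc0 ha₁ ha₂ hc hpi.le (Or.inl hkl)
      rw [Real.cos_pi, Complex.ofReal_neg, Complex.ofReal_one] at h0
      have h1 : (k : ℝ) * (2 * Real.pi) * (1 / 2) = k * Real.pi := by ring
      rw [hd (1 / 2) (by simp only [d, h1, Real.sin_nat_mul_pi]; simp), hder,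
        show 2 * Real.pi * (1 / 2) = Real.pi by ring, Real.cos_pi,
        Complex.ofReal_neg, Complex.ofReal_one, cross_two_mul, hw]
      refine mul_ne_zero (Complex.normSq_pos.2 (mul_ne_zero two_ne_zero h0)).ne'
        (cross_mul_ofReal_ne_zero hc0 hw' ?_)
      rw [h1, Real.cos_nat_mul_pi]
      simp [hb, hk', hpi.ne'])
  refine h.mono fun ε hε => ?_
  convert hε using 2 with t
  rw [thinLissajous_eq, Polynomial.eval_pow]
  simp only [d, mul_assoc, Complex.real_smul]
  ring

/-- The displacement is again `2pd + εd²`; at half speed `p` and `d` both change sign after a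
period, so it is periodic. At `t = 1/2` the arc is at the origin, and the derivative of the
displacement is a multiple of `p'd` instead of `pd'`. -/
theorem thinLissajous_fold_reduces (hc0 : c ≠ 0) (ha₁ : a₁ ^ 2 = 1) (ha₂ : a₂ ^ 2 = 1) {b : ℝ}
    (hb : b ≠ 0) (hk2 : k % 2 = 1) (hl2 : l % 2 = 1) (hc : k.Coprime l) :
    ∃ n, 4 * n = (k - 1) * (l - 1) ∧ ∀ᶠ ε in 𝓝[>] (0 : ℝ),
      ReducesToStandard (fun t => thinLissajous c a₁ a₂ b k l ε (Real.pi * t) ^ 2) n := by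
  obtain ⟨E, hE, hcard⟩ := isArc_lissajousFold (c := c) hc0 ha₁ ha₂ hk2 hl2 hc
  have hpi := Real.pi_pos
  have hk : 0 < k := by omega
  have hl : 0 < l := by omega
  have hk' : (k : ℝ) ≠ 0 := by positivity
  have ha₁' : a₁ ≠ 0 := by rintro rfl; norm_num at ha₁
  have ha₂' : a₂ ≠ 0 := by rintro rfl; norm_num at ha₂
  refine ⟨E.card, hcard, ?_⟩
  set p := lissajous c a₁ a₂ k l with hp
  let d : ℝ → ℂ := fun t => c * ((b * Real.sin (k * Real.pi * t) : ℝ) : ℂ)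
  have hper : ∀ t, d (t + 1) = -d t := fun t => by
    simp only [d]
    rw [show (k : ℝ) * Real.pi * (t + 1) = k * Real.pi * t + k * Real.pi by ring,
      Real.sin_add_nat_mul_pi, Odd.neg_one_pow (Nat.odd_iff.2 hk2)]
    push_cast
    ring
  have hpper : ∀ t : ℝ, p.eval ((Real.cos (Real.pi * (t + 1)) : ℝ) : ℂ) =
      -p.eval ((Real.cos (Real.pi * t) : ℝ) : ℂ) := fun t => by
    rw [hp, lissajous_eval_cos, lissajous_eval_cos,
      show (k : ℝ) * (Real.pi * (t + 1)) = k * (Real.pi * t) + k * Real.pi by ring,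
      show (l : ℝ) * (Real.pi * (t + 1)) = l * (Real.pi * t) + l * Real.pi by ring,
      Real.cos_add_nat_mul_pi, Real.cos_add_nat_mul_pi, Odd.neg_one_pow (Nat.odd_iff.2 hk2),
      Odd.neg_one_pow (Nat.odd_iff.2 hl2)]
    push_cast
    ring
  have hcosd : ∀ t : ℝ, HasDerivAt (fun t : ℝ => Real.cos (Real.pi * t))
      (-Real.sin (Real.pi * t) * Real.pi) t := fun t => by
    have := ((hasDerivAt_id t).const_mul Real.pi).cos
    simpa using this
  have hpd : ∀ t : ℝ, HasDerivAt (fun t : ℝ => p.eval ((Real.cos (Real.pi * t) : ℝ) : ℂ))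
      ((-Real.sin (Real.pi * t) * Real.pi) • p.derivative.eval ((Real.cos (Real.pi * t) : ℝ) : ℂ)) t :=
    fun t => (p.hasDerivAt_ofReal _).scomp t (hcosd t)
  have hd : ∀ t, deriv (fun t => 2 * p.eval ((Real.cos (Real.pi * t) : ℝ) : ℂ) * d t +
      (0 : ℝ) • d t ^ 2) t =
      2 * ((-Real.sin (Real.pi * t) * Real.pi) • p.derivative.eval ((Real.cos (Real.pi * t) : ℝ) : ℂ)) * d t +
      2 * p.eval ((Real.cos (Real.pi * t) : ℝ) : ℂ) *
      (c * ((b * (Real.cos (k * Real.pi * t) * (k * Real.pi)) : ℝ) : ℂ)) := by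
    intro t
    have h1 := ((hpd t).const_mul 2).mul (hasDerivAt_displacement (c := c) b (k * Real.pi) t)
    simp only [zero_smul, add_zero]
    exact h1.deriv
  have h := hE.eventually_reduces
    (B := fun q : ℝ × ℝ => 2 * p.eval ((Real.cos (Real.pi * q.2) : ℝ) : ℂ) * d q.2 +
      q.1 • d q.2 ^ 2) (by
      have h1 : ContDiff ℝ ∞ fun q : ℝ × ℝ => d q.2 := contDiff_displacement b _
      have h2 : ContDiff ℝ ∞ fun q : ℝ × ℝ => ((Real.cos (Real.pi * q.2) : ℝ) : ℂ) :=
        Complex.ofRealCLM.contDiff.comp (f := fun q : ℝ × ℝ => Real.cos (Real.pi * q.2)) (by fun_prop)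
      have h3 : ContDiff ℝ ∞ fun q : ℝ × ℝ => p.eval ((Real.cos (Real.pi * q.2) : ℝ) : ℂ) :=
        p.contDiff_eval_real.comp h2
      exact ((contDiff_const.mul h3).mul h1).add (contDiff_fst.smul (h1.pow 2)))
    (fun ε t => by simp only [hper, hpper, neg_sq]; ring) (by
      obtain ⟨w, hw, hw'⟩ := lissajous_derivative_eval_one (c := c) (a₁ := a₁) (k := k) ha₂' hl
      have h0 := lissajous_eval_ne_zero (θ := 0) hc0 ha₁' ha₂' hc le_rfl (Or.inr (by positivity))
      have h1 := lissajousFold_derivative_eval (c := c) ha₁ ha₂ hk2 hl2 0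
      rw [mul_zero, Real.cos_zero, Complex.ofReal_one, ← hp] at h1
      rw [Real.cos_zero, Complex.ofReal_one, ← hp] at h0
      intro h2
      have h3 := congrArg (fun x => (4 * 1 : ℝ) * x) h2
      simp only at h3
      rw [← cross_smul_left, h1, hd 0] at h3
      have h4 : d 0 = 0 := by simp [d]
      rw [h4, mul_zero, zero_add, mul_zero, Real.cos_zero, Complex.ofReal_one, cross_two_mul, hw] at h3
      refine mul_ne_zero (Complex.normSq_pos.2 (mul_ne_zero two_ne_zero h0)).ne'
        (cross_mul_ofReal_ne_zero hc0 hw' ?_) (h3.trans (mul_zero _))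
      simp [hb, hk', hpi.ne']) (by
      obtain ⟨w, hw, hw'⟩ := lissajous_derivative_eval_zero (c := c) (a₁ := a₁) (k := k) ha₂' hl2
      have h1 := lissajousFold_derivative_eval_neg_one (c := c) ha₁ ha₂ hk2 hl2
      have h0 := lissajous_eval_zero (c := c) (a₁ := a₁) (a₂ := a₂) hk2 hl2
      rw [← hp] at h0 h1 hw
      intro h2
      have h3 := congrArg (fun x => (2 : ℝ) * x) h2
      simp only at h3
      obtain ⟨s, hs, hs'⟩ : ∃ s : ℝ, s ≠ 0 ∧ d (1 / 2) = c * (s : ℂ) := by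
        refine ⟨_, ?_, rfl⟩
        refine mul_ne_zero hb fun h5 => ?_
        obtain ⟨n, hn⟩ := Real.sin_eq_zero_iff.1 h5
        have h6 : (n : ℝ) * 2 = k := mul_left_cancel₀ Real.pi_ne_zero (by linear_combination 2 * hn)
        have h7 : n * 2 = (k : ℤ) := by exact_mod_cast h6
        omega
      rw [← cross_smul_left, Complex.real_smul, Complex.ofReal_ofNat, h1, hd (1 / 2),
        show Real.pi * (1 / 2) = Real.pi / 2 by ring, Real.cos_pi_div_two, Complex.ofReal_zero, h0,
        mul_zero, zero_mul, add_zero, Real.sin_pi_div_two, hs', hw, mul_zero,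
        show (c * w) ^ 2 = (c * w) * (c * w) by ring,
        show 2 * ((-1 * Real.pi) • (c * w)) * (c * (s : ℂ)) =
          (c * w) * (c * ((-2 * Real.pi * s : ℝ) : ℂ)) by
          rw [Complex.real_smul]; push_cast; ring, cross_mul_left] at h3
      have hw0 : w ≠ 0 := fun h => hw' (by rw [h]; rfl)
      refine mul_ne_zero (Complex.normSq_pos.2 (mul_ne_zero hc0 hw0)).ne'
        (cross_mul_ofReal_ne_zero hc0 hw' ?_) h3
      simp [hs, hpi.ne'])
  refine h.mono fun ε hε => ?_
  convert hε using 2 with t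
  have h1 := lissajousFold_eval (c := c) ha₁ ha₂ hk2 hl2 (Real.pi * t)
  rw [← mul_assoc] at h1
  rw [thinLissajous_eq, h1]
  simp only [d, mul_assoc, Complex.real_smul]
  ring

end

/-! ### Functions that oscillate like the cosine -/

/-- A smooth even function of period `1` that changes sign after half a period and decreases in the
first half of the period. -/
structure CosLike (f : ℝ → ℝ) : Prop where
  smooth : ContDiff ℝ ∞ f
  even : ∀ θ, f (-θ) = f θ
  half : ∀ θ, f (θ + 1 / 2) = -f θ
  deriv_neg : ∀ θ ∈ Ioo (0 : ℝ) (1 / 2), deriv f θ < 0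

namespace CosLike

variable {f : ℝ → ℝ} (hf : CosLike f)
include hf

theorem hasDerivAt (θ : ℝ) : HasDerivAt f (deriv f θ) θ :=
  (hf.smooth.differentiable (by simp) θ).hasDerivAt

theorem continuous_deriv : Continuous (deriv f) := hf.smooth.continuous_deriv (by simp)

theorem periodic : Function.Periodic f 1 := fun θ => by
  rw [show θ + 1 = θ + 1 / 2 + 1 / 2 by ring, hf.half, hf.half, neg_neg]

theorem deriv_half (θ : ℝ) : deriv f (θ + 1 / 2) = -deriv f θ := by
  have h1 := (hf.hasDerivAt (θ + 1 / 2)).comp_add_const θ (1 / 2)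
  have h2 : (fun x => f (x + 1 / 2)) = fun x => -f x := funext hf.half
  rw [h2] at h1
  exact h1.unique (hf.hasDerivAt θ).neg

theorem deriv_neg_eq (θ : ℝ) : deriv f (-θ) = -deriv f θ := by
  have h1 := (hf.hasDerivAt (-θ)).scomp θ (hasDerivAt_neg θ)
  have h2 : f ∘ Neg.neg = f := funext hf.even
  rw [h2] at h1
  have := h1.unique (hf.hasDerivAt θ)
  simp at this
  linarith

theorem periodic_deriv : Function.Periodic (deriv f) 1 := fun θ => by
  rw [show θ + 1 = θ + 1 / 2 + 1 / 2 by ring, hf.deriv_half, hf.deriv_half, neg_neg]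

theorem add_half (e : ℕ) (θ : ℝ) : f (θ + e / 2) = (-1) ^ e * f θ := by
  induction e with
  | zero => simp
  | succ e ih =>
    rw [show θ + ((e + 1 : ℕ) : ℝ) / 2 = θ + e / 2 + 1 / 2 by push_cast; ring, hf.half, ih]; ring

theorem deriv_add_half (e : ℕ) (θ : ℝ) : deriv f (θ + e / 2) = (-1) ^ e * deriv f θ := by
  induction e with
  | zero => simp
  | succ e ih =>
    rw [show θ + ((e + 1 : ℕ) : ℝ) / 2 = θ + e / 2 + 1 / 2 by push_cast; ring, hf.deriv_half, ih]
    ring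

theorem strictAntiOn : StrictAntiOn f (Icc 0 (1 / 2)) :=
  strictAntiOn_of_deriv_neg (convex_Icc _ _) hf.smooth.continuous.continuousOn fun x hx => by
    rw [interior_Icc] at hx
    exact hf.deriv_neg x hx

theorem apply_abs_sub_round (θ : ℝ) : f |θ - round θ| = f θ := by
  have h1 : f (θ - round θ) = f θ := by
    have := periodic_int hf.periodic θ (-round θ)
    push_cast at this
    rwa [← sub_eq_add_neg] at this
  rcases abs_choice (θ - round θ) with h | h <;> rw [h]
  · exact h1
  · rw [hf.even, h1]

/-- Evenness and periodicity reduce both arguments to `[0, 1/2]`, where the function is injective.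
-/
theorem eq_iff {θ₀ θ₁ : ℝ} : f θ₀ = f θ₁ ↔ (∃ n : ℤ, θ₁ - θ₀ = n) ∨ ∃ n : ℤ, θ₁ + θ₀ = n := by
  constructor
  · intro h
    rw [← hf.apply_abs_sub_round θ₀, ← hf.apply_abs_sub_round θ₁] at h
    have h2 := hf.strictAntiOn.injOn ⟨abs_nonneg _, abs_sub_round θ₀⟩
      ⟨abs_nonneg _, abs_sub_round θ₁⟩ h
    rcases abs_eq_abs.1 h2 with h3 | h3
    · exact Or.inl ⟨round θ₁ - round θ₀, by push_cast; linarith⟩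
    · exact Or.inr ⟨round θ₀ + round θ₁, by push_cast; linarith⟩
  · rintro (⟨n, hn⟩ | ⟨n, hn⟩)
    · rw [← periodic_int hf.periodic θ₀ n, ← hn]; congr 1; ring
    · rw [← hf.even θ₀, ← periodic_int hf.periodic (-θ₀) n, ← hn]; congr 1; ring

theorem deriv_eq_zero_iff {θ : ℝ} : deriv f θ = 0 ↔ ∃ n : ℤ, 2 * θ = n := by
  have h0 : deriv f 0 = 0 := by
    have := hf.deriv_neg_eq 0
    rw [neg_zero] at this
    linarith
  constructor
  · intro h
    have h1 : deriv f (θ - round θ) = 0 := by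
      have := periodic_int hf.periodic_deriv θ (-round θ)
      push_cast at this
      rw [sub_eq_add_neg, this, h]
    have h2 : deriv f |θ - round θ| = 0 := by
      rcases abs_choice (θ - round θ) with h | h <;> rw [h]
      · exact h1
      · rw [hf.deriv_neg_eq, h1, neg_zero]
    have h3 : ¬ |θ - round θ| ∈ Ioo (0 : ℝ) (1 / 2) := fun h4 => (hf.deriv_neg _ h4).ne h2
    have h4 := abs_sub_round θ
    rcases (abs_nonneg (θ - round θ)).eq_or_lt with h5 | h5
    · have h6 := abs_eq_zero.1 h5.symm
      exact ⟨2 * round θ, by push_cast; linarith⟩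
    · have h6 : |θ - round θ| = 1 / 2 := le_antisymm h4 (not_lt.1 fun h7 => h3 ⟨h5, h7⟩)
      rcases (abs_eq (by norm_num)).1 h6 with h7 | h7
      · exact ⟨2 * round θ + 1, by push_cast; linarith⟩
      · exact ⟨2 * round θ - 1, by push_cast; linarith⟩
  · rintro h
    rcases eq_int_or_half h with ⟨m, rfl⟩ | ⟨m, rfl⟩
    · rw [periodic_int hf.periodic_deriv, h0]
    · rw [periodic_int hf.periodic_deriv, show (1 / 2 : ℝ) = 0 + 1 / 2 by ring, hf.deriv_half, h0,
        neg_zero]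

theorem eq_zero_iff {θ : ℝ} : f θ = 0 ↔ ∃ n : ℤ, 4 * θ = 2 * n + 1 := by
  have h0 : f (1 / 4) = 0 := by
    have := hf.half (-(1 / 4))
    rw [hf.even] at this
    norm_num at this
    linarith
  rw [← h0, eq_comm, hf.eq_iff]
  constructor
  · rintro (⟨n, hn⟩ | ⟨n, hn⟩)
    · exact ⟨2 * n, by push_cast; linarith⟩
    · exact ⟨2 * n - 1, by push_cast; linarith⟩
  · rintro ⟨n, hn⟩
    rcases Int.even_or_odd' n with ⟨m, rfl | rfl⟩
    · exact Or.inl ⟨m, by push_cast at hn; linarith⟩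
    · exact Or.inr ⟨m + 1, by push_cast at hn ⊢; linarith⟩

/-- Equal values leave `θ₁ ≡ θ₀` or `θ₁ ≡ -θ₀`. In the second case the derivatives are opposite, so
a positive ratio makes them vanish, and the zeros of the derivative are fixed by the reflection. -/
theorem sub_of_pos {θ₀ θ₁ r : ℝ} (hr : 0 < r) (h : f θ₁ = f θ₀) (h' : deriv f θ₁ = r * deriv f θ₀) :
    ∃ n : ℤ, θ₁ - θ₀ = n := by
  rcases hf.eq_iff.1 h.symm with h1 | ⟨n, hn⟩
  · exact h1
  · have h2 : deriv f θ₁ = -deriv f θ₀ := by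
      rw [show θ₁ = -θ₀ + n by linarith, periodic_int hf.periodic_deriv, hf.deriv_neg_eq]
    have h3 : deriv f θ₀ = 0 := by
      have : (1 + r) * deriv f θ₀ = 0 := by linarith
      exact (mul_eq_zero.1 this).resolve_left (by linarith)
    obtain ⟨m, hm⟩ := hf.deriv_eq_zero_iff.1 h3
    exact ⟨n - m, by push_cast; linarith⟩

theorem add_of_neg {θ₀ θ₁ r : ℝ} (hr : r < 0) (h : f θ₁ = f θ₀) (h' : deriv f θ₁ = r * deriv f θ₀) :
    ∃ n : ℤ, θ₁ + θ₀ = n := by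
  obtain ⟨n, hn⟩ := hf.sub_of_pos (θ₀ := -θ₀) (θ₁ := θ₁) (r := -r) (by linarith)
    (by rw [h, hf.even]) (by rw [h', hf.deriv_neg_eq]; ring)
  exact ⟨n, by linarith⟩

end CosLike

/-- The defining conditions are convex, which permits linear deformation of the oscillations. -/
theorem CosLike.combine {f g : ℝ → ℝ} (hf : CosLike f) (hg : CosLike g) {a b : ℝ} (ha : 0 ≤ a)
    (hb : 0 ≤ b) (hab : 0 < a + b) : CosLike fun θ => a * f θ + b * g θ where
  smooth := (contDiff_const.mul hf.smooth).add (contDiff_const.mul hg.smooth)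
  even θ := by simp only [hf.even, hg.even]
  half θ := by simp only [hf.half, hg.half]; ring
  deriv_neg θ hθ := by
    have h := (((hf.hasDerivAt θ).const_mul a).add ((hg.hasDerivAt θ).const_mul b)).deriv
    have h1 := hf.deriv_neg θ hθ
    have h2 := hg.deriv_neg θ hθ
    refine lt_of_eq_of_lt h ?_
    rcases ha.eq_or_lt with rfl | ha
    · have := mul_neg_of_pos_of_neg (show 0 < b by linarith) h2
      linarith
    · have := mul_neg_of_pos_of_neg ha h1
      have := mul_nonpos_of_nonneg_of_nonpos hb h2.le
      linarith

theorem cosLike_cos : CosLike fun θ => Real.cos (2 * Real.pi * θ) where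
  smooth := by fun_prop
  even θ := by rw [mul_neg, Real.cos_neg]
  half θ := by rw [show 2 * Real.pi * (θ + 1 / 2) = 2 * Real.pi * θ + Real.pi by ring, Real.cos_add_pi]
  deriv_neg θ hθ := by
    have hpi := Real.pi_pos
    rw [(ThinFamily.hasDerivAt_cos_two_pi θ).deriv]
    have := Real.sin_pos_of_pos_of_lt_pi (x := 2 * Real.pi * θ) (by nlinarith [hθ.1])
      (by nlinarith [hθ.2])
    have := mul_pos this (show 0 < 2 * Real.pi by positivity)
    linarith

/-! ### Curves on the torus -/

/-- A path of odd functions from `sinh (z / 2)` to `z / 2`. -/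
def stretch (s : ℝ) (z : ℂ) : ℂ := (1 - s) * Complex.sinh (z / 2) + s * (z / 2)

/-- The derivative of `stretch s`. -/
def stretchDeriv (s : ℝ) (z : ℂ) : ℂ := ((1 - s) * Complex.cosh (z / 2) + s) / 2

theorem hasDerivAt_stretch (s : ℝ) (z : ℂ) : HasDerivAt (stretch s) (stretchDeriv s z) z := by
  have h1 := (hasDerivAt_id z).div_const 2
  have h2 := (h1.csinh.const_mul (1 - s : ℂ)).add (h1.const_mul (s : ℂ))
  refine h2.congr_deriv ?_
  simp only [stretchDeriv, id]
  ring

theorem stretch_neg (s : ℝ) (z : ℂ) : stretch s (-z) = -stretch s z := by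
  simp only [stretch, neg_div, Complex.sinh_neg]; ring

theorem stretchDeriv_neg (s : ℝ) (z : ℂ) : stretchDeriv s (-z) = stretchDeriv s z := by
  simp only [stretchDeriv, neg_div, Complex.cosh_neg]

theorem contDiff_stretch (s : ℝ) : ContDiff ℝ ∞ (stretch s) := by
  have h1 : ContDiff ℝ ∞ fun z : ℂ => Complex.sinh (z / 2) :=
    (Complex.contDiff_sinh.restrict_scalars ℝ).comp (f := fun z : ℂ => z / 2) (by fun_prop)
  exact (contDiff_const.mul h1).add (by fun_prop)

/-- `Re cosh(z/2) = cosh(Re z/2) cos(Im z/2)` is positive on the strip. -/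
theorem stretchDeriv_re_pos {s : ℝ} (hs : s ∈ Icc (0 : ℝ) 1) {z : ℂ} (hz : |z.im| < Real.pi) :
    0 < (stretchDeriv s z).re := by
  have hz' := abs_lt.1 hz
  have h1 : (stretchDeriv s z).re =
      ((1 - s) * (Real.cosh (z.re / 2) * Real.cos (z.im / 2)) + s) / 2 := by
    have h2 : z / 2 = ((z.re / 2 : ℝ) : ℂ) + ((z.im / 2 : ℝ) : ℂ) * Complex.I := by
      conv_lhs => rw [← Complex.re_add_im z]
      push_cast; ring
    have h3 : (Complex.cosh (z / 2)).re = Real.cosh (z.re / 2) * Real.cos (z.im / 2) := by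
      rw [h2, Complex.cosh_add, Complex.cosh_mul_I, Complex.sinh_mul_I, ← Complex.ofReal_cosh,
        ← Complex.ofReal_sinh, ← Complex.ofReal_cos, ← Complex.ofReal_sin, ← Complex.ofReal_mul,
        ← mul_assoc, ← Complex.ofReal_mul, Complex.add_re, Complex.ofReal_re, Complex.re_ofReal_mul,
        Complex.I_re, mul_zero, add_zero]
    have h4 : stretchDeriv s z = (((1 - s) / 2 : ℝ) : ℂ) * Complex.cosh (z / 2) + ((s / 2 : ℝ) : ℂ) := by
      rw [stretchDeriv]; push_cast; ring
    rw [h4, Complex.add_re, Complex.re_ofReal_mul, Complex.ofReal_re, h3]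
    ring
  have h5 : 0 < Real.cosh (z.re / 2) * Real.cos (z.im / 2) :=
    mul_pos (Real.cosh_pos _) (Real.cos_pos_of_mem_Ioo ⟨by linarith, by linarith⟩)
  rw [h1]
  rcases hs.1.eq_or_lt with h | h
  · rw [← h]; linarith
  · have := mul_nonneg (sub_nonneg.2 hs.2) h5.le
    linarith

/-- A holomorphic function on a convex set is injective if its derivative has positive real part:
along the segment from `z` to `w` the real part of its quotient by `w - z` increases strictly. -/
theorem stretch_injOn {s : ℝ} (hs : s ∈ Icc (0 : ℝ) 1) {z w : ℂ} (hz : |z.im| < Real.pi)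
    (hw : |w.im| < Real.pi) (h : stretch s z = stretch s w) : z = w := by
  by_contra hne
  have hd : w - z ≠ 0 := sub_ne_zero.2 fun h => hne h.symm
  let p : ℝ → ℂ := fun x => z + x • (w - z)
  have hp : ∀ x, HasDerivAt p (w - z) x := fun x => by
    have := ((hasDerivAt_id x).smul_const (w - z)).const_add z
    rwa [one_smul] at this
  have hF : ∀ x, HasDerivAt (fun x => stretch s (p x) / (w - z)) (stretchDeriv s (p x)) x := fun x => by
    have := ((hasDerivAt_stretch s (p x)).comp_of_eq x (hp x) rfl).div_const (w - z)
    rwa [mul_div_cancel_right₀ _ hd] at this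
  have hre : ∀ x, HasDerivAt (fun x => (stretch s (p x) / (w - z)).re) (stretchDeriv s (p x)).re x :=
    fun x => Complex.reCLM.hasFDerivAt.comp_hasDerivAt x (hF x)
  have hmono : StrictMonoOn (fun x => (stretch s (p x) / (w - z)).re) (Icc 0 1) := by
    refine strictMonoOn_of_deriv_pos (convex_Icc _ _)
      (fun x _ => (hre x).continuousAt.continuousWithinAt) fun x hx => ?_
    rw [interior_Icc] at hx
    rw [(hre x).deriv]
    refine stretchDeriv_re_pos hs ?_
    have h1 : (p x).im = (1 - x) * z.im + x * w.im := by
      simp [p]; ring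
    have hz' := abs_lt.1 hz
    have hw' := abs_lt.1 hw
    rw [h1, abs_lt]
    have hx1 := hx.1
    have hx2 : 0 < 1 - x := by linarith [hx.2]
    constructor
    · nlinarith [mul_lt_mul_of_pos_left hz'.1 hx2, mul_lt_mul_of_pos_left hw'.1 hx1]
    · nlinarith [mul_lt_mul_of_pos_left hz'.2 hx2, mul_lt_mul_of_pos_left hw'.2 hx1]
  have h01 := hmono ⟨le_rfl, zero_le_one⟩ ⟨zero_le_one, le_rfl⟩ zero_lt_one
  simp [p, h] at h01

theorem stretch_zero (s : ℝ) : stretch s 0 = 0 := by simp [stretch]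

/-- The point of the torus at time `t`. -/
def torusPoint (f₁ f₂ : ℝ → ℝ) (φ₁ φ₂ : ℝ) (k l : ℕ) (t : ℝ) : ℂ :=
  (f₁ (k * t + φ₁) : ℂ) + (f₂ (l * t + φ₂) : ℂ) * Complex.I

/-- The velocity of the point of the torus. -/
def torusPointVel (f₁' f₂' : ℝ → ℝ) (φ₁ φ₂ : ℝ) (k l : ℕ) (t : ℝ) : ℂ :=
  ((k * f₁' (k * t + φ₁) : ℝ) : ℂ) + ((l * f₂' (l * t + φ₂) : ℝ) : ℂ) * Complex.I

/-- The curve of an orbit on the torus, in the coordinate in which it is doubly covered. -/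
def torusCurve (c : ℂ) (s : ℝ) (f₁ f₂ : ℝ → ℝ) (φ₁ φ₂ : ℝ) (k l : ℕ) (t : ℝ) : ℂ :=
  c * stretch s (torusPoint f₁ f₂ φ₁ φ₂ k l t)

/-- The velocity of `torusCurve`. -/
def torusVel (c : ℂ) (s : ℝ) (f₁ f₁' f₂ f₂' : ℝ → ℝ) (φ₁ φ₂ : ℝ) (k l : ℕ) (t : ℝ) : ℂ :=
  c * (stretchDeriv s (torusPoint f₁ f₂ φ₁ φ₂ k l t) * torusPointVel f₁' f₂' φ₁ φ₂ k l t)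

theorem hasDerivAt_torusCurve {c : ℂ} {s : ℝ} {f₁ f₁' f₂ f₂' : ℝ → ℝ}
    (h₁ : ∀ θ, HasDerivAt f₁ (f₁' θ) θ) (h₂ : ∀ θ, HasDerivAt f₂ (f₂' θ) θ) (φ₁ φ₂ : ℝ) (k l : ℕ)
    (t : ℝ) : HasDerivAt (torusCurve c s f₁ f₂ φ₁ φ₂ k l)
      (torusVel c s f₁ f₁' f₂ f₂' φ₁ φ₂ k l t) t := by
  have hlin : ∀ (n : ℕ) (φ : ℝ), HasDerivAt (fun t : ℝ => n * t + φ) n t := fun n φ => by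
    simpa using ((hasDerivAt_id t).const_mul (n : ℝ)).add_const φ
  have h3 : HasDerivAt (fun t : ℝ => f₁ (k * t + φ₁)) (k * f₁' (k * t + φ₁)) t := by
    rw [mul_comm]
    exact (h₁ (k * t + φ₁)).comp t (hlin k φ₁)
  have h4 : HasDerivAt (fun t : ℝ => f₂ (l * t + φ₂)) (l * f₂' (l * t + φ₂)) t := by
    rw [mul_comm]
    exact (h₂ (l * t + φ₂)).comp t (hlin l φ₂)
  have h5 : HasDerivAt (torusPoint f₁ f₂ φ₁ φ₂ k l) (torusPointVel f₁' f₂' φ₁ φ₂ k l t) t :=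
    h3.ofReal_comp.add (h4.ofReal_comp.mul_const Complex.I)
  exact ((hasDerivAt_stretch s _).comp_of_eq t h5 rfl).const_mul c

theorem contDiff_torusCurve (c : ℂ) (s : ℝ) {f₁ f₂ : ℝ → ℝ} (h₁ : ContDiff ℝ ∞ f₁)
    (h₂ : ContDiff ℝ ∞ f₂) (φ₁ φ₂ : ℝ) (k l : ℕ) :
    ContDiff ℝ ∞ (torusCurve c s f₁ f₂ φ₁ φ₂ k l) := by
  have h3 : ContDiff ℝ ∞ fun t : ℝ => f₁ (k * t + φ₁) := h₁.comp (by fun_prop)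
  have h4 : ContDiff ℝ ∞ fun t : ℝ => f₂ (l * t + φ₂) := h₂.comp (by fun_prop)
  have h5 : ContDiff ℝ ∞ (torusPoint f₁ f₂ φ₁ φ₂ k l) :=
    (Complex.ofRealCLM.contDiff.comp h3).add ((Complex.ofRealCLM.contDiff.comp h4).mul contDiff_const)
  exact contDiff_const.mul ((contDiff_stretch s).comp h5)

/-- A closed orbit on a torus, given by its two oscillations. -/
structure TorusData where
  c : ℂ
  s : ℝ
  f₁ : ℝ → ℝ
  f₂ : ℝ → ℝ
  φ₁ : ℝ
  φ₂ : ℝ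
  k : ℕ
  l : ℕ
  c_ne : c ≠ 0
  hs : s ∈ Icc (0 : ℝ) 1
  hf₁ : CosLike f₁
  hf₂ : CosLike f₂
  bound : ∀ θ, |f₂ θ| < Real.pi
  k_pos : 0 < k
  l_pos : 0 < l
  coprime : k.Coprime l

namespace TorusData

variable (D : TorusData)

/-- The curve of the orbit. -/
def curve : ℝ → ℂ := torusCurve D.c D.s D.f₁ D.f₂ D.φ₁ D.φ₂ D.k D.l

/-- The velocity of the orbit. -/
def vel : ℝ → ℂ := torusVel D.c D.s D.f₁ (deriv D.f₁) D.f₂ (deriv D.f₂) D.φ₁ D.φ₂ D.k D.l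

theorem hasDerivAt_curve (t : ℝ) : HasDerivAt D.curve (D.vel t) t :=
  hasDerivAt_torusCurve D.hf₁.hasDerivAt D.hf₂.hasDerivAt _ _ _ _ t

theorem contDiff_curve : ContDiff ℝ ∞ D.curve :=
  contDiff_torusCurve _ _ D.hf₁.smooth D.hf₂.smooth _ _ _ _

/-- Both momenta vanish at some time. -/
def HasBrake : Prop := ∃ (t : ℝ) (m n : ℤ), 2 * (D.k * t + D.φ₁) = m ∧ 2 * (D.l * t + D.φ₂) = n

/-- Both positions vanish at some time. -/
def HasCollision : Prop :=
  ∃ (t : ℝ) (m n : ℤ), 4 * (D.k * t + D.φ₁) = 2 * m + 1 ∧ 4 * (D.l * t + D.φ₂) = 2 * n + 1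

theorem exists_int_combination (N : ℤ) : ∃ m n : ℤ, (D.l : ℤ) * m - D.k * n = N := by
  have hb : (D.k : ℤ) * D.k.gcdA D.l + D.l * D.k.gcdB D.l = 1 := by
    have := Nat.gcd_eq_gcd_ab D.k D.l
    rw [D.coprime] at this
    exact_mod_cast this.symm
  exact ⟨N * D.k.gcdB D.l, -(N * D.k.gcdA D.l), by linear_combination N * hb⟩

/-- Eliminating `t` leaves `2(lφ₁ - kφ₂) = lm - kn`, and by coprimality the right-hand side is an
arbitrary integer. -/
theorem hasBrake_iff : D.HasBrake ↔ ∃ n : ℤ, 2 * (D.l * D.φ₁ - D.k * D.φ₂) = n := by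
  have hk : (D.k : ℝ) ≠ 0 := by exact_mod_cast D.k_pos.ne'
  constructor
  · rintro ⟨t, m, n, h1, h2⟩
    exact ⟨D.l * m - D.k * n, by push_cast; linear_combination D.l * h1 - D.k * h2⟩
  · rintro ⟨N, hN⟩
    obtain ⟨m, n, hmn⟩ := D.exists_int_combination N
    have hmn' : (D.l : ℝ) * m - D.k * n = N := by exact_mod_cast hmn
    refine ⟨(m / 2 - D.φ₁) / D.k, m, n, by field_simp; ring, ?_⟩
    refine mul_left_cancel₀ hk ?_
    field_simp
    linear_combination -hN + hmn'

theorem hasCollision_iff :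
    D.HasCollision ↔ ∃ n : ℤ, 4 * (D.l * D.φ₁ - D.k * D.φ₂) = 2 * n + (D.l - D.k) := by
  have hk : (D.k : ℝ) ≠ 0 := by exact_mod_cast D.k_pos.ne'
  constructor
  · rintro ⟨t, m, n, h1, h2⟩
    exact ⟨D.l * m - D.k * n, by push_cast; linear_combination D.l * h1 - D.k * h2⟩
  · rintro ⟨N, hN⟩
    obtain ⟨m, n, hmn⟩ := D.exists_int_combination N
    have hmn' : (D.l : ℝ) * m - D.k * n = N := by exact_mod_cast hmn
    refine ⟨((2 * m + 1) / 4 - D.φ₁) / D.k, m, n, by field_simp; ring, ?_⟩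
    refine mul_left_cancel₀ hk ?_
    field_simp
    linear_combination -hN + 2 * hmn'

theorem abs_im_lt (t : ℝ) : |(torusPoint D.f₁ D.f₂ D.φ₁ D.φ₂ D.k D.l t).im| < Real.pi := by
  simpa [torusPoint] using D.bound (D.l * t + D.φ₂)

theorem stretchDeriv_ne_zero (t : ℝ) :
    stretchDeriv D.s (torusPoint D.f₁ D.f₂ D.φ₁ D.φ₂ D.k D.l t) ≠ 0 := fun h => by
  have := stretchDeriv_re_pos D.hs (D.abs_im_lt t)
  rw [h] at this
  exact lt_irrefl _ this

theorem vel_ne_zero (h : ¬ D.HasBrake) (t : ℝ) : D.vel t ≠ 0 := by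
  have hk : (D.k : ℝ) ≠ 0 := by exact_mod_cast D.k_pos.ne'
  have hl : (D.l : ℝ) ≠ 0 := by exact_mod_cast D.l_pos.ne'
  refine mul_ne_zero D.c_ne (mul_ne_zero (D.stretchDeriv_ne_zero t) (ofReal_add_mul_I_ne_zero ?_))
  rintro ⟨h1, h2⟩
  obtain ⟨m, hm⟩ := D.hf₁.deriv_eq_zero_iff.1 ((mul_eq_zero.1 h1).resolve_left hk)
  obtain ⟨n, hn⟩ := D.hf₂.deriv_eq_zero_iff.1 ((mul_eq_zero.1 h2).resolve_left hl)
  exact h ⟨t, m, n, hm, hn⟩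

/-- `stretch s` is odd and injective on the strip, so equality up to sign descends to the torus
coordinates. -/
theorem curve_eq {e : ℕ} {t₀ t₁ : ℝ} (h : D.curve t₁ = (-1) ^ e * D.curve t₀) :
    torusPoint D.f₁ D.f₂ D.φ₁ D.φ₂ D.k D.l t₁ =
      (-1) ^ e * torusPoint D.f₁ D.f₂ D.φ₁ D.φ₂ D.k D.l t₀ := by
  have h1 : ∀ (e : ℕ) (z : ℂ), stretch D.s ((-1) ^ e * z) = (-1) ^ e * stretch D.s z := by
    intro e z
    rcases neg_one_pow_eq_or ℂ e with h | h <;> rw [h]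
    · simp
    · rw [neg_one_mul, stretch_neg, neg_one_mul]
  have h2 : ∀ (e : ℕ) (z : ℂ), |((-1) ^ e * z).im| = |z.im| := by
    intro e z
    rcases neg_one_pow_eq_or ℂ e with h | h <;> rw [h] <;> simp
  refine stretch_injOn D.hs (D.abs_im_lt t₁) (by rw [h2]; exact D.abs_im_lt t₀) ?_
  rw [h1]
  refine mul_left_cancel₀ D.c_ne ?_
  simp only [curve, torusCurve] at h
  rw [h]; ring

theorem apply_eq {e : ℕ} {t₀ t₁ : ℝ} (h : D.curve t₁ = (-1) ^ e * D.curve t₀) :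
    D.f₁ (D.k * t₁ + D.φ₁) = D.f₁ (D.k * t₀ + D.φ₁ + e / 2) ∧
    D.f₂ (D.l * t₁ + D.φ₂) = D.f₂ (D.l * t₀ + D.φ₂ + e / 2) := by
  have h1 := D.curve_eq h
  have hs : ((-1 : ℂ)) ^ e = (((-1 : ℝ) ^ e : ℝ) : ℂ) := by push_cast; rfl
  rw [hs, torusPoint, torusPoint] at h1
  have h2 := congrArg Complex.re h1
  have h3 := congrArg Complex.im h1
  simp at h2 h3
  have hs' : ∀ x : ℝ, ((-1 : ℂ) ^ e).re * x = (-1) ^ e * x := fun x => by rw [hs, Complex.ofReal_re]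
  have hs'' : ((-1 : ℂ) ^ e).im = 0 := by rw [hs, Complex.ofReal_im]
  rw [D.hf₁.add_half, D.hf₂.add_half]
  simp only [hs', hs'', zero_mul, add_zero, sub_zero] at h2 h3
  exact ⟨h2, h3⟩

/-- The times differ by a translation of the torus by a multiple of half a period. -/
def Translate (e : ℕ) (t₀ t₁ : ℝ) : Prop :=
  ∃ m n : ℤ, D.k * (t₁ - t₀) = m + e / 2 ∧ D.l * (t₁ - t₀) = n + e / 2

/-- The times are related by a reflection of the torus. -/
def Reflect (e : ℕ) (t₀ t₁ : ℝ) : Prop :=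
  ∃ m n : ℤ, D.k * (t₁ + t₀) + 2 * D.φ₁ = m + e / 2 ∧ D.l * (t₁ + t₀) + 2 * D.φ₂ = n + e / 2

theorem vel_eq {e : ℕ} {t₀ t₁ r : ℝ} (h : D.curve t₁ = (-1) ^ e * D.curve t₀)
    (h' : D.vel t₁ = ((-1) ^ e * r : ℝ) • D.vel t₀) :
    deriv D.f₁ (D.k * t₁ + D.φ₁) = r * deriv D.f₁ (D.k * t₀ + D.φ₁ + e / 2) ∧
    deriv D.f₂ (D.l * t₁ + D.φ₂) = r * deriv D.f₂ (D.l * t₀ + D.φ₂ + e / 2) := by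
  have hk : (D.k : ℝ) ≠ 0 := by exact_mod_cast D.k_pos.ne'
  have hl : (D.l : ℝ) ≠ 0 := by exact_mod_cast D.l_pos.ne'
  have h1 : stretchDeriv D.s (torusPoint D.f₁ D.f₂ D.φ₁ D.φ₂ D.k D.l t₁) =
      stretchDeriv D.s (torusPoint D.f₁ D.f₂ D.φ₁ D.φ₂ D.k D.l t₀) := by
    rw [D.curve_eq h]
    rcases neg_one_pow_eq_or ℂ e with h | h <;> rw [h]
    · rw [one_mul]
    · rw [neg_one_mul, stretchDeriv_neg]
  have h2 : torusPointVel (deriv D.f₁) (deriv D.f₂) D.φ₁ D.φ₂ D.k D.l t₁ =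
      (((-1) ^ e * r : ℝ) : ℂ) * torusPointVel (deriv D.f₁) (deriv D.f₂) D.φ₁ D.φ₂ D.k D.l t₀ := by
    refine mul_left_cancel₀ (D.stretchDeriv_ne_zero t₁) (mul_left_cancel₀ D.c_ne ?_)
    simp only [vel, torusVel, Complex.real_smul] at h'
    rw [h', h1]; ring
  have h3 := congrArg Complex.re h2
  have h4 := congrArg Complex.im h2
  rw [Complex.re_ofReal_mul] at h3
  rw [Complex.im_ofReal_mul] at h4
  simp only [torusPointVel, Complex.add_re, Complex.add_im, Complex.ofReal_re, Complex.ofReal_im,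
    Complex.re_ofReal_mul, Complex.im_ofReal_mul, Complex.I_re, Complex.I_im, mul_zero, mul_one,
    add_zero, zero_add] at h3 h4
  rw [D.hf₁.deriv_add_half, D.hf₂.deriv_add_half]
  exact ⟨mul_left_cancel₀ hk (by linarith), mul_left_cancel₀ hl (by linarith)⟩

theorem translate_of_pos {e : ℕ} {t₀ t₁ r : ℝ} (hr : 0 < r) (h : D.curve t₁ = (-1) ^ e * D.curve t₀)
    (h' : D.vel t₁ = ((-1) ^ e * r : ℝ) • D.vel t₀) : D.Translate e t₀ t₁ := by
  obtain ⟨h1, h2⟩ := D.apply_eq h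
  obtain ⟨h3, h4⟩ := D.vel_eq h h'
  obtain ⟨m, hm⟩ := D.hf₁.sub_of_pos hr h1 h3
  obtain ⟨n, hn⟩ := D.hf₂.sub_of_pos hr h2 h4
  exact ⟨m, n, by linarith, by linarith⟩

theorem reflect_of_neg {e : ℕ} {t₀ t₁ r : ℝ} (hr : r < 0) (h : D.curve t₁ = (-1) ^ e * D.curve t₀)
    (h' : D.vel t₁ = ((-1) ^ e * r : ℝ) • D.vel t₀) : D.Reflect e t₀ t₁ := by
  obtain ⟨h1, h2⟩ := D.apply_eq h
  obtain ⟨h3, h4⟩ := D.vel_eq h h'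
  obtain ⟨m, hm⟩ := D.hf₁.add_of_neg hr h1 h3
  obtain ⟨n, hn⟩ := D.hf₂.add_of_neg hr h2 h4
  exact ⟨m - e, n - e, by push_cast; linarith, by push_cast; linarith⟩

/-- The reflection fixes the midpoint of the two times. For even `e` both phases are there multiples
of `1/2`, a brake; for odd `e` they would be odd multiples of `1/4`, a collision. -/
theorem hasBrake_of_reflect {e : ℕ} (he : Even e) {t₀ t₁ : ℝ} (h : D.Reflect e t₀ t₁) :
    D.HasBrake := by
  obtain ⟨m, n, h1, h2⟩ := h
  obtain ⟨p, rfl⟩ := he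
  push_cast at h1 h2
  exact ⟨(t₁ + t₀) / 2, m + p, n + p, by push_cast; linarith, by push_cast; linarith⟩

theorem hasCollision_of_reflect {e : ℕ} (he : Odd e) {t₀ t₁ : ℝ} (h : D.Reflect e t₀ t₁) :
    D.HasCollision := by
  obtain ⟨m, n, h1, h2⟩ := h
  obtain ⟨p, rfl⟩ := he
  push_cast at h1 h2
  exact ⟨(t₁ + t₀) / 2, m + p, n + p, by push_cast; linarith, by push_cast; linarith⟩

/-- By Bézout `2(t₁ - t₀)` is an integer `N`, and multiplying back gives `kN = 2m + e` and `lN = 2n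
+ e`, from which the parities are read off. -/
theorem sub_of_translate {e : ℕ} {t₀ t₁ : ℝ} (h : D.Translate e t₀ t₁) :
    ∃ N : ℤ, 2 * (t₁ - t₀) = N ∧ (Even e → Even N) ∧ (Odd e → Odd (D.k * N) ∧ Odd (D.l * N)) := by
  obtain ⟨m, n, h1, h2⟩ := h
  obtain ⟨a, b, hab⟩ := D.exists_int_combination 1
  have hab' : (D.l : ℝ) * a - D.k * b = 1 := by exact_mod_cast hab
  have hN : 2 * (t₁ - t₀) = (((2 * n + e) * a - (2 * m + e) * b : ℤ) : ℝ) := by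
    push_cast
    linear_combination (-2 * (t₁ - t₀)) * hab' + (2 * a) * h2 - (2 * b) * h1
  refine ⟨_, hN, fun he => ?_, fun he => ?_⟩
  · have hE : Even (e : ℤ) := by exact_mod_cast he
    exact (((even_two_mul n).add hE).mul_right a).sub (((even_two_mul m).add hE).mul_right b)
  · have hO : Odd (e : ℤ) := by exact_mod_cast he
    have e1 : (D.k : ℤ) * ((2 * n + e) * a - (2 * m + e) * b) = 2 * m + e := by
      have : ((D.k : ℝ) * (((2 * n + e) * a - (2 * m + e) * b : ℤ) : ℝ)) = 2 * m + e := by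
        rw [← hN]; linear_combination 2 * h1
      exact_mod_cast this
    have e2 : (D.l : ℤ) * ((2 * n + e) * a - (2 * m + e) * b) = 2 * n + e := by
      have : ((D.l : ℝ) * (((2 * n + e) * a - (2 * m + e) * b : ℤ) : ℝ)) = 2 * n + e := by
        rw [← hN]; linear_combination 2 * h2
      exact_mod_cast this
    rw [e1, e2]
    exact ⟨(even_two_mul m).add_odd hO, (even_two_mul n).add_odd hO⟩

/-- A loop made of the curve of the orbit: itself, its square, or its square at half the speed. The
predicate `P` tells the parities of the half-periods that have to be taken into account. -/
structure IsLoop (γ γ' : ℝ → ℂ) (κ : ℝ) (P : ℕ → Prop) : Prop where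
  hasDerivAt : ∀ t, HasDerivAt γ (γ' t) t
  contDiff : ContDiff ℝ ∞ γ
  periodic : Function.Periodic γ 1
  vel_ne_zero : ∀ t, γ' t ≠ 0
  eq : ∀ t₀ t₁, γ t₀ = γ t₁ → ∃ e, P e ∧ D.curve (κ * t₁) = (-1) ^ e * D.curve (κ * t₀) ∧
    ∀ r : ℝ, γ' t₁ = r • γ' t₀ → D.vel (κ * t₁) = ((-1) ^ e * r : ℝ) • D.vel (κ * t₀)
  add : ∀ e e', P e → P e' → P (e + e')
  translate : ∀ e t₀ t₁, P e → D.Translate e (κ * t₀) (κ * t₁) → ∃ n : ℤ, t₁ - t₀ = n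
  reflect : ∀ e t₀ t₁, P e → ¬ D.Reflect e (κ * t₀) (κ * t₁)

variable {D}

theorem IsLoop.sub_of_tangency {γ γ' : ℝ → ℂ} {κ : ℝ} {P : ℕ → Prop} (h : D.IsLoop γ γ' κ P)
    {t₀ t₁ r : ℝ} (hr : 0 < r) (h1 : γ t₀ = γ t₁) (h2 : γ' t₁ = r • γ' t₀) :
    ∃ n : ℤ, t₁ - t₀ = n := by
  obtain ⟨e, hP, h3, h4⟩ := h.eq t₀ t₁ h1
  exact h.translate e t₀ t₁ hP (D.translate_of_pos hr h3 (h4 r h2))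

theorem not_int_sub_of_mem_Ico {t₀ t₁ : ℝ} (h0 : t₀ ∈ Ico (0 : ℝ) 1) (h1 : t₁ ∈ Ico (0 : ℝ) 1)
    (hne : t₀ ≠ t₁) : ¬ ∃ n : ℤ, t₁ - t₀ = n := by
  rintro ⟨n, hn⟩
  have h2 : (n : ℝ) < 1 := by linarith [h0.1, h1.2]
  have h3 : (-1 : ℝ) < n := by linarith [h0.2, h1.1]
  have h4 : n < 1 := by exact_mod_cast h2
  have h5 : -1 < n := by exact_mod_cast h3
  have h6 : n = 0 := by omega
  rw [h6, Int.cast_zero] at hn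
  exact hne (by linarith)

/-- Parallel velocities at a double point would give a translation or a reflection of the torus,
according to the sign of their ratio, and both are excluded. At a triple point each coordinate
relates consecutive phases by a translation or a reflection. If both coordinates are of the same
kind for one of the consecutive pairs, that pair is excluded. Otherwise both consecutive pairs are
of mixed kind, and composing them yields the same kind in both coordinates for the outer pair. -/
theorem IsLoop.isGenericImmersion {γ γ' : ℝ → ℂ} {κ : ℝ} {P : ℕ → Prop} (h : D.IsLoop γ γ' κ P) :
    IsGenericImmersion γ := by
  have hder : deriv γ = γ' := funext fun t => (h.hasDerivAt t).deriv
  refine ⟨⟨h.contDiff, h.periodic, by rw [hder]; exact h.vel_ne_zero⟩, ?_, ?_⟩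
  · intro t₀ h0 t₁ h1 hne he
    rw [hder, LinearIndependent.pair_iff' (h.vel_ne_zero t₀)]
    intro r hr
    rcases lt_trichotomy r 0 with hr0 | rfl | hr0
    · obtain ⟨e, hP, h3, h4⟩ := h.eq t₀ t₁ he
      exact h.reflect e t₀ t₁ hP (D.reflect_of_neg hr0 h3 (h4 r hr.symm))
    · rw [zero_smul] at hr
      exact h.vel_ne_zero t₁ hr.symm
    · exact not_int_sub_of_mem_Ico h0 h1 hne (h.sub_of_tangency hr0 he hr.symm)
  · rintro t₀ h0 t₁ h1 t₂ h2 h01 h12 h02 ⟨he, he'⟩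
    obtain ⟨e, hP, h3, -⟩ := h.eq t₀ t₁ he
    obtain ⟨e', hP', h3', -⟩ := h.eq t₁ t₂ he'
    obtain ⟨a1, a2⟩ := D.apply_eq h3
    obtain ⟨b1, b2⟩ := D.apply_eq h3'
    have nT01 : ¬ D.Translate e (κ * t₀) (κ * t₁) := fun hT =>
      not_int_sub_of_mem_Ico h0 h1 h01 (h.translate e _ _ hP hT)
    have nT12 : ¬ D.Translate e' (κ * t₁) (κ * t₂) := fun hT =>
      not_int_sub_of_mem_Ico h1 h2 h12 (h.translate e' _ _ hP' hT)
    have nT02 : ¬ D.Translate (e + e') (κ * t₀) (κ * t₂) := fun hT =>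
      not_int_sub_of_mem_Ico h0 h2 h02 (h.translate _ _ _ (h.add _ _ hP hP') hT)
    have nR01 := h.reflect e t₀ t₁ hP
    have nR12 := h.reflect e' t₁ t₂ hP'
    have nR02 := h.reflect (e + e') t₀ t₂ (h.add _ _ hP hP')
    rcases D.hf₁.eq_iff.1 a1.symm with ⟨p, hp⟩ | ⟨p, hp⟩ <;>
    rcases D.hf₂.eq_iff.1 a2.symm with ⟨q, hq⟩ | ⟨q, hq⟩
    · exact nT01 ⟨p, q, by linarith, by linarith⟩
    · rcases D.hf₁.eq_iff.1 b1.symm with ⟨p', hp'⟩ | ⟨p', hp'⟩ <;>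
      rcases D.hf₂.eq_iff.1 b2.symm with ⟨q', hq'⟩ | ⟨q', hq'⟩
      · exact nT12 ⟨p', q', by linarith, by linarith⟩
      · exact nT02 ⟨p + p', q' - q - e', by push_cast; linarith, by push_cast; linarith⟩
      · exact nR02 ⟨p' - p - e - e', q + q' - e, by push_cast; linarith, by push_cast; linarith⟩
      · exact nR12 ⟨p' - e', q' - e', by push_cast; linarith, by push_cast; linarith⟩
    · rcases D.hf₁.eq_iff.1 b1.symm with ⟨p', hp'⟩ | ⟨p', hp'⟩ <;>
      rcases D.hf₂.eq_iff.1 b2.symm with ⟨q', hq'⟩ | ⟨q', hq'⟩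
      · exact nT12 ⟨p', q', by linarith, by linarith⟩
      · exact nR02 ⟨p + p' - e, q' - q - e - e', by push_cast; linarith, by push_cast; linarith⟩
      · exact nT02 ⟨p' - p - e', q + q', by push_cast; linarith, by push_cast; linarith⟩
      · exact nR12 ⟨p' - e', q' - e', by push_cast; linarith, by push_cast; linarith⟩
    · exact nR01 ⟨p - e, q - e, by push_cast; linarith, by push_cast; linarith⟩

variable (D)

theorem curve_ne_zero (h : ¬ D.HasCollision) (t : ℝ) : D.curve t ≠ 0 := by
  intro h0
  have h1 : torusPoint D.f₁ D.f₂ D.φ₁ D.φ₂ D.k D.l t = 0 := by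
    refine stretch_injOn D.hs (D.abs_im_lt t) (by simpa using Real.pi_pos) ?_
    rw [stretch_zero]
    exact (mul_eq_zero.1 h0).resolve_left D.c_ne
  have h2 := congrArg Complex.re h1
  have h3 := congrArg Complex.im h1
  simp [torusPoint] at h2 h3
  obtain ⟨m, hm⟩ := D.hf₁.eq_zero_iff.1 h2
  obtain ⟨n, hn⟩ := D.hf₂.eq_zero_iff.1 h3
  exact h ⟨t, m, n, hm, hn⟩

theorem curve_add_half (e : ℕ) (t : ℝ) (h : D.k % 2 = D.l % 2) :
    D.curve (t + e / 2) = (-1) ^ (D.k * e) * D.curve t := by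
  have h1 : torusPoint D.f₁ D.f₂ D.φ₁ D.φ₂ D.k D.l (t + e / 2) =
      (-1) ^ (D.k * e) * torusPoint D.f₁ D.f₂ D.φ₁ D.φ₂ D.k D.l t := by
    have e1 : (D.k : ℝ) * (t + e / 2) + D.φ₁ = D.k * t + D.φ₁ + (D.k * e : ℕ) / 2 := by
      push_cast; ring
    have e2 : (D.l : ℝ) * (t + e / 2) + D.φ₂ = D.l * t + D.φ₂ + (D.l * e : ℕ) / 2 := by
      push_cast; ring
    have e3 : ((-1 : ℝ)) ^ (D.l * e) = (-1) ^ (D.k * e) := by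
      rw [pow_mul, pow_mul, neg_one_pow_eq_pow_mod_two, ← h, ← neg_one_pow_eq_pow_mod_two]
    rw [torusPoint, torusPoint, e1, e2, D.hf₁.add_half, D.hf₂.add_half, e3]
    push_cast
    ring
  rw [curve, torusCurve, torusCurve, h1]
  rcases neg_one_pow_eq_or ℂ (D.k * e) with h | h <;> rw [h]
  · simp
  · rw [neg_one_mul, stretch_neg]; ring

theorem periodic_curve : Function.Periodic D.curve 1 := by
  intro t
  have h1 := periodic_int D.hf₁.periodic (D.k * t + D.φ₁) D.k
  have h2 := periodic_int D.hf₂.periodic (D.l * t + D.φ₂) D.l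
  push_cast at h1 h2
  rw [curve, torusCurve, torusCurve, torusPoint, torusPoint,
    show (D.k : ℝ) * (t + 1) + D.φ₁ = D.k * t + D.φ₁ + D.k by ring, h1,
    show (D.l : ℝ) * (t + 1) + D.φ₂ = D.l * t + D.φ₂ + D.l by ring, h2]

theorem isLoop (h : ¬ D.HasBrake) : D.IsLoop D.curve D.vel 1 Even where
  hasDerivAt := D.hasDerivAt_curve
  contDiff := D.contDiff_curve
  periodic := D.periodic_curve
  vel_ne_zero := D.vel_ne_zero h
  eq t₀ t₁ he := ⟨0, ⟨0, rfl⟩, by simp [he], fun r hr => by simpa using hr⟩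
  add _ _ := Even.add
  translate e t₀ t₁ he hT := by
    obtain ⟨N, hN, h1, -⟩ := D.sub_of_translate hT
    obtain ⟨M, rfl⟩ := h1 he
    exact ⟨M, by push_cast at hN; linarith⟩
  reflect e t₀ t₁ he hR := h (D.hasBrake_of_reflect he hR)

theorem sq_eq (t₀ t₁ : ℝ) (hc : ¬ D.HasCollision) (h : D.curve t₀ ^ 2 = D.curve t₁ ^ 2) :
    ∃ e, D.curve t₁ = (-1) ^ e * D.curve t₀ ∧ ∀ r : ℝ, 2 * D.curve t₁ * D.vel t₁ =
      r • (2 * D.curve t₀ * D.vel t₀) → D.vel t₁ = ((-1) ^ e * r : ℝ) • D.vel t₀ := by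
  obtain ⟨e, he⟩ : ∃ e : ℕ, D.curve t₁ = (-1) ^ e * D.curve t₀ := by
    rcases sq_eq_sq_iff_eq_or_eq_neg.1 h with h | h
    · exact ⟨0, by simp [h]⟩
    · exact ⟨1, by simp [h]⟩
  refine ⟨e, he, fun r hr => ?_⟩
  rw [he, Complex.real_smul] at hr
  have h0 := D.curve_ne_zero hc t₀
  have hsq : ((-1 : ℂ)) ^ e * (-1) ^ e = 1 := by rw [← mul_pow]; simp
  rw [Complex.real_smul]
  push_cast
  refine mul_left_cancel₀ (mul_ne_zero two_ne_zero h0) ?_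
  linear_combination (-1) ^ e * hr - (2 * D.curve t₀ * D.vel t₁) * hsq

theorem hasDerivAt_curve_sq (t : ℝ) :
    HasDerivAt (fun t => D.curve t ^ 2) (2 * D.curve t * D.vel t) t := by
  have h := (D.hasDerivAt_curve t).fun_pow 2
  refine h.congr_deriv ?_
  rw [pow_one]
  norm_num

theorem isLoop_sq (h : ¬ D.HasBrake) (hc : ¬ D.HasCollision) (hkl : (D.k + D.l) % 2 = 1) :
    D.IsLoop (fun t => D.curve t ^ 2) (fun t => 2 * D.curve t * D.vel t) 1 fun _ => True where
  hasDerivAt := D.hasDerivAt_curve_sq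
  contDiff := D.contDiff_curve.pow 2
  periodic t := by simp only [D.periodic_curve t]
  vel_ne_zero t := mul_ne_zero (mul_ne_zero two_ne_zero (D.curve_ne_zero hc t)) (D.vel_ne_zero h t)
  eq t₀ t₁ he := by
    obtain ⟨e, h1, h2⟩ := D.sq_eq t₀ t₁ hc he
    exact ⟨e, trivial, by simpa using h1, by simpa using h2⟩
  add _ _ _ _ := trivial
  translate e t₀ t₁ _ hT := by
    obtain ⟨N, hN, h1, h2⟩ := D.sub_of_translate hT
    rcases Nat.even_or_odd e with he | he
    · obtain ⟨M, rfl⟩ := h1 he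
      exact ⟨M, by push_cast at hN; linarith⟩
    · obtain ⟨h3, h4⟩ := h2 he
      have h5 := (Int.odd_mul.1 h3).1
      have h6 := (Int.odd_mul.1 h4).1
      rw [Int.odd_iff] at h5 h6
      omega
  reflect e t₀ t₁ _ hR := by
    rcases Nat.even_or_odd e with he | he
    · exact h (D.hasBrake_of_reflect he hR)
    · exact hc (D.hasCollision_of_reflect he hR)

theorem isLoop_fold (h : ¬ D.HasBrake) (hc : ¬ D.HasCollision) (hk : D.k % 2 = 1)
    (hl : D.l % 2 = 1) : D.IsLoop (fun t => D.curve (1 / 2 * t) ^ 2)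
      (fun t => (1 / 2 : ℝ) • (2 * D.curve (1 / 2 * t) * D.vel (1 / 2 * t))) (1 / 2) fun _ => True where
  hasDerivAt t := by
    have h1 : HasDerivAt (fun t : ℝ => 1 / 2 * t) (1 / 2) t := by
      simpa using (hasDerivAt_id t).const_mul (1 / 2 : ℝ)
    exact (D.hasDerivAt_curve_sq (1 / 2 * t)).scomp t h1
  contDiff := by
    have h1 : ContDiff ℝ ∞ fun t : ℝ => D.curve (1 / 2 * t) := D.contDiff_curve.comp (by fun_prop)
    exact h1.pow 2
  periodic t := by
    have := D.curve_add_half 1 (1 / 2 * t) (by omega)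
    rw [Nat.cast_one] at this
    simp only
    rw [show 1 / 2 * (t + 1) = 1 / 2 * t + 1 / 2 by ring, this, mul_pow, ← pow_mul, mul_comm _ 2,
      pow_mul]
    simp
  vel_ne_zero t := smul_ne_zero (by norm_num) (mul_ne_zero (mul_ne_zero two_ne_zero
    (D.curve_ne_zero hc _)) (D.vel_ne_zero h _))
  eq t₀ t₁ he := by
    obtain ⟨e, h1, h2⟩ := D.sq_eq _ _ hc he
    refine ⟨e, trivial, h1, fun r hr => h2 r ?_⟩
    rw [smul_comm] at hr
    exact smul_right_injective ℂ (by norm_num : (1 / 2 : ℝ) ≠ 0) hr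
  add _ _ _ _ := trivial
  translate e t₀ t₁ _ hT := by
    obtain ⟨N, hN, -⟩ := D.sub_of_translate hT
    exact ⟨N, by linarith⟩
  reflect e t₀ t₁ _ hR := by
    rcases Nat.even_or_odd e with he | he
    · exact h (D.hasBrake_of_reflect he hR)
    · exact hc (D.hasCollision_of_reflect he hR)

end TorusData

/-! ### Deformation of regular orbits and their `J⁺` -/

namespace TorusData

variable (D : TorusData)

/-- The linear deformation of an orbit to a Lissajous curve. -/
def deform {g : ℝ → ℝ} (hg : CosLike g) (ψ₁ ψ₂ : ℝ) (s : Icc (0 : ℝ) 1) : TorusData where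
  c := D.c
  s := (1 - s) * D.s + s
  f₁ := fun θ => (1 - s) * D.f₁ θ + s * g θ
  f₂ := fun θ => (1 - s) * D.f₂ θ + s * Real.cos (2 * Real.pi * θ)
  φ₁ := (1 - s) * D.φ₁ + s * ψ₁
  φ₂ := (1 - s) * D.φ₂ + s * ψ₂
  k := D.k
  l := D.l
  c_ne := D.c_ne
  hs := by
    have h1 := mul_nonneg (sub_nonneg.2 s.2.2) D.hs.1
    have h2 := mul_nonneg (sub_nonneg.2 s.2.2) (sub_nonneg.2 D.hs.2)
    exact ⟨add_nonneg h1 s.2.1, by linarith⟩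
  hf₁ := D.hf₁.combine hg (sub_nonneg.2 s.2.2) s.2.1 (by linarith)
  hf₂ := D.hf₂.combine cosLike_cos (sub_nonneg.2 s.2.2) s.2.1 (by linarith)
  bound θ := by
    have h1 := D.bound θ
    have h2 : |Real.cos (2 * Real.pi * θ)| < Real.pi :=
      (Real.abs_cos_le_one _).trans_lt (by linarith [Real.pi_gt_three])
    have h3 := abs_add_le ((1 - s) * D.f₂ θ) (s * Real.cos (2 * Real.pi * θ))
    rw [abs_mul, abs_mul, abs_of_nonneg (sub_nonneg.2 s.2.2), abs_of_nonneg s.2.1] at h3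
    have h4 := s.2.1
    have h5 := s.2.2
    rcases h4.eq_or_lt with h | h
    · rw [← h] at h3 ⊢; linarith
    · nlinarith
  k_pos := D.k_pos
  l_pos := D.l_pos
  coprime := D.coprime

variable {D} {g : ℝ → ℝ} {hg : CosLike g} {ψ₁ ψ₂ : ℝ}

theorem continuous_curve_deform :
    Continuous fun p : Icc (0 : ℝ) 1 × ℝ => (D.deform hg ψ₁ ψ₂ p.1).curve p.2 := by
  have h1 := D.hf₁.smooth.continuous
  have h2 := D.hf₂.smooth.continuous
  have h3 := hg.smooth.continuous
  simp only [deform, curve, torusCurve, torusPoint, stretch]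
  fun_prop

theorem continuous_vel_deform :
    Continuous fun p : Icc (0 : ℝ) 1 × ℝ => (D.deform hg ψ₁ ψ₂ p.1).vel p.2 := by
  have h1 := D.hf₁.smooth.continuous
  have h2 := D.hf₂.smooth.continuous
  have h3 := hg.smooth.continuous
  have h4 := D.hf₁.continuous_deriv
  have h5 := D.hf₂.continuous_deriv
  have h6 := hg.continuous_deriv
  have h7 := cosLike_cos.continuous_deriv
  have e : ∀ {f h : ℝ → ℝ} (_ : CosLike f) (_ : CosLike h) (s : ℝ),
      deriv (fun θ => (1 - s) * f θ + s * h θ) = fun θ => (1 - s) * deriv f θ + s * deriv h θ :=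
    fun hf hh s => funext fun θ =>
      (((hf.hasDerivAt θ).const_mul (1 - s)).add ((hh.hasDerivAt θ).const_mul s)).deriv
  simp only [deform, vel, torusVel, torusPoint, torusPointVel, stretchDeriv, e D.hf₁ hg,
    e D.hf₂ cosLike_cos]
  fun_prop

theorem deform_zero {s : Icc (0 : ℝ) 1} (hs : (s : ℝ) = 0) : D.deform hg ψ₁ ψ₂ s = D := by
  simp [deform, hs]

/-- The phase of an orbit relative to a brake orbit. -/
def phase (D : TorusData) : ℝ := 4 * (D.l * D.φ₁ - D.k * D.φ₂)

theorem phase_ne {n : ℤ} (h : ¬ D.HasBrake) : D.phase ≠ 2 * n := fun h1 =>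
  h (D.hasBrake_iff.2 ⟨n, by rw [phase] at h1; linarith⟩)

theorem phase_ne_of_collision {n : ℤ} (h : ¬ D.HasCollision) : D.phase ≠ 2 * n + (D.l - D.k) :=
  fun h1 => h (D.hasCollision_iff.2 ⟨n, h1⟩)

/-- Brakes have even phase, and the only even integer within distance one of `2j` is `2j`. -/
theorem not_hasBrake_of_abs {j : ℤ} (h0 : D.phase ≠ 2 * j) (h1 : |D.phase - 2 * j| ≤ 1) :
    ¬ D.HasBrake := by
  rw [hasBrake_iff]
  rintro ⟨n, hn⟩
  have h2 : D.phase = 2 * n := by rw [phase]; linarith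
  rw [h2] at h0 h1
  obtain ⟨h3, h4⟩ := abs_le.1 h1
  have h5 : 2 * n - 2 * j ≤ 1 := by exact_mod_cast h4
  have h6 : -1 ≤ 2 * n - 2 * j := by exact_mod_cast h3
  have h7 : n = j := by omega
  exact h0 (by rw [h7])

/-- Collision phases are the integers congruent to `l - k` modulo `2`. They are odd when `k + l` is
odd, which is why the ends of the interval have to be avoided in that case. -/
theorem not_hasCollision_of_abs {j : ℤ} (h0 : D.phase ≠ 2 * j) (h1 : |D.phase - 2 * j| ≤ 1)
    (h2 : (D.k + D.l) % 2 = 1 → |D.phase - 2 * j| < 1) : ¬ D.HasCollision := by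
  rw [hasCollision_iff]
  rintro ⟨n, hn⟩
  have h3 : D.phase = 2 * n + (D.l - D.k) := hn
  have h4 : D.phase - 2 * j = ((2 * n + (D.l - D.k) - 2 * j : ℤ) : ℝ) := by rw [h3]; push_cast; ring
  rw [h4] at h1 h2
  have h5 : (2 * n + (D.l - D.k) - 2 * j : ℤ) ≠ 0 := fun h => by
    rw [h, Int.cast_zero] at h4
    exact h0 (by linarith)
  have h6 : |(2 * n + (D.l - D.k) - 2 * j : ℤ)| ≤ 1 := by exact_mod_cast h1
  have h7 : (D.k + D.l) % 2 = 1 → |(2 * n + (D.l - D.k) - 2 * j : ℤ)| < 1 := fun h => by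
    exact_mod_cast h2 h
  rcases Nat.mod_two_eq_zero_or_one (D.k + D.l) with h | h
  · rw [abs_le] at h6
    omega
  · have := h7 h
    rw [abs_lt] at this
    omega

theorem phase_deform (s : Icc (0 : ℝ) 1) : (D.deform hg ψ₁ ψ₂ s).phase =
    (1 - s) * D.phase + s * (4 * (D.l * ψ₁ - D.k * ψ₂)) := by
  simp only [phase, deform]
  ring

/-- A regular orbit can be deformed through regular orbits to a thin Lissajous curve. -/
theorem exists_deform (h : ¬ D.HasBrake) (hc : ¬ D.HasCollision) :
    ∃ a₁ a₂ b : ℝ, a₁ ^ 2 = 1 ∧ a₂ ^ 2 = 1 ∧ b ≠ 0 ∧ ∀ᶠ ε in 𝓝[>] (0 : ℝ),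
      ∃ (g : ℝ → ℝ) (hg : CosLike g) (ψ₁ ψ₂ : ℝ),
        (∀ s, ¬ (D.deform hg ψ₁ ψ₂ s).HasBrake ∧ ¬ (D.deform hg ψ₁ ψ₂ s).HasCollision) ∧
        ∀ s : Icc (0 : ℝ) 1, (s : ℝ) = 1 → ∀ t, (D.deform hg ψ₁ ψ₂ s).curve t =
          thinLissajous (D.c / 2) a₁ a₂ b D.k D.l ε (2 * Real.pi * t) := by
  -- The phases `m/2`, `n/2` chosen below belong to a brake of phase `2j`, the even integer nearest
  -- to the given phase. The target is moved off it slightly, to the side of the given orbit, so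
  -- that linear interpolation of the phases meets neither brakes nor collisions.
  set j := round (D.phase / 2) with hj
  obtain ⟨m, n, hmn⟩ := D.exists_int_combination j
  have hmn' : (D.l : ℝ) * m - D.k * n = j := by exact_mod_cast hmn
  set x := D.phase - 2 * j with hx
  have hx0 : x ≠ 0 := sub_ne_zero.2 (phase_ne h)
  have hx1 : |x| ≤ 1 := by
    have h1 := abs_sub_round (D.phase / 2)
    rw [← hj, show D.phase / 2 - j = x / 2 by rw [hx]; ring, abs_div, abs_two] at h1
    linarith
  have hx2 : (D.k + D.l) % 2 = 1 → |x| < 1 := fun hkl => by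
    refine lt_of_le_of_ne hx1 fun h1 => ?_
    obtain ⟨p, hp⟩ : ∃ p : ℤ, (1 : ℤ) - (D.l - D.k) = 2 * p := ⟨(1 - (D.l - D.k)) / 2, by omega⟩
    have hp' : (1 : ℝ) - (D.l - D.k) = 2 * p := by exact_mod_cast hp
    rcases eq_or_eq_neg_of_abs_eq h1 with h1 | h1
    · exact phase_ne_of_collision (n := j + p) hc (by push_cast; linarith)
    · exact phase_ne_of_collision (n := j + p - 1) hc (by push_cast; linarith)
  obtain ⟨σ, hσ, hσx⟩ : ∃ σ : ℝ, σ ^ 2 = 1 ∧ 0 < σ * x := by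
    rcases hx0.lt_or_gt with h1 | h1
    · exact ⟨-1, by norm_num, by linarith⟩
    · exact ⟨1, by norm_num, by linarith⟩
  have hsq : ∀ p : ℤ, Real.cos (Real.pi * p) ^ 2 = 1 := fun p => by
    rw [Real.cos_sq', mul_comm, Real.sin_int_mul_pi]; ring
  have hσ0 : σ ≠ 0 := fun h => by rw [h] at hσx; linarith
  have hm0 : Real.cos (Real.pi * m) ≠ 0 := fun h => by have := hsq m; rw [h] at this; norm_num at this
  refine ⟨Real.cos (Real.pi * m), Real.cos (Real.pi * n), -Real.cos (Real.pi * m) * σ, hsq m, hsq n,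
    mul_ne_zero (neg_ne_zero.2 hm0) hσ0, ?_⟩
  have hev : ∀ᶠ ε in 𝓝[>] (0 : ℝ), 4 * D.l * (Real.arctan ε / (2 * Real.pi)) < 1 := by
    have hcont : ContinuousAt (fun ε => 4 * D.l * (Real.arctan ε / (2 * Real.pi))) 0 := by
      have := Real.continuous_arctan
      exact Continuous.continuousAt (by fun_prop)
    have h0 : 4 * D.l * (Real.arctan 0 / (2 * Real.pi)) < 1 := by simp
    exact (hcont.tendsto.eventually_lt_const h0).filter_mono nhdsWithin_le_nhds
  filter_upwards [hev, self_mem_nhdsWithin] with ε hε hε0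
  have hε0 : 0 < ε := hε0
  have hq : 0 < √(1 + ε ^ 2) := by positivity
  -- The identity `√(1 + ε²) cos(x + arctan ε) = cos x - ε sin x` converts the phase shift `δ` into
  -- the displacement of the thin curve. The zero summand fits the form of `CosLike.combine`.
  have hg : CosLike fun θ => √(1 + ε ^ 2) * Real.cos (2 * Real.pi * θ) + 0 * Real.cos (2 * Real.pi * θ) :=
    cosLike_cos.combine cosLike_cos hq.le le_rfl (by linarith)
  set δ := Real.arctan ε / (2 * Real.pi) with hδ
  have hδ0 : 0 < δ := div_pos (Real.arctan_pos.2 hε0) (by positivity)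
  have hl0 : (0 : ℝ) < D.l := by exact_mod_cast D.l_pos
  refine ⟨_, hg, m / 2 + σ * δ, n / 2, fun s => ?_, fun s hs t => ?_⟩
  · have h1 : (D.deform hg (m / 2 + σ * δ) (n / 2) s).phase - 2 * j =
        (1 - s) * x + s * (4 * D.l * (σ * δ)) := by
      rw [phase_deform, hx]
      linear_combination (2 * (s : ℝ)) * hmn'
    have hs0 := s.2.1
    have hs1 := s.2.2
    have habs : |x| = σ * x := by
      rw [← abs_of_pos hσx, abs_mul, ← sq_abs] at *
      have : |σ| = 1 := by
        have := abs_nonneg σ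
        nlinarith
      rw [this, one_mul]
    have hdl : 0 < 4 * D.l * δ := by positivity
    have h2 : σ * ((D.deform hg (m / 2 + σ * δ) (n / 2) s).phase - 2 * j) =
        (1 - s) * |x| + s * (4 * D.l * δ) := by
      rw [h1, habs]
      linear_combination ((s : ℝ) * (4 * D.l * δ)) * hσ
    have h3 : 0 < (1 - s) * |x| + s * (4 * D.l * δ) := by
      rcases hs0.eq_or_lt with h | h
      · rw [← h]
        have := abs_pos.2 hx0
        linarith
      · have := mul_pos h hdl
        have := mul_nonneg (sub_nonneg.2 hs1) (abs_nonneg x)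
        linarith
    have h4 : |(D.deform hg (m / 2 + σ * δ) (n / 2) s).phase - 2 * j| =
        (1 - s) * |x| + s * (4 * D.l * δ) := by
      rw [← abs_of_pos h3, ← h2, abs_mul]
      have h5 : |σ| = 1 := by
        have := abs_nonneg σ
        have := sq_abs σ
        nlinarith
      rw [h5, one_mul]
    have h5 : (D.deform hg (m / 2 + σ * δ) (n / 2) s).phase ≠ 2 * j := fun h6 => by
      rw [h6, sub_self, abs_zero] at h4
      linarith
    have h6 : (1 - s) * |x| + s * (4 * D.l * δ) ≤ 1 := by nlinarith
    have h7 : (D.k + D.l) % 2 = 1 → (1 - s) * |x| + s * (4 * D.l * δ) < 1 := fun hkl => by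
      have := hx2 hkl
      rcases hs0.eq_or_lt with h | h
      · rw [← h]; linarith
      · nlinarith
    rw [← h4] at h6 h7
    exact ⟨not_hasBrake_of_abs h5 h6, not_hasCollision_of_abs h5 h6 h7⟩
  · have hcs : ∀ (y : ℝ) (p : ℤ), Real.cos (y + Real.pi * p) = Real.cos y * Real.cos (Real.pi * p) := by
      intro y p
      rw [Real.cos_add, mul_comm Real.pi, Real.sin_int_mul_pi]; ring
    have h1 : √(1 + ε ^ 2) * Real.cos (2 * Real.pi * (D.k * t + (m / 2 + σ * δ))) =
        Real.cos (Real.pi * m) * Real.cos (D.k * (2 * Real.pi * t)) +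
          ε * (-Real.cos (Real.pi * m) * σ * Real.sin (D.k * (2 * Real.pi * t))) := by
      have hδ2 : 2 * Real.pi * δ = Real.arctan ε := by rw [hδ]; field_simp
      rw [show 2 * Real.pi * (D.k * t + (m / 2 + σ * δ)) =
        (D.k * (2 * Real.pi * t) + σ * (2 * Real.pi * δ)) + Real.pi * m by ring, hcs, hδ2, Real.cos_add]
      have h2 : Real.cos (σ * Real.arctan ε) = 1 / √(1 + ε ^ 2) ∧
          Real.sin (σ * Real.arctan ε) = σ * (ε / √(1 + ε ^ 2)) := by
        rcases eq_or_eq_neg_of_sq_eq_sq σ 1 (by rw [hσ, one_pow]) with h | h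
        · rw [h]; simp [Real.cos_arctan, Real.sin_arctan]
        · rw [h]; simp [Real.cos_arctan, Real.sin_arctan]
      rw [h2.1, h2.2]
      field_simp
      ring
    have h2 : Real.cos (2 * Real.pi * (D.l * t + n / 2)) =
        Real.cos (Real.pi * n) * Real.cos (D.l * (2 * Real.pi * t)) := by
      rw [show 2 * Real.pi * (D.l * t + n / 2) = D.l * (2 * Real.pi * t) + Real.pi * n by ring, hcs,
        mul_comm]
    simp only [deform, curve, torusCurve, torusPoint, stretch, hs, thinLissajous, sub_self, zero_mul,
      zero_add, one_mul, add_zero]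
    rw [h1, h2]
    push_cast
    ring

/-- `F` is the identity, the square, or the square at half speed. Each curve of the deformation is
an `IsLoop`, so no direct self-tangency occurs. -/
theorem jPlusPath_deform {a₁ a₂ b ε κ : ℝ} {F : (ℝ → ℂ) → ℝ → ℂ} {F' : (ℝ → ℂ) → (ℝ → ℂ) → ℝ → ℂ}
    {P : ℕ → Prop}
    (h1 : ∀ s : Icc (0 : ℝ) 1, (s : ℝ) = 1 → ∀ t, (D.deform hg ψ₁ ψ₂ s).curve t =
      thinLissajous (D.c / 2) a₁ a₂ b D.k D.l ε (2 * Real.pi * t))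
    (hF : ∀ σ : ℝ → ℝ → ℂ, (Continuous fun p : ℝ × ℝ => σ p.1 p.2) →
      Continuous fun p : ℝ × ℝ => F (σ p.1) p.2)
    (hF' : ∀ σ σ' : ℝ → ℝ → ℂ, (Continuous fun p : ℝ × ℝ => σ p.1 p.2) →
      (Continuous fun p : ℝ × ℝ => σ' p.1 p.2) → Continuous fun p : ℝ × ℝ => F' (σ p.1) (σ' p.1) p.2)
    (hL : ∀ s, (D.deform hg ψ₁ ψ₂ s).IsLoop (F (D.deform hg ψ₁ ψ₂ s).curve)
      (F' (D.deform hg ψ₁ ψ₂ s).curve (D.deform hg ψ₁ ψ₂ s).vel) κ P) :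
    JPlusPath (F D.curve)
      (F fun t => thinLissajous (D.c / 2) a₁ a₂ b D.k D.l ε (2 * Real.pi * t)) 0 := by
  obtain ⟨e, he, he0, he1⟩ : ∃ e : ℝ → Icc (0 : ℝ) 1, Continuous e ∧ (e 0 : ℝ) = 0 ∧ (e 1 : ℝ) = 1 :=
    ⟨projIcc 0 1 zero_le_one, continuous_projIcc, by simp, by simp⟩
  have hc : Continuous fun p : ℝ × ℝ => (D.deform hg ψ₁ ψ₂ (e p.1)).curve p.2 :=
    (continuous_curve_deform (D := D) (hg := hg) (ψ₁ := ψ₁) (ψ₂ := ψ₂)).comp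
      (f := fun p : ℝ × ℝ => (e p.1, p.2)) ((he.comp continuous_fst).prodMk continuous_snd)
  have hv : Continuous fun p : ℝ × ℝ => (D.deform hg ψ₁ ψ₂ (e p.1)).vel p.2 :=
    (continuous_vel_deform (D := D) (hg := hg) (ψ₁ := ψ₁) (ψ₂ := ψ₂)).comp
      (f := fun p : ℝ × ℝ => (e p.1, p.2)) ((he.comp continuous_fst).prodMk continuous_snd)
  have h := JPlusPath.of_forall (Γ := fun s => F (D.deform hg ψ₁ ψ₂ (e s)).curve)
    (Γ' := fun s => F' (D.deform hg ψ₁ ψ₂ (e s)).curve (D.deform hg ψ₁ ψ₂ (e s)).vel)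
    (hF (fun s => (D.deform hg ψ₁ ψ₂ (e s)).curve) hc)
    (hF' (fun s => (D.deform hg ψ₁ ψ₂ (e s)).curve) (fun s => (D.deform hg ψ₁ ψ₂ (e s)).vel) hc hv)
    (fun s => (hL (e s)).hasDerivAt) (fun s => (hL (e s)).contDiff)
    (fun s => (hL (e s)).periodic) (fun s _ => (hL (e s)).vel_ne_zero)
    fun s _ t₀ t₁ r hr h3 h4 => (hL (e s)).sub_of_tangency hr h3 h4
  rw [deform_zero he0] at h
  rwa [show (D.deform hg ψ₁ ψ₂ (e 1)).curve =
    fun t => thinLissajous (D.c / 2) a₁ a₂ b D.k D.l ε (2 * Real.pi * t) from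
    funext fun t => h1 _ he1 t] at h

/-- Deform to a thin Lissajous curve and retract it; both steps work for some common small `ε`. -/
theorem isArnoldJPlus_curve (h : ¬ D.HasBrake) (hc : ¬ D.HasCollision) :
    IsArnoldJPlus D.curve ((D.k - 1) * (D.l - 1)) := by
  obtain ⟨a₁, a₂, b, ha₁, ha₂, hb, hev⟩ := exists_deform h hc
  have ha₁' : a₁ ≠ 0 := fun h => by rw [h] at ha₁; norm_num at ha₁
  have ha₂' : a₂ ≠ 0 := fun h => by rw [h] at ha₂; norm_num at ha₂
  obtain ⟨n, hn, hev'⟩ := thinLissajous_reduces (div_ne_zero D.c_ne two_ne_zero) ha₁' ha₂' hb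
    D.k_pos D.l_pos D.coprime
  obtain ⟨ε, ⟨g, hg, ψ₁, ψ₂, hs, h1⟩, h2⟩ := (hev.and hev').exists
  have hJ := jPlusPath_deform (F := fun σ => σ) (F' := fun _ σ' => σ') h1 (fun _ h => h)
    (fun _ _ _ h => h) fun s => isLoop _ (hs s).1
  have h3 := (hJ.reducesToStandard h2).isArnoldJPlus (D.isLoop h).isGenericImmersion
  have hk := D.k_pos
  have hl := D.l_pos
  have e : 2 * ((0 + n : ℕ) : ℤ) = (D.k - 1) * (D.l - 1) := by
    rw [zero_add, ← Nat.cast_pred hk, ← Nat.cast_pred hl]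
    exact_mod_cast hn
  rwa [e] at h3

theorem isArnoldJPlus_sq (h : ¬ D.HasBrake) (hc : ¬ D.HasCollision) (hkl : (D.k + D.l) % 2 = 1) :
    IsArnoldJPlus (fun t => D.curve t ^ 2) ((D.k - 1) * (D.l - 1) + D.k * D.l) := by
  obtain ⟨a₁, a₂, b, ha₁, ha₂, hb, hev⟩ := exists_deform h hc
  have ha₁' : a₁ ≠ 0 := fun h => by rw [h] at ha₁; norm_num at ha₁
  have ha₂' : a₂ ≠ 0 := fun h => by rw [h] at ha₂; norm_num at ha₂
  obtain ⟨n, hn, hev'⟩ := thinLissajous_sq_reduces (div_ne_zero D.c_ne two_ne_zero) ha₁' ha₂' hb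
    D.k_pos D.l_pos D.coprime hkl
  obtain ⟨ε, ⟨g, hg, ψ₁, ψ₂, hs, h1⟩, h2⟩ := (hev.and hev').exists
  have hJ := jPlusPath_deform (F := fun σ t => σ t ^ 2) (F' := fun σ σ' t => 2 * σ t * σ' t) h1
    (fun _ h => h.pow 2) (fun _ _ h h' => (continuous_const.mul h).mul h')
    fun s => isLoop_sq _ (hs s).1 (hs s).2 hkl
  have h3 := (hJ.reducesToStandard h2).isArnoldJPlus (D.isLoop_sq h hc hkl).isGenericImmersion
  have hk := D.k_pos
  have hl := D.l_pos
  have e : 2 * ((0 + n : ℕ) : ℤ) = (D.k - 1) * (D.l - 1) + D.k * D.l := by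
    rw [zero_add, ← Nat.cast_pred hk, ← Nat.cast_pred hl]
    exact_mod_cast hn
  rwa [e] at h3

theorem isArnoldJPlus_fold (h : ¬ D.HasBrake) (hc : ¬ D.HasCollision) (hk2 : D.k % 2 = 1)
    (hl2 : D.l % 2 = 1) : ∃ v : ℤ, 2 * v = (D.k - 1) * (D.l - 1) ∧
      IsArnoldJPlus (fun t => D.curve (1 / 2 * t) ^ 2) v := by
  obtain ⟨a₁, a₂, b, ha₁, ha₂, hb, hev⟩ := exists_deform h hc
  obtain ⟨n, hn, hev'⟩ := thinLissajous_fold_reduces (div_ne_zero D.c_ne two_ne_zero) ha₁ ha₂ hb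
    hk2 hl2 D.coprime
  obtain ⟨ε, ⟨g, hg, ψ₁, ψ₂, hs, h1⟩, h2⟩ := (hev.and hev').exists
  have hJ := jPlusPath_deform (F := fun σ t => σ (1 / 2 * t) ^ 2)
    (F' := fun σ σ' t => (1 / 2 : ℝ) • (2 * σ (1 / 2 * t) * σ' (1 / 2 * t))) h1
    (fun σ h => by
      have : Continuous fun p : ℝ × ℝ => σ p.1 (1 / 2 * p.2) :=
        h.comp (f := fun p : ℝ × ℝ => (p.1, 1 / 2 * p.2)) (by fun_prop)
      exact this.pow 2)
    (fun σ σ' h h' => by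
      have h3 : Continuous fun p : ℝ × ℝ => σ p.1 (1 / 2 * p.2) :=
        h.comp (f := fun p : ℝ × ℝ => (p.1, 1 / 2 * p.2)) (by fun_prop)
      have h4 : Continuous fun p : ℝ × ℝ => σ' p.1 (1 / 2 * p.2) :=
        h'.comp (f := fun p : ℝ × ℝ => (p.1, 1 / 2 * p.2)) (by fun_prop)
      exact ((continuous_const.mul h3).mul h4).const_smul (1 / 2 : ℝ))
    fun s => isLoop_fold _ (hs s).1 (hs s).2 hk2 hl2
  simp only [show ∀ t, 2 * Real.pi * (1 / 2 * t) = Real.pi * t from fun t => by ring] at hJ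
  have h3 := (hJ.reducesToStandard h2).isArnoldJPlus (D.isLoop_fold h hc hk2 hl2).isGenericImmersion
  have hk := D.k_pos
  have hl := D.l_pos
  refine ⟨_, ?_, h3⟩
  rw [zero_add, ← Nat.cast_pred hk, ← Nat.cast_pred hl, ← mul_assoc]
  exact_mod_cast hn

end TorusData

/-! ### Winding numbers -/

/-- The winding number is read off from a continuous logarithm. -/
theorem isWindingNumber_of_exp {γ L : ℝ → ℂ} {a : ℂ} {w : ℤ} (hL : Continuous L) (ha : a ≠ 0)
    (h : ∀ t, γ t = a * Complex.exp (L t)) (hw : (L 1).im - (L 0).im = 2 * Real.pi * w) :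
    IsWindingNumber γ w := by
  refine ⟨fun t => by rw [h]; exact mul_ne_zero ha (Complex.exp_ne_zero _),
    fun t => a.arg + (L t).im, by fun_prop, fun t => ?_, by linarith⟩
  have h1 : ‖γ t‖ = ‖a‖ * Real.exp (L t).re := by rw [h, norm_mul, Complex.norm_exp]
  have h2 : Complex.exp (L t) = Complex.exp (L t).re * Complex.exp ((L t).im * Complex.I) := by
    rw [← Complex.exp_add, Complex.re_add_im]
  rw [h1, h t, h2]
  conv_lhs => rw [← Complex.norm_mul_exp_arg_mul_I a]
  push_cast
  rw [add_mul, Complex.exp_add]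
  ring

/-- A continuously differentiable curve in the punctured plane has a logarithm. -/
theorem exists_log_of_ne_zero {σ σ' : ℝ → ℂ} (hd : ∀ t, HasDerivAt σ (σ' t) t) (hc : Continuous σ')
    (h0 : ∀ t, σ t ≠ 0) : ∃ L : ℝ → ℂ, (∀ t, HasDerivAt L (σ' t / σ t) t) ∧
      ∀ t, σ t = σ 0 * Complex.exp (L t) := by
  have hcont : Continuous fun t => σ' t / σ t :=
    hc.div (continuous_iff_continuousAt.2 fun t => (hd t).continuousAt) h0
  let L : ℝ → ℂ := fun t => ∫ x in (0 : ℝ)..t, σ' x / σ x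
  have hL : ∀ t, HasDerivAt L (σ' t / σ t) t := fun t =>
    intervalIntegral.integral_hasDerivAt_right (hcont.intervalIntegrable _ _)
      (hcont.stronglyMeasurableAtFilter _ _) hcont.continuousAt
  refine ⟨L, hL, fun t => ?_⟩
  have h1 : ∀ t, HasDerivAt (fun t => σ t * Complex.exp (-L t)) 0 t := fun t => by
    refine ((hd t).mul (hL t).neg.cexp).congr_deriv ?_
    have := h0 t
    field_simp
    ring
  have h2 := is_const_of_deriv_eq_zero (fun t => (h1 t).differentiableAt) (fun t => (h1 t).deriv) t 0
  simp only [L, intervalIntegral.integral_same, neg_zero, Complex.exp_zero, mul_one] at h2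
  rw [← h2, mul_assoc, ← Complex.exp_add, neg_add_cancel, Complex.exp_zero, mul_one]

/-- If the reflected logarithmic derivative repeats itself after half a period, the curve has
winding number zero. -/
theorem im_log_sub_eq_zero {L L' : ℝ → ℂ} (hL : ∀ t, HasDerivAt L (L' t) t)
    (h : ∀ t, L' (t + 1 / 2) = (starRingEnd ℂ) (L' t)) : (L 1).im - (L 0).im = 0 := by
  have h1 : ∀ t, HasDerivAt (fun t => L (t + 1 / 2) - (starRingEnd ℂ) (L t)) 0 t := fun t => by
    have h2 : HasDerivAt (fun t => L (t + 1 / 2)) (L' (t + 1 / 2)) t :=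
      (hL (t + 1 / 2)).comp_add_const t (1 / 2)
    refine (h2.sub (Complex.conjCLE.toContinuousLinearMap.hasFDerivAt.comp_hasDerivAt t
      (hL t))).congr_deriv ?_
    rw [h]
    simp
  have h2 := is_const_of_deriv_eq_zero (fun t => (h1 t).differentiableAt) (fun t => (h1 t).deriv)
    (1 / 2) 0
  have h3 := congrArg Complex.im h2
  simp only [Complex.sub_im, Complex.conj_im] at h3
  norm_num at h3
  linarith

/-- If the logarithmic derivative repeats itself after half a period, where the curve is reversed, and
the curve does not take opposite directions at times symmetric to some fixed time, then it makes half
a turn in half a period. -/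
theorem im_log_sub_eq_pi {σ L L' : ℝ → ℂ} {a : ℂ} (ha : a ≠ 0) (hL : ∀ t, HasDerivAt L (L' t) t)
    (hσ : ∀ t, σ t = a * Complex.exp (L t)) (h : ∀ t, L' (t + 1 / 2) = L' t)
    (hhalf : ∀ t, σ (t + 1 / 2) = -σ t) {t₀ : ℝ}
    (hno : ∀ u ∈ Ioo (0 : ℝ) (1 / 4), ∀ r : ℝ, 0 < r → σ (t₀ + u) ≠ -(r * σ (t₀ - u))) :
    ∃ w : ℤ, w ^ 2 = 1 ∧ ∀ t, (L (t + 1 / 2)).im - (L t).im = Real.pi * w := by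
  have hcL : Continuous L := continuous_iff_continuousAt.2 fun t => (hL t).continuousAt
  have h1 : ∀ t, HasDerivAt (fun t => L (t + 1 / 2) - L t) 0 t := fun t => by
    have h2 : HasDerivAt (fun t => L (t + 1 / 2)) (L' (t + 1 / 2)) t :=
      (hL (t + 1 / 2)).comp_add_const t (1 / 2)
    refine (h2.sub (hL t)).congr_deriv ?_
    rw [h, sub_self]
  have h2 := is_const_of_deriv_eq_zero (fun t => (h1 t).differentiableAt) (fun t => (h1 t).deriv)
  set A := L (t₀ - 1 / 4 + 1 / 2) - L (t₀ - 1 / 4) with hA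
  have hexp : Complex.exp A = -1 := by
    have h3 := hhalf (t₀ - 1 / 4)
    rw [hσ, hσ, ← mul_neg] at h3
    rw [hA, Complex.exp_sub, mul_left_cancel₀ ha h3, neg_div, div_self (Complex.exp_ne_zero _)]
  have hImA : ∃ n : ℤ, A.im = Real.pi * (2 * n + 1) := by
    rw [← Complex.exp_pi_mul_I, Complex.exp_eq_exp_iff_exists_int] at hexp
    obtain ⟨n, hn⟩ := hexp
    refine ⟨n, ?_⟩
    rw [hn]
    simp
    ring
  have hopp : ∀ u ∈ Ioo (0 : ℝ) (1 / 4), ∀ n : ℤ,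
      (L (t₀ + u)).im - (L (t₀ - u)).im ≠ Real.pi * (2 * n + 1) := by
    intro u hu n hn
    have h3 : Complex.exp (L (t₀ + u) - L (t₀ - u)) =
        -(Real.exp ((L (t₀ + u)).re - (L (t₀ - u)).re) : ℂ) := by
      rw [← Complex.re_add_im (L (t₀ + u) - L (t₀ - u)), Complex.exp_add, Complex.sub_im, hn,
        Complex.sub_re, Complex.ofReal_exp, ← mul_neg_one]
      congr 1
      rw [← Complex.exp_pi_mul_I, Complex.exp_eq_exp_iff_exists_int]
      exact ⟨n, by push_cast; ring⟩
    refine hno u hu _ (Real.exp_pos ((L (t₀ + u)).re - (L (t₀ - u)).re)) ?_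
    rw [Complex.exp_sub] at h3
    rw [hσ, hσ, (div_eq_iff (Complex.exp_ne_zero _)).1 h3]
    ring
  have hcR : Continuous fun u => (L (t₀ + u)).im - (L (t₀ - u)).im := by fun_prop
  -- The angle between the directions at `t₀ + u` and `t₀ - u` starts at `0` and is never an odd
  -- multiple of `π`, so it stays below `π` until `u = 1/4`, where it is the turn over half a
  -- period.
  have hbound : |A.im| ≤ Real.pi := by
    have hlt : ∀ u ∈ Ioo (0 : ℝ) (1 / 4), |(L (t₀ + u)).im - (L (t₀ - u)).im| < Real.pi := by
      intro u hu
      by_contra hge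
      rw [not_lt] at hge
      have hiv := intermediate_value_Icc hu.1.le (hcR.abs.continuousOn)
      obtain ⟨v, hv, hv'⟩ := hiv (show Real.pi ∈ _ by
        simp only [add_zero, sub_zero, sub_self, abs_zero]
        exact ⟨Real.pi_pos.le, hge⟩)
      have hv0 : 0 < v := by
        refine lt_of_le_of_ne hv.1 fun h => ?_
        rw [← h] at hv'
        simp only [add_zero, sub_zero, sub_self, abs_zero] at hv'
        exact Real.pi_pos.ne hv'
      have hvm : v ∈ Ioo (0 : ℝ) (1 / 4) := ⟨hv0, hv.2.trans_lt hu.2⟩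
      rcases eq_or_eq_neg_of_abs_eq hv' with h | h
      · exact hopp v hvm 0 (by rw [h]; push_cast; ring)
      · exact hopp v hvm (-1) (by rw [h]; push_cast; ring)
    have hcl : (1 / 4 : ℝ) ∈ closure (Ioo (0 : ℝ) (1 / 4)) := by
      rw [closure_Ioo (by norm_num)]
      exact ⟨by norm_num, le_rfl⟩
    have := le_on_closure (fun u hu => (hlt u hu).le) hcR.abs.continuousOn continuousOn_const hcl
    rw [hA, show t₀ - 1 / 4 + 1 / 2 = t₀ + 1 / 4 by ring, Complex.sub_im]
    exact this
  obtain ⟨n, hn⟩ := hImA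
  refine ⟨2 * n + 1, ?_, fun t => ?_⟩
  · rw [hn, abs_mul, abs_of_pos Real.pi_pos, mul_le_iff_le_one_right Real.pi_pos] at hbound
    have h3 : |(2 * n + 1 : ℤ)| ≤ 1 := by exact_mod_cast hbound
    rw [abs_le] at h3
    have : n = 0 ∨ n = -1 := by omega
    rcases this with rfl | rfl <;> norm_num
  · rw [← Complex.sub_im, h2 t (t₀ - 1 / 4), ← hA, hn]
    push_cast
    ring

theorem stretch_conj (s : ℝ) (z : ℂ) :
    stretch s ((starRingEnd ℂ) z) = (starRingEnd ℂ) (stretch s z) := by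
  have h : (starRingEnd ℂ) z / 2 = (starRingEnd ℂ) (z / 2) := by
    rw [map_div₀, map_ofNat]
  simp only [stretch, h, Complex.sinh_conj, map_add, map_mul, map_sub, map_one, Complex.conj_ofReal]

theorem stretchDeriv_conj (s : ℝ) (z : ℂ) :
    stretchDeriv s ((starRingEnd ℂ) z) = (starRingEnd ℂ) (stretchDeriv s z) := by
  have h : (starRingEnd ℂ) z / 2 = (starRingEnd ℂ) (z / 2) := by
    rw [map_div₀, map_ofNat]
  have h2 : (starRingEnd ℂ) 2 = 2 := map_ofNat _ 2
  rw [stretchDeriv, h, Complex.cosh_conj, stretchDeriv, map_div₀, h2]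
  simp only [map_add, map_mul, map_sub, map_one, Complex.conj_ofReal]

theorem stretch_re_add_im (s x y : ℝ) : stretch s ((x : ℂ) + (y : ℂ) * Complex.I) =
    (((1 - s) * (Real.sinh (x / 2) * Real.cos (y / 2)) + s * (x / 2) : ℝ) : ℂ) +
    (((1 - s) * (Real.cosh (x / 2) * Real.sin (y / 2)) + s * (y / 2) : ℝ) : ℂ) * Complex.I := by
  rw [stretch, add_div, mul_div_right_comm, Complex.sinh_add, Complex.cosh_mul_I, Complex.sinh_mul_I]
  push_cast
  ring

theorem stretch_im_pos {s : ℝ} (hs : s ∈ Icc (0 : ℝ) 1) {z : ℂ} (h0 : 0 < z.im)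
    (h1 : z.im < Real.pi) : 0 < (stretch s z).im := by
  rw [← Complex.re_add_im z, stretch_re_add_im]
  simp only [Complex.add_im, Complex.ofReal_im, Complex.im_ofReal_mul, Complex.I_im, mul_one, zero_add]
  have h2 := mul_pos (Real.cosh_pos (z.re / 2)) (Real.sin_pos_of_pos_of_lt_pi (x := z.im / 2)
    (by linarith) (by linarith))
  rcases hs.1.eq_or_lt with h | h
  · rw [← h]; linarith
  · have := mul_nonneg (sub_nonneg.2 hs.2) h2.le
    have := mul_pos h (half_pos h0)
    linarith

theorem stretch_im_neg {s : ℝ} (hs : s ∈ Icc (0 : ℝ) 1) {z : ℂ} (h0 : z.im < 0)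
    (h1 : -Real.pi < z.im) : (stretch s z).im < 0 := by
  have := stretch_im_pos hs (z := -z) (by simpa using h0) (by simp; linarith)
  rw [stretch_neg, Complex.neg_im] at this
  linarith

/-- `stretch s` on the real line. -/
def stretchRe (s x : ℝ) : ℝ := (1 - s) * Real.sinh (x / 2) + s * (x / 2)

theorem stretch_ofReal_re (s x : ℝ) : (stretch s x).re = stretchRe s x := by
  have := stretch_re_add_im s x 0
  simp only [Complex.ofReal_zero, zero_mul, add_zero, zero_div, Real.cos_zero, Real.sin_zero, mul_one,
    mul_zero] at this
  rw [this, Complex.ofReal_re, stretchRe]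

theorem stretchRe_pos {s : ℝ} (hs : s ∈ Icc (0 : ℝ) 1) {x : ℝ} (h : 0 < x) : 0 < stretchRe s x := by
  have h2 := Real.sinh_pos_iff.2 (half_pos h)
  rw [stretchRe]
  rcases hs.1.eq_or_lt with h' | h'
  · rw [← h']; linarith
  · have := mul_nonneg (sub_nonneg.2 hs.2) h2.le
    have := mul_pos h' (half_pos h)
    linarith

theorem stretchRe_neg {s : ℝ} (hs : s ∈ Icc (0 : ℝ) 1) {x : ℝ} (h : x < 0) : stretchRe s x < 0 := by
  have := stretchRe_pos hs (neg_pos.2 h)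
  simp only [stretchRe, neg_div, Real.sinh_neg] at this ⊢
  linarith

theorem mul_neg_of_stretchRe {s : ℝ} (hs : s ∈ Icc (0 : ℝ) 1) {x y r : ℝ} (hr : 0 < r) (hy : y ≠ 0)
    (h : stretchRe s x = -r * stretchRe s y) : x < 0 ∧ 0 < y ∨ 0 < x ∧ y < 0 := by
  have h0 : stretchRe s 0 = 0 := by simp [stretchRe]
  rcases hy.lt_or_gt with hy | hy
  · have h1 := stretchRe_neg hs hy
    refine Or.inr ⟨?_, hy⟩
    by_contra! hx
    rcases hx.eq_or_lt with rfl | hx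
    · rw [h0] at h; nlinarith
    · have := stretchRe_neg hs hx
      nlinarith
  · have h1 := stretchRe_pos hs hy
    refine Or.inl ⟨?_, hy⟩
    by_contra! hx
    rcases hx.eq_or_lt with rfl | hx
    · rw [h0] at h; nlinarith
    · have := stretchRe_pos hs hx
      nlinarith

namespace TorusData

variable {D : TorusData}

theorem continuous_vel : Continuous D.vel := by
  have h1 : deriv D.curve = D.vel := funext fun t => (D.hasDerivAt_curve t).deriv
  rw [← h1]
  exact D.contDiff_curve.continuous_deriv (by simp)

theorem torusPoint_add_half (t : ℝ) : torusPoint D.f₁ D.f₂ D.φ₁ D.φ₂ D.k D.l (t + 1 / 2) =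
    (((-1) ^ D.k * D.f₁ (D.k * t + D.φ₁) : ℝ) : ℂ) +
      (((-1) ^ D.l * D.f₂ (D.l * t + D.φ₂) : ℝ) : ℂ) * Complex.I := by
  rw [← D.hf₁.add_half, ← D.hf₂.add_half, torusPoint]
  ring_nf

theorem torusPointVel_add_half (t : ℝ) :
    torusPointVel (deriv D.f₁) (deriv D.f₂) D.φ₁ D.φ₂ D.k D.l (t + 1 / 2) =
    ((D.k * ((-1) ^ D.k * deriv D.f₁ (D.k * t + D.φ₁)) : ℝ) : ℂ) +
      ((D.l * ((-1) ^ D.l * deriv D.f₂ (D.l * t + D.φ₂)) : ℝ) : ℂ) * Complex.I := by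
  rw [← D.hf₁.deriv_add_half, ← D.hf₂.deriv_add_half, torusPointVel]
  ring_nf

/-- One of `k`, `l` is odd and the other even, so half a period conjugates the torus point up to
sign. `stretch` is odd and commutes with conjugation, and the sign cancels in the quotient. -/
theorem logDeriv_add_half_of_odd (hkl : (D.k + D.l) % 2 = 1) (t : ℝ) :
    D.vel (t + 1 / 2) / D.curve (t + 1 / 2) = (starRingEnd ℂ) (D.vel t / D.curve t) := by
  have hc := D.c_ne
  have e : ∀ s : ℝ, D.vel s / D.curve s =
      stretchDeriv D.s (torusPoint D.f₁ D.f₂ D.φ₁ D.φ₂ D.k D.l s) *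
        torusPointVel (deriv D.f₁) (deriv D.f₂) D.φ₁ D.φ₂ D.k D.l s /
        stretch D.s (torusPoint D.f₁ D.f₂ D.φ₁ D.φ₂ D.k D.l s) := fun s => by
    rw [vel, curve, torusVel, torusCurve, mul_div_mul_left _ _ hc]
  rw [e, e]
  rcases Nat.even_or_odd D.k with hk | hk
  · have hl : Odd D.l := by
      rw [Nat.even_iff] at hk
      rw [Nat.odd_iff]; omega
    have h1 : torusPoint D.f₁ D.f₂ D.φ₁ D.φ₂ D.k D.l (t + 1 / 2) =
        (starRingEnd ℂ) (torusPoint D.f₁ D.f₂ D.φ₁ D.φ₂ D.k D.l t) := by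
      rw [torusPoint_add_half, hk.neg_one_pow, hl.neg_one_pow]
      simp [torusPoint]
    have h2 : torusPointVel (deriv D.f₁) (deriv D.f₂) D.φ₁ D.φ₂ D.k D.l (t + 1 / 2) =
        (starRingEnd ℂ) (torusPointVel (deriv D.f₁) (deriv D.f₂) D.φ₁ D.φ₂ D.k D.l t) := by
      rw [torusPointVel_add_half, hk.neg_one_pow, hl.neg_one_pow]
      simp [torusPointVel]
    rw [h1, h2, stretch_conj, stretchDeriv_conj, map_div₀, map_mul]
  · have hl : Even D.l := by
      rw [Nat.odd_iff] at hk
      rw [Nat.even_iff]; omega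
    have h1 : torusPoint D.f₁ D.f₂ D.φ₁ D.φ₂ D.k D.l (t + 1 / 2) =
        -(starRingEnd ℂ) (torusPoint D.f₁ D.f₂ D.φ₁ D.φ₂ D.k D.l t) := by
      rw [torusPoint_add_half, hk.neg_one_pow, hl.neg_one_pow]
      simp [torusPoint, add_comm]
    have h2 : torusPointVel (deriv D.f₁) (deriv D.f₂) D.φ₁ D.φ₂ D.k D.l (t + 1 / 2) =
        -(starRingEnd ℂ) (torusPointVel (deriv D.f₁) (deriv D.f₂) D.φ₁ D.φ₂ D.k D.l t) := by
      rw [torusPointVel_add_half, hk.neg_one_pow, hl.neg_one_pow]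
      simp [torusPointVel, add_comm]
    rw [h1, h2, stretch_neg, stretchDeriv_neg, stretch_conj, stretchDeriv_conj, mul_neg, neg_div_neg_eq,
      map_div₀, map_mul]

theorem vel_add_half (t : ℝ) (h : D.k % 2 = D.l % 2) :
    D.vel (t + 1 / 2) = (-1) ^ D.k * D.vel t := by
  have h1 : HasDerivAt (fun t => D.curve (t + 1 / 2)) (D.vel (t + 1 / 2)) t :=
    (D.hasDerivAt_curve (t + 1 / 2)).comp_add_const t (1 / 2)
  have h2 : (fun t => D.curve (t + 1 / 2)) = fun t => (-1) ^ D.k * D.curve t := funext fun t => by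
    have := D.curve_add_half 1 t h
    rwa [Nat.cast_one, mul_one] at this
  rw [h2] at h1
  exact h1.unique ((D.hasDerivAt_curve t).const_mul _)

theorem isWindingNumber_sq (hc : ¬ D.HasCollision) (hkl : (D.k + D.l) % 2 = 1) :
    IsWindingNumber (fun t => D.curve t ^ 2) 0 := by
  obtain ⟨L, hL, hσ⟩ := exists_log_of_ne_zero D.hasDerivAt_curve continuous_vel (D.curve_ne_zero hc)
  have hcL : Continuous L := continuous_iff_continuousAt.2 fun t => (hL t).continuousAt
  refine isWindingNumber_of_exp (L := fun t => 2 * L t) (by fun_prop)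
    (pow_ne_zero 2 (D.curve_ne_zero hc 0)) (fun t => ?_) ?_
  · rw [hσ t, mul_pow, ← Complex.exp_nat_mul, Nat.cast_two]
  · have := im_log_sub_eq_zero hL (logDeriv_add_half_of_odd hkl)
    simp
    linarith

/-- At `t₀` the second oscillation has a turning point. The offset `δ` of the first phase from a
multiple of `1/2` is measured by the distance of the phase of the orbit to the nearest even integer;
this is at most one, and nonzero because even phases are collisions here. -/
theorem exists_center (hc : ¬ D.HasCollision) (hkl : D.k % 2 = D.l % 2) :
    ∃ (t₀ δ : ℝ) (m n : ℤ), 0 < |4 * D.l * δ| ∧ |4 * D.l * δ| < 2 ∧ D.k * t₀ + D.φ₁ = m / 2 + δ ∧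
      D.l * t₀ + D.φ₂ = n / 2 := by
  have hl : (D.l : ℝ) ≠ 0 := by exact_mod_cast D.l_pos.ne'
  set j := round (D.phase / 2) with hj
  obtain ⟨m, n, hmn⟩ := D.exists_int_combination j
  have hmn' : (D.l : ℝ) * m - D.k * n = j := by exact_mod_cast hmn
  have h1 := abs_sub_round (D.phase / 2)
  rw [← hj, show D.phase / 2 - j = (D.phase - 2 * j) / 2 by ring, abs_div, abs_two] at h1
  have h2 : D.phase ≠ 2 * j := by
    obtain ⟨p, hp⟩ : ∃ p : ℤ, ((D.l : ℤ) - D.k) = 2 * p := ⟨((D.l : ℤ) - D.k) / 2, by omega⟩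
    have hp' : (D.l : ℝ) - D.k = 2 * p := by exact_mod_cast hp
    have := phase_ne_of_collision (n := j - p) hc
    rw [hp'] at this
    push_cast at this
    intro h
    exact this (by linarith)
  have h3 : 4 * D.l * ((D.phase - 2 * j) / (4 * D.l)) = D.phase - 2 * j := by field_simp
  refine ⟨(n / 2 - D.φ₂) / D.l, (D.phase - 2 * j) / (4 * D.l), m, n, ?_, ?_, ?_, by field_simp; ring⟩
  · rw [h3]
    exact abs_pos.2 (sub_ne_zero.2 h2)
  · rw [h3]
    linarith
  · rw [phase]
    field_simp
    linear_combination (-4) * hmn'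

/-- The second oscillation is even about `t₀`, so the symmetric points have the same imaginary part.
As `stretch` preserves its sign, opposite directions make it zero. The real parts then have opposite
signs, so `f₁` has a zero within `|δ|` of `ku + m/2`. With the zero of `f₂` this yields an integer
of absolute value below `2`, even since `k` and `l` are odd, hence `0`. Then `l` divides `4lu`, an
integer strictly between `0` and `l`. -/
theorem not_opposite (hc : ¬ D.HasCollision) (hk2 : D.k % 2 = 1) (hl2 : D.l % 2 = 1) :
    ∃ t₀ : ℝ, ∀ u ∈ Ioo (0 : ℝ) (1 / 4), ∀ r : ℝ, 0 < r →
      D.curve (t₀ + u) ≠ -(r * D.curve (t₀ - u)) := by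
  obtain ⟨t₀, δ, m, n, -, hδ, h1, h2⟩ := exists_center hc (by omega)
  refine ⟨t₀, fun u hu r hr h => ?_⟩
  have hs : stretch D.s (torusPoint D.f₁ D.f₂ D.φ₁ D.φ₂ D.k D.l (t₀ + u)) =
      ((-r : ℝ) : ℂ) * stretch D.s (torusPoint D.f₁ D.f₂ D.φ₁ D.φ₂ D.k D.l (t₀ - u)) := by
    refine mul_left_cancel₀ D.c_ne ?_
    simp only [curve, torusCurve] at h
    rw [h]
    push_cast
    ring
  have him : (torusPoint D.f₁ D.f₂ D.φ₁ D.φ₂ D.k D.l (t₀ - u)).im =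
      (torusPoint D.f₁ D.f₂ D.φ₁ D.φ₂ D.k D.l (t₀ + u)).im := by
    simp only [torusPoint, Complex.add_im, Complex.ofReal_im, Complex.im_ofReal_mul, Complex.I_im,
      mul_one, zero_add]
    rw [show D.l * (t₀ - u) + D.φ₂ = -(D.l * (t₀ + u) + D.φ₂) + n by linarith,
      periodic_int D.hf₂.periodic, D.hf₂.even]
  have him0 : (torusPoint D.f₁ D.f₂ D.φ₁ D.φ₂ D.k D.l (t₀ + u)).im = 0 := by
    have h3 := congrArg Complex.im hs
    rw [Complex.im_ofReal_mul] at h3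
    have h4 := abs_lt.1 (D.abs_im_lt (t₀ + u))
    rcases lt_trichotomy (torusPoint D.f₁ D.f₂ D.φ₁ D.φ₂ D.k D.l (t₀ + u)).im 0 with h5 | h5 | h5
    · have h6 := stretch_im_neg D.hs h5 h4.1
      have h7 := stretch_im_neg D.hs (him ▸ h5) (him ▸ h4.1)
      nlinarith
    · exact h5
    · have h6 := stretch_im_pos D.hs h5 h4.2
      have h7 := stretch_im_pos D.hs (him ▸ h5) (him ▸ h4.2)
      nlinarith
  rw [him0] at him
  have hre := congrArg Complex.re hs
  have hofReal : ∀ {z : ℂ}, z.im = 0 → z = (z.re : ℂ) := fun hz => Complex.ext rfl hz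
  rw [hofReal him, hofReal him0, Complex.re_ofReal_mul, stretch_ofReal_re, stretch_ofReal_re] at hre
  have hne : D.f₁ (D.k * (t₀ - u) + D.φ₁) ≠ 0 := fun h0 => by
    refine D.curve_ne_zero hc (t₀ - u) ?_
    have : torusPoint D.f₁ D.f₂ D.φ₁ D.φ₂ D.k D.l (t₀ - u) = 0 :=
      Complex.ext (by simpa [torusPoint] using h0) (by simpa using him)
    rw [curve, torusCurve, this, stretch_zero, mul_zero]
  simp only [torusPoint, Complex.add_re, Complex.ofReal_re, Complex.re_ofReal_mul, Complex.I_re,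
    mul_zero, add_zero, Complex.add_im, Complex.ofReal_im, Complex.im_ofReal_mul, Complex.I_im,
    mul_one, zero_add] at hre him0
  have hθ₂ : D.k * (t₀ - u) + D.φ₁ = -(D.k * u + m / 2 - δ) + m := by linarith
  have hθ₁ : D.k * (t₀ + u) + D.φ₁ = D.k * u + m / 2 + δ := by linarith
  rw [hθ₂, periodic_int D.hf₁.periodic, D.hf₁.even] at hre hne
  rw [hθ₁] at hre
  obtain ⟨θ, hθ, hθ0⟩ : ∃ θ ∈ uIcc (D.k * u + m / 2 - δ) (D.k * u + m / 2 + δ), D.f₁ θ = 0 := by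
    refine intermediate_value_uIcc (D.hf₁.smooth.continuous.continuousOn) ?_
    rcases mul_neg_of_stretchRe D.hs hr hne hre with ⟨h3, h4⟩ | ⟨h3, h4⟩
    · exact mem_uIcc.2 (Or.inr ⟨h3.le, h4.le⟩)
    · exact mem_uIcc.2 (Or.inl ⟨h4.le, h3.le⟩)
  obtain ⟨p, hp⟩ := D.hf₁.eq_zero_iff.1 hθ0
  obtain ⟨q, hq⟩ := D.hf₂.eq_zero_iff.1 him0
  have hq' : 4 * D.l * u = ((2 * q + 1 - 2 * n : ℤ) : ℝ) := by push_cast; linarith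
  have hl0 : (0 : ℝ) < D.l := by exact_mod_cast D.l_pos
  have hθ' : |θ - (D.k * u + m / 2)| ≤ |δ| := by
    rcases mem_uIcc.1 hθ with ⟨h3, h4⟩ | ⟨h3, h4⟩
    · exact abs_le.2 ⟨by linarith [le_abs_self δ], by linarith [le_abs_self δ]⟩
    · exact abs_le.2 ⟨by linarith [neg_abs_le δ], by linarith [neg_abs_le δ]⟩
  have hint : |((D.l * (2 * p + 1) - D.k * (2 * q + 1 - 2 * n) - 2 * m * D.l : ℤ) : ℝ)| < 2 := by
    have e : ((D.l * (2 * p + 1) - D.k * (2 * q + 1 - 2 * n) - 2 * m * D.l : ℤ) : ℝ) =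
        4 * D.l * (θ - (D.k * u + m / 2)) := by
      push_cast at hq' ⊢
      linear_combination (-(D.l : ℝ)) * hp + D.k * hq'
    rw [e, abs_mul, abs_of_pos (by positivity : (0 : ℝ) < 4 * D.l)]
    rw [abs_mul, abs_of_pos (by positivity : (0 : ℝ) < 4 * D.l)] at hδ
    exact (mul_le_mul_of_nonneg_left hθ' (by positivity)).trans_lt hδ
  have hint' : |(D.l * (2 * p + 1) - D.k * (2 * q + 1 - 2 * n) - 2 * m * D.l : ℤ)| < 2 := by
    exact_mod_cast hint
  have heven : Even (D.l * (2 * p + 1) - D.k * (2 * q + 1 - 2 * n) - 2 * m * D.l : ℤ) := by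
    have hk : Odd (D.k : ℤ) := by rw [Int.odd_iff]; omega
    have hl : Odd (D.l : ℤ) := by rw [Int.odd_iff]; omega
    have h3 : Odd (2 * p + 1) := ⟨p, rfl⟩
    have h4 : Odd (2 * q + 1 - 2 * n) := ⟨q - n, by ring⟩
    exact ((hl.mul h3).sub_odd (hk.mul h4)).sub ((even_two_mul m).mul_right _)
  have hzero : (D.l * (2 * p + 1) - D.k * (2 * q + 1 - 2 * n) - 2 * m * D.l : ℤ) = 0 := by
    obtain ⟨v, hv⟩ := heven
    rw [hv, abs_lt] at hint'
    omega
  have hdvd : (D.l : ℤ) ∣ 2 * q + 1 - 2 * n :=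
    (Nat.isCoprime_iff_coprime.2 D.coprime.symm).dvd_of_dvd_mul_left
      ⟨2 * p + 1 - 2 * m, by linear_combination -hzero⟩
  have hpos : (0 : ℝ) < ((2 * q + 1 - 2 * n : ℤ) : ℝ) := by
    rw [← hq']
    exact mul_pos (by positivity) hu.1
  have hlt : ((2 * q + 1 - 2 * n : ℤ) : ℝ) < D.l := by
    rw [← hq']
    nlinarith [hu.2]
  have h3 := Int.le_of_dvd (by exact_mod_cast hpos) hdvd
  have h4 : (2 * q + 1 - 2 * n : ℤ) < D.l := by exact_mod_cast hlt
  omega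

theorem isWindingNumber_fold (hc : ¬ D.HasCollision) (hk2 : D.k % 2 = 1) (hl2 : D.l % 2 = 1) :
    ∃ w : ℤ, w ^ 2 = 1 ∧ IsWindingNumber (fun t => D.curve (1 / 2 * t) ^ 2) w := by
  obtain ⟨L, hL, hσ⟩ := exists_log_of_ne_zero D.hasDerivAt_curve continuous_vel (D.curve_ne_zero hc)
  have hcL : Continuous L := continuous_iff_continuousAt.2 fun t => (hL t).continuousAt
  have hk : Odd D.k := Nat.odd_iff.2 hk2
  have hhalf : ∀ t, D.curve (t + 1 / 2) = -D.curve t := fun t => by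
    have := D.curve_add_half 1 t (by omega)
    rwa [Nat.cast_one, mul_one, hk.neg_one_pow, neg_one_mul] at this
  obtain ⟨t₀, ht₀⟩ := not_opposite hc hk2 hl2
  obtain ⟨w, hw, hw'⟩ := im_log_sub_eq_pi (D.curve_ne_zero hc 0) hL hσ (fun t => by
    rw [hhalf, vel_add_half t (by omega), hk.neg_one_pow, neg_one_mul, neg_div_neg_eq]) hhalf ht₀
  refine ⟨w, hw, isWindingNumber_of_exp (L := fun t => 2 * L (1 / 2 * t)) (by fun_prop)
    (pow_ne_zero 2 (D.curve_ne_zero hc 0)) (fun t => ?_) ?_⟩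
  · rw [hσ (1 / 2 * t), mul_pow, ← Complex.exp_nat_mul, Nat.cast_two]
  · have := hw' 0
    simp
    norm_num at this
    linarith

end TorusData

/-! ### Oscillations in a symmetric potential well -/

theorem IsMinimalPeriod.eq_int_mul {α : Type*} {f : ℝ → α} {T τ : ℝ} (hT : IsMinimalPeriod f T)
    (hτ : Function.Periodic f τ) : ∃ n : ℤ, τ = n * T := by
  obtain ⟨⟨hT0, hTp⟩, hmin⟩ := hT
  refine ⟨⌊τ / T⌋, ?_⟩
  have h1 : Function.Periodic f (τ - ⌊τ / T⌋ * T) := hτ.sub_period (hTp.int_mul _)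
  have h2 := Int.floor_le (τ / T)
  have h3 := Int.lt_floor_add_one (τ / T)
  rw [le_div_iff₀ hT0] at h2
  rw [div_lt_iff₀ hT0, add_mul, one_mul] at h3
  by_contra hne
  have h4 : 0 < τ - ⌊τ / T⌋ * T := lt_of_le_of_ne (by linarith) fun h => hne (by linarith)
  have := hmin ⟨h4, h1⟩
  linarith

/-- Two solutions of `x' = 4 p`, `p' = F x` over a compact interval coincide if they do so once. -/
theorem oscillator_unique {F : ℝ → ℝ} (hF : ContDiff ℝ ∞ F) {a : ℝ} {x p y q : ℝ → ℝ}
    (hx : ∀ t, HasDerivAt x (4 * p t) t) (hp : ∀ t, HasDerivAt p (F (x t)) t) (hxa : ∀ t, |x t| ≤ a)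
    (hy : ∀ t, HasDerivAt y (4 * q t) t) (hq : ∀ t, HasDerivAt q (F (y t)) t) (hya : ∀ t, |y t| ≤ a)
    {t₀ : ℝ} (h : x t₀ = y t₀) (h' : p t₀ = q t₀) : x = y ∧ p = q := by
  obtain ⟨K, hK⟩ := ((hF.of_le (by simp : (1 : WithTop ℕ∞) ≤ ∞)).locallyLipschitz.locallyLipschitzOn
    (s := Icc (-a) a)).exists_lipschitzOnWith_of_compact isCompact_Icc
  have hL : LipschitzOnWith (max 4 K) (fun z : ℝ × ℝ => ((4 * z.2, F z.1) : ℝ × ℝ))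
      (Icc (-a) a ×ˢ univ) := by
    refine LipschitzOnWith.of_dist_le_mul fun z hz w hw => ?_
    rw [Prod.dist_eq]
    have h4 : dist (4 * z.2) (4 * w.2) = 4 * dist z.2 w.2 := by
      rw [Real.dist_eq, Real.dist_eq, ← mul_sub, abs_mul]; norm_num
    have h5 := hK.dist_le_mul _ hz.1 _ hw.1
    have h6 : dist z.1 w.1 ≤ dist z w := le_max_left _ _
    have h7 : dist z.2 w.2 ≤ dist z w := le_max_right _ _
    refine max_le ?_ ?_
    · simp only [h4]
      refine mul_le_mul ?_ h7 dist_nonneg (by positivity)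
      exact_mod_cast le_max_left 4 K
    · refine h5.trans (mul_le_mul ?_ h6 dist_nonneg (by positivity))
      exact_mod_cast le_max_right 4 K
  have := ODE_solution_unique_univ (v := fun _ z => ((4 * z.2, F z.1) : ℝ × ℝ))
    (s := fun _ => Icc (-a) a ×ˢ univ) (f := fun t => (x t, p t)) (g := fun t => (y t, q t)) (t₀ := t₀)
    (fun _ => hL) (fun t => ⟨(hx t).prodMk (hp t), abs_le.1 (hxa t), trivial⟩)
    (fun t => ⟨(hy t).prodMk (hq t), abs_le.1 (hya t), trivial⟩) (Prod.ext h h')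
  exact ⟨funext fun t => congrArg Prod.fst (congrFun this t),
    funext fun t => congrArg Prod.snd (congrFun this t)⟩

/-- Bootstrapping: each pass through the equations gains one derivative for `x` and `p` together. -/
theorem oscillator_contDiff {F : ℝ → ℝ} (hF : ContDiff ℝ ∞ F) {x p : ℝ → ℝ}
    (hx : ∀ t, HasDerivAt x (4 * p t) t) (hp : ∀ t, HasDerivAt p (F (x t)) t) : ContDiff ℝ ∞ x := by
  have hdx : deriv x = fun t => 4 * p t := funext fun t => (hx t).deriv
  have hdp : deriv p = fun t => F (x t) := funext fun t => (hp t).deriv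
  have h : ∀ n : ℕ, ContDiff ℝ n x ∧ ContDiff ℝ n p := by
    intro n
    induction n with
    | zero =>
      exact ⟨contDiff_zero.2 (continuous_iff_continuousAt.2 fun t => (hx t).continuousAt),
        contDiff_zero.2 (continuous_iff_continuousAt.2 fun t => (hp t).continuousAt)⟩
    | succ n ih =>
      have hω : ((n : ℕ) : WithTop ℕ∞) ≠ ω := by simp
      refine ⟨?_, ?_⟩
      · push_cast
        rw [contDiff_succ_iff_deriv, hdx]
        exact ⟨fun t => (hx t).differentiableAt, fun h => absurd h hω, contDiff_const.mul ih.2⟩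
      · push_cast
        rw [contDiff_succ_iff_deriv, hdp]
        exact ⟨fun t => (hp t).differentiableAt, fun h => absurd h hω,
          (hF.of_le (by exact_mod_cast le_top)).comp ih.1⟩
  exact contDiff_infty.2 fun n => (h n).1

/-- The motion in a symmetric potential well. -/
theorem exists_cosLike_of_well {V F : ℝ → ℝ} {a E T : ℝ} {x p : ℝ → ℝ} (hF : ContDiff ℝ ∞ F)
    (hodd : ∀ y, F (-y) = -F y) (ha : 0 < a) (hV : ∀ y, |y| < a → V y < E) (hFa : F a ≠ 0)
    (hx : ∀ t, HasDerivAt x (4 * p t) t) (hp : ∀ t, HasDerivAt p (F (x t)) t)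
    (hE : ∀ t, 2 * p t ^ 2 + V (x t) = E) (hxa : ∀ t, |x t| ≤ a)
    (hT : IsMinimalPeriod (fun t => (x t, p t)) T) :
    ∃ (f : ℝ → ℝ) (φ : ℝ), CosLike f ∧ (∀ θ, |f θ| ≤ a) ∧ ∀ t, x t = f (t / T + φ) := by
  have hT0 : 0 < T := hT.1.1
  have hper : ∀ t, x (t + T) = x t := fun t => congrArg Prod.fst (hT.1.2 t)
  have hxc : Continuous x := continuous_iff_continuousAt.2 fun t => (hx t).continuousAt
  have hpc : Continuous p := continuous_iff_continuousAt.2 fun t => (hp t).continuousAt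
  have hturn : ∀ t, p t = 0 → x t = a ∨ x t = -a := by
    intro t h
    refine eq_or_eq_neg_of_abs_eq (le_antisymm (hxa t) (not_lt.1 fun h1 => ?_))
    have h2 := hV _ h1
    have h3 := hE t
    rw [h] at h3
    linarith
  have hFna : F (-a) ≠ 0 := by rw [hodd]; exact neg_ne_zero.2 hFa
  have hext : ∀ t, (∀ s, x s ≤ x t) ∨ (∀ s, x t ≤ x s) → p t = 0 := by
    intro t h
    have h1 : IsLocalExtr x t := by
      rcases h with h | h
      · exact Or.inr (Eventually.of_forall h)
      · exact Or.inl (Eventually.of_forall h)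
    have := h1.hasDerivAt_eq_zero (hx t)
    linarith
  -- The force at `±a` is nonzero, so there is no equilibrium. Hence the maximum and the minimum of
  -- `x` differ and are `a` and `-a`.
  have hmove : ∀ t, p t = 0 → ¬ ∀ s, x s = x t := by
    intro t h h1
    have h2 : ∀ s, p s = 0 := fun s => hext s (Or.inl fun r => by rw [h1 r, h1 s])
    have h3 : HasDerivAt p 0 t := by
      have : p = fun _ => 0 := funext h2
      rw [this]
      exact hasDerivAt_const _ _
    have h4 := (hp t).unique h3
    rcases hturn t h with h5 | h5 <;> rw [h5] at h4
    · exact hFa h4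
    · exact hFna h4
  have hcomp : (Icc (0 : ℝ) T).Nonempty := ⟨0, le_rfl, hT0.le⟩
  have hred : ∀ s, ∃ s' ∈ Icc (0 : ℝ) T, x s = x s' := fun s => by
    obtain ⟨s', h1, h2⟩ := (show Function.Periodic x T from hper).exists_mem_Ico₀ hT0 s
    exact ⟨s', ⟨h1.1, h1.2.le⟩, h2⟩
  obtain ⟨tM, -, hM⟩ := isCompact_Icc.exists_isMaxOn hcomp hxc.continuousOn
  obtain ⟨tm, -, hm⟩ := isCompact_Icc.exists_isMinOn hcomp hxc.continuousOn
  have hM' : ∀ s, x s ≤ x tM := fun s => by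
    obtain ⟨s', h1, h2⟩ := hred s
    rw [h2]; exact hM h1
  have hm' : ∀ s, x tm ≤ x s := fun s => by
    obtain ⟨s', h1, h2⟩ := hred s
    rw [h2]; exact hm h1
  have hpM := hext tM (Or.inl hM')
  have hpm := hext tm (Or.inr hm')
  have hxM : x tM = a := by
    refine (hturn tM hpM).resolve_right fun h => hmove tM hpM fun s => le_antisymm (hM' s) ?_
    rw [h]
    exact (abs_le.1 (hxa s)).1
  have hxm : x tm = -a := by
    refine (hturn tm hpm).resolve_left fun h => hmove tm hpm fun s => le_antisymm ?_ (hm' s)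
    rw [h]
    exact (abs_le.1 (hxa s)).2
  have hshift : ∀ s t, HasDerivAt (fun t => x (t + s)) (4 * p (t + s)) t ∧
      HasDerivAt (fun t => p (t + s)) (F (x (t + s))) t := fun s t =>
    ⟨(hx (t + s)).comp_add_const t s, (hp (t + s)).comp_add_const t s⟩
  -- The state determines the motion, so times with equal states differ by a multiple of the minimal
  -- period.
  have hrep : ∀ t s, x t = x s → p t = p s → ∃ n : ℤ, t - s = n * T := by
    intro t s h1 h2
    obtain ⟨h3, h4⟩ := oscillator_unique hF (t₀ := s) (fun r => (hshift (t - s) r).1)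
      (fun r => (hshift (t - s) r).2) (fun r => hxa _) hx hp hxa (by simpa using h1) (by simpa using h2)
    exact hT.eq_int_mul fun r => Prod.ext (congrFun h3 r) (congrFun h4 r)
  -- Reversing time at a maximum gives a solution with the same state there.
  have heven : ∀ t, x (tM - t) = x (tM + t) := by
    have h1 := (oscillator_unique hF (x := fun t => x (tM - t)) (p := fun t => -p (tM - t))
      (y := fun t => x (t + tM)) (q := fun t => p (t + tM)) (t₀ := 0)
      (fun t => ((hx (tM - t)).comp_const_sub tM t).congr_deriv (by ring))
      (fun t => ((hp (tM - t)).comp_const_sub tM t).neg.congr_deriv (by ring)) (fun t => hxa _)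
      (fun r => (hshift tM r).1) (fun r => (hshift tM r).2) (fun r => hxa _) (by simp)
      (by simp [hpM])).1
    intro t
    rw [add_comm]
    exact congrFun h1 t
  -- As the force is odd, `-x` is a motion too; shifted from a minimum to a maximum, it has the same
  -- state as `x`.
  obtain ⟨hneg, hneg'⟩ := oscillator_unique hF (x := fun t => -x (t + (tm - tM)))
    (p := fun t => -p (t + (tm - tM))) (t₀ := tM)
    (fun t => ((hshift (tm - tM) t).1).neg.congr_deriv (by ring))
    (fun t => ((hshift (tm - tM) t).2).neg.congr_deriv (by rw [hodd])) (fun t => by rw [abs_neg]; exact hxa _)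
    hx hp hxa (by simp [hxM, hxm]) (by simp [hpM, hpm])
  have hneg1 : ∀ t, x (t + (tm - tM)) = -x t := fun t => by
    have := congrFun hneg t
    linarith
  have hneg2 : ∀ t, p (t + (tm - tM)) = -p t := fun t => by
    have := congrFun hneg' t
    linarith
  -- Twice the shift from maximum to minimum is a multiple `nT`. If `n` were even, the shift would
  -- be a period and `a = -a`; for odd `n` it equals `T/2` up to periods.
  have hhalf : ∀ t, x (t + T / 2) = -x t ∧ p (t + T / 2) = -p t := by
    obtain ⟨n, hn⟩ := hT.eq_int_mul (τ := 2 * (tm - tM)) fun t => by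
      have e : t + 2 * (tm - tM) = t + (tm - tM) + (tm - tM) := by ring
      rw [e, hneg1, hneg2, hneg1, hneg2, neg_neg, neg_neg]
    have hpn : ∀ (m : ℤ) t, x (t + m * T) = x t ∧ p (t + m * T) = p t := fun m t => by
      have := hT.1.2.int_mul m t
      exact ⟨congrArg Prod.fst this, congrArg Prod.snd this⟩
    rcases Int.even_or_odd' n with ⟨m, rfl | rfl⟩
    · exfalso
      have h1 := hneg1 tM
      have e : tm - tM = m * T := by push_cast at hn; linarith
      rw [e, (hpn m tM).1, hxM] at h1
      linarith
    · intro t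
      have e : t + T / 2 = t + (tm - tM) + ((-m : ℤ) : ℝ) * T := by push_cast at hn ⊢; linarith
      rw [e, (hpn (-m) _).1, (hpn (-m) _).2]
      exact ⟨hneg1 t, hneg2 t⟩
  have hp0 : ∀ t ∈ Ioo 0 (T / 2), p (tM + t) ≠ 0 := by
    intro t ht h
    obtain ⟨s, hs, n, hn⟩ : ∃ s, (s = t ∨ s = t + T / 2) ∧ ∃ n : ℤ, s = n * T := by
      rcases hturn _ h with h1 | h1
      · obtain ⟨n, hn⟩ := hrep (tM + t) tM (by rw [h1, hxM]) (by rw [h, hpM])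
        exact ⟨t, Or.inl rfl, n, by linarith⟩
      · obtain ⟨h2, h3⟩ := hhalf (tM + t)
        obtain ⟨n, hn⟩ := hrep (tM + t + T / 2) tM (by rw [h2, h1, hxM, neg_neg])
          (by rw [h3, h, hpM, neg_zero])
        exact ⟨t + T / 2, Or.inr rfl, n, by linarith⟩
    have h1 : 0 < s ∧ s < T := by
      rcases hs with rfl | rfl
      · exact ⟨ht.1, by linarith [ht.2]⟩
      · exact ⟨by linarith [ht.1], by linarith [ht.2]⟩
    rw [hn] at h1
    have h2 : (0 : ℝ) < n := pos_of_mul_pos_left h1.1 hT0.le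
    have h3 : (n : ℝ) < 1 := by
      by_contra! h
      nlinarith
    have h4 : 0 < n := by exact_mod_cast h2
    have h5 : n < 1 := by exact_mod_cast h3
    omega
  have hpneg : ∀ t ∈ Ioo 0 (T / 2), p (tM + t) < 0 := by
    have hfc : Continuous fun t => p (tM + t) := by fun_prop
    have hder : ∀ t, HasDerivAt (fun t => x (tM + t)) (4 * p (tM + t)) t := fun t =>
      (hx (tM + t)).comp_const_add tM t
    obtain ⟨s, hs, hs'⟩ := exists_hasDerivAt_eq_slope (fun t => x (tM + t)) (fun t => 4 * p (tM + t))
      (half_pos hT0) (by fun_prop) fun t _ => hder t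
    have hsneg : p (tM + s) < 0 := by
      rw [(hhalf tM).1, add_zero, hxM] at hs'
      have : (-a - a) / (T / 2 - 0) < 0 := div_neg_of_neg_of_pos (by linarith) (by linarith)
      linarith
    intro t ht
    by_contra! hge
    obtain ⟨r, hr, hr0⟩ := intermediate_value_uIcc (a := s) (b := t) hfc.continuousOn
      (show (0 : ℝ) ∈ _ from mem_uIcc.2 (Or.inl ⟨hsneg.le, hge⟩))
    exact hp0 r ⟨(lt_min hs.1 ht.1).trans_le hr.1, hr.2.trans_lt (max_lt hs.2 ht.2)⟩ hr0
  have hdf : ∀ θ, HasDerivAt (fun θ => x (tM + T * θ)) (4 * p (tM + T * θ) * T) θ := fun θ => by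
    have h1 : HasDerivAt (fun θ => tM + T * θ) T θ := by
      simpa using ((hasDerivAt_id θ).const_mul T).const_add tM
    exact (hx (tM + T * θ)).comp θ h1
  refine ⟨fun θ => x (tM + T * θ), -(tM / T), ⟨?_, fun θ => ?_, fun θ => ?_, fun θ hθ => ?_⟩,
    fun θ => hxa _, fun t => ?_⟩
  · exact (oscillator_contDiff hF hx hp).comp (by fun_prop)
  · rw [mul_neg, ← sub_eq_add_neg, heven]
  · rw [← (hhalf _).1]
    ring_nf
  · rw [(hdf θ).deriv]
    have := hpneg (T * θ) ⟨mul_pos hT0 hθ.1, by nlinarith [hθ.2]⟩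
    nlinarith
  · congr 1
    field_simp
    ring

/-! ### Separation of the regularized flow into two oscillators -/

theorem deriv_regularizedHamiltonian_pLam (μ c lam nu pLam pNu : ℝ) :
    deriv (fun p => regularizedHamiltonian μ c lam nu p pNu) pLam = 4 * pLam := by
  refine HasDerivAt.deriv ?_
  simp only [regularizedHamiltonian, kLam]
  refine ((((((hasDerivAt_id pLam).fun_pow 2).const_mul 2).sub_const _).sub_const _).add_const
    _).congr_deriv ?_
  simp
  ring

theorem deriv_regularizedHamiltonian_pNu (μ c lam nu pLam pNu : ℝ) :
    deriv (fun p => regularizedHamiltonian μ c lam nu pLam p) pNu = 4 * pNu := by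
  refine HasDerivAt.deriv ?_
  simp only [regularizedHamiltonian, kNu]
  refine ((((((hasDerivAt_id pNu).fun_pow 2).const_mul 2).add_const _).add_const _).const_add
    _).congr_deriv ?_
  simp
  ring

theorem deriv_regularizedHamiltonian_lam (μ c lam nu pLam pNu : ℝ) :
    deriv (fun x => regularizedHamiltonian μ c x nu pLam pNu) lam =
      -(2 * Real.sinh lam * (1 + c * Real.cosh lam)) := by
  refine HasDerivAt.deriv ?_
  simp only [regularizedHamiltonian, kLam]
  refine (((((Real.hasDerivAt_cosh lam).const_mul 2).const_sub _).sub
    (((Real.hasDerivAt_cosh lam).fun_pow 2).const_mul c)).add_const _).congr_deriv ?_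
  simp
  ring

theorem deriv_regularizedHamiltonian_nu (μ c lam nu pLam pNu : ℝ) :
    deriv (fun x => regularizedHamiltonian μ c lam x pLam pNu) nu =
      -(2 * Real.sin nu * (1 - 2 * μ + c * Real.cos nu)) := by
  refine HasDerivAt.deriv ?_
  simp only [regularizedHamiltonian, kNu]
  refine (((((Real.hasDerivAt_cos nu).const_mul _).const_add _).add
    (((Real.hasDerivAt_cos nu).fun_pow 2).const_mul c)).const_add _).congr_deriv ?_
  simp
  ring

/-- The sign of `cos` at the center. -/
def Primary.sign : Primary → ℝ
  | .earth => -1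
  | .moon => 1

theorem Primary.cos_add_angle (b : Primary) (y : ℝ) :
    Real.cos (y + b.angle) = b.sign * Real.cos y := by
  cases b <;> simp [Primary.angle, Primary.sign, Real.cos_add_pi]

theorem Primary.sin_add_angle (b : Primary) (y : ℝ) :
    Real.sin (y + b.angle) = b.sign * Real.sin y := by
  cases b <;> simp [Primary.angle, Primary.sign, Real.sin_add_pi]

theorem Primary.sign_mul_sign (b : Primary) : b.sign * b.sign = 1 := by
  cases b <;> simp [Primary.sign]

namespace EulerOrbit

variable {μ c : ℝ} (x : EulerOrbit μ c)

theorem lam_ode (t : ℝ) : HasDerivAt x.lam (4 * x.pLam t) t := by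
  have := x.hasDerivAt_lam t
  rwa [deriv_regularizedHamiltonian_pLam] at this

theorem nu_ode (t : ℝ) : HasDerivAt x.nu (4 * x.pNu t) t := by
  have := x.hasDerivAt_nu t
  rwa [deriv_regularizedHamiltonian_pNu] at this

theorem pLam_ode (t : ℝ) :
    HasDerivAt x.pLam (2 * Real.sinh (x.lam t) * (1 + c * Real.cosh (x.lam t))) t := by
  have := x.hasDerivAt_pLam t
  rwa [deriv_regularizedHamiltonian_lam, neg_neg] at this

theorem pNu_ode (t : ℝ) :
    HasDerivAt x.pNu (2 * Real.sin (x.nu t) * (1 - 2 * μ + c * Real.cos (x.nu t))) t := by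
  have := x.hasDerivAt_pNu t
  rwa [deriv_regularizedHamiltonian_nu, neg_neg] at this

/-- The orbit on the same torus with the phase of `λ` shifted. -/
def shiftLam (a : ℝ) : EulerOrbit μ c where
  lam t := x.lam (t + a)
  nu := x.nu
  pLam t := x.pLam (t + a)
  pNu := x.pNu
  hasDerivAt_lam t := by
    rw [deriv_regularizedHamiltonian_pLam]
    exact (x.lam_ode (t + a)).comp_add_const t a
  hasDerivAt_nu t := by
    rw [deriv_regularizedHamiltonian_pNu]
    exact x.nu_ode t
  hasDerivAt_pLam t := by
    rw [deriv_regularizedHamiltonian_lam, neg_neg]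
    exact (x.pLam_ode (t + a)).comp_add_const t a
  hasDerivAt_pNu t := by
    rw [deriv_regularizedHamiltonian_nu, neg_neg]
    exact x.pNu_ode t

end EulerOrbit

theorem IsMinimalPeriod.comp_add_const {α : Type*} {f : ℝ → α} {T : ℝ} (h : IsMinimalPeriod f T)
    (a : ℝ) : IsMinimalPeriod (fun t => f (t + a)) T := by
  refine ⟨⟨h.1.1, h.1.2.add_const a⟩, fun τ hτ => h.2 ⟨hτ.1, ?_⟩⟩
  have := hτ.2.add_const (-a)
  simpa using this

theorem IsTorusOrbit.shiftLam {μ c g : ℝ} {x : EulerOrbit μ c} {b : Primary} {k l : ℕ}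
    (h : IsTorusOrbit x g b k l) (a : ℝ) : IsTorusOrbit (x.shiftLam a) g b k l := by
  obtain ⟨h1, h2, h3, T, T', h4, h5, h6⟩ := h
  exact ⟨fun t => h1 _, h2, h3, T, T', h4.comp_add_const a, h5, h6⟩

/-- The well of `K_λ`. -/
theorem exists_lam_well {c g : ℝ} (hc : c < 0) (hgc : -2 < g + c) :
    ∃ a : ℝ, 0 < a ∧ 1 + c * Real.cosh a < 0 ∧
      (∀ y, |y| < a → -2 * Real.cosh y - c * Real.cosh y ^ 2 < g) ∧
      ∀ y, -2 * Real.cosh y - c * Real.cosh y ^ 2 ≤ g → |y| ≤ a := by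
  -- For `u = cosh y ≥ C` the potential `u(-cu - 2)` is at least `1 + |g|`, so the level `g` is
  -- reached before.
  set C : ℝ := (3 + |g| - c) / -c with hC
  have hC1 : -c * C = 3 + |g| - c := by
    rw [hC]
    exact mul_div_cancel₀ _ (by linarith)
  have hgabs := abs_nonneg g
  have hC0 : 1 ≤ C := by
    rw [hC, one_le_div (by linarith)]
    linarith
  have hcosh : C ≤ Real.cosh (Real.arsinh C) := by
    rw [Real.cosh_arsinh]
    exact Real.le_sqrt_of_sq_le (by linarith)
  have hbig : g ≤ -2 * Real.cosh (Real.arsinh C) - c * Real.cosh (Real.arsinh C) ^ 2 := by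
    set u := Real.cosh (Real.arsinh C)
    have h1 : 3 + |g| - c ≤ -c * u := by
      rw [← hC1]
      exact mul_le_mul_of_nonneg_left hcosh (by linarith)
    have h2 : 1 * (1 + |g|) ≤ u * (-c * u - 2) :=
      mul_le_mul (by linarith) (by linarith) (by linarith) (by linarith)
    have := le_abs_self g
    linarith [show u * (-c * u - 2) = -2 * u - c * u ^ 2 by ring]
  have hcont : Continuous fun y => -2 * Real.cosh y - c * Real.cosh y ^ 2 := by
    have := Real.continuous_cosh
    fun_prop
  obtain ⟨a, ha, haE⟩ := intermediate_value_Icc (Real.arsinh_nonneg_iff.2 (by linarith : 0 ≤ C))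
    hcont.continuousOn (show g ∈ _ from ⟨by simp; linarith, hbig⟩)
  simp only at haE
  have ha0 : 0 < a := by
    refine lt_of_le_of_ne ha.1 fun h => ?_
    rw [← h] at haE
    simp at haE
    linarith
  -- The second factor is positive at `u = 1`, because `-2 < g + c`, and increases with `u`. So the
  -- sign of potential minus level is that of `u - cosh a`.
  have hfac : ∀ u : ℝ, -2 * u - c * u ^ 2 - g =
      (u - Real.cosh a) * (-c * (u + Real.cosh a) - 2) := fun u => by rw [← haE]; ring
  have hca : 1 < Real.cosh a := Real.one_lt_cosh.2 ha0.ne'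
  have h1 : 0 < -c * (1 + Real.cosh a) - 2 := by
    have := hfac 1
    by_contra! h
    nlinarith
  have hpos : ∀ y, 0 < -c * (Real.cosh y + Real.cosh a) - 2 := fun y => by
    have := Real.one_le_cosh y
    nlinarith
  refine ⟨a, ha0, by nlinarith, fun y hy => ?_, fun y hy => ?_⟩
  · have h2 : Real.cosh y < Real.cosh a := Real.cosh_lt_cosh.2 (by rwa [abs_of_pos ha0])
    have := hfac (Real.cosh y)
    have := mul_pos (sub_pos.2 h2) (hpos y)
    linarith
  · by_contra! h
    have h2 : Real.cosh a < Real.cosh y := Real.cosh_lt_cosh.2 (by rwa [abs_of_pos ha0])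
    have := hfac (Real.cosh y)
    have := mul_pos (sub_pos.2 h2) (hpos y)
    linarith

/-- In the regions `S` and `S'` the interval of the allowed angles around a center is bounded by a
barrier. -/
theorem exists_barrier {μ c g : ℝ} {b : Primary} (h : InRegionS μ g c ∨ InRegionS' μ g c)
    (hb : 2 * (b.sign * (1 - 2 * μ)) + c + g ≤ 0) :
    2 * (b.sign * (1 - 2 * μ)) + c + g < 0 ∧ ∃ u : ℝ, -1 ≤ u ∧ u < 1 ∧
      0 < 2 * (b.sign * (1 - 2 * μ)) * u + c * u ^ 2 + g := by
  set m := b.sign * (1 - 2 * μ) with hm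
  have habs : |1 - 2 * μ| = |m| := by
    rw [hm]
    cases b <;> simp [Primary.sign, abs_sub_comm]
  have h1 := neg_abs_le m
  have h2 := le_abs_self m
  rcases h with ⟨hc, -, h4, h5, h6⟩ | ⟨hc, h4, h5⟩
  · rw [habs] at h4 h5
    have h6' : g * c < m ^ 2 := by
      rw [← sq_abs m, ← habs, sq_abs]
      exact h6
    -- The vertex of the parabola, with value `(m² - gc)/(-c) > 0`.
    refine ⟨by linarith, -m / c, ?_, ?_, ?_⟩
    · rw [le_div_iff_of_neg hc]
      linarith
    · rw [div_lt_iff_of_neg hc]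
      linarith
    · have e : 2 * m * (-m / c) + c * (-m / c) ^ 2 + g = (m ^ 2 - g * c) / -c := by
        have := hc.ne
        field_simp
        ring
      rw [e]
      exact div_pos (by linarith) (by linarith)
  · rw [habs] at h4 h5
    have h6 : m < 0 := by
      by_contra! h
      rw [abs_of_nonneg h] at h4
      linarith
    rw [abs_of_neg h6] at h4 h5
    -- In `S'` the center is the heavier one, and the position of the other center is itself
    -- forbidden.
    exact ⟨by linarith, -1, le_rfl, by norm_num, by linarith⟩

/-- The well of `K_ν`. -/
theorem exists_nu_well {m c g u₀ : ℝ} (hc : c < 0) (h1 : 2 * m + c + g < 0) (hu₀ : -1 ≤ u₀)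
    (hu₀' : u₀ < 1) (h0 : 0 < 2 * m * u₀ + c * u₀ ^ 2 + g) :
    ∃ a : ℝ, 0 < a ∧ a < Real.pi ∧ m + c * Real.cos a < 0 ∧
      (∀ y, |y| < a → 2 * m * Real.cos y + c * Real.cos y ^ 2 < -g) ∧
      ∀ y, (∀ z, 0 ≤ z → z ≤ |y| → 2 * m * Real.cos z + c * Real.cos z ^ 2 ≤ -g) → |y| ≤ a := by
  have hcont : Continuous fun u : ℝ => 2 * m * u + c * u ^ 2 + g := by fun_prop
  obtain ⟨u, hu, hu0⟩ := intermediate_value_Icc' hu₀'.le hcont.continuousOn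
    (show (0 : ℝ) ∈ _ from ⟨by simp; linarith, h0.le⟩)
  simp only at hu0
  have hne : u₀ < u := lt_of_le_of_ne hu.1 fun h => by rw [h] at h0; linarith
  have hne' : u < 1 := lt_of_le_of_ne hu.2 fun h => by rw [h] at hu0; linarith
  have hfac : ∀ v : ℝ, 2 * m * v + c * v ^ 2 + g = (v - u) * (2 * m + c * (v + u)) := fun v => by
    linear_combination hu0
  have hs : 2 * m + c * (u₀ + u) < 0 := by
    have := hfac u₀
    by_contra! h
    nlinarith
  have hcos : Real.cos (Real.arccos u) = u := Real.cos_arccos (by linarith) hne'.le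
  have ha0 : 0 < Real.arccos u := Real.arccos_pos.2 hne'
  have hapi : Real.arccos u < Real.pi :=
    lt_of_le_of_ne (Real.arccos_le_pi u) fun h => by
      rw [Real.arccos_eq_pi] at h
      linarith
  refine ⟨Real.arccos u, ha0, hapi, by rw [hcos]; nlinarith, fun y hy => ?_, fun y hy => ?_⟩
  · have h2 : u < Real.cos y := by
      rw [← Real.cos_abs y, ← hcos]
      exact Real.cos_lt_cos_of_nonneg_of_le_pi (abs_nonneg y) hapi.le hy
    have h3 := hfac (Real.cos y)
    have h4 : 2 * m + c * (Real.cos y + u) < 0 := by nlinarith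
    have := mul_neg_of_pos_of_neg (sub_pos.2 h2) h4
    linarith
  · by_contra! h
    have ha : Real.arccos u < Real.arccos u₀ := Real.arccos_lt_arccos hu₀ hne hne'.le
    set z := min |y| (Real.arccos u₀) with hz
    have hz1 : Real.arccos u < z := lt_min h ha
    have hz2 : z ≤ Real.arccos u₀ := min_le_right _ _
    have h2 : Real.cos z < u := by
      conv_rhs => rw [← hcos]
      exact Real.cos_lt_cos_of_nonneg_of_le_pi ha0.le (hz2.trans (Real.arccos_le_pi _)) hz1
    have h3 : u₀ ≤ Real.cos z := by
      rw [← Real.cos_arccos hu₀ hu₀'.le]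
      exact Real.cos_le_cos_of_nonneg_of_le_pi (ha0.le.trans hz1.le) (Real.arccos_le_pi _) hz2
    have h4 := hy z (ha0.le.trans hz1.le) (min_le_left _ _)
    have h5 := hfac (Real.cos z)
    have h6 : 2 * m + c * (Real.cos z + u) < 0 := by nlinarith
    have := mul_pos_of_neg_of_neg (sub_neg.2 h2) h6
    linarith

variable {μ c g : ℝ} {x : EulerOrbit μ c} {b : Primary} {k l : ℕ}

theorem EulerOrbit.exists_lam (hc : c < 0) (hgc : -2 < g + c)
    (hK : ∀ t, kLam c (x.lam t) (x.pLam t) = g) {T : ℝ}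
    (hT : IsMinimalPeriod (fun t => (x.lam t, x.pLam t)) T) :
    ∃ (f : ℝ → ℝ) (φ : ℝ), CosLike f ∧ ∀ t, x.lam t = f (t / T + φ) := by
  obtain ⟨a, ha, h1, h2, h3⟩ := exists_lam_well hc hgc
  have hE : ∀ t, 2 * x.pLam t ^ 2 + (-2 * Real.cosh (x.lam t) - c * Real.cosh (x.lam t) ^ 2) = g :=
    fun t => by rw [← hK t, kLam]; ring
  obtain ⟨f, φ, h4, -, h5⟩ := exists_cosLike_of_well
    (V := fun y => -2 * Real.cosh y - c * Real.cosh y ^ 2)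
    (F := fun y => 2 * Real.sinh y * (1 + c * Real.cosh y))
    ((contDiff_const.mul Real.contDiff_sinh).mul (contDiff_const.add
      (contDiff_const.mul Real.contDiff_cosh)))
    (fun y => by simp only [Real.sinh_neg, Real.cosh_neg]; ring) ha h2
    (mul_ne_zero (mul_ne_zero two_ne_zero (Real.sinh_pos_iff.2 ha).ne') h1.ne)
    x.lam_ode x.pLam_ode hE (fun t => h3 _ (by have := hE t; nlinarith [sq_nonneg (x.pLam t)])) hT
  exact ⟨f, φ, h4, h5⟩

/-- In the variable `y = ν - ν_b` the potential is `2m cos y + c cos² y` with `m = ±(1 - 2μ)`, for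
either center. The condition on the interval between the center and `ν` confines `y` to the well
around `0`. -/
theorem EulerOrbit.exists_nu (h : InRegionS μ g c ∨ InRegionS' μ g c)
    (hK : ∀ t, kNu μ c (x.nu t) (x.pNu t) = -g)
    (hb : ∀ t, ∀ y ∈ uIcc b.angle (x.nu t), kNu μ c y 0 ≤ -g) {T : ℝ}
    (hT : IsMinimalPeriod (fun t => (x.nu t, x.pNu t)) T) :
    ∃ (f : ℝ → ℝ) (φ : ℝ), CosLike f ∧ (∀ θ, |f θ| < Real.pi) ∧
      ∀ t, x.nu t = f (t / T + φ) + b.angle := by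
  have hc : c < 0 := by
    rcases h with h | h
    · exact h.1
    · exact h.1
  set m := b.sign * (1 - 2 * μ) with hm
  have hsq : b.sign ^ 2 = 1 := by rw [sq, b.sign_mul_sign]
  have hkey : ∀ y, kNu μ c (y + b.angle) 0 = 2 * m * Real.cos y + c * Real.cos y ^ 2 := fun y => by
    rw [kNu, b.cos_add_angle, mul_pow, hsq, hm]
    ring
  have h0 := hb 0 b.angle left_mem_uIcc
  have hk0 := hkey 0
  rw [zero_add] at hk0
  rw [hk0, Real.cos_zero] at h0
  obtain ⟨h1, u₀, hu₀, hu₀', h2⟩ := exists_barrier (b := b) h (by rw [← hm]; linarith)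
  rw [← hm] at h1 h2
  obtain ⟨a, ha, hapi, h3, h4, h5⟩ := exists_nu_well hc h1 hu₀ hu₀' h2
  have hE : ∀ t, 2 * x.pNu t ^ 2 + (2 * m * Real.cos (x.nu t - b.angle) +
      c * Real.cos (x.nu t - b.angle) ^ 2) = -g := fun t => by
    rw [← hkey, ← hK t, kNu, kNu, sub_add_cancel]
    ring
  have hin : ∀ t, |x.nu t - b.angle| ≤ a := fun t => h5 _ fun z hz hz' => by
    rcases le_total 0 (x.nu t - b.angle) with h6 | h6
    · rw [← hkey]
      rw [abs_of_nonneg h6] at hz'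
      exact hb t _ (mem_uIcc.2 (Or.inl ⟨by linarith, by linarith⟩))
    · rw [← Real.cos_neg, ← hkey]
      rw [abs_of_nonpos h6] at hz'
      exact hb t _ (mem_uIcc.2 (Or.inr ⟨by linarith, by linarith⟩))
  have hT' : IsMinimalPeriod (fun t => (x.nu t - b.angle, x.pNu t)) T := by
    refine ⟨⟨hT.1.1, fun t => ?_⟩, fun τ hτ => hT.2 ⟨hτ.1, fun t => ?_⟩⟩
    · have := hT.1.2 t
      simp only [Prod.mk.injEq] at this ⊢
      exact ⟨by rw [this.1], this.2⟩
    · have := hτ.2 t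
      simp only [Prod.mk.injEq, sub_left_inj] at this ⊢
      exact this
  have hode : ∀ t, HasDerivAt x.pNu (2 * Real.sin (x.nu t - b.angle) *
      (m + c * Real.cos (x.nu t - b.angle))) t := fun t => by
    refine (x.pNu_ode t).congr_deriv ?_
    conv_lhs => rw [show x.nu t = x.nu t - b.angle + b.angle by ring, b.cos_add_angle, b.sin_add_angle]
    rw [hm]
    linear_combination (2 * Real.sin (x.nu t - b.angle) * c * Real.cos (x.nu t - b.angle)) * hsq
  obtain ⟨f, φ, h6, h7, h8⟩ := exists_cosLike_of_well
    (V := fun y => 2 * m * Real.cos y + c * Real.cos y ^ 2)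
    (F := fun y => 2 * Real.sin y * (m + c * Real.cos y))
    ((contDiff_const.mul Real.contDiff_sin).mul (contDiff_const.add
      (contDiff_const.mul Real.contDiff_cos)))
    (fun y => by simp only [Real.sin_neg, Real.cos_neg]; ring) ha h4
    (mul_ne_zero (mul_ne_zero two_ne_zero (Real.sin_pos_of_pos_of_lt_pi ha hapi).ne') h3.ne)
    (fun t => (x.nu_ode t).sub_const _) hode hE hin hT'
  exact ⟨f, φ, h6, fun θ => (h7 θ).trans_lt hapi, fun t => by rw [← h8]; ring⟩

/-! ### From orbits to trajectories -/

/-- The orbit `x` around `b` runs through the torus as described by `D`, with period `T`. -/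
structure Follows {μ c : ℝ} (x : EulerOrbit μ c) (b : Primary) (D : TorusData) (T : ℝ) : Prop where
  T_pos : 0 < T
  c_sq : D.c ^ 2 = (b.sign : ℂ)
  s_eq : D.s = 0
  lam : ∀ t, x.lam t = D.f₁ (D.k * (t / T) + D.φ₁)
  nu : ∀ t, x.nu t = D.f₂ (D.l * (t / T) + D.φ₂) + b.angle

/-- The ratio of the periods gives the common period `T = k T_λ = l T_ν`. -/
theorem IsTorusOrbit.exists_follows (hμ₀ : 0 < μ) (hμ₁ : μ < 1) (hk : 0 < k) (hl : 0 < l)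
    (hkl : k.Coprime l) (h : InRegionS μ g c ∨ InRegionS' μ g c) (hx : IsTorusOrbit x g b k l) :
    ∃ (D : TorusData) (T : ℝ), Follows x b D T ∧ D.k = k ∧ D.l = l := by
  obtain ⟨h1, h2, h3, T₁, T₂, h4, h5, h6⟩ := hx
  have hμ : |1 - 2 * μ| < 1 := abs_lt.2 ⟨by linarith, by linarith⟩
  have hc : c < 0 ∧ -2 < g + c := by
    rcases h with h | h
    · exact ⟨h.1, h.2.1⟩
    · exact ⟨h.1, by linarith [h.2.1]⟩
  obtain ⟨f₁, φ₁, hf₁, hlam⟩ := x.exists_lam (g := g) hc.1 hc.2 h1 h4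
  obtain ⟨f₂, φ₂, hf₂, hπ, hnu⟩ := x.exists_nu h h2 h3 h5
  obtain ⟨c₀, hc₀⟩ : ∃ z : ℂ, z ^ 2 = (b.sign : ℂ) := by
    cases b
    · exact ⟨Complex.I, by simp [Primary.sign]⟩
    · exact ⟨1, by simp [Primary.sign]⟩
  have hc0 : c₀ ≠ 0 := fun h => by
    rw [h] at hc₀
    cases b <;> simp [Primary.sign] at hc₀
  have hT₁ := h4.1.1
  have hT₂ := h5.1.1
  have hl' : (0 : ℝ) < l := by exact_mod_cast hl
  have hk' : (0 : ℝ) < k := by exact_mod_cast hk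
  have hT : T₁ * k = T₂ * l := by
    field_simp at h6
    linarith
  refine ⟨⟨c₀, 0, f₁, f₂, φ₁, φ₂, k, l, hc0, ⟨le_rfl, zero_le_one⟩, hf₁, hf₂, hπ, hk, hl, hkl⟩, T₁ * k,
    ⟨by positivity, hc₀, rfl, fun t => ?_, fun t => ?_⟩, rfl, rfl⟩
  · rw [hlam]
    congr 2
    field_simp
  · rw [hnu]
    congr 3
    simp only [hT]
    field_simp

namespace TorusData

variable {D : TorusData}

theorem odd_of_add_even (h : ¬ (D.k + D.l) % 2 = 1) : D.k % 2 = 1 ∧ D.l % 2 = 1 := by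
  by_contra h1
  have h2 : 2 ∣ D.k ∧ 2 ∣ D.l := by omega
  have := Nat.dvd_gcd h2.1 h2.2
  rw [D.coprime] at this
  omega

variable (D) in
/-- The period of the trajectory as a fraction of the period in the elliptic coordinates. -/
def loopPeriod : ℝ := if (D.k + D.l) % 2 = 1 then 1 else 1 / 2

variable (D) in
/-- The simply covered trajectory. -/
def loop (t : ℝ) : ℂ := D.curve (D.loopPeriod * t) ^ 2

theorem loopPeriod_pos : 0 < D.loopPeriod := by
  rw [loopPeriod]
  split_ifs <;> norm_num

theorem loop_of_odd (h : (D.k + D.l) % 2 = 1) : D.loop = fun t => D.curve t ^ 2 := by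
  funext t
  rw [loop, loopPeriod, if_pos h, one_mul]

theorem loop_of_even (h : ¬ (D.k + D.l) % 2 = 1) : D.loop = fun t => D.curve (1 / 2 * t) ^ 2 := by
  funext t
  rw [loop, loopPeriod, if_neg h]

theorem exists_isLoop (h : ¬ D.HasBrake) (hc : ¬ D.HasCollision) :
    ∃ γ' κ P, D.IsLoop D.loop γ' κ P := by
  by_cases hkl : (D.k + D.l) % 2 = 1
  · rw [loop_of_odd hkl]
    exact ⟨_, _, _, D.isLoop_sq h hc hkl⟩
  · rw [loop_of_even hkl]
    obtain ⟨hk, hl⟩ := odd_of_add_even hkl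
    exact ⟨_, _, _, D.isLoop_fold h hc hk hl⟩

/-- A period makes position and velocity repeat, a direct self-tangency, so by `IsLoop` it is an
integer. -/
theorem isMinimalPeriod_loop (h : ¬ D.HasBrake) (hc : ¬ D.HasCollision) :
    IsMinimalPeriod D.loop 1 := by
  obtain ⟨γ', κ, P, hL⟩ := exists_isLoop h hc
  refine ⟨⟨zero_lt_one, hL.periodic⟩, fun τ ⟨hτ, hp⟩ => ?_⟩
  have h1 : γ' (0 + τ) = γ' 0 := by
    have h2 : HasDerivAt (fun t => D.loop (t + τ)) (γ' (0 + τ)) 0 :=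
      (hL.hasDerivAt (0 + τ)).comp_add_const 0 τ
    rw [show (fun t => D.loop (t + τ)) = D.loop from funext hp] at h2
    exact h2.unique (hL.hasDerivAt 0)
  obtain ⟨n, hn⟩ := hL.sub_of_tangency one_pos (hp 0).symm (by rw [h1, one_smul])
  rw [zero_add, sub_zero] at hn
  rw [hn] at hτ ⊢
  exact_mod_cast hτ

theorem loop_ne_zero (hc : ¬ D.HasCollision) (t : ℝ) : D.loop t ≠ 0 :=
  pow_ne_zero 2 (D.curve_ne_zero hc _)

theorem isJOne_loop (h : ¬ D.HasBrake) (hc : ¬ D.HasCollision) : IsJOne D.loop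
    (if Odd (D.k + D.l) then 2 * (D.k : ℚ) * D.l - D.k - D.l + 1
      else ((D.k : ℚ) * D.l - D.k - D.l + 2) / 2) := by
  by_cases hkl : (D.k + D.l) % 2 = 1
  · rw [if_pos (Nat.odd_iff.2 hkl), loop_of_odd hkl]
    refine ⟨_, _, isArnoldJPlus_sq h hc hkl, isWindingNumber_sq hc hkl, ?_⟩
    push_cast
    ring
  · rw [if_neg fun h => hkl (Nat.odd_iff.1 h), loop_of_even hkl]
    obtain ⟨hk, hl⟩ := odd_of_add_even hkl
    obtain ⟨v, hv, hv'⟩ := isArnoldJPlus_fold h hc hk hl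
    obtain ⟨w, hw, hw'⟩ := isWindingNumber_fold hc hk hl
    refine ⟨v, w, hv', hw', ?_⟩
    have h1 : 2 * (v : ℚ) = (D.k - 1) * (D.l - 1) := by exact_mod_cast hv
    have h2 : (w : ℚ) ^ 2 = 1 := by exact_mod_cast hw
    rw [h2]
    linarith

/-- The curve `σ` is the required lift: a square root of the trajectory for even winding number, of
the trajectory run twice for odd winding number. -/
theorem isJTwo_loop (h : ¬ D.HasBrake) (hc : ¬ D.HasCollision) :
    IsJTwo D.loop ((D.k : ℚ) * D.l - D.k - D.l + 1) := by
  obtain ⟨w, hw⟩ : ∃ w : ℤ, IsWindingNumber D.loop w ∧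
      ((Even w ∧ ∀ t, D.curve t ^ 2 = D.loop t) ∨ (Odd w ∧ ∀ t, D.curve t ^ 2 = D.loop (2 * t))) := by
    by_cases hkl : (D.k + D.l) % 2 = 1
    · rw [loop_of_odd hkl]
      exact ⟨0, isWindingNumber_sq hc hkl, Or.inl ⟨Even.zero, fun _ => rfl⟩⟩
    · rw [loop_of_even hkl]
      obtain ⟨hk, hl⟩ := odd_of_add_even hkl
      obtain ⟨w, hw, hw'⟩ := isWindingNumber_fold hc hk hl
      refine ⟨w, hw', Or.inr ⟨?_, fun t => ?_⟩⟩
      · rcases eq_or_eq_neg_of_sq_eq_sq w 1 (by rw [hw, one_pow]) with rfl | rfl <;> decide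
      · simp only [one_div, inv_mul_cancel_left₀ (two_ne_zero' ℝ)]
  refine ⟨_, w, D.curve, hw.1, hw.2, isArnoldJPlus_curve h hc, ?_⟩
  push_cast
  ring

theorem vel_eq_zero {t : ℝ} (h₁ : deriv D.f₁ (D.k * t + D.φ₁) = 0)
    (h₂ : deriv D.f₂ (D.l * t + D.φ₂) = 0) : D.vel t = 0 := by
  simp [vel, torusVel, torusPointVel, h₁, h₂]

theorem curve_eq_zero {t : ℝ} (h₁ : D.f₁ (D.k * t + D.φ₁) = 0) (h₂ : D.f₂ (D.l * t + D.φ₂) = 0) :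
    D.curve t = 0 := by
  simp [curve, torusCurve, torusPoint, h₁, h₂, stretch_zero]

theorem hasBrake_iff_deriv : D.HasBrake ↔
    ∃ t, deriv D.f₁ (D.k * t + D.φ₁) = 0 ∧ deriv D.f₂ (D.l * t + D.φ₂) = 0 := by
  simp only [HasBrake, D.hf₁.deriv_eq_zero_iff, D.hf₂.deriv_eq_zero_iff, exists_and_left,
    exists_and_right]

theorem hasCollision_iff_zero : D.HasCollision ↔
    ∃ t, D.f₁ (D.k * t + D.φ₁) = 0 ∧ D.f₂ (D.l * t + D.φ₂) = 0 := by
  simp only [HasCollision, D.hf₁.eq_zero_iff, D.hf₂.eq_zero_iff, exists_and_left, exists_and_right]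

/-- For `k` and `l` odd, brakes and collisions both occur exactly at the even phases. -/
theorem hasBrake_iff_hasCollision (h : ¬ (D.k + D.l) % 2 = 1) : D.HasBrake ↔ D.HasCollision := by
  obtain ⟨p, hp⟩ : ∃ p : ℤ, ((D.l : ℤ) - D.k) = 2 * p := ⟨((D.l : ℤ) - D.k) / 2, by omega⟩
  have hp' : (D.l : ℝ) - D.k = 2 * p := by exact_mod_cast hp
  rw [hasBrake_iff, hasCollision_iff, hp']
  constructor
  · rintro ⟨n, hn⟩
    exact ⟨n - p, by push_cast; linarith⟩
  · rintro ⟨n, hn⟩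
    exact ⟨n + p, by push_cast; linarith⟩

variable (D) in
/-- The phase of the first oscillation is shifted. -/
def shift (a : ℝ) : TorusData := { D with φ₁ := D.φ₁ + a }

/-- Small shifts of a distinguished orbit are not distinguished. -/
theorem not_hasBrake_shift (h : D.HasBrake ∨ D.HasCollision) {a : ℝ} (ha : a ≠ 0)
    (ha' : |4 * D.l * a| < 1) : ¬ (D.shift a).HasBrake ∧ ¬ (D.shift a).HasCollision := by
  have hl0 : (0 : ℝ) < D.l := by exact_mod_cast D.l_pos
  obtain ⟨N, hN⟩ : ∃ N : ℤ, 4 * (D.l * D.φ₁ - D.k * D.φ₂) = N := by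
    rcases h with h | h
    · obtain ⟨n, hn⟩ := D.hasBrake_iff.1 h
      exact ⟨2 * n, by push_cast; linarith⟩
    · obtain ⟨n, hn⟩ := D.hasCollision_iff.1 h
      exact ⟨2 * n + (D.l - D.k), by push_cast; linarith⟩
  have key : ∀ M : ℤ, 4 * (D.l * (D.φ₁ + a) - D.k * D.φ₂) ≠ M := fun M hM => by
    have h1 : 4 * D.l * a = ((M - N : ℤ) : ℝ) := by push_cast; linarith
    rw [h1] at ha'
    have h2 : |M - N| < 1 := by exact_mod_cast ha'
    rw [Int.abs_lt_one_iff.1 h2, Int.cast_zero] at h1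
    exact (mul_ne_zero (by positivity) ha) h1
  rw [hasBrake_iff, hasCollision_iff]
  refine ⟨fun ⟨n, hn⟩ => key (2 * n) ?_, fun ⟨n, hn⟩ => key (2 * n + (D.l - D.k)) ?_⟩
  · simp only [shift] at hn
    push_cast
    linarith
  · simp only [shift] at hn
    push_cast
    linarith

end TorusData

namespace Follows

variable {μ c T : ℝ} {x : EulerOrbit μ c} {b : Primary} {D : TorusData} (h : Follows x b D T)
include h

/-- The position is `cosh(λ + iν)/2`. Shifting `ν` by the angle of the center multiplies this by a
sign, and `cosh z - 1 = 2 sinh²(z/2)`. -/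
theorem relPosition_eq (t : ℝ) : x.relPosition b t = D.curve (t / T) ^ 2 := by
  have h1 : D.curve (t / T) ^ 2 = (b.sign : ℂ) *
      Complex.sinh (((x.lam t : ℂ) + ((x.nu t - b.angle : ℝ) : ℂ) * Complex.I) / 2) ^ 2 := by
    rw [h.nu, h.lam, add_sub_cancel_right, TorusData.curve, torusCurve, mul_pow, h.c_sq, torusPoint,
      stretch, h.s_eq]
    simp
  have h2 : ∀ z : ℂ, Complex.sinh (z / 2) ^ 2 = (Complex.cosh z - 1) / 2 := fun z => by
    have := Complex.cosh_two_mul (z / 2)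
    rw [mul_div_cancel₀ z two_ne_zero, Complex.cosh_sq] at this
    rw [this]
    ring
  have h3 : Complex.cosh ((x.lam t : ℂ) + ((x.nu t - b.angle : ℝ) : ℂ) * Complex.I) =
      (b.sign : ℂ) * (2 * ellipticPosition (x.lam t) (x.nu t)) := by
    have hcos : Real.cos (x.nu t) = b.sign * Real.cos (x.nu t - b.angle) := by
      rw [← b.cos_add_angle, sub_add_cancel]
    have hsin : Real.sin (x.nu t) = b.sign * Real.sin (x.nu t - b.angle) := by
      rw [← b.sin_add_angle, sub_add_cancel]
    have hsq : (b.sign : ℂ) * b.sign = 1 := by exact_mod_cast b.sign_mul_sign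
    have e : ellipticPosition (x.lam t) (x.nu t) =
        ((Real.cosh (x.lam t) * Real.cos (x.nu t) / 2 : ℝ) : ℂ) +
          ((Real.sinh (x.lam t) * Real.sin (x.nu t) / 2 : ℝ) : ℂ) * Complex.I :=
      Complex.mk_eq_add_mul_I _ _
    rw [e, hcos, hsin, Complex.cosh_add, Complex.cosh_mul_I, Complex.sinh_mul_I]
    push_cast
    linear_combination (-(Complex.cosh (x.lam t) * Complex.cos (x.nu t - b.angle) +
      Complex.sinh (x.lam t) * (Complex.sin (x.nu t - b.angle) * Complex.I))) * hsq
  have h4 : b.position = (b.sign : ℂ) / 2 := by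
    cases b <;> simp [Primary.position, Primary.sign]
  have hsq : (b.sign : ℂ) * b.sign = 1 := by exact_mod_cast b.sign_mul_sign
  rw [h1, h2, h3, EulerOrbit.relPosition, h4]
  linear_combination (-ellipticPosition (x.lam t) (x.nu t)) * hsq

theorem pLam_eq (t : ℝ) : x.pLam t = D.k / (4 * T) * deriv D.f₁ (D.k * (t / T) + D.φ₁) := by
  have hT := h.T_pos.ne'
  have h1 : HasDerivAt (fun t => D.k * (t / T) + D.φ₁) (D.k * (1 / T)) t :=
    (((hasDerivAt_id t).div_const T).const_mul _).add_const _
  have h2 := (D.hf₁.hasDerivAt (D.k * (t / T) + D.φ₁)).comp t h1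
  rw [show D.f₁ ∘ (fun t => D.k * (t / T) + D.φ₁) = x.lam from funext fun t => (h.lam t).symm] at h2
  have h3 := (x.lam_ode t).unique h2
  field_simp
  field_simp at h3
  linarith

theorem pNu_eq (t : ℝ) : x.pNu t = D.l / (4 * T) * deriv D.f₂ (D.l * (t / T) + D.φ₂) := by
  have hT := h.T_pos.ne'
  have h1 : HasDerivAt (fun t => D.l * (t / T) + D.φ₂) (D.l * (1 / T)) t :=
    (((hasDerivAt_id t).div_const T).const_mul _).add_const _
  have h2 := ((D.hf₂.hasDerivAt (D.l * (t / T) + D.φ₂)).comp t h1).add_const b.angle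
  rw [show (fun t => (D.f₂ ∘ (fun t => D.l * (t / T) + D.φ₂)) t + b.angle) = x.nu from
    funext fun t => (h.nu t).symm] at h2
  have h3 := (x.nu_ode t).unique h2
  field_simp
  field_simp at h3
  linarith

theorem isBrake_iff (t : ℝ) : x.IsBrake t ↔ deriv D.f₁ (D.k * (t / T) + D.φ₁) = 0 ∧
    deriv D.f₂ (D.l * (t / T) + D.φ₂) = 0 := by
  have hT := h.T_pos.ne'
  have hk : (D.k : ℝ) ≠ 0 := by exact_mod_cast D.k_pos.ne'
  have hl : (D.l : ℝ) ≠ 0 := by exact_mod_cast D.l_pos.ne'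
  rw [EulerOrbit.IsBrake, h.pLam_eq, h.pNu_eq]
  simp [hT, hk, hl]

theorem isCollision_iff (t : ℝ) : x.IsCollision b t ↔ D.f₁ (D.k * (t / T) + D.φ₁) = 0 ∧
    D.f₂ (D.l * (t / T) + D.φ₂) = 0 := by
  rw [EulerOrbit.IsCollision, h.lam, h.nu, add_eq_right]

theorem relPosition_mul (t : ℝ) : x.relPosition b (T * t) = D.curve t ^ 2 := by
  rw [h.relPosition_eq, mul_div_cancel_left₀ _ h.T_pos.ne']

theorem relPosition_eq_loop (t : ℝ) : x.relPosition b t = D.loop (t / (T * D.loopPeriod)) := by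
  have := D.loopPeriod_pos.ne'
  have := h.T_pos.ne'
  rw [h.relPosition_eq, TorusData.loop]
  congr 2
  field_simp

theorem isMinimalPeriod_relPosition (hb : ¬ D.HasBrake) (hc : ¬ D.HasCollision) :
    IsMinimalPeriod (x.relPosition b) (T * D.loopPeriod) := by
  have hpos := mul_pos h.T_pos D.loopPeriod_pos
  obtain ⟨⟨-, h1⟩, h2⟩ := TorusData.isMinimalPeriod_loop hb hc
  refine ⟨⟨hpos, fun t => ?_⟩, fun τ hτ => ?_⟩
  · rw [h.relPosition_eq_loop, h.relPosition_eq_loop, add_div, div_self hpos.ne', h1]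
  · have h3 := h2 (a := τ / (T * D.loopPeriod)) ⟨div_pos hτ.1 hpos, fun t => by
      have := hτ.2 (t * (T * D.loopPeriod))
      rwa [h.relPosition_eq_loop, h.relPosition_eq_loop, add_div,
        mul_div_cancel_right₀ _ hpos.ne'] at this⟩
    rwa [le_div_iff₀ hpos, one_mul] at h3

theorem isGenericCurveOf_loop (hb : ¬ D.HasBrake) (hc : ¬ D.HasCollision) :
    IsGenericCurveOf x b D.loop := by
  obtain ⟨γ', κ, P, hL⟩ := TorusData.exists_isLoop hb hc
  refine ⟨⟨_, h.isMinimalPeriod_relPosition hb hc, funext fun t => ?_⟩, hL.isGenericImmersion,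
    TorusData.loop_ne_zero hc⟩
  rw [h.relPosition_eq_loop, mul_div_cancel_left₀ _ (mul_pos h.T_pos D.loopPeriod_pos).ne']

/-- At a brake the velocity of the trajectory vanishes and at a collision the trajectory meets the
center, so a generic curve comes from regular data; the minimal period is unique. -/
theorem eq_loop {γ : ℝ → ℂ} (hγ : IsGenericCurveOf x b γ) :
    ¬ D.HasBrake ∧ ¬ D.HasCollision ∧ γ = D.loop := by
  obtain ⟨⟨S, hS, rfl⟩, ⟨⟨-, -, himm⟩, -⟩, hne⟩ := hγ
  have hS0 : S ≠ 0 := hS.1.1.ne'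
  have hb : ¬ D.HasBrake := fun hb => by
    obtain ⟨t, h1, h2⟩ := TorusData.hasBrake_iff_deriv.1 hb
    refine himm (T * t / S) (HasDerivAt.deriv ?_)
    have h3 : HasDerivAt (fun s => S * s / T) (S * 1 / T) (T * t / S) :=
      ((hasDerivAt_id _).const_mul S).div_const T
    have h4 : S * (T * t / S) / T = t := by
      have := h.T_pos.ne'
      field_simp
    have h5 := D.hasDerivAt_curve_sq (S * (T * t / S) / T)
    rw [h4, TorusData.vel_eq_zero h1 h2, mul_zero] at h5
    have h6 := HasDerivAt.scomp_of_eq (T * t / S) h5 h3 h4.symm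
    rw [smul_zero] at h6
    refine h6.congr_of_eventuallyEq (Eventually.of_forall fun s => ?_)
    exact h.relPosition_eq _
  have hc : ¬ D.HasCollision := fun hc => by
    obtain ⟨t, h1, h2⟩ := TorusData.hasCollision_iff_zero.1 hc
    refine hne (T * t / S) ?_
    simp only [mul_div_cancel₀ _ hS0]
    rw [h.relPosition_mul, TorusData.curve_eq_zero h1 h2, zero_pow two_ne_zero]
  refine ⟨hb, hc, funext fun t => ?_⟩
  rw [IsLeast.unique hS (h.isMinimalPeriod_relPosition hb hc), h.relPosition_eq_loop,
    mul_div_cancel_left₀ _ (mul_pos h.T_pos D.loopPeriod_pos).ne']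

/-- For `k + l` odd, half a period changes the sign of exactly one of the two oscillations. This
yields a second brake at a different point, or a second collision with different momenta even up to
a common sign. For `k` and `l` odd, brake and collision occur together. -/
theorem isDistinguished (hbc : D.HasBrake ∨ D.HasCollision) : IsDistinguished x b := by
  have hT := h.T_pos.ne'
  have hkT : (D.k : ℝ) / (4 * T) ≠ 0 := div_ne_zero (by exact_mod_cast D.k_pos.ne') (by simpa)
  have hlT : (D.l : ℝ) / (4 * T) ≠ 0 := div_ne_zero (by exact_mod_cast D.l_pos.ne') (by simpa)
  have e1 : ∀ t, D.k * (T * (t + 1 / 2) / T) + D.φ₁ = D.k * t + D.φ₁ + D.k / 2 := fun t => by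
    field_simp
    ring
  have e2 : ∀ t, D.l * (T * (t + 1 / 2) / T) + D.φ₂ = D.l * t + D.φ₂ + D.l / 2 := fun t => by
    field_simp
    ring
  have e0 : ∀ t, T * t / T = t := fun t => mul_div_cancel_left₀ _ hT
  have hnn : ∀ (f : ℝ → ℝ), CosLike f → ∀ θ, f θ = 0 → deriv f θ ≠ 0 := by
    intro f hf θ h1 h2
    obtain ⟨m, hm⟩ := hf.eq_zero_iff.1 h1
    obtain ⟨n, hn⟩ := hf.deriv_eq_zero_iff.1 h2
    have h3 : (2 * n : ℝ) = 2 * m + 1 := by linarith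
    have h4 : 2 * n = 2 * m + 1 := by exact_mod_cast h3
    omega
  by_cases hkl : (D.k + D.l) % 2 = 1
  · have hpar : D.k % 2 = 1 ∧ D.l % 2 = 0 ∨ D.k % 2 = 0 ∧ D.l % 2 = 1 := by omega
    have hsign : ((-1 : ℝ) ^ D.k = -1 ∧ (-1 : ℝ) ^ D.l = 1) ∨
        ((-1 : ℝ) ^ D.k = 1 ∧ (-1 : ℝ) ^ D.l = -1) := by
      rcases hpar with ⟨h1, h2⟩ | ⟨h1, h2⟩
      · exact Or.inl ⟨(Nat.odd_iff.2 h1).neg_one_pow, (Nat.even_iff.2 h2).neg_one_pow⟩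
      · exact Or.inr ⟨(Nat.even_iff.2 h1).neg_one_pow, (Nat.odd_iff.2 h2).neg_one_pow⟩
    rcases hbc with hb | hc
    · obtain ⟨t, h1, h2⟩ := TorusData.hasBrake_iff_deriv.1 hb
      refine Or.inl ⟨T * t, T * (t + 1 / 2), (h.isBrake_iff _).2 ?_, (h.isBrake_iff _).2 ?_, fun h3 => ?_⟩
      · rw [e0]
        exact ⟨h1, h2⟩
      · rw [e1, e2, D.hf₁.deriv_add_half, D.hf₂.deriv_add_half, h1, h2, mul_zero, mul_zero]
        exact ⟨rfl, rfl⟩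
      · rw [h.relPosition_mul, h.relPosition_mul] at h3
        have hf₁ : D.f₁ (D.k * t + D.φ₁) ≠ 0 := fun h4 => hnn _ D.hf₁ _ h4 h1
        have hf₂ : D.f₂ (D.l * t + D.φ₂) ≠ 0 := fun h4 => hnn _ D.hf₂ _ h4 h2
        obtain ⟨e, he⟩ : ∃ e : ℕ, D.curve (t + 1 / 2) = (-1) ^ e * D.curve t := by
          rcases sq_eq_sq_iff_eq_or_eq_neg.1 h3 with h | h
          · exact ⟨0, by simp [h]⟩
          · exact ⟨1, by simp [h]⟩
        obtain ⟨h4, h5⟩ := D.apply_eq he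
        rw [show D.k * (t + 1 / 2) + D.φ₁ = D.k * t + D.φ₁ + D.k / 2 by ring, D.hf₁.add_half,
          D.hf₁.add_half] at h4
        rw [show D.l * (t + 1 / 2) + D.φ₂ = D.l * t + D.φ₂ + D.l / 2 by ring, D.hf₂.add_half,
          D.hf₂.add_half] at h5
        have h6 := mul_right_cancel₀ hf₁ h4
        have h7 := mul_right_cancel₀ hf₂ h5
        rcases hsign with ⟨h8, h9⟩ | ⟨h8, h9⟩ <;> rw [h8] at h6 <;> rw [h9, ← h6] at h7 <;>
          norm_num at h7
    · obtain ⟨t, h1, h2⟩ := TorusData.hasCollision_iff_zero.1 hc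
      have h3 : x.pLam (T * t) ≠ 0 := by
        rw [h.pLam_eq, e0]
        exact mul_ne_zero hkT (hnn _ D.hf₁ _ h1)
      have h4 : x.pNu (T * t) ≠ 0 := by
        rw [h.pNu_eq, e0]
        exact mul_ne_zero hlT (hnn _ D.hf₂ _ h2)
      have h5 : x.pLam (T * (t + 1 / 2)) = (-1) ^ D.k * x.pLam (T * t) := by
        rw [h.pLam_eq, h.pLam_eq, e1, e0, D.hf₁.deriv_add_half]
        ring
      have h6 : x.pNu (T * (t + 1 / 2)) = (-1) ^ D.l * x.pNu (T * t) := by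
        rw [h.pNu_eq, h.pNu_eq, e2, e0, D.hf₂.deriv_add_half]
        ring
      refine Or.inr (Or.inl ⟨T * t, T * (t + 1 / 2), (h.isCollision_iff _).2 ?_,
        (h.isCollision_iff _).2 ?_, fun h7 => ?_, fun h7 => ?_⟩)
      · rw [e0]
        exact ⟨h1, h2⟩
      · rw [e1, e2, D.hf₁.add_half, D.hf₂.add_half, h1, h2, mul_zero, mul_zero]
        exact ⟨rfl, rfl⟩
      · rw [h5, h6, Prod.mk.injEq] at h7
        rcases hsign with ⟨h8, h9⟩ | ⟨h8, h9⟩ <;> rw [h8, h9] at h7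
        · exact h3 (by linarith [h7.1])
        · exact h4 (by linarith [h7.2])
      · rw [h5, h6, Prod.mk.injEq] at h7
        rcases hsign with ⟨h8, h9⟩ | ⟨h8, h9⟩ <;> rw [h8, h9] at h7
        · exact h4 (by linarith [h7.2])
        · exact h3 (by linarith [h7.1])
  · have hb : D.HasBrake := hbc.elim id (TorusData.hasBrake_iff_hasCollision hkl).2
    have hc := (TorusData.hasBrake_iff_hasCollision hkl).1 hb
    obtain ⟨t, h1⟩ := TorusData.hasBrake_iff_deriv.1 hb
    obtain ⟨t', h2⟩ := TorusData.hasCollision_iff_zero.1 hc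
    exact Or.inr (Or.inr ⟨T * t, T * t', (h.isBrake_iff _).2 (by rwa [e0]),
      (h.isCollision_iff _).2 (by rwa [e0])⟩)

theorem shiftLam (a : ℝ) : Follows (x.shiftLam a) b (D.shift (D.k * (a / T))) T where
  T_pos := h.T_pos
  c_sq := h.c_sq
  s_eq := h.s_eq
  lam t := by
    refine (h.lam (t + a)).trans ?_
    simp only [TorusData.shift]
    congr 1
    ring
  nu t := h.nu t

end Follows

/-- An invariant of the regular orbits is an invariant of all orbits of the family. -/
theorem IsTorusOrbit.hasInvariant {μ g c : ℝ} {x : EulerOrbit μ c} {b : Primary} {k l : ℕ}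
    (hμ₀ : 0 < μ) (hμ₁ : μ < 1) (hk : 0 < k) (hl : 0 < l) (hkl : k.Coprime l)
    (hgc : InRegionS μ g c ∨ InRegionS' μ g c) (hx : IsTorusOrbit x g b k l)
    {J : (ℝ → ℂ) → ℚ → Prop} {a : ℚ} (hJ : ∀ D : TorusData, D.k = k → D.l = l → ¬ D.HasBrake →
      ¬ D.HasCollision → J D.loop a) : HasInvariant J x b k l a := by
  obtain ⟨D, T, hD, hDk, hDl⟩ := hx.exists_follows hμ₀ hμ₁ hk hl hkl hgc
  by_cases hbc : D.HasBrake ∨ D.HasCollision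
  · refine Or.inr ⟨hD.isDistinguished hbc, ?_, Eventually.of_forall ?_⟩
    · have hT := hD.T_pos
      have hk0 : (D.k : ℝ) ≠ 0 := by exact_mod_cast D.k_pos.ne'
      -- Shifting the phase of `λ` stays on the torus, tends to `x`, and makes the orbit regular for
      -- small nonzero shifts.
      have htend : Tendsto (fun s => (x.shiftLam s).state 0) (𝓝[≠] 0) (𝓝 (x.state 0)) := by
        have h1 : Continuous x.lam := continuous_iff_continuousAt.2 fun t => (x.lam_ode t).continuousAt
        have h2 : Continuous x.pLam :=
          continuous_iff_continuousAt.2 fun t => (x.pLam_ode t).continuousAt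
        have h3 : Continuous fun s => (x.shiftLam s).state 0 := by
          simp only [EulerOrbit.state, EulerOrbit.shiftLam]
          fun_prop
        have h4 := h3.tendsto 0
        simp only [EulerOrbit.state, EulerOrbit.shiftLam, add_zero] at h4
        exact h4.mono_left nhdsWithin_le_nhds
      have hsmall : ∀ᶠ s in 𝓝[≠] (0 : ℝ), |4 * D.l * (D.k * (s / T))| < 1 := by
        have h1 : Continuous fun s => |4 * D.l * (D.k * (s / T))| := by fun_prop
        have h2 : |4 * D.l * (D.k * (0 / T))| < 1 := by simp
        exact ((h1.tendsto 0).eventually_lt_const h2).filter_mono nhdsWithin_le_nhds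
      refine htend.frequently (Eventually.frequently ?_)
      filter_upwards [hsmall, self_mem_nhdsWithin] with s hs hs0
      obtain ⟨h1, h2⟩ := TorusData.not_hasBrake_shift hbc
        (mul_ne_zero hk0 (div_ne_zero hs0 hT.ne')) hs
      exact ⟨_, g, c, x.shiftLam s, hgc, hx.shiftLam s, rfl, (hD.shiftLam s).isGenericCurveOf_loop h1 h2⟩
    -- Every generic member, on whatever torus of the family, follows regular data with the same `k`
    -- and `l`, and so has the same value.
    · rintro z γ ⟨g', c', y, hgc', hy, -, hγ⟩
      obtain ⟨D', T', hD', hk', hl'⟩ := hy.exists_follows hμ₀ hμ₁ hk hl hkl hgc'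
      obtain ⟨h1, h2, rfl⟩ := hD'.eq_loop hγ
      exact hJ D' hk' hl' h1 h2
  · rw [not_or] at hbc
    exact Or.inl ⟨_, hD.isGenericCurveOf_loop hbc.1 hbc.2, hJ D hDk hDl hbc.1 hbc.2⟩

end

theorem theorem4p5 (μ : ℝ) (hμ₀ : 0 < μ) (hμ₁ : μ < 1) (k l : ℕ) (hk : 0 < k) (hl : 0 < l)
    (hkl : Nat.Coprime k l) (b : Primary) (g c : ℝ)
    (hgc : InRegionS μ g c ∨ InRegionS' μ g c)
    (x : EulerOrbit μ c) (hx : IsTorusOrbit x g b k l) :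
    HasInvariant IsJOne x b k l
      (if Odd (k + l) then 2 * (k : ℚ) * l - k - l + 1 else ((k : ℚ) * l - k - l + 2) / 2) ∧
    HasInvariant IsJTwo x b k l ((k : ℚ) * l - k - l + 1) := by
  refine ⟨hx.hasInvariant hμ₀ hμ₁ hk hl hkl hgc ?_, hx.hasInvariant hμ₀ hμ₁ hk hl hkl hgc ?_⟩
  · rintro D rfl rfl h1 h2
    exact TorusData.isJOne_loop h1 h2
  · rintro D rfl rfl h1 h2
    exact TorusData.isJTwo_loop h1 h2
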